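/- Let $M$ be a compact hypercomplex manifold with $\dim_{\mathbb C}M=r$, i.e. a compact smooth manifold of real dimension $2r$ with three (integrable) complex structures $\mathbf I,\mathbf J,\mathbf K$ satisfying $\mathbf I\mathbf J=\mathbf K$, $\mathbf J\mathbf K=\mathbf I$, $\mathbf K\mathbf I=\mathbf J$. Let $Q$ be a compact complex manifold with $\dim_{\mathbb C}Q=n$ and complex structure $I$, which carries a balanced metric $\omega_Q$, and let $h:Q\to\mathbb P^1$ be a holomorphic map that is not constant on any connected component of $Q$. (A balanced metric on a complex manifold of complex dimension $p$ is a smooth positive definite real $(1,1)$-form $\xi$ with $\mathrm d(\xi^{p-1})=0$.) Let $X=M\times Q$ be the product smooth manifold with the complex structure which at $(m,q)\in X$ is $$\underline{\mathbf I}=\bigl(a\,\mathbf I+b\,\mathbf J+c\,\mathbf K,\; I\bigr)\quad\text{on } T_mM\oplus T_qQ,$$ where, if $h(q)=[Z_1,Z_2]$, $$(a,b,c)=\left(\frac{|Z_2|^2-|Z_1|^2}{|Z_1|^2+|Z_2|^2},\ \frac{Z_1\overline Z_2+\overline Z_1Z_2}{|Z_1|^2+|Z_2|^2},\ \sqrt{-1}\,\frac{\overline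 Z_1Z_2-Z_1\overline Z_2}{|Z_1|^2+|Z_2|^2}\right).$$ Then there exists a balanced metric on $(X,\underline{\mathbf I})$, i.e. a smooth positive definite real $(1,1)$-form $\xi$ on $X$ with $\mathrm d(\xi^{n+r-1})=0$. -/

import Mathlib

open scoped Manifold ContDiff LinearAlgebra.Projectivization

noncomputable section

namespace TwistorBalanced

/-! ### Wedge products of alternating forms on a real vector space -/

section Wedge

variable {V : Type*} [AddCommGroup V] [Module ℝ V] [TopologicalSpace V]

/-- The multilinear map `(v₁, …, v_{k+l}) ↦ α (v₁, …, v_k) * β (v_{k+1}, …, v_{k+l})`. -/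
def tensorForm {k l : ℕ} (α : V [⋀^Fin k]→L[ℝ] ℝ) (β : V [⋀^Fin l]→L[ℝ] ℝ) :
    ContinuousMultilinearMap ℝ (fun _ : Fin (k + l) => V) ℝ where
  toMultilinearMap := ((LinearMap.mul' ℝ ℝ).compMultilinearMap
    (MultilinearMap.domCoprod α.toMultilinearMap β.toMultilinearMap)).domDomCongr finSumFinEquiv
  cont := by
    have h : Continuous fun v : Fin (k + l) → V =>
        α (fun i => v (Fin.castAdd l i)) * β (fun j => v (Fin.natAdd k j)) :=
      (α.cont.comp (by fun_prop)).mul (β.cont.comp (by fun_prop))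
    exact h

theorem tensorForm_apply {k l : ℕ} (α : V [⋀^Fin k]→L[ℝ] ℝ) (β : V [⋀^Fin l]→L[ℝ] ℝ)
    (v : Fin (k + l) → V) :
    tensorForm α β v = α (fun i => v (Fin.castAdd l i)) * β (fun j => v (Fin.natAdd k j)) :=
  rfl

/-- The wedge product
`(α ∧ β)(v₁, …, v_{k+l}) = 1/(k! l!) ∑_σ sign σ · α(v_{σ 1}, …, v_{σ k}) β(v_{σ(k+1)}, …)`. -/
def wedge {k l : ℕ} (α : V [⋀^Fin k]→L[ℝ] ℝ) (β : V [⋀^Fin l]→L[ℝ] ℝ) :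
    V [⋀^Fin (k + l)]→L[ℝ] ℝ :=
  ((k.factorial * l.factorial : ℝ)⁻¹) • ContinuousMultilinearMap.alternatization (tensorForm α β)

/-- The power `α ^ m = α ∧ ⋯ ∧ α` (`m` factors) of a `2`-form `α`. -/
def wedgePow (α : V [⋀^Fin 2]→L[ℝ] ℝ) : (m : ℕ) → V [⋀^Fin (2 * m)]→L[ℝ] ℝ
  | 0 => ContinuousAlternatingMap.constOfIsEmpty ℝ V (Fin 0) (1 : ℝ)
  | m + 1 => wedge (wedgePow α m) α

end Wedge

/-! ### Differential forms and fields of endomorphisms on a real manifold -/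

section Manifold

variable {V : Type*} [NormedAddCommGroup V] [NormedSpace ℝ V]
  {H : Type*} [TopologicalSpace H] (I : ModelWithCorners ℝ V H)
  (P : Type*) [TopologicalSpace P] [ChartedSpace H P]

/-- A (not necessarily continuous) real differential `k`-form on `P`. -/
abbrev Form (k : ℕ) : Type _ := ∀ x : P, TangentSpace I x [⋀^Fin k]→L[ℝ] ℝ

/-- A (not necessarily continuous) field of endomorphisms of the tangent bundle of `P`. -/
abbrev EndField : Type _ := ∀ x : P, TangentSpace I x →L[ℝ] TangentSpace I x

variable {I P}

/-- The expression of a form in the preferred chart at `x₀`, that is, its pullback under the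
inverse of that chart. -/
def Form.inChart {k : ℕ} (α : Form I P k) (x₀ : P) (y : V) : V [⋀^Fin k]→L[ℝ] ℝ :=
  (α ((extChartAt I x₀).symm y)).compContinuousLinearMap
    (mfderivWithin 𝓘(ℝ, V) I (extChartAt I x₀).symm (Set.range I) y)

/-- A form is smooth if its expressions in the charts are smooth. -/
def Form.IsSmooth {k : ℕ} (α : Form I P k) : Prop :=
  ∀ x₀ : P, ContDiffOn ℝ ∞ (α.inChart x₀) (extChartAt I x₀).target

/-- The exterior derivative of a form: at `x` it is the exterior derivative of the expression of
the form in the chart at `x`, pulled back to the manifold. -/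
def Form.d {k : ℕ} (α : Form I P k) : Form I P (k + 1) := fun x =>
  (extDerivWithin (α.inChart x) (Set.range I) (extChartAt I x x)).compContinuousLinearMap
    (mfderiv I 𝓘(ℝ, V) (extChartAt I x) x)

/-- The pointwise power `α ^ m` of a `2`-form. -/
def Form.pow (α : Form I P 2) (m : ℕ) : Form I P (2 * m) := fun x => wedgePow (α x) m

/-- A field of endomorphisms is smooth if it is a smooth section of `End(TP)`. -/
def EndField.IsSmooth [IsManifold I ∞ P] (J : EndField I P) : Prop :=
  ContMDiff I (I.prod 𝓘(ℝ, V →L[ℝ] V)) ∞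
    (fun x => Bundle.TotalSpace.mk' (V →L[ℝ] V)
      (E := fun x : P => TangentSpace I x →L[ℝ] TangentSpace I x) x (J x))

/-- The Nijenhuis bracket
`N_J(X, Y) = [JX, JY] - J[JX, Y] - J[X, JY] - [X, Y]` of two vector fields. -/
def EndField.nijenhuis (J : EndField I P) (X Y : ∀ x : P, TangentSpace I x) (x : P) :
    TangentSpace I x :=
  VectorField.mlieBracket I (fun y => J y (X y)) (fun y => J y (Y y)) x
    - J x (VectorField.mlieBracket I (fun y => J y (X y)) Y x)
    - J x (VectorField.mlieBracket I X (fun y => J y (Y y)) x)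
    - VectorField.mlieBracket I X Y x

/-- A complex structure on a smooth manifold: a smooth field `J` of endomorphisms with `J² = -1`
that is integrable, i.e. whose Nijenhuis tensor vanishes. -/
structure EndField.IsComplexStructure [IsManifold I ∞ P] (J : EndField I P) : Prop where
  smooth : J.IsSmooth
  sq : ∀ (x : P) (v : TangentSpace I x), J x (J x v) = -v
  integrable : ∀ (x : P) (X Y : ∀ x : P, TangentSpace I x),
    ContMDiffAt I I.tangent ∞ (fun y => (⟨y, X y⟩ : TangentBundle I P)) x →
    ContMDiffAt I I.tangent ∞ (fun y => (⟨y, Y y⟩ : TangentBundle I P)) x →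
    J.nijenhuis X Y x = 0

/-- A hypercomplex structure: complex structures `i`, `j`, `k` with
`ij = k`, `jk = i`, `ki = j`. -/
structure HypercomplexStructure (I : ModelWithCorners ℝ V H)
    (P : Type*) [TopologicalSpace P] [ChartedSpace H P] [IsManifold I ∞ P] where
  i : EndField I P
  j : EndField I P
  k : EndField I P
  isComplex_i : i.IsComplexStructure
  isComplex_j : j.IsComplexStructure
  isComplex_k : k.IsComplexStructure
  i_j : ∀ (x : P) (v : TangentSpace I x), i x (j x v) = k x v
  j_k : ∀ (x : P) (v : TangentSpace I x), j x (k x v) = i x v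
  k_i : ∀ (x : P) (v : TangentSpace I x), k x (i x v) = j x v

/-- `ξ` is a balanced metric on the manifold `P` of complex dimension `p` with complex structure
`J`: a smooth real `2`-form of type `(1,1)` (i.e. `J`-invariant) which is positive definite, with
`d(ξ^{p-1}) = 0`. -/
structure IsBalancedMetric (J : EndField I P) (p : ℕ) (ξ : Form I P 2) : Prop where
  smooth : ξ.IsSmooth
  type_one_one : ∀ (x : P) (u v : TangentSpace I x), ξ x ![J x u, J x v] = ξ x ![u, v]
  pos : ∀ (x : P) (u : TangentSpace I x), u ≠ 0 → 0 < ξ x ![u, J x u]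
  closed : (ξ.pow (p - 1)).d = 0

end Manifold

/-! ### Complex manifolds, the projective line and the space `X = M × Q` -/

/-- The projective line `ℙ¹`, with homogeneous coordinates `[Z₁, Z₂] = [Z 0, Z 1]`. -/
abbrev P1 : Type := ℙ ℂ (Fin 2 → ℂ)

/-- The components of `(Z₁, Z₂) ↦ (|Z₂|² - |Z₁|², Z₁ Z̄₂ + Z̄₁ Z₂, √-1 (Z̄₁ Z₂ - Z₁ Z̄₂)) /
(|Z₁|² + |Z₂|²)`; all three are real. -/
def sphereVec (Z : Fin 2 → ℂ) : Fin 3 → ℝ :=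
  ![(‖Z 1‖ ^ 2 - ‖Z 0‖ ^ 2) / (‖Z 0‖ ^ 2 + ‖Z 1‖ ^ 2),
    (Z 0 * star (Z 1) + star (Z 0) * Z 1).re / (‖Z 0‖ ^ 2 + ‖Z 1‖ ^ 2),
    (Complex.I * (star (Z 0) * Z 1 - Z 0 * star (Z 1))).re / (‖Z 0‖ ^ 2 + ‖Z 1‖ ^ 2)]

theorem sphereVec_smul (t : ℂ) (ht : t ≠ 0) (Z : Fin 2 → ℂ) :
    sphereVec (t • Z) = sphereVec Z := by
  have ht' : (‖t‖ ^ 2 : ℝ) ≠ 0 := by positivity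
  have hs : t * star t = ((‖t‖ ^ 2 : ℝ) : ℂ) := by
    have := Complex.mul_conj' t
    simpa using this
  have e1 : t * Z 0 * star (t * Z 1) + star (t * Z 0) * (t * Z 1)
      = ((‖t‖ ^ 2 : ℝ) : ℂ) * (Z 0 * star (Z 1) + star (Z 0) * Z 1) := by
    rw [← hs, star_mul', star_mul']; ring
  have e2 : Complex.I * (star (t * Z 0) * (t * Z 1) - t * Z 0 * star (t * Z 1))
      = ((‖t‖ ^ 2 : ℝ) : ℂ) * (Complex.I * (star (Z 0) * Z 1 - Z 0 * star (Z 1))) := by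
    rw [← hs, star_mul', star_mul']; ring
  have e3 : ‖t * Z 0‖ ^ 2 + ‖t * Z 1‖ ^ 2 = ‖t‖ ^ 2 * (‖Z 0‖ ^ 2 + ‖Z 1‖ ^ 2) := by
    rw [norm_mul, norm_mul]; ring
  have e4 : ‖t * Z 1‖ ^ 2 - ‖t * Z 0‖ ^ 2 = ‖t‖ ^ 2 * (‖Z 1‖ ^ 2 - ‖Z 0‖ ^ 2) := by
    rw [norm_mul, norm_mul]; ring
  unfold sphereVec
  simp only [Pi.smul_apply, smul_eq_mul]
  rw [e1, e2, e3, e4, Complex.re_ofReal_mul, Complex.re_ofReal_mul,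
    mul_div_mul_left _ _ ht', mul_div_mul_left _ _ ht', mul_div_mul_left _ _ ht']

/-- The identification `ℙ¹ → S² ⊆ ℝ³` induced by `sphereVec`. -/
def toSphere (p : P1) : Fin 3 → ℝ :=
  Projectivization.lift (fun Z : {Z : Fin 2 → ℂ // Z ≠ 0} => sphereVec Z)
    (fun a b t h => by
      have ht : t ≠ 0 := by
        rintro rfl
        exact a.2 (by rw [h, zero_smul])
      simp only [h]
      exact sphereVec_smul t ht b) p

section Twistor

variable {F : Type*} [NormedAddCommGroup F] [NormedSpace ℂ F]
  {Q : Type*} [TopologicalSpace Q] [ChartedSpace F Q]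

variable (F) in
/-- A map to `ℙ¹` is holomorphic if near every point it is `[f₁, f₂]` with holomorphic functions
`f₁`, `f₂` that have no common zero. -/
def IsHolomorphicToP1 (h : Q → P1) : Prop :=
  ∀ q : Q, ∃ U : Set Q, IsOpen U ∧ q ∈ U ∧ ∃ f : Q → (Fin 2 → ℂ),
    MDifferentiableOn 𝓘(ℂ, F) 𝓘(ℂ, Fin 2 → ℂ) f U ∧
      ∀ q' ∈ U, ∃ hf : f q' ≠ 0, h q' = Projectivization.mk ℂ (f q') hf

variable (F Q) in
/-- The complex structure of a complex manifold, on the underlying real manifold: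
multiplication by `√-1` on the tangent spaces. -/
def mulI : EndField 𝓘(ℝ, F) Q := fun _ =>
  (Complex.I • ContinuousLinearMap.id ℝ F : F →L[ℝ] F)

variable {E : Type*} [NormedAddCommGroup E] [NormedSpace ℝ E]
  {M : Type*} [TopologicalSpace M] [ChartedSpace E M] [IsManifold 𝓘(ℝ, E) ∞ M]

/-- The complex structure on `X = M × Q`: at `(m, q)` it is `a 𝐈 + b 𝐉 + c 𝐊` on `T_m M`, where
`(a, b, c) ∈ S²` is the point corresponding to `h q ∈ ℙ¹`, and the complex structure of `Q` on
`T_q Q`. -/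
def twistorStructure (S : HypercomplexStructure 𝓘(ℝ, E) M) (h : Q → P1) :
    EndField (𝓘(ℝ, E).prod 𝓘(ℝ, F)) (M × Q) := fun x =>
  ((toSphere (h x.2) 0 • S.i x.1 + toSphere (h x.2) 1 • S.j x.1 +
      toSphere (h x.2) 2 • S.k x.1 :
    TangentSpace 𝓘(ℝ, E) x.1 →L[ℝ] TangentSpace 𝓘(ℝ, E) x.1).prodMap (mulI F Q x.2))

end Twistor

end TwistorBalanced

end

/-!
Write `N` for the complex dimension of `X = M × Q`. The equation `d (ξ ^ (N - 1)) = 0` is linear in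
a bivector density: after the choice of a constant volume form, a nondegenerate two-form `ξ`
corresponds to its inverse bivector multiplied by the density of `ξ ^ N` (`poisson`), the covectors
`β` satisfy `β ∧ ξ ^ (N - 1) = c ι_{Λ β} vol`, and `ξ ^ (N - 1)` is closed exactly if `Λ β` is
divergence free for all constant covectors `β` (`extDeriv_wedgePow_eq_zero_iff`). Conversely, if
`N ≥ 2`, then every bivector density which is divergence free, invariant under the complex structure
and definite comes from a balanced metric (`exists_isBalancedMetric`). This is the statement that a
positive `(N - 1, N - 1)`-form has a positive root. It remains to find such a density on `X`. For
`N = 1` the differential condition is void.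

On the fibre `M`, averaging a metric over the quaternion group gives a hyperhermitian metric
(`exists_compat_metric`); let `G` be the contravariant metric tensor times the volume density, and
let `K₀`, `K₁`, `K₂` be the three complex structures. Integrability of the `Kₗ` implies that a
single vector density `Y` measures the failure of the metric to be balanced for all of them:
`div (Kₗ G β) = -β (Kₗ Y)` for constant covectors `β`, and `div (Kₗ Y) = 0` (`exists_lee_field`). The
first equation holds because the contraction of the Nijenhuis tensor of `Kₗ` with `Kⱼ G`, `j ≠ l`,
leaves a single term (`contr_comp_eq_zero`), the second one because the divergence of the divergence
of a bivector vanishes.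

On the base `Q`, let `a : Q → S²` be the composition of `h` with the identification of the
projective line with the sphere, and let `e ≥ 0` be its energy density with respect to the balanced
metric. The components of `a` satisfy `Δaₗ = -2 e aₗ` (`lapl_sphere_map`), where `Δ` is the divergence
of the gradient. Since `a` is not constant on any component, `e` does not vanish identically on any
component, and there is a function `f` with `p = Δf + 2 e f > 0` (`exists_schr_pos`). Here no
spectral theory is needed: the set of points at which some `g` with `Δg + 2 e g ≥ 0` is strict
contains the points with `e > 0`, is open, and is closed by means of the bump functions of
`exists_bump`; by compactness a finite sum of such functions is strict everywhere.

On the product, the bivector density `lam` has the diagonal blocks `p (∑ aₗ Kₗ) G` on the fibre and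
`(C ρ + f div Y) J G` on the base, where `ρ` is the volume density of the fibre, and the mixed part
`J∇f ⊗ Y - ∑ (aₗ ∇f - f ∇aₗ) ⊗ Kₗ Y`. Since `div (aₗ ∇f - f ∇aₗ) = p aₗ` (`div_wronsk`), the divergence
of the mixed part along the base cancels the divergence of the block of the fibre, and its
divergence along the fibre cancels that of the block of the base (`divg_lam`). The Cauchy-Riemann
equations for `a` make the mixed part invariant under the twistor complex structure (`quat_mixed`).
Finally the density is definite if the constant `C` is large, because `C` enters the block of the
base only, and the mixed part is controlled by the Cauchy-Schwarz inequality
(`exists_lam_definite`).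

Fields on a manifold are families of fields on the images of the preferred charts, related by the
coordinate changes with the appropriate power of the Jacobian determinant. Smoothness of the
holomorphic map `h` is deduced from Cauchy's formula.
-/

set_option maxSynthPendingDepth 3
set_option linter.unusedSectionVars false

noncomputable section

namespace TwistorBalanced

open Module
open ContinuousAlternatingMap (alternatizeUncurryFin alternatizeUncurryFin_apply
  alternatizeUncurryFinCLM curryLeft_apply_apply)

/-! ### Exterior and interior multiplication -/

section FormAlgebra

variable {V : Type*} [NormedAddCommGroup V] [NormedSpace ℝ V]
  {W : Type*} [NormedAddCommGroup W] [NormedSpace ℝ W]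

/-- Exterior multiplication `Ω ↦ β ∧ Ω` by a covector `β`. -/
def extMul {k : ℕ} (β : V →L[ℝ] ℝ) (Ω : V [⋀^Fin k]→L[ℝ] ℝ) : V [⋀^Fin (k + 1)]→L[ℝ] ℝ :=
  alternatizeUncurryFin (β.smulRight Ω)

theorem extMul_apply {k : ℕ} (β : V →L[ℝ] ℝ) (Ω : V [⋀^Fin k]→L[ℝ] ℝ) (v : Fin (k + 1) → V) :
    extMul β Ω v = ∑ i : Fin (k + 1), (-1) ^ (i : ℕ) * (β (v i) * Ω (i.removeNth v)) := by
  simp [extMul, alternatizeUncurryFin_apply]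

theorem extMul_add {k : ℕ} (β : V →L[ℝ] ℝ) (Ω Ω' : V [⋀^Fin k]→L[ℝ] ℝ) :
    extMul β (Ω + Ω') = extMul β Ω + extMul β Ω' := by
  ext v; simp [extMul_apply, mul_add, Finset.sum_add_distrib]

theorem extMul_smul {k : ℕ} (β : V →L[ℝ] ℝ) (c : ℝ) (Ω : V [⋀^Fin k]→L[ℝ] ℝ) :
    extMul β (c • Ω) = c • extMul β Ω := by
  ext v; simp only [extMul_apply, ContinuousAlternatingMap.smul_apply, smul_eq_mul, Finset.mul_sum]
  exact Finset.sum_congr rfl fun i _ => by ring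

theorem extMul_sub {k : ℕ} (β : V →L[ℝ] ℝ) (Ω Ω' : V [⋀^Fin k]→L[ℝ] ℝ) :
    extMul β (Ω - Ω') = extMul β Ω - extMul β Ω' := by
  ext v; simp [extMul_apply, mul_sub, Finset.sum_sub_distrib]

theorem extMul_neg {k : ℕ} (β : V →L[ℝ] ℝ) (Ω : V [⋀^Fin k]→L[ℝ] ℝ) :
    extMul β (-Ω) = -extMul β Ω := by
  ext v; simp [extMul_apply]

theorem extMul_zero {k : ℕ} (β : V →L[ℝ] ℝ) : extMul β (0 : V [⋀^Fin k]→L[ℝ] ℝ) = 0 := by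
  ext v; simp [extMul_apply]

theorem extMul_sum {k : ℕ} {ι : Type*} (s : Finset ι) (β : V →L[ℝ] ℝ)
    (Ω : ι → V [⋀^Fin k]→L[ℝ] ℝ) :
    extMul β (∑ i ∈ s, Ω i) = ∑ i ∈ s, extMul β (Ω i) := by
  classical
  induction s using Finset.induction_on with
  | empty => simp [extMul_zero]
  | insert a s ha ih => rw [Finset.sum_insert ha, Finset.sum_insert ha, extMul_add, ih]

theorem sum_smul_extMul {k : ℕ} {ι : Type*} (s : Finset ι) (c : ι → ℝ) (β : ι → V →L[ℝ] ℝ)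
    (Ω : V [⋀^Fin k]→L[ℝ] ℝ) :
    ∑ i ∈ s, c i • extMul (β i) Ω = extMul (∑ i ∈ s, c i • β i) Ω := by
  ext v
  simp only [ContinuousAlternatingMap.sum_apply, ContinuousAlternatingMap.smul_apply, extMul_apply,
    _root_.sum_apply, _root_.smul_apply, smul_eq_mul, Finset.mul_sum, Finset.sum_mul]
  rw [Finset.sum_comm]
  exact Finset.sum_congr rfl fun i _ => Finset.sum_congr rfl fun j _ => by ring

theorem extMul_neg_left {k : ℕ} (β : V →L[ℝ] ℝ) (Ω : V [⋀^Fin k]→L[ℝ] ℝ) :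
    extMul (-β) Ω = -extMul β Ω := by
  ext v; simp [extMul_apply]

/-- Uncurrying twice changes sign when the two curried arguments are exchanged. -/
theorem alternatizeUncurryFin_comp_swap {k : ℕ} (f g : V →L[ℝ] V →L[ℝ] V [⋀^Fin k]→L[ℝ] ℝ)
    (h : ∀ x y, f x y = g y x) :
    alternatizeUncurryFin (alternatizeUncurryFinCLM ℝ V ℝ ∘L f)
      = -alternatizeUncurryFin (alternatizeUncurryFinCLM ℝ V ℝ ∘L g) := by
  ext v
  rw [ContinuousAlternatingMap.neg_apply,
    ContinuousAlternatingMap.alternatizeUncurryFin_alternatizeUncurryFinCLM_comp_apply,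
    ContinuousAlternatingMap.alternatizeUncurryFin_alternatizeUncurryFinCLM_comp_apply,
    ← Finset.sum_neg_distrib]
  refine Finset.sum_congr rfl fun i _ => ?_
  rw [← Finset.sum_neg_distrib]
  refine Finset.sum_congr rfl fun j _ => ?_
  rw [h, h, ← smul_neg, neg_sub]

theorem extMul_extMul {k : ℕ} (α β : V →L[ℝ] ℝ) (Ω : V [⋀^Fin k]→L[ℝ] ℝ) :
    extMul α (extMul β Ω) = -extMul β (extMul α Ω) := by
  have e : ∀ α β : V →L[ℝ] ℝ, alternatizeUncurryFinCLM ℝ V ℝ ∘L (α.smulRight (β.smulRight Ω))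
      = α.smulRight (extMul β Ω) := fun α β => by
    ext x v
    simp [extMul, alternatizeUncurryFin_apply]
  have h := alternatizeUncurryFin_comp_swap (α.smulRight (β.smulRight Ω))
    (β.smulRight (α.smulRight Ω)) (fun x y => by
      ext v
      change α x * (β y * Ω v) = β y * (α x * Ω v)
      ring)
  rw [e, e] at h
  exact h

/-- Interior multiplication is an antiderivation with respect to exterior multiplication. -/
theorem curryLeft_extMul {k : ℕ} (α : V →L[ℝ] ℝ) (Ω : V [⋀^Fin (k + 1)]→L[ℝ] ℝ) (u : V) :
    (extMul α Ω).curryLeft u = α u • Ω - extMul α (Ω.curryLeft u) := by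
  ext v
  simp only [curryLeft_apply_apply, extMul_apply, ContinuousAlternatingMap.sub_apply, ContinuousAlternatingMap.smul_apply, smul_eq_mul]
  rw [Fin.sum_univ_succ]
  simp only [Matrix.vecCons, Fin.val_zero, pow_zero, one_mul, Fin.cons_zero, Fin.val_succ,
    Fin.cons_succ, sub_eq_add_neg, ← Finset.sum_neg_distrib]
  congr 1
  refine Finset.sum_congr rfl fun i _ => ?_
  have : (Fin.removeNth i.succ (Fin.cons u v : Fin (k + 2) → V)) = Fin.cons u (i.removeNth v) := by
    ext j
    refine Fin.cases ?_ (fun j => ?_) j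
    · simp [Fin.removeNth]
    · simp [Fin.removeNth]
  rw [this, pow_succ]; ring

theorem curryLeft_extMul_zero (α : V →L[ℝ] ℝ) (Ω : V [⋀^Fin 0]→L[ℝ] ℝ) (u : V) :
    (extMul α Ω).curryLeft u = α u • Ω := by
  ext v
  have h := extMul_apply α Ω (Fin.cons u v)
  rw [Fin.sum_univ_succ] at h
  simp only [Fin.val_zero, pow_zero, one_mul, Fin.cons_zero, Finset.univ_eq_empty,
    Finset.sum_empty, add_zero] at h
  refine h.trans ?_
  rw [ContinuousAlternatingMap.smul_apply, smul_eq_mul, Subsingleton.elim (Fin.removeNth _ _) v]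

/-- A form whose degree is smaller than the dimension vanishes if its products with all covectors
vanish. -/
theorem eq_zero_of_forall_extMul_eq_zero [FiniteDimensional ℝ V] {k : ℕ} (hk : k < finrank ℝ V)
    (Ω : V [⋀^Fin k]→L[ℝ] ℝ) (h : ∀ β : V →L[ℝ] ℝ, extMul β Ω = 0) : Ω = 0 := by
  ext w
  -- a covector `f` which vanishes on the arguments `w`, evaluated on a further vector `u`
  have hlt : Submodule.span ℝ (Set.range w) < ⊤ := by
    refine lt_of_le_of_ne le_top fun e => ?_
    have h1 := finrank_range_le_card (R := ℝ) w
    rw [Set.finrank, e, finrank_top, Fintype.card_fin] at h1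
    omega
  obtain ⟨f, hf0, hf⟩ := Submodule.exists_le_ker_of_lt_top _ hlt
  obtain ⟨u, hu⟩ : ∃ u, f u ≠ 0 := by
    by_contra! hc
    exact hf0 (LinearMap.ext hc)
  have hfw : ∀ i, f (w i) = 0 := fun i =>
    LinearMap.mem_ker.1 (hf (Submodule.subset_span ⟨i, rfl⟩))
  have h2 := congrArg (fun Θ => Θ (Fin.cons u w)) (h (LinearMap.toContinuousLinearMap f))
  simp only [extMul_apply, ContinuousAlternatingMap.coe_zero, Pi.zero_apply] at h2
  rw [Fin.sum_univ_succ] at h2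
  simpa [hfw, hu] using h2

theorem form_eq_zero_of_finrank_lt [FiniteDimensional ℝ V] {k : ℕ} (hk : finrank ℝ V < k)
    (Ω : V [⋀^Fin k]→L[ℝ] ℝ) : Ω = 0 := by
  ext w
  have hld : ¬ LinearIndependent ℝ w := fun hl => by
    have := hl.fintype_card_le_finrank
    rw [Fintype.card_fin] at this
    omega
  exact Ω.toAlternatingMap.map_linearDependent w hld

end FormAlgebra

/-! ### Powers of a two-form -/

section Wedge

variable {V : Type*} [NormedAddCommGroup V] [NormedSpace ℝ V]
  {W : Type*} [NormedAddCommGroup W] [NormedSpace ℝ W]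

variable (V) in
/-- The linear map sending a `2`-form `ξ` to the map `u ↦ ξ(u, ·)`. -/
def flatL : (V [⋀^Fin 2]→L[ℝ] ℝ) →L[ℝ] V →L[ℝ] V →L[ℝ] ℝ :=
  (ContinuousLinearMap.compL ℝ V (V [⋀^Fin 1]→L[ℝ] ℝ) (V →L[ℝ] ℝ)
    ((ContinuousAlternatingMap.ofSubsingletonLIE (𝕜 := ℝ) (E := V) (F := ℝ) (0 : Fin 1)).symm.toContinuousLinearEquiv :
      (V [⋀^Fin 1]→L[ℝ] ℝ) →L[ℝ] V →L[ℝ] ℝ)).comp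
    (ContinuousAlternatingMap.curryLeftLI (𝕜 := ℝ) (E := V) (F := ℝ) (n := 1)).toContinuousLinearMap

/-- The map `u ↦ ξ(u, ·)` of a `2`-form `ξ`. -/
def flat (ξ : V [⋀^Fin 2]→L[ℝ] ℝ) : V →L[ℝ] V →L[ℝ] ℝ := flatL V ξ

theorem flat_apply (ξ : V [⋀^Fin 2]→L[ℝ] ℝ) (u v : V) : flat ξ u v = ξ ![u, v] := by
  change ξ (Matrix.vecCons u _) = _
  congr 1
  ext j
  fin_cases j <;> rfl

/-- Expansion of the alternatization of `b ⊗ f` along the first argument. -/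
theorem sum_perm_cons {k : ℕ} (b : V →L[ℝ] ℝ) (f : (Fin k → V) → ℝ) (v : Fin (k + 1) → V) :
    ∑ σ : Equiv.Perm (Fin (k + 1)),
        (Equiv.Perm.sign σ : ℤ) * (b (v (σ 0)) * f (fun j => v (σ j.succ)))
      = ∑ i : Fin (k + 1), (-1) ^ (i : ℕ) * (b (v i) *
          ∑ τ : Equiv.Perm (Fin k), (Equiv.Perm.sign τ : ℤ) * f (fun j => i.removeNth v (τ j))) := by
  -- a permutation is determined by the image `i` of `0` and the induced permutation of the others
  let e : Fin (k + 1) × Equiv.Perm (Fin k) ≃ Equiv.Perm (Fin (k + 1)) :=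
    { toFun := fun p => p.1.cycleRange.symm * Equiv.Perm.decomposeFin.symm (0, p.2)
      invFun := fun σ => (σ 0, (Equiv.Perm.decomposeFin ((σ 0).cycleRange * σ)).2)
      left_inv := fun p => by
        have h0 : (p.1.cycleRange.symm * Equiv.Perm.decomposeFin.symm (0, p.2)) 0 = p.1 := by
          simp
        ext1
        · exact h0
        · simp only [h0, ← mul_assoc]
          have : p.1.cycleRange * p.1.cycleRange.symm = 1 := mul_inv_cancel _
          rw [this, one_mul, Equiv.apply_symm_apply]
      right_inv := fun σ => by
        have : ((Equiv.Perm.decomposeFin ((σ 0).cycleRange * σ)).1 : Fin (k + 1)) = 0 := by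
          have h := Equiv.Perm.decomposeFin_symm_apply_zero
            (Equiv.Perm.decomposeFin ((σ 0).cycleRange * σ)).1
            (Equiv.Perm.decomposeFin ((σ 0).cycleRange * σ)).2
          rw [Prod.mk.eta, Equiv.symm_apply_apply] at h
          rw [← h]; simp
        have h2 : ((0 : Fin (k + 1)), (Equiv.Perm.decomposeFin ((σ 0).cycleRange * σ)).2)
            = Equiv.Perm.decomposeFin ((σ 0).cycleRange * σ) := Prod.ext this.symm rfl
        simp only [h2, Equiv.symm_apply_apply, ← mul_assoc]
        have : (σ 0).cycleRange.symm * (σ 0).cycleRange = 1 := inv_mul_cancel _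
        rw [this, one_mul] }
  rw [← Equiv.sum_comp e, Fintype.sum_prod_type]
  refine Finset.sum_congr rfl fun i _ => ?_
  rw [Finset.mul_sum, Finset.mul_sum]
  refine Finset.sum_congr rfl fun τ _ => ?_
  have h0 : e (i, τ) 0 = i := by simp [e]
  have hs : ∀ j : Fin k, e (i, τ) j.succ = i.succAbove (τ j) := fun j => by
    simp [e]
  have hsign : (Equiv.Perm.sign (e (i, τ)) : ℤ) = (-1) ^ (i : ℕ) * Equiv.Perm.sign τ := by
    have : Equiv.Perm.sign (e (i, τ)) = (-1) ^ (i : ℕ) * Equiv.Perm.sign τ := by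
      simp only [e, Equiv.coe_fn_mk, Equiv.Perm.sign_mul, Equiv.Perm.decomposeFin.symm_sign,
        Equiv.Perm.sign_symm, Fin.sign_cycleRange, if_true, one_mul]
    rw [this]; simp
  rw [h0, hsign]
  simp only [hs, Fin.removeNth]
  push_cast; ring

theorem wedge_apply {k l : ℕ} (α : V [⋀^Fin k]→L[ℝ] ℝ) (β : V [⋀^Fin l]→L[ℝ] ℝ)
    (v : Fin (k + l) → V) : wedge α β v = ((k.factorial * l.factorial : ℝ)⁻¹) *
      ∑ σ : Equiv.Perm (Fin (k + l)), (Equiv.Perm.sign σ : ℤ) *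
      (α (fun i => v (σ (Fin.castAdd l i))) * β (fun j => v (σ (Fin.natAdd k j)))) := by
  rw [wedge, ContinuousAlternatingMap.smul_apply, smul_eq_mul]
  congr 1
  refine (ContinuousMultilinearMap.alternatization_apply_apply _ _).trans ?_
  refine Finset.sum_congr rfl fun σ _ => ?_
  rw [Units.smul_def, zsmul_eq_mul]
  rfl

/-- The product of a form with a `2`-form, in terms of products with covectors. -/
theorem wedge_eq_sum_extMul {ι : Type*} [Fintype ι] (e : Basis ι ℝ V) (e' : ι → V →L[ℝ] ℝ)
    (he : ∀ i v, e' i v = e.repr v i) {k : ℕ} (Ω : V [⋀^Fin k]→L[ℝ] ℝ) (ξ : V [⋀^Fin 2]→L[ℝ] ℝ) :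
    wedge Ω ξ = (2⁻¹ : ℝ) • ∑ i, extMul (e' i)
      (extMul (flat ξ (e i)) Ω) := by
  classical
  set b : ι → V →L[ℝ] ℝ := fun i => flat ξ (e i) with hb
  have hξ : ∀ x y, ξ ![x, y] = ∑ i, e' i x * b i y := fun x y => by
    rw [← flat_apply]
    conv_lhs => rw [← e.sum_repr x]
    simp only [hb, he, map_sum, map_smul, _root_.sum_apply, _root_.smul_apply, smul_eq_mul]
  ext v
  have hkf : (k.factorial : ℝ) ≠ 0 := by positivity
  have key : ∑ σ : Equiv.Perm (Fin (k + 2)), (Equiv.Perm.sign σ : ℤ) *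
      (Ω (fun i => v (σ (Fin.castAdd 2 i))) * ξ (fun j => v (σ (Fin.natAdd k j))))
      = (k.factorial : ℝ) * ∑ i, extMul (e' i) (extMul (b i) Ω) v := by
    -- the permutation `ρ` moves the two arguments of `ξ` in front of the arguments of `Ω`; it is the
    -- square of a rotation and hence even
    let ρ : Equiv.Perm (Fin (k + 2)) := (finRotate (k + 2)).symm * (finRotate (k + 2)).symm
    have hρs : ∀ j : Fin (k + 1), (finRotate (k + 2)).symm j.succ = j.castSucc := fun j => by
      rw [Equiv.symm_apply_eq]
      ext; simp [coe_finRotate_of_ne_last (Fin.castSucc_lt_last j).ne]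
    have hρ0 : (finRotate (k + 2)).symm 0 = Fin.last (k + 1) := by
      rw [Equiv.symm_apply_eq, finRotate_last]
    have hρ : ∀ j : Fin k, ρ j.succ.succ = Fin.castAdd 2 j := fun j => by
      simp only [ρ, Equiv.Perm.mul_apply]
      rw [hρs, ← Fin.succ_castSucc, hρs]; rfl
    have h0 : ρ 0 = Fin.natAdd k 0 := by
      simp only [ρ, Equiv.Perm.mul_apply]
      rw [hρ0, ← Fin.succ_last, hρs]; ext; simp
    have h1 : ρ 1 = Fin.natAdd k 1 := by
      simp only [ρ, Equiv.Perm.mul_apply]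
      rw [← Fin.succ_zero_eq_one, hρs, Fin.castSucc_zero, hρ0]; ext; simp
    have hsg : Equiv.Perm.sign ρ = 1 := by
      simp only [ρ, Equiv.Perm.sign_mul, Int.units_mul_self]
    rw [← Equiv.sum_comp (Equiv.mulRight ρ⁻¹)]
    have step : ∀ σ : Equiv.Perm (Fin (k + 2)),
        ((Equiv.Perm.sign (Equiv.mulRight ρ⁻¹ σ) : ℤ) : ℝ) *
          (Ω (fun i => v (Equiv.mulRight ρ⁻¹ σ (Fin.castAdd 2 i))) *
            ξ (fun j => v (Equiv.mulRight ρ⁻¹ σ (Fin.natAdd k j))))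
        = ∑ i, (Equiv.Perm.sign σ : ℤ) * (e' i (v (σ 0)) *
          (fun w : Fin (k + 1) → V => b i (w 0) * Ω (fun j => w j.succ)) (fun j => v (σ j.succ))) := by
      intro σ
      have a1 : (Equiv.Perm.sign (Equiv.mulRight ρ⁻¹ σ)) = Equiv.Perm.sign σ := by
        simp [Equiv.Perm.sign_mul, hsg]
      have a2 : ∀ i : Fin k, (Equiv.mulRight ρ⁻¹ σ) (Fin.castAdd 2 i) = σ i.succ.succ := fun i => by
        rw [← hρ]; simp
      have a3 : (fun j => v (Equiv.mulRight ρ⁻¹ σ (Fin.natAdd k j))) = ![v (σ 0), v (σ 1)] := by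
        ext j
        fin_cases j
        · simp only [Fin.zero_eta, Matrix.cons_val_zero]; rw [← h0]; simp
        · simp only [Fin.mk_one, Matrix.cons_val_one]; rw [← h1]; simp
      rw [a1, a3, hξ]
      simp only [a2, Finset.mul_sum]
      exact Finset.sum_congr rfl fun i _ => by rw [Fin.succ_zero_eq_one]; ring
    rw [Finset.sum_congr rfl fun σ _ => step σ, Finset.sum_comm, Finset.mul_sum]
    refine Finset.sum_congr rfl fun i _ => ?_
    rw [sum_perm_cons (e' i) (fun w : Fin (k + 1) → V => b i (w 0) * Ω (fun j => w j.succ)) v,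
      extMul_apply, Finset.mul_sum]
    refine Finset.sum_congr rfl fun p _ => ?_
    rw [sum_perm_cons (b i) Ω, extMul_apply, Finset.mul_sum, Finset.mul_sum, Finset.mul_sum,
      Finset.mul_sum, Finset.mul_sum]
    refine Finset.sum_congr rfl fun q _ => ?_
    -- `Ω` is already alternating, so that its alternatization only yields the factor `k!`
    have : ∑ τ : Equiv.Perm (Fin k), (Equiv.Perm.sign τ : ℤ) *
        Ω (fun j => q.removeNth (p.removeNth v) (τ j)) = k.factorial *
          Ω (q.removeNth (p.removeNth v)) := by
      have : ∀ τ : Equiv.Perm (Fin k), ((Equiv.Perm.sign τ : ℤ) : ℝ) *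
        Ω (fun j => q.removeNth (p.removeNth v) (τ j)) = Ω (q.removeNth (p.removeNth v)) := by
        intro τ
        have h := Ω.map_perm (q.removeNth (p.removeNth v)) τ
        have h' : Ω (fun j => q.removeNth (p.removeNth v) (τ j)) =
          Equiv.Perm.sign τ • Ω (q.removeNth (p.removeNth v)) := h
        rw [h']
        rcases Int.units_eq_one_or (Equiv.Perm.sign τ) with h | h <;> simp [h]
      rw [Finset.sum_congr rfl fun τ _ => this τ]
      simp [Finset.card_univ, Fintype.card_perm]
    rw [this]; ring
  rw [wedge_apply, key, ContinuousAlternatingMap.smul_apply, ContinuousAlternatingMap.sum_apply, smul_eq_mul]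
  simp only [Nat.factorial_two]
  push_cast
  field_simp
  rfl

theorem flat_swap (ξ : V [⋀^Fin 2]→L[ℝ] ℝ) (u v : V) : flat ξ u v = -flat ξ v u := by
  rw [flat_apply, flat_apply]
  have h := ξ.toAlternatingMap.map_swap ![u, v] (show (0 : Fin 2) ≠ 1 by decide)
  have e : (![u, v] ∘ Equiv.swap (0 : Fin 2) 1) = ![v, u] := by
    ext j; fin_cases j <;> simp
  rw [e] at h
  change ξ ![v, u] = -ξ ![u, v] at h
  rw [h, neg_neg]

/-- The covector dual to the `i`-th vector of a basis. -/
def dualCov [FiniteDimensional ℝ V] {ι : Type*} (e : Basis ι ℝ V) (i : ι) : V →L[ℝ] ℝ :=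
  LinearMap.toContinuousLinearMap (e.coord i)

theorem dualCov_apply [FiniteDimensional ℝ V] {ι : Type*} (e : Basis ι ℝ V) (i : ι) (v : V) :
    dualCov e i v = e.repr v i := rfl

theorem sum_dualCov_smul [FiniteDimensional ℝ V] {ι : Type*} [Fintype ι] (e : Basis ι ℝ V)
    (β : V →L[ℝ] ℝ) : ∑ i, β (e i) • dualCov e i = β := by
  ext v
  conv_rhs => rw [← e.sum_repr v]
  simp only [_root_.sum_apply, _root_.smul_apply, dualCov_apply, map_sum, map_smul, smul_eq_mul]
  exact Finset.sum_congr rfl fun i _ => mul_comm _ _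

variable [FiniteDimensional ℝ V]

theorem extMul_wedge {k : ℕ} (β : V →L[ℝ] ℝ) (Ω : V [⋀^Fin k]→L[ℝ] ℝ)
    (ξ : V [⋀^Fin 2]→L[ℝ] ℝ) : extMul β (wedge Ω ξ) = wedge (extMul β Ω) ξ := by
  rw [wedge_eq_sum_extMul (finBasis ℝ V) (dualCov (finBasis ℝ V)) (dualCov_apply _),
    wedge_eq_sum_extMul (finBasis ℝ V) (dualCov (finBasis ℝ V)) (dualCov_apply _),
    extMul_smul, extMul_sum]
  congr 1
  refine Finset.sum_congr rfl fun i _ => ?_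
  rw [extMul_extMul, extMul_extMul β, ← extMul_neg_left, extMul_neg_left, extMul_neg,
    neg_neg]

/-- The interior product with `Ω ∧ ξ`, for a two-form `ξ`. The two halves of the expansion of `ξ`
in a basis and its dual basis contribute the same term. -/
theorem curryLeft_wedge {k : ℕ} (Ω : V [⋀^Fin (k + 1)]→L[ℝ] ℝ) (ξ : V [⋀^Fin 2]→L[ℝ] ℝ) (u : V) :
    (wedge Ω ξ).curryLeft u = wedge (Ω.curryLeft u) ξ + extMul (flat ξ u) Ω := by
  set e := finBasis ℝ V
  rw [wedge_eq_sum_extMul e (dualCov e) (dualCov_apply _),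
    wedge_eq_sum_extMul e (dualCov e) (dualCov_apply _)]
  have h1 : ∑ i, dualCov e i u • extMul (flat ξ (e i)) Ω = extMul (flat ξ u) Ω := by
    rw [sum_smul_extMul]
    congr 1
    conv_rhs => rw [← e.sum_repr u]
    simp only [map_sum, map_smul, dualCov_apply]
  have h2 : ∑ i, flat ξ (e i) u • extMul (dualCov e i) Ω = -extMul (flat ξ u) Ω := by
    rw [sum_smul_extMul, ← extMul_neg_left]
    congr 1
    rw [← sum_dualCov_smul e (-flat ξ u)]
    refine Finset.sum_congr rfl fun i _ => ?_
    rw [flat_swap]; rfl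
  have h3 : ∀ i, (extMul (dualCov e i) (extMul (flat ξ (e i)) Ω)).curryLeft u
      = dualCov e i u • extMul (flat ξ (e i)) Ω - flat ξ (e i) u • extMul (dualCov e i) Ω
        + extMul (dualCov e i) (extMul (flat ξ (e i)) (Ω.curryLeft u)) := fun i => by
    rw [curryLeft_extMul, curryLeft_extMul, extMul_sub, extMul_smul]
    abel
  have h4 : ∀ (c : ℝ) (s : Fin (finrank ℝ V) → V [⋀^Fin (k + 1 + 1 + 1)]→L[ℝ] ℝ),
      (c • ∑ i, s i).curryLeft u = c • ∑ i, (s i).curryLeft u := fun c s => by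
    ext v
    simp [ContinuousAlternatingMap.sum_apply]
  refine (h4 _ _).trans ?_
  rw [Finset.sum_congr rfl fun i _ => h3 i, Finset.sum_add_distrib, Finset.sum_sub_distrib, h1, h2,
    smul_add]
  refine (add_comm _ _).trans ?_
  congr 1
  rw [sub_neg_eq_add, ← two_smul ℝ, smul_smul]
  norm_num

/-- The interior product with the powers of a two-form: `ι_u ξ ^ (m + 1) = (m + 1) (ι_u ξ) ∧ ξ ^ m`. -/
theorem curryLeft_wedgePow_succ (ξ : V [⋀^Fin 2]→L[ℝ] ℝ) (m : ℕ) (u : V) :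
    ContinuousAlternatingMap.curryLeft (n := 2 * m + 1) (wedgePow ξ (m + 1)) u
      = ((m + 1 : ℕ) : ℝ) • extMul (flat ξ u) (wedgePow ξ m) := by
  induction m with
  | zero =>
    set e := finBasis ℝ V
    have hw : wedgePow ξ 1 = wedge (wedgePow ξ 0) ξ := rfl
    have h2 : ∑ i, flat ξ (e i) u • extMul (dualCov e i) (wedgePow ξ 0)
        = -extMul (flat ξ u) (wedgePow ξ 0) := by
      rw [sum_smul_extMul, ← extMul_neg_left]
      congr 1
      rw [← sum_dualCov_smul e (-flat ξ u)]
      refine Finset.sum_congr rfl fun i _ => ?_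
      rw [flat_swap]; rfl
    have h1 : ∑ i, dualCov e i u • extMul (flat ξ (e i)) (wedgePow ξ 0)
        = extMul (flat ξ u) (wedgePow ξ 0) := by
      rw [sum_smul_extMul]
      congr 1
      conv_rhs => rw [← e.sum_repr u]
      simp only [map_sum, map_smul, dualCov_apply]
    have h3 : ∀ i, (extMul (dualCov e i) (extMul (flat ξ (e i)) (wedgePow ξ 0))).curryLeft u
        = dualCov e i u • extMul (flat ξ (e i)) (wedgePow ξ 0)
          - flat ξ (e i) u • extMul (dualCov e i) (wedgePow ξ 0) := fun i => by
      rw [curryLeft_extMul, curryLeft_extMul_zero, extMul_smul]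
    have h4 : ∀ (c : ℝ) (s : Fin (finrank ℝ V) → V [⋀^Fin (2 * 0 + 1 + 1)]→L[ℝ] ℝ),
        (c • ∑ i, s i).curryLeft u = c • ∑ i, (s i).curryLeft u := fun c s => by
      ext v
      simp [ContinuousAlternatingMap.sum_apply]
    change (wedge (wedgePow ξ 0) ξ).curryLeft u = _
    rw [wedge_eq_sum_extMul e (dualCov e) (dualCov_apply _)]
    refine (h4 _ _).trans ?_
    rw [Finset.sum_congr rfl fun i _ => h3 i, Finset.sum_sub_distrib, h1, h2,
      sub_neg_eq_add, ← two_smul ℝ, smul_smul]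
    norm_num
  | succ m ih =>
    have h := curryLeft_wedge (k := 2 * m + 1) (wedgePow ξ (m + 1)) ξ u
    refine Eq.trans (b := wedge (ContinuousAlternatingMap.curryLeft (n := 2 * m + 1)
      (wedgePow ξ (m + 1)) u) ξ + extMul (flat ξ u) (wedgePow ξ (m + 1))) h ?_
    rw [ih]
    have hs : ∀ (c : ℝ) (Θ : V [⋀^Fin (2 * m + 1)]→L[ℝ] ℝ), wedge (c • Θ) ξ = c • wedge Θ ξ :=
      fun c Θ => by
        set e := finBasis ℝ V
        rw [wedge_eq_sum_extMul e (dualCov e) (dualCov_apply _),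
          wedge_eq_sum_extMul e (dualCov e) (dualCov_apply _), smul_comm]
        simp only [extMul_smul, ← Finset.smul_sum]
    rw [hs]
    have hx : wedge (extMul (flat ξ u) (wedgePow ξ m)) ξ
        = extMul (flat ξ u) (wedgePow ξ (m + 1)) := (extMul_wedge _ _ _).symm
    refine Eq.trans (b := ((m + 1 : ℕ) : ℝ) • extMul (flat ξ u) (wedgePow ξ (m + 1))
      + extMul (flat ξ u) (wedgePow ξ (m + 1))) (congrArg₂ _ (congrArg _ hx) rfl) ?_
    have hc : ((m + 1 + 1 : ℕ) : ℝ) = ((m + 1 : ℕ) : ℝ) + 1 := by push_cast; ring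
    rw [hc, add_smul _ (1 : ℝ), one_smul]

/-- A power of a nondegenerate `2`-form does not vanish up to the top degree. -/
theorem wedgePow_ne_zero (ξ : V [⋀^Fin 2]→L[ℝ] ℝ) (hξ : Function.Surjective (flat ξ)) (m : ℕ)
    (hm : 2 * m ≤ finrank ℝ V) : wedgePow ξ m ≠ 0 := by
  induction m with
  | zero =>
    intro h
    have := congrArg (fun Θ => Θ Fin.elim0) h
    simp [wedgePow] at this
  | succ m ih =>
    intro h
    refine ih (by omega) (eq_zero_of_forall_extMul_eq_zero (by omega) _ fun β => ?_)
    -- every covector is `ξ(u, ·)`, and its product with `ξ ^ m` is a multiple of `ι_u ξ ^ (m + 1)`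
    obtain ⟨u, rfl⟩ := hξ β
    have h1 := curryLeft_wedgePow_succ ξ m u
    rw [h] at h1
    have h2 : ((m + 1 : ℕ) : ℝ) • extMul (flat ξ u) (wedgePow ξ m) = 0 := by
      rw [← h1]; ext v; rfl
    exact (smul_eq_zero.1 h2).resolve_left (by positivity)

end Wedge

/-! ### Pullback and smooth dependence -/
section Pullback

variable {V : Type*} [NormedAddCommGroup V] [NormedSpace ℝ V]
  {W : Type*} [NormedAddCommGroup W] [NormedSpace ℝ W]

theorem wedge_comp {k l : ℕ} (α : W [⋀^Fin k]→L[ℝ] ℝ) (β : W [⋀^Fin l]→L[ℝ] ℝ) (A : V →L[ℝ] W) :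
    wedge (α.compContinuousLinearMap A) (β.compContinuousLinearMap A)
      = (wedge α β).compContinuousLinearMap A := by
  ext v
  have h : (wedge α β).compContinuousLinearMap A v = wedge α β (fun i => A (v i)) := rfl
  rw [h, wedge_apply, wedge_apply]
  rfl

theorem wedgePow_comp (ξ : W [⋀^Fin 2]→L[ℝ] ℝ) (A : V →L[ℝ] W) (m : ℕ) :
    wedgePow (ξ.compContinuousLinearMap A) m = (wedgePow ξ m).compContinuousLinearMap A := by
  induction m with
  | zero => ext v; rfl
  | succ m ih =>
    change wedge (wedgePow (ξ.compContinuousLinearMap A) m) (ξ.compContinuousLinearMap A)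
      = (wedge (wedgePow ξ m) ξ).compContinuousLinearMap A
    rw [ih, wedge_comp]

theorem flat_comp (ξ : W [⋀^Fin 2]→L[ℝ] ℝ) (A : V →L[ℝ] W) (u v : V) :
    flat (ξ.compContinuousLinearMap A) u v = flat ξ (A u) (A v) := by
  rw [flat_apply, flat_apply]
  change ξ _ = _
  congr 1
  ext j; fin_cases j <;> rfl

end Pullback

section Smooth

variable {V : Type*} [NormedAddCommGroup V] [NormedSpace ℝ V] [FiniteDimensional ℝ V]
  {W : Type*} [NormedAddCommGroup W] [NormedSpace ℝ W] {n : WithTop ℕ∞}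

/-- Exterior multiplication as a continuous bilinear map. -/
def extMulL (V : Type*) [NormedAddCommGroup V] [NormedSpace ℝ V] (k : ℕ) :
    (V →L[ℝ] ℝ) →L[ℝ] (V [⋀^Fin k]→L[ℝ] ℝ) →L[ℝ] V [⋀^Fin (k + 1)]→L[ℝ] ℝ :=
  (ContinuousLinearMap.compL ℝ (V [⋀^Fin k]→L[ℝ] ℝ) (V →L[ℝ] V [⋀^Fin k]→L[ℝ] ℝ)
    (V [⋀^Fin (k + 1)]→L[ℝ] ℝ) (alternatizeUncurryFinCLM ℝ V ℝ)).comp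
    (ContinuousLinearMap.smulRightL ℝ V (V [⋀^Fin k]→L[ℝ] ℝ))

theorem extMulL_apply {k : ℕ} (β : V →L[ℝ] ℝ) (Ω : V [⋀^Fin k]→L[ℝ] ℝ) :
    extMulL V k β Ω = extMul β Ω := rfl

theorem contDiff_wedgePow (m : ℕ) :
    ContDiff ℝ n fun ξ : V [⋀^Fin 2]→L[ℝ] ℝ => wedgePow ξ m := by
  induction m with
  | zero => exact contDiff_const
  | succ m ih =>
    set e := finBasis ℝ V
    have h : (fun ξ : V [⋀^Fin 2]→L[ℝ] ℝ => wedgePow ξ (m + 1)) = fun ξ => (2⁻¹ : ℝ) •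
        ∑ i, extMulL V _ (dualCov e i) (extMulL V _ (flatL V ξ (e i)) (wedgePow ξ m)) := by
      ext1 ξ
      exact wedge_eq_sum_extMul e (dualCov e) (dualCov_apply _) _ _
    rw [h]
    have hs : ContDiff ℝ n fun ξ : V [⋀^Fin 2]→L[ℝ] ℝ =>
        ∑ i, extMulL V _ (dualCov e i) (extMulL V _ (flatL V ξ (e i)) (wedgePow ξ m)) := by
      refine ContDiff.sum fun i _ => (extMulL V (2 * m + 1) (dualCov e i)).contDiff.comp ?_
      exact ((extMulL V (2 * m)).contDiff.comp
        ((flatL V).contDiff.clm_apply contDiff_const)).clm_apply ih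
    exact hs.const_smul (2⁻¹ : ℝ)

end Smooth

/-! ### Divergence of vector fields and exterior derivatives -/

section Divergence

variable {V : Type*} [NormedAddCommGroup V] [NormedSpace ℝ V]

/-- The divergence of a vector field on a vector space, with respect to the translation invariant
volume. -/
def divg (W : V → V) (y : V) : ℝ := LinearMap.trace ℝ V (fderiv ℝ W y : V →ₗ[ℝ] V)

theorem trace_eq_sum_dualCov [FiniteDimensional ℝ V] {ι : Type*} [Fintype ι] (e : Basis ι ℝ V)
    (A : V →L[ℝ] V) : LinearMap.trace ℝ V (A : V →ₗ[ℝ] V) = ∑ i, dualCov e i (A (e i)) := by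
  classical
  rw [LinearMap.trace_eq_matrix_trace ℝ e, Matrix.trace]
  exact Finset.sum_congr rfl fun i _ => by
    rw [Matrix.diag_apply, LinearMap.toMatrix_apply]; rfl

theorem divg_eq_sum [FiniteDimensional ℝ V] {ι : Type*} [Fintype ι] (e : Basis ι ℝ V)
    (W : V → V) (y : V) : divg W y = ∑ i, dualCov e i (fderiv ℝ W y (e i)) :=
  trace_eq_sum_dualCov e _

theorem Filter.EventuallyEq.divg_eq {W W' : V → V} {y : V} (h : W =ᶠ[nhds y] W') :
    divg W y = divg W' y := by
  rw [divg, divg, h.fderiv_eq]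

theorem divg_add {W W' : V → V} {y : V} (h : DifferentiableAt ℝ W y)
    (h' : DifferentiableAt ℝ W' y) : divg (fun z => W z + W' z) y = divg W y + divg W' y := by
  rw [divg, fderiv_fun_add h h']; simp [divg]

theorem divg_neg {W : V → V} {y : V} : divg (fun z => -W z) y = -divg W y := by
  rw [divg, fderiv_fun_neg]; simp [divg]

theorem divg_sub {W W' : V → V} {y : V} (h : DifferentiableAt ℝ W y)
    (h' : DifferentiableAt ℝ W' y) : divg (fun z => W z - W' z) y = divg W y - divg W' y := by
  rw [divg, fderiv_fun_sub h h']; simp [divg]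

theorem divg_const_smul {W : V → V} {y : V} (h : DifferentiableAt ℝ W y) (c : ℝ) :
    divg (fun z => c • W z) y = c * divg W y := by
  rw [divg, fderiv_fun_const_smul h]; simp [divg]

theorem divg_sum {ι : Type*} (s : Finset ι) {W : ι → V → V} {y : V}
    (h : ∀ i ∈ s, DifferentiableAt ℝ (W i) y) :
    divg (fun z => ∑ i ∈ s, W i z) y = ∑ i ∈ s, divg (W i) y := by
  rw [divg, fderiv_fun_sum h]; simp [divg]

theorem divg_smul [FiniteDimensional ℝ V] {u : V → ℝ} {W : V → V} {y : V}
    (hu : DifferentiableAt ℝ u y) (h : DifferentiableAt ℝ W y) :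
    divg (fun z => u z • W z) y = fderiv ℝ u y (W y) + u y * divg W y := by
  set e := finBasis ℝ V
  rw [divg_eq_sum e, divg_eq_sum e, fderiv_fun_smul hu h, Finset.mul_sum]
  simp only [_root_.add_apply, _root_.smul_apply, ContinuousLinearMap.smulRight_apply, map_add,
    map_smul, smul_eq_mul, Finset.sum_add_distrib]
  rw [add_comm]
  congr 1
  conv_rhs => rw [← e.sum_repr (W y)]
  simp only [map_sum, map_smul, smul_eq_mul, dualCov_apply]
  exact Finset.sum_congr rfl fun i _ => mul_comm _ _

/-- The contraction of a skew-symmetric contravariant tensor with a symmetric bilinear form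
vanishes. -/
theorem trace_comp_skew [FiniteDimensional ℝ V] (P : (V →L[ℝ] ℝ) →L[ℝ] V)
    (hP : ∀ β γ : V →L[ℝ] ℝ, β (P γ) = -γ (P β)) (H : V →L[ℝ] V →L[ℝ] ℝ)
    (hH : ∀ u v, H u v = H v u) :
    LinearMap.trace ℝ V (P.comp H : V →ₗ[ℝ] V) = 0 := by
  set e := finBasis ℝ V
  rw [trace_eq_sum_dualCov e]
  have h : ∀ i, dualCov e i ((P.comp H) (e i)) = ∑ j, H (e i) (e j) * dualCov e i (P (dualCov e j)) :=
    fun i => by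
      rw [ContinuousLinearMap.comp_apply]
      conv_lhs => rw [← sum_dualCov_smul e (H (e i))]
      simp only [map_sum, map_smul, smul_eq_mul]
  have h2 : ∑ i, ∑ j, H (e i) (e j) * dualCov e i (P (dualCov e j))
      = -∑ i, ∑ j, H (e i) (e j) * dualCov e i (P (dualCov e j)) := by
    conv_lhs => rw [Finset.sum_comm]
    rw [← Finset.sum_neg_distrib]
    refine Finset.sum_congr rfl fun i _ => ?_
    rw [← Finset.sum_neg_distrib]
    refine Finset.sum_congr rfl fun j _ => ?_
    rw [hP, hH]; ring
  rw [Finset.sum_congr rfl fun i _ => h i]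
  linarith

/-- The alternatization of `v ↦ ι_{A v} τ`, for a top degree form `τ`, is `(tr A) τ`. This is the
algebra behind `d (ι_W τ) = (div W) τ`. -/
theorem alternatizeUncurryFin_curryLeft_comp [FiniteDimensional ℝ V] {k : ℕ}
    (hk : finrank ℝ V = k + 1) (τ : V [⋀^Fin (k + 1)]→L[ℝ] ℝ) (A : V →L[ℝ] V) :
    alternatizeUncurryFin (τ.curryLeft.comp A) = LinearMap.trace ℝ V (A : V →ₗ[ℝ] V) • τ := by
  set e := finBasis ℝ V
  have h1 : τ.curryLeft.comp A
      = ∑ i, ((dualCov e i).comp A).smulRight (τ.curryLeft (e i)) := by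
    ext1 v
    conv_lhs => rw [ContinuousLinearMap.comp_apply, ← e.sum_repr (A v)]
    simp only [map_sum, map_smul, _root_.sum_apply]
    rfl
  have h2 : ∀ (β : V →L[ℝ] ℝ) (u : V), extMul β (τ.curryLeft u) = β u • τ := fun β u => by
    have h := curryLeft_extMul β τ u
    rw [form_eq_zero_of_finrank_lt (by omega) (extMul β τ)] at h
    have h0 : ContinuousAlternatingMap.curryLeft (0 : V [⋀^Fin (k + 1 + 1)]→L[ℝ] ℝ) u = 0 := by
      ext v; rfl
    rw [h0] at h
    exact (sub_eq_zero.1 h.symm).symm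
  rw [h1]
  change alternatizeUncurryFinCLM ℝ V ℝ _ = _
  rw [map_sum]
  rw [trace_eq_sum_dualCov e, Finset.sum_smul]
  refine Finset.sum_congr rfl fun i _ => ?_
  exact h2 ((dualCov e i).comp A) (e i)

theorem extDeriv_curryLeft [FiniteDimensional ℝ V] {k : ℕ} (hk : finrank ℝ V = k + 1)
    (τ : V [⋀^Fin (k + 1)]→L[ℝ] ℝ) {W : V → V} {y : V} (hW : DifferentiableAt ℝ W y) :
    extDeriv (fun z => τ.curryLeft (W z)) y = divg W y • τ := by
  rw [extDeriv]
  have : fderiv ℝ (fun z => τ.curryLeft (W z)) y = τ.curryLeft.comp (fderiv ℝ W y) :=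
    (τ.curryLeft.hasFDerivAt.comp y hW.hasFDerivAt).fderiv
  rw [this, alternatizeUncurryFin_curryLeft_comp hk]
  rfl

theorem extDeriv_extMul {k : ℕ} (β : V →L[ℝ] ℝ) {Ω : V → V [⋀^Fin k]→L[ℝ] ℝ} {y : V}
    (hΩ : DifferentiableAt ℝ Ω y) :
    extDeriv (fun z => extMul β (Ω z)) y = -extMul β (extDeriv Ω y) := by
  set D := fderiv ℝ Ω y
  have h1 : fderiv ℝ (fun z => extMul β (Ω z)) y = (extMulL V k β).comp D :=
    ((extMulL V k β).hasFDerivAt.comp y hΩ.hasFDerivAt).fderiv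
  have h2 : (extMulL V k β).comp D = (alternatizeUncurryFinCLM ℝ V ℝ).comp
      ((ContinuousLinearMap.smulRightL ℝ V (V [⋀^Fin k]→L[ℝ] ℝ) β).comp D) := rfl
  have h3 : β.smulRight (alternatizeUncurryFin D)
      = (alternatizeUncurryFinCLM ℝ V ℝ).comp (β.smulRight D) := by
    ext x v
    simp [alternatizeUncurryFin_apply]
  rw [extDeriv, h1, h2, extMul, extDeriv, h3]
  refine alternatizeUncurryFin_comp_swap _ _ fun x y => ?_
  rfl

/-- A form `Ω` of codimension two is closed at a point if the divergences of the vector fields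
`W β` defined by `β ∧ Ω = ι_{W β} τ`, where `β` runs through the constant covectors and `τ` is a
constant volume form, vanish at that point. -/
theorem extDeriv_eq_zero_iff_divg [FiniteDimensional ℝ V] {k : ℕ} (hk : finrank ℝ V = k + 2)
    (τ : V [⋀^Fin (k + 2)]→L[ℝ] ℝ) (hτ : τ ≠ 0) {Ω : V → V [⋀^Fin k]→L[ℝ] ℝ} {y : V}
    (hΩ : DifferentiableAt ℝ Ω y) {W : (V →L[ℝ] ℝ) → V → V}
    (hW : ∀ β, DifferentiableAt ℝ (W β) y)
    (h : ∀ β, ∀ᶠ z in nhds y, extMul β (Ω z) = τ.curryLeft (W β z)) :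
    extDeriv Ω y = 0 ↔ ∀ β, divg (W β) y = 0 := by
  have key : ∀ β, divg (W β) y • τ = -extMul β (extDeriv Ω y) := fun β => by
    rw [← extDeriv_extMul β hΩ, ← extDeriv_curryLeft hk τ (hW β)]
    exact (Filter.EventuallyEq.extDeriv_eq (h β)).symm
  constructor
  · intro h0 β
    have := key β
    rw [h0, extMul_zero, neg_zero] at this
    exact (smul_eq_zero.1 this).resolve_right hτ
  · intro h0
    refine eq_zero_of_forall_extMul_eq_zero (by omega) _ fun β => ?_
    have := key β
    rw [h0, zero_smul] at this
    exact neg_eq_zero.1 this.symm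

end Divergence

theorem two_le_infty : (2 : WithTop ℕ∞) ≤ ∞ := by
  have : ((2 : ℕ∞) : WithTop ℕ∞) ≤ ((⊤ : ℕ∞) : WithTop ℕ∞) := WithTop.coe_le_coe.2 le_top
  exact this

/-! ### Volume forms and the transformation of divergences -/

section Piola

variable {V : Type*} [NormedAddCommGroup V] [NormedSpace ℝ V] [FiniteDimensional ℝ V]

/-- The volume form of a basis. -/
def volForm {k : ℕ} (e : Basis (Fin k) ℝ V) : V [⋀^Fin k]→L[ℝ] ℝ where
  toMultilinearMap := e.det.toMultilinearMap
  cont := by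
    have : Continuous fun v : Fin k → V => (e.toMatrix v).det := by
      refine Continuous.matrix_det (continuous_matrix fun i j => ?_)
      exact (dualCov e i).continuous.comp (continuous_apply j)
    exact this
  map_eq_zero_of_eq' := e.det.map_eq_zero_of_eq'

theorem volForm_ne_zero {k : ℕ} (e : Basis (Fin k) ℝ V) : volForm e ≠ 0 := fun h => by
  have := congrArg (fun τ => τ e) h
  change e.det e = 0 at this
  rw [e.det_self] at this
  exact one_ne_zero this

/-- The determinant of an endomorphism. -/
def cdet (A : V →L[ℝ] V) : ℝ := LinearMap.det (A : V →ₗ[ℝ] V)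

theorem volForm_comp {k : ℕ} (e : Basis (Fin k) ℝ V) (A : V →L[ℝ] V) (v : Fin k → V) :
    volForm e (fun i => A (v i)) = cdet A * volForm e v :=
  e.det_comp (A : V →ₗ[ℝ] V) v

theorem contDiff_cdet {n : WithTop ℕ∞} : ContDiff ℝ n (cdet (V := V)) := by
  classical
  set e := finBasis ℝ V
  have h : (cdet (V := V)) = fun A => ∑ σ : Equiv.Perm (Fin (finrank ℝ V)),
      ((Equiv.Perm.sign σ : ℤ) : ℝ) * ∏ i, dualCov e (σ i) (A (e i)) := by
    ext A
    rw [cdet, ← LinearMap.det_toMatrix e, Matrix.det_apply]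
    refine Finset.sum_congr rfl fun σ _ => ?_
    rw [Units.smul_def, zsmul_eq_mul]
    congr 1
    refine Finset.prod_congr rfl fun i _ => ?_
    rw [LinearMap.toMatrix_apply]; rfl
  rw [h]
  refine ContDiff.sum fun σ _ => contDiff_const.mul (contDiff_prod fun i _ => ?_)
  exact (dualCov e (σ i)).contDiff.comp (contDiff_id.clm_apply contDiff_const)

theorem cdet_comp (A B : V →L[ℝ] V) : cdet (A.comp B) = cdet A * cdet B :=
  LinearMap.det_comp (A : V →ₗ[ℝ] V) (B : V →ₗ[ℝ] V)

/-- A top degree form transforms with the determinant. -/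
theorem form_comp_eq_cdet_mul {k : ℕ} (e : Basis (Fin k) ℝ V) (τ : V [⋀^Fin k]→L[ℝ] ℝ)
    (A : V →L[ℝ] V) (v : Fin k → V) : τ (fun i => A (v i)) = cdet A * τ v := by
  have h : ∀ w, τ w = τ e * volForm e w := fun w => by
    have := τ.toAlternatingMap.eq_smul_basis_det e
    have h2 := congrArg (fun t => t w) this
    exact h2
  rw [h, h v, volForm_comp]; ring

theorem divg_of_subsingleton (h : finrank ℝ V = 0) (W : V → V) (y : V) : divg W y = 0 := by
  have : Subsingleton V := finrank_zero_iff.1 h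
  rw [divg, Subsingleton.elim (fderiv ℝ W y : V →ₗ[ℝ] V) 0, map_zero]

/-- The divergence of a vector field with values in densities is a density. -/
theorem divg_of_density {ψ : V → V} {W W' : V → V} {y : V} (hψ : ContDiffAt ℝ 2 ψ y)
    (hdet : cdet (fderiv ℝ ψ y) ≠ 0) (hW : DifferentiableAt ℝ W (ψ y))
    (hW' : DifferentiableAt ℝ W' y)
    (h : ∀ᶠ z in nhds y, fderiv ℝ ψ z (W' z) = |cdet (fderiv ℝ ψ z)| • W (ψ z)) :
    divg W' y = |cdet (fderiv ℝ ψ y)| * divg W (ψ y) := by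
  obtain h0 | ⟨k, hk⟩ : finrank ℝ V = 0 ∨ ∃ k, finrank ℝ V = k + 1 := by
    rcases hh : finrank ℝ V with _ | k
    · exact Or.inl rfl
    · exact Or.inr ⟨k, rfl⟩
  · rw [divg_of_subsingleton h0, divg_of_subsingleton h0, mul_zero]
  set e : Basis (Fin (k + 1)) ℝ V := finBasisOfFinrankEq ℝ V hk
  set τ := volForm e
  have hcont : ContinuousAt (fun z => cdet (fderiv ℝ ψ z)) y :=
    (contDiff_cdet (n := 0)).continuous.continuousAt.comp
      (hψ.continuousAt_fderiv (by norm_num))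
  -- the sign of the Jacobian determinant is locally constant
  obtain ⟨s, hs, hsy⟩ : ∃ s : ℝ, s * s = 1 ∧ ∀ᶠ z in nhds y,
      cdet (fderiv ℝ ψ z) = s * |cdet (fderiv ℝ ψ z)| ∧ |cdet (fderiv ℝ ψ z)| ≠ 0 := by
    rcases lt_or_gt_of_ne hdet with hn | hp
    · refine ⟨-1, by norm_num, ?_⟩
      filter_upwards [hcont.eventually_lt continuousAt_const hn] with z hz
      exact ⟨by rw [abs_of_neg hz]; ring, abs_ne_zero.2 hz.ne⟩
    · refine ⟨1, by norm_num, ?_⟩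
      filter_upwards [continuousAt_const.eventually_lt hcont hp] with z hz
      exact ⟨by rw [abs_of_pos hz]; ring, abs_ne_zero.2 hz.ne'⟩
  have hα : DifferentiableAt ℝ (fun x => τ.curryLeft (W x)) (ψ y) :=
    τ.curryLeft.differentiableAt.comp _ hW
  -- up to the sign `s`, the form `ι_{W'} τ` is the pullback of `ι_W τ`, and the exterior derivative
  -- commutes with pullbacks
  have hpb := extDeriv_pullback (r := 2) hα hψ (by simp)
  rw [extDeriv_curryLeft hk τ hW] at hpb
  have hev : (fun z => (τ.curryLeft (W (ψ z))).compContinuousLinearMap (fderiv ℝ ψ z))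
      =ᶠ[nhds y] fun z => τ.curryLeft (s • W' z) := by
    filter_upwards [h, hsy] with z hz ⟨hz1, hz2⟩
    have hWz : W (ψ z) = |cdet (fderiv ℝ ψ z)|⁻¹ • fderiv ℝ ψ z (W' z) := by
      rw [hz, smul_smul, inv_mul_cancel₀ hz2, one_smul]
    ext v
    have h1 := volForm_comp e (fderiv ℝ ψ z) (Fin.cons (W' z) v)
    have e1 : (fun i => fderiv ℝ ψ z ((Fin.cons (W' z) v : Fin (k + 1) → V) i))
        = Fin.cons (fderiv ℝ ψ z (W' z)) (fun i => fderiv ℝ ψ z (v i)) := by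
      ext i; refine Fin.cases rfl (fun i => rfl) i
    rw [e1] at h1
    have h2 : (τ.curryLeft (W (ψ z))).compContinuousLinearMap (fderiv ℝ ψ z) v
        = |cdet (fderiv ℝ ψ z)|⁻¹ *
          τ.curryLeft (fderiv ℝ ψ z (W' z)) (fun i => fderiv ℝ ψ z (v i)) := by
      rw [hWz, map_smul]; rfl
    have h3 : τ.curryLeft (s • W' z) v = s * τ.curryLeft (W' z) v := by rw [map_smul]; rfl
    rw [h2, h3]
    change _ * volForm e (Fin.cons _ _) = s * volForm e (Fin.cons _ _)
    rw [h1]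
    generalize |cdet (fderiv ℝ ψ z)| = a at hz1 hz2
    rw [hz1]
    field_simp
  rw [hev.extDeriv_eq, extDeriv_curryLeft hk τ (W := fun z => s • W' z) (hW'.const_smul s), divg_const_smul hW'] at hpb
  have h4 := congrArg (fun t => t e) hpb
  have h5 : volForm e (fun i => fderiv ℝ ψ y (e i)) = cdet (fderiv ℝ ψ y) * volForm e e :=
    volForm_comp e _ _
  have h6 : volForm e e = 1 := e.det_self
  change s * divg W' y * volForm e e = divg W (ψ y) * volForm e (fun i => fderiv ℝ ψ y (e i)) at h4
  rw [h5, h6, hsy.self_of_nhds.1] at h4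
  have : s * (s * divg W' y) = s * (s * (|cdet (fderiv ℝ ψ y)| * divg W (ψ y))) := by
    congr 1; linarith
  rwa [← mul_assoc, ← mul_assoc, hs, one_mul, one_mul] at this

/-- The divergence of a bivector field with values in densities is a vector field with values in
densities: the second derivatives of the coordinate change drop out by skew-symmetry. -/
theorem divg_of_bivector_density {ψ : V → V} {P P' : V → (V →L[ℝ] ℝ) →L[ℝ] V} {y : V}
    (hψ : ContDiffAt ℝ ∞ ψ y) (hdet : cdet (fderiv ℝ ψ y) ≠ 0)
    (hP : DifferentiableAt ℝ P (ψ y)) (hP' : DifferentiableAt ℝ P' y)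
    (hskew : ∀ β γ : V →L[ℝ] ℝ, β (P' y γ) = -γ (P' y β))
    (h : ∀ᶠ z in nhds y, ∀ β : V →L[ℝ] ℝ,
      fderiv ℝ ψ z (P' z (β.comp (fderiv ℝ ψ z))) = |cdet (fderiv ℝ ψ z)| • P (ψ z) β)
    (β : V →L[ℝ] ℝ) :
    divg (fun z => P' z (β.comp (fderiv ℝ ψ y))) y
      = |cdet (fderiv ℝ ψ y)| * divg (fun x => P x β) (ψ y) := by
  have hψ2 : ContDiffAt ℝ 2 ψ y := hψ.of_le two_le_infty
  have hd : DifferentiableAt ℝ (fderiv ℝ ψ) y :=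
    (hψ2.fderiv_right (m := 1) (by norm_num)).differentiableAt (by norm_num)
  have hb : HasFDerivAt (fun z => β.comp (fderiv ℝ ψ z))
      ((ContinuousLinearMap.compL ℝ V V ℝ β).comp (fderiv ℝ (fderiv ℝ ψ) y)) y :=
    (ContinuousLinearMap.compL ℝ V V ℝ β).hasFDerivAt.comp y hd.hasFDerivAt
  have hW' := hP'.hasFDerivAt.clm_apply hb
  rw [← divg_of_density hψ2 hdet (W := fun x => P x β)
    (hP.clm_apply (differentiableAt_const β)) hW'.differentiableAt (h.mono fun z hz => hz β)]
  have h0 := hP'.hasFDerivAt.clm_apply (hasFDerivAt_const (β.comp (fderiv ℝ ψ y)) y)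
  rw [divg, divg, hW'.fderiv, h0.fderiv]
  have hz := trace_comp_skew (P' y) hskew
    ((ContinuousLinearMap.compL ℝ V V ℝ β).comp (fderiv ℝ (fderiv ℝ ψ) y)) (fun u v => by
      have hsym := hψ2.isSymmSndFDerivAt (by simp)
      change β (fderiv ℝ (fderiv ℝ ψ) y u v) = β (fderiv ℝ (fderiv ℝ ψ) y v u)
      rw [hsym.eq])
  simp only [ContinuousLinearMap.coe_add, map_add, hz, zero_add, ContinuousLinearMap.comp_zero,
    ContinuousLinearMap.coe_zero, map_zero]

/-- The divergence of the divergence of a bivector field vanishes: it is a contraction of the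
symmetric second derivatives with the skew-symmetric bivector. -/
theorem divg_divg_eq_zero {P : V → (V →L[ℝ] ℝ) →L[ℝ] V} {Z : V → V} {y : V}
    (hP : ContDiffAt ℝ 2 P y)
    (hskew : ∀ᶠ z in nhds y, ∀ β γ : V →L[ℝ] ℝ, β (P z γ) = -γ (P z β))
    (hZ : DifferentiableAt ℝ Z y)
    (h : ∀ᶠ z in nhds y, ∀ β : V →L[ℝ] ℝ, β (Z z) = divg (fun x => P x β) z) :
    divg Z y = 0 := by
  set e := finBasis ℝ V
  have hd : DifferentiableAt ℝ (fderiv ℝ P) y :=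
    (hP.fderiv_right (m := 1) (by norm_num)).differentiableAt (by norm_num)
  have hPd : ∀ᶠ z in nhds y, DifferentiableAt ℝ P z := by
    filter_upwards [hP.eventually (by simp)] with z hz using hz.differentiableAt (by norm_num)
  -- the diagonal entries of the derivative of `Z`, in terms of the second derivatives of `P`
  have h1 : ∀ k, dualCov e k (fderiv ℝ Z y (e k))
      = ∑ j, dualCov e j (fderiv ℝ (fderiv ℝ P) y (e k) (e j) (dualCov e k)) := fun k => by
    have ev : (fun z => dualCov e k (Z z)) =ᶠ[nhds y]
        fun z => ∑ j, dualCov e j (fderiv ℝ P z (e j) (dualCov e k)) := by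
      filter_upwards [h, hPd] with z hz hPz
      rw [hz, divg_eq_sum e]
      refine Finset.sum_congr rfl fun j _ => ?_
      rw [(hPz.hasFDerivAt.clm_apply (hasFDerivAt_const (dualCov e k) z)).fderiv]
      simp
    have e1 : fderiv ℝ (fun z => dualCov e k (Z z)) y = (dualCov e k).comp (fderiv ℝ Z y) :=
      ((dualCov e k).hasFDerivAt.comp y hZ.hasFDerivAt).fderiv
    have e2 : HasFDerivAt (fun z => ∑ j, dualCov e j (fderiv ℝ P z (e j) (dualCov e k)))
        (∑ j, (dualCov e j).comp ((((ContinuousLinearMap.apply ℝ V (dualCov e k))).comp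
          (ContinuousLinearMap.apply ℝ _ (e j))).comp (fderiv ℝ (fderiv ℝ P) y))) y := by
      refine HasFDerivAt.fun_sum fun j _ => ?_
      exact (dualCov e j).hasFDerivAt.comp y
        ((((ContinuousLinearMap.apply ℝ V (dualCov e k))).comp
          (ContinuousLinearMap.apply ℝ _ (e j))).hasFDerivAt.comp y hd.hasFDerivAt)
    have e3 := congrArg (fun A => A (e k)) (e1.symm.trans (ev.fderiv_eq.trans e2.fderiv))
    simpa using e3
  -- the second derivatives of `P` are skew-symmetric
  have hsk2 : ∀ u v : V, ∀ β γ : V →L[ℝ] ℝ, β (fderiv ℝ (fderiv ℝ P) y u v γ)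
      = -γ (fderiv ℝ (fderiv ℝ P) y u v β) := by
    intro u v β γ
    have hsk1 : ∀ᶠ z in nhds y, β (fderiv ℝ P z v γ) = -γ (fderiv ℝ P z v β) := by
      filter_upwards [hskew.eventually_nhds, hPd] with z hz hPz
      have ev : (fun x => β (P x γ)) =ᶠ[nhds z] fun x => -γ (P x β) := by
        filter_upwards [hz] with x hx using hx β γ
      have d1 : HasFDerivAt (fun x => β (P x γ))
          (β.comp ((ContinuousLinearMap.apply ℝ V γ).comp (fderiv ℝ P z))) z :=
        β.hasFDerivAt.comp z ((ContinuousLinearMap.apply ℝ V γ).hasFDerivAt.comp z hPz.hasFDerivAt)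
      have d2 : HasFDerivAt (fun x => -γ (P x β))
          (-γ.comp ((ContinuousLinearMap.apply ℝ V β).comp (fderiv ℝ P z))) z :=
        (γ.hasFDerivAt.comp z
          ((ContinuousLinearMap.apply ℝ V β).hasFDerivAt.comp z hPz.hasFDerivAt)).fun_neg
      have := congrArg (fun A => A v) (d1.fderiv.symm.trans (ev.fderiv_eq.trans d2.fderiv))
      simpa using this
    have d1 : HasFDerivAt (fun x => β (fderiv ℝ P x v γ))
        (β.comp (((ContinuousLinearMap.apply ℝ V γ).comp
          (ContinuousLinearMap.apply ℝ _ v)).comp (fderiv ℝ (fderiv ℝ P) y))) y :=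
      β.hasFDerivAt.comp y (((ContinuousLinearMap.apply ℝ V γ).comp
          (ContinuousLinearMap.apply ℝ _ v)).hasFDerivAt.comp y hd.hasFDerivAt)
    have d2 : HasFDerivAt (fun x => -γ (fderiv ℝ P x v β))
        (-γ.comp (((ContinuousLinearMap.apply ℝ V β).comp
          (ContinuousLinearMap.apply ℝ _ v)).comp (fderiv ℝ (fderiv ℝ P) y))) y :=
      (γ.hasFDerivAt.comp y (((ContinuousLinearMap.apply ℝ V β).comp
          (ContinuousLinearMap.apply ℝ _ v)).hasFDerivAt.comp y hd.hasFDerivAt)).fun_neg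
    have := congrArg (fun A => A u) (d1.fderiv.symm.trans
      ((Filter.EventuallyEq.fderiv_eq hsk1).trans d2.fderiv))
    simpa using this
  have hsym := hP.isSymmSndFDerivAt (by simp)
  rw [divg_eq_sum e, Finset.sum_congr rfl fun k _ => h1 k]
  have h2 : ∑ k, ∑ j, dualCov e j (fderiv ℝ (fderiv ℝ P) y (e k) (e j) (dualCov e k))
      = -∑ k, ∑ j, dualCov e j (fderiv ℝ (fderiv ℝ P) y (e k) (e j) (dualCov e k)) := by
    conv_lhs => rw [Finset.sum_comm]
    rw [← Finset.sum_neg_distrib]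
    refine Finset.sum_congr rfl fun i _ => ?_
    rw [← Finset.sum_neg_distrib]
    refine Finset.sum_congr rfl fun j _ => ?_
    rw [hsk2, hsym.eq]
  linarith

end Piola

section Prod

variable {E : Type*} [NormedAddCommGroup E] [NormedSpace ℝ E] [FiniteDimensional ℝ E]
  {F : Type*} [NormedAddCommGroup F] [NormedSpace ℝ F] [FiniteDimensional ℝ F]

theorem divg_prod {W : E × F → E × F} {y : E × F} (hW : DifferentiableAt ℝ W y) :
    divg W y = divg (fun p => (W (p, y.2)).1) y.1 + divg (fun q => (W (y.1, q)).2) y.2 := by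
  have h1 : HasFDerivAt (fun p : E => (W (p, y.2)).1)
      ((ContinuousLinearMap.fst ℝ E F).comp ((fderiv ℝ W y).comp (ContinuousLinearMap.inl ℝ E F)))
      y.1 := by
    refine (ContinuousLinearMap.fst ℝ E F).hasFDerivAt.comp y.1 ?_
    exact HasFDerivAt.comp (g := W) y.1 (by exact hW.hasFDerivAt)
      (hasFDerivAt_prodMk_left y.1 y.2)
  have h2 : HasFDerivAt (fun q : F => (W (y.1, q)).2)
      ((ContinuousLinearMap.snd ℝ E F).comp ((fderiv ℝ W y).comp (ContinuousLinearMap.inr ℝ E F)))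
      y.2 := by
    refine (ContinuousLinearMap.snd ℝ E F).hasFDerivAt.comp y.2 ?_
    exact HasFDerivAt.comp (g := W) y.2 (by exact hW.hasFDerivAt)
      (hasFDerivAt_prodMk_right y.1 y.2)
  rw [divg, divg, divg, h1.fderiv, h2.fderiv]
  set e := finBasis ℝ E
  set f := finBasis ℝ F
  rw [trace_eq_sum_dualCov (e.prod f), trace_eq_sum_dualCov e, trace_eq_sum_dualCov f,
    Fintype.sum_sum_type]
  congr 1
  · refine Finset.sum_congr rfl fun i _ => ?_
    simp [dualCov_apply]
  · refine Finset.sum_congr rfl fun i _ => ?_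
    simp [dualCov_apply]

end Prod

end TwistorBalanced

namespace TwistorBalanced

open Module Set

/-! ### Fields on manifolds as compatible families on charts -/

section Atlas

variable {V : Type*} [NormedAddCommGroup V] [NormedSpace ℝ V]
  {P : Type*} [TopologicalSpace P] [ChartedSpace V P]

variable (V) in
/-- The change of coordinates from the preferred chart at `x₀` to the one at `x₁`. -/
def coordCh (x₀ x₁ : P) (y : V) : V := chartAt V x₁ ((chartAt V x₀).symm y)

variable (V) in
/-- The domain of the change of coordinates. -/
def coordDom (x₀ x₁ : P) : Set V := ((chartAt V x₀).symm.trans (chartAt V x₁)).source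

theorem mem_coordDom {x₀ x₁ : P} {y : V} : y ∈ coordDom V x₀ x₁ ↔
    y ∈ (chartAt V x₀).target ∧ (chartAt V x₀).symm y ∈ (chartAt V x₁).source := by
  rw [coordDom, OpenPartialHomeomorph.trans_source]; rfl

theorem isOpen_coordDom (x₀ x₁ : P) : IsOpen (coordDom V x₀ x₁) :=
  OpenPartialHomeomorph.open_source _

theorem coordCh_mem {x₀ x₁ : P} {y : V} (h : y ∈ coordDom V x₀ x₁) :
    coordCh V x₀ x₁ y ∈ coordDom V x₁ x₀ := by
  rw [mem_coordDom] at h ⊢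
  refine ⟨(chartAt V x₁).map_source h.2, ?_⟩
  rw [coordCh, (chartAt V x₁).left_inv h.2]
  exact (chartAt V x₀).map_target h.1

theorem coordCh_mem_target {x₀ x₁ : P} {y : V} (h : y ∈ coordDom V x₀ x₁) :
    coordCh V x₀ x₁ y ∈ (chartAt V x₁).target :=
  (mem_coordDom.1 (coordCh_mem h)).1

theorem chartAt_symm_coordCh {x₀ x₁ : P} {y : V} (h : y ∈ coordDom V x₀ x₁) :
    (chartAt V x₁).symm (coordCh V x₀ x₁ y) = (chartAt V x₀).symm y :=
  (chartAt V x₁).left_inv (mem_coordDom.1 h).2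

theorem coordCh_coordCh {x₀ x₁ : P} {y : V} (h : y ∈ coordDom V x₀ x₁) :
    coordCh V x₁ x₀ (coordCh V x₀ x₁ y) = y := by
  rw [coordCh, chartAt_symm_coordCh h, (chartAt V x₀).right_inv (mem_coordDom.1 h).1]

theorem mem_coordDom_self {x₀ : P} {y : V} (h : y ∈ (chartAt V x₀).target) :
    y ∈ coordDom V x₀ ((chartAt V x₀).symm y) :=
  mem_coordDom.2 ⟨h, mem_chart_source V _⟩

variable [IsManifold 𝓘(ℝ, V) ∞ P]

theorem contDiffOn_coordCh (x₀ x₁ : P) : ContDiffOn ℝ ∞ (coordCh V x₀ x₁) (coordDom V x₀ x₁) := by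
  have h := contDiffOn_ext_coord_change (I := 𝓘(ℝ, V)) (n := ∞) x₁ x₀
  refine ContDiffOn.congr_mono h (fun y _ => ?_) (fun y hy => ?_)
  · simp [coordCh]
  · rw [mem_coordDom] at hy
    simpa using hy

theorem contDiffAt_coordCh {x₀ x₁ : P} {y : V} (h : y ∈ coordDom V x₀ x₁) :
    ContDiffAt ℝ ∞ (coordCh V x₀ x₁) y :=
  (contDiffOn_coordCh x₀ x₁).contDiffAt ((isOpen_coordDom x₀ x₁).mem_nhds h)

theorem infty_ne_zero : (∞ : WithTop ℕ∞) ≠ 0 := by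
  intro h
  have : ((⊤ : ℕ∞) : WithTop ℕ∞) = ((0 : ℕ∞) : WithTop ℕ∞) := h
  exact absurd (WithTop.coe_injective this) (by simp)

theorem infty_add_one : (∞ : WithTop ℕ∞) + 1 = ∞ := by
  have : ((⊤ : ℕ∞) : WithTop ℕ∞) + ((1 : ℕ∞) : WithTop ℕ∞) = ((⊤ : ℕ∞) : WithTop ℕ∞) := by
    rw [← WithTop.coe_add]; simp
  exact this

theorem differentiableAt_coordCh {x₀ x₁ : P} {y : V} (h : y ∈ coordDom V x₀ x₁) :
    DifferentiableAt ℝ (coordCh V x₀ x₁) y :=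
  (contDiffAt_coordCh h).differentiableAt infty_ne_zero

variable (V) in
/-- The differential of the change of coordinates. -/
abbrev jac (x₀ x₁ : P) (y : V) : V →L[ℝ] V := fderiv ℝ (coordCh V x₀ x₁) y

theorem contDiffOn_jac (x₀ x₁ : P) : ContDiffOn ℝ ∞ (jac V x₀ x₁) (coordDom V x₀ x₁) :=
  (contDiffOn_coordCh x₀ x₁).fderiv_of_isOpen (isOpen_coordDom x₀ x₁) (infty_add_one).le

theorem jac_comp_jac {x₀ x₁ : P} {y : V} (h : y ∈ coordDom V x₀ x₁) :
    (jac V x₁ x₀ (coordCh V x₀ x₁ y)).comp (jac V x₀ x₁ y) = ContinuousLinearMap.id ℝ V := by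
  have h1 : HasFDerivAt (fun z => coordCh V x₁ x₀ (coordCh V x₀ x₁ z))
      ((jac V x₁ x₀ (coordCh V x₀ x₁ y)).comp (jac V x₀ x₁ y)) y :=
    (differentiableAt_coordCh (coordCh_mem h)).hasFDerivAt.comp y
      (differentiableAt_coordCh h).hasFDerivAt
  have h2 : (fun z => coordCh V x₁ x₀ (coordCh V x₀ x₁ z)) =ᶠ[nhds y] id := by
    filter_upwards [(isOpen_coordDom x₀ x₁).mem_nhds h] with z hz using coordCh_coordCh hz
  rw [← h1.fderiv, h2.fderiv_eq, fderiv_id]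

theorem jac_jac_apply {x₀ x₁ : P} {y : V} (h : y ∈ coordDom V x₀ x₁) (v : V) :
    jac V x₁ x₀ (coordCh V x₀ x₁ y) (jac V x₀ x₁ y v) = v :=
  congrArg (fun A => A v) (jac_comp_jac h)

theorem jac_jac_apply' {x₀ x₁ : P} {y : V} (h : y ∈ coordDom V x₀ x₁) (v : V) :
    jac V x₀ x₁ y (jac V x₁ x₀ (coordCh V x₀ x₁ y) v) = v := by
  have := jac_jac_apply (coordCh_mem h) v
  rwa [coordCh_coordCh h] at this

theorem jac_injective {x₀ x₁ : P} {y : V} (h : y ∈ coordDom V x₀ x₁) :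
    Function.Injective (jac V x₀ x₁ y) :=
  Function.LeftInverse.injective (jac_jac_apply h)

theorem jac_self {x₀ : P} {y : V} (h : y ∈ (chartAt V x₀).target) :
    jac V x₀ x₀ y = ContinuousLinearMap.id ℝ V := by
  have h2 : coordCh V x₀ x₀ =ᶠ[nhds y] id := by
    filter_upwards [(chartAt V x₀).open_target.mem_nhds h] with z hz
      using (chartAt V x₀).right_inv hz
  rw [jac, h2.fderiv_eq, fderiv_id]

theorem cdet_jac_ne_zero [FiniteDimensional ℝ V] {x₀ x₁ : P} {y : V} (h : y ∈ coordDom V x₀ x₁) :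
    cdet (jac V x₀ x₁ y) ≠ 0 := by
  intro h0
  have h1 := congrArg cdet (jac_comp_jac h)
  rw [cdet_comp, h0, mul_zero] at h1
  have : cdet (ContinuousLinearMap.id ℝ V) = 1 := LinearMap.det_id
  rw [this] at h1
  exact zero_ne_one h1

theorem abs_cdet_jac_pos [FiniteDimensional ℝ V] {x₀ x₁ : P} {y : V} (h : y ∈ coordDom V x₀ x₁) :
    0 < |cdet (jac V x₀ x₁ y)| := abs_pos.2 (cdet_jac_ne_zero h)

/-- A family of local expressions is smooth. -/
def SmoothFam {R : Type*} [NormedAddCommGroup R] [NormedSpace ℝ R] (s : P → V → R) : Prop :=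
  ∀ x₀, ContDiffOn ℝ ∞ (s x₀) (chartAt V x₀).target

/-- The local expressions of a function. -/
def IsFun (u : P → V → ℝ) : Prop :=
  ∀ x₀ x₁, ∀ y ∈ coordDom V x₀ x₁, u x₀ y = u x₁ (coordCh V x₀ x₁ y)

/-- The local expressions of a density. -/
def IsDens (ρ : P → V → ℝ) : Prop :=
  ∀ x₀ x₁, ∀ y ∈ coordDom V x₀ x₁, ρ x₀ y = |cdet (jac V x₀ x₁ y)| * ρ x₁ (coordCh V x₀ x₁ y)

/-- The local expressions of a vector field with values in densities. -/
def IsVecDens (W : P → V → V) : Prop :=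
  ∀ x₀ x₁, ∀ y ∈ coordDom V x₀ x₁,
    jac V x₀ x₁ y (W x₀ y) = |cdet (jac V x₀ x₁ y)| • W x₁ (coordCh V x₀ x₁ y)

/-- The local expressions of a contravariant tensor of order two with values in densities, viewed
as a map from covectors to vectors. -/
def IsCoDens (T : P → V → (V →L[ℝ] ℝ) →L[ℝ] V) : Prop :=
  ∀ x₀ x₁, ∀ y ∈ coordDom V x₀ x₁, ∀ β : V →L[ℝ] ℝ,
    jac V x₀ x₁ y (T x₀ y (β.comp (jac V x₀ x₁ y)))
      = |cdet (jac V x₀ x₁ y)| • T x₁ (coordCh V x₀ x₁ y) β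

/-- The local expressions of a field of endomorphisms. -/
def IsEndFam (J : P → V → V →L[ℝ] V) : Prop :=
  ∀ x₀ x₁, ∀ y ∈ coordDom V x₀ x₁, ∀ v,
    jac V x₀ x₁ y (J x₀ y v) = J x₁ (coordCh V x₀ x₁ y) (jac V x₀ x₁ y v)

/-- The local expressions of a `2`-form. -/
def IsFormFam (ξ : P → V → V [⋀^Fin 2]→L[ℝ] ℝ) : Prop :=
  ∀ x₀ x₁, ∀ y ∈ coordDom V x₀ x₁,
    ξ x₀ y = (ξ x₁ (coordCh V x₀ x₁ y)).compContinuousLinearMap (jac V x₀ x₁ y)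

theorem SmoothFam.contDiffAt {R : Type*} [NormedAddCommGroup R] [NormedSpace ℝ R] {s : P → V → R}
    (h : SmoothFam s) {x₀ : P} {y : V} (hy : y ∈ (chartAt V x₀).target) :
    ContDiffAt ℝ ∞ (s x₀) y :=
  (h x₀).contDiffAt ((chartAt V x₀).open_target.mem_nhds hy)

theorem SmoothFam.differentiableAt {R : Type*} [NormedAddCommGroup R] [NormedSpace ℝ R]
    {s : P → V → R} (h : SmoothFam s) {x₀ : P} {y : V} (hy : y ∈ (chartAt V x₀).target) :
    DifferentiableAt ℝ (s x₀) y :=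
  (h.contDiffAt hy).differentiableAt infty_ne_zero

theorem SmoothFam.fderiv {R : Type*} [NormedAddCommGroup R] [NormedSpace ℝ R]
    {s : P → V → R} (h : SmoothFam s) : SmoothFam fun x₀ y => fderiv ℝ (s x₀) y := fun x₀ =>
  (h x₀).fderiv_of_isOpen (chartAt V x₀).open_target infty_add_one.le

theorem contDiffOn_divg [FiniteDimensional ℝ V] {W : V → V} {s : Set V} (hs : IsOpen s)
    (hW : ContDiffOn ℝ ∞ W s) : ContDiffOn ℝ ∞ (divg W) s := by
  set e := finBasis ℝ V
  have : divg W = fun y => ∑ i, dualCov e i (_root_.fderiv ℝ W y (e i)) := by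
    ext y; exact divg_eq_sum e W y
  rw [this]
  refine ContDiffOn.sum fun i _ => (dualCov e i).contDiff.comp_contDiffOn ?_
  exact (hW.fderiv_of_isOpen hs infty_add_one.le).clm_apply contDiffOn_const

theorem SmoothFam.divg [FiniteDimensional ℝ V] {W : P → V → V} (h : SmoothFam W) :
    SmoothFam fun x₀ y => divg (W x₀) y := fun x₀ =>
  contDiffOn_divg (chartAt V x₀).open_target (h x₀)

theorem IsVecDens.divg [FiniteDimensional ℝ V] {W : P → V → V} (h : IsVecDens W)
    (hs : SmoothFam W) : IsDens fun x₀ y => divg (W x₀) y := fun x₀ x₁ y hy =>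
  divg_of_density ((contDiffAt_coordCh hy).of_le two_le_infty) (cdet_jac_ne_zero hy)
    (hs.differentiableAt (coordCh_mem_target hy)) (hs.differentiableAt (mem_coordDom.1 hy).1)
    (Filter.eventually_of_mem ((isOpen_coordDom x₀ x₁).mem_nhds hy) fun z hz => h x₀ x₁ z hz)

theorem IsFun.fderiv_eq {u : P → V → ℝ} (h : IsFun u) (hs : SmoothFam u) {x₀ x₁ : P} {y : V}
    (hy : y ∈ coordDom V x₀ x₁) :
    _root_.fderiv ℝ (u x₀) y
      = (_root_.fderiv ℝ (u x₁) (coordCh V x₀ x₁ y)).comp (jac V x₀ x₁ y) := by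
  have h1 := (hs.differentiableAt (coordCh_mem_target hy)).hasFDerivAt.comp y
    (differentiableAt_coordCh hy).hasFDerivAt
  rw [← h1.fderiv]
  refine Filter.EventuallyEq.fderiv_eq ?_
  filter_upwards [(isOpen_coordDom x₀ x₁).mem_nhds hy] with z hz using h x₀ x₁ z hz

/-- The vector field dual to the divergence of a contravariant tensor field. -/
def divVec [FiniteDimensional ℝ V] (T : V → (V →L[ℝ] ℝ) →L[ℝ] V) (y : V) : V :=
  ∑ i, divg (fun z => T z (dualCov (finBasis ℝ V) i)) y • finBasis ℝ V i

theorem apply_divVec [FiniteDimensional ℝ V] {T : V → (V →L[ℝ] ℝ) →L[ℝ] V} {y : V}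
    (hT : DifferentiableAt ℝ T y) (β : V →L[ℝ] ℝ) :
    β (divVec T y) = divg (fun z => T z β) y := by
  set e := finBasis ℝ V
  have h1 : (fun z => T z β) = fun z => ∑ i, β (e i) • T z (dualCov e i) := by
    ext1 z
    conv_lhs => rw [← sum_dualCov_smul e β]
    simp only [map_sum, map_smul]
  have hd : ∀ i, DifferentiableAt ℝ (fun z => T z (dualCov e i)) y := fun i =>
    hT.clm_apply (differentiableAt_const _)
  rw [h1, divg_sum (W := fun i z => β (e i) • T z (dualCov e i)) _
    (fun i _ => (hd i).const_smul (β (e i))), divVec, map_sum]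
  refine Finset.sum_congr rfl fun i _ => ?_
  rw [divg_const_smul (hd i), map_smul, smul_eq_mul, mul_comm]

theorem eq_of_forall_covector [FiniteDimensional ℝ V] {v w : V} (h : ∀ β : V →L[ℝ] ℝ, β v = β w) :
    v = w := by
  refine (finBasis ℝ V).ext_elem fun i => ?_
  exact h (dualCov (finBasis ℝ V) i)

theorem SmoothFam.divVec [FiniteDimensional ℝ V] {T : P → V → (V →L[ℝ] ℝ) →L[ℝ] V}
    (h : SmoothFam T) : SmoothFam fun x₀ y => divVec (T x₀) y := fun x₀ => by
  refine ContDiffOn.sum fun i _ => ContDiffOn.smul ?_ contDiffOn_const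
  exact contDiffOn_divg (chartAt V x₀).open_target ((h x₀).clm_apply contDiffOn_const)

theorem IsCoDens.divVec [FiniteDimensional ℝ V] {T : P → V → (V →L[ℝ] ℝ) →L[ℝ] V}
    (h : IsCoDens T) (hs : SmoothFam T)
    (hskew : ∀ x₀, ∀ y ∈ (chartAt V x₀).target, ∀ β γ : V →L[ℝ] ℝ,
      β (T x₀ y γ) = -γ (T x₀ y β)) :
    IsVecDens fun x₀ y => divVec (T x₀) y := fun x₀ x₁ y hy => by
  refine eq_of_forall_covector fun β => ?_
  have h1 := divg_of_bivector_density (contDiffAt_coordCh hy) (cdet_jac_ne_zero hy)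
    (hs.differentiableAt (coordCh_mem_target hy)) (hs.differentiableAt (mem_coordDom.1 hy).1)
    (hskew x₀ y (mem_coordDom.1 hy).1)
    (Filter.eventually_of_mem ((isOpen_coordDom x₀ x₁).mem_nhds hy) fun z hz => h x₀ x₁ z hz) β
  rw [← apply_divVec (hs.differentiableAt (mem_coordDom.1 hy).1),
    ← apply_divVec (hs.differentiableAt (coordCh_mem_target hy))] at h1
  rw [map_smul, smul_eq_mul]
  exact h1

/-- A vector density which vanishes at the centres of all charts vanishes. -/
theorem IsVecDens.eq_zero {W : P → V → V} (h : IsVecDens W)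
    (h0 : ∀ x : P, W x (chartAt V x x) = 0) {x₀ : P} {y : V} (hy : y ∈ (chartAt V x₀).target) :
    W x₀ y = 0 := by
  have hm := mem_coordDom_self hy
  have h1 := h _ _ _ hm
  have h2 : coordCh V x₀ ((chartAt V x₀).symm y) y
      = chartAt V ((chartAt V x₀).symm y) ((chartAt V x₀).symm y) := rfl
  rw [h2, h0, smul_zero] at h1
  exact jac_injective hm (by rw [h1, map_zero])

theorem IsVecDens.sub {W W' : P → V → V} (h : IsVecDens W) (h' : IsVecDens W') :
    IsVecDens fun x₀ y => W x₀ y - W' x₀ y := fun x₀ x₁ y hy => by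
  rw [map_sub, h _ _ _ hy, h' _ _ _ hy, smul_sub]

theorem IsEndFam.vecDens {J : P → V → V →L[ℝ] V} (hJ : IsEndFam J) {W : P → V → V}
    (h : IsVecDens W) : IsVecDens fun x₀ y => J x₀ y (W x₀ y) := fun x₀ x₁ y hy => by
  rw [hJ _ _ _ hy, h _ _ _ hy, map_smul]

theorem IsEndFam.coDens {J : P → V → V →L[ℝ] V} (hJ : IsEndFam J)
    {T : P → V → (V →L[ℝ] ℝ) →L[ℝ] V} (h : IsCoDens T) :
    IsCoDens fun x₀ y => (J x₀ y).comp (T x₀ y) := fun x₀ x₁ y hy β => by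
  rw [ContinuousLinearMap.comp_apply, hJ _ _ _ hy, h _ _ _ hy, map_smul]; rfl

theorem IsCoDens.grad {T : P → V → (V →L[ℝ] ℝ) →L[ℝ] V} (h : IsCoDens T) {u : P → V → ℝ}
    (hu : IsFun u) (hus : SmoothFam u) :
    IsVecDens fun x₀ y => T x₀ y (_root_.fderiv ℝ (u x₀) y) := fun x₀ x₁ y hy => by
  change jac V x₀ x₁ y (T x₀ y (_root_.fderiv ℝ (u x₀) y)) = _
  rw [hu.fderiv_eq hus hy, h _ _ _ hy]

theorem SmoothFam.grad {T : P → V → (V →L[ℝ] ℝ) →L[ℝ] V} (h : SmoothFam T) {u : P → V → ℝ}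
    (hus : SmoothFam u) : SmoothFam fun x₀ y => T x₀ y (_root_.fderiv ℝ (u x₀) y) := fun x₀ =>
  (h x₀).clm_apply (hus.fderiv x₀)

end Atlas

/-! ### Forms and endomorphism fields in charts -/

section Charts

variable {V : Type*} [NormedAddCommGroup V] [NormedSpace ℝ V]
  {P : Type*} [TopologicalSpace P] [ChartedSpace V P] [IsManifold 𝓘(ℝ, V) ∞ P]

theorem mfderivWithin_extChartAt_symm_eq {x₀ : P} {y : V} (hy : y ∈ (chartAt V x₀).target) :
    mfderivWithin 𝓘(ℝ, V) 𝓘(ℝ, V) (extChartAt 𝓘(ℝ, V) x₀).symm (range 𝓘(ℝ, V)) y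
      = jac V x₀ ((chartAt V x₀).symm y) y := by
  have h1 : MDifferentiableWithinAt 𝓘(ℝ, V) 𝓘(ℝ, V) (extChartAt 𝓘(ℝ, V) x₀).symm
      (range 𝓘(ℝ, V)) y :=
    mdifferentiableWithinAt_extChartAt_symm (by simpa using hy)
  refine (if_pos h1).trans ?_
  simp only [mfld_simps, fderivWithin_univ]
  rfl

theorem Form.inChart_eq {k : ℕ} (α : Form 𝓘(ℝ, V) P k) {x₀ : P} {y : V}
    (hy : y ∈ (chartAt V x₀).target) :
    α.inChart x₀ y = (show V [⋀^Fin k]→L[ℝ] ℝ from α ((chartAt V x₀).symm y)).compContinuousLinearMap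
      (jac V x₀ ((chartAt V x₀).symm y) y) := by
  have := mfderivWithin_extChartAt_symm_eq hy
  rw [Form.inChart, this]
  rfl

theorem Form.IsSmooth.smoothFam {k : ℕ} {α : Form 𝓘(ℝ, V) P k} (h : α.IsSmooth) :
    SmoothFam (R := V [⋀^Fin k]→L[ℝ] ℝ) α.inChart := fun x₀ => by
  have := h x₀
  simpa using this

theorem jac_comp {x₀ x₁ x₂ : P} {y : V} (h : y ∈ coordDom V x₀ x₁) (h2 : y ∈ coordDom V x₀ x₂) :
    jac V x₀ x₂ y = (jac V x₁ x₂ (coordCh V x₀ x₁ y)).comp (jac V x₀ x₁ y) := by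
  have h3 : coordCh V x₀ x₁ y ∈ coordDom V x₁ x₂ := by
    refine mem_coordDom.2 ⟨coordCh_mem_target h, ?_⟩
    rw [chartAt_symm_coordCh h]
    exact (mem_coordDom.1 h2).2
  have h1 := (differentiableAt_coordCh h3).hasFDerivAt.comp y
    (differentiableAt_coordCh h).hasFDerivAt
  rw [← h1.fderiv]
  refine Filter.EventuallyEq.fderiv_eq ?_
  filter_upwards [(isOpen_coordDom x₀ x₁).mem_nhds h] with z hz
  rw [Function.comp_apply, coordCh, coordCh, chartAt_symm_coordCh hz]

theorem Form.isFormFam (α : Form 𝓘(ℝ, V) P 2) :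
    IsFormFam (V := V) (P := P) α.inChart := fun x₀ x₁ y hy => by
  have hm := mem_coordDom_self (mem_coordDom.1 hy).1
  rw [α.inChart_eq (mem_coordDom.1 hy).1, α.inChart_eq (coordCh_mem_target hy)]
  have e := chartAt_symm_coordCh hy
  rw [e, jac_comp hy hm]
  rfl

theorem Form.d_eq_zero_iff {k : ℕ} (α : Form 𝓘(ℝ, V) P k) (x : P) :
    α.d x = 0 ↔ extDeriv (α.inChart x) (chartAt V x x) = 0 := by
  have h1 : mfderiv 𝓘(ℝ, V) 𝓘(ℝ, V) (extChartAt 𝓘(ℝ, V) x) x = ContinuousLinearMap.id ℝ V := by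
    have h := mdifferentiableAt_extChartAt (I := 𝓘(ℝ, V)) (mem_chart_source V x)
    refine (if_pos h).trans ?_
    simp only [mfld_simps, fderivWithin_univ]
    exact jac_self (mem_chart_target V x)
  have h2 : α.d x = extDeriv (α.inChart x) (chartAt V x x) := by
    rw [Form.d, h1]
    simp only [mfld_simps, extDerivWithin_univ]
    rfl
  rw [h2]
  exact Iff.rfl

/-- The local expressions of a field of endomorphisms. -/
def EndField.inChart (J : EndField 𝓘(ℝ, V) P) (x₀ : P) (y : V) : V →L[ℝ] V :=
  (jac V ((chartAt V x₀).symm y) x₀ (coordCh V x₀ ((chartAt V x₀).symm y) y)).comp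
    ((show V →L[ℝ] V from J ((chartAt V x₀).symm y)).comp (jac V x₀ ((chartAt V x₀).symm y) y))

theorem EndField.jac_inChart (J : EndField 𝓘(ℝ, V) P) {x₀ : P} {y : V}
    (hy : y ∈ (chartAt V x₀).target) (v : V) :
    jac V x₀ ((chartAt V x₀).symm y) y (J.inChart x₀ y v)
      = (show V →L[ℝ] V from J ((chartAt V x₀).symm y)) (jac V x₀ ((chartAt V x₀).symm y) y v) :=
  jac_jac_apply' (mem_coordDom_self hy) _

theorem EndField.isEndFam (J : EndField 𝓘(ℝ, V) P) : IsEndFam J.inChart := fun x₀ x₁ y hy v => by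
  have hm := mem_coordDom_self (mem_coordDom.1 hy).1
  have hm' := mem_coordDom_self (coordCh_mem_target hy)
  have e := chartAt_symm_coordCh hy
  refine jac_injective hm' ?_
  rw [J.jac_inChart (coordCh_mem_target hy)]
  rw [e] at hm' ⊢
  have hc := jac_comp hy hm
  have h1 : ∀ w, jac V x₁ ((chartAt V x₀).symm y) (coordCh V x₀ x₁ y) (jac V x₀ x₁ y w)
      = jac V x₀ ((chartAt V x₀).symm y) y w := fun w => by rw [hc]; rfl
  rw [h1, h1, J.jac_inChart (mem_coordDom.1 hy).1]

theorem EndField.inChart_center (J : EndField 𝓘(ℝ, V) P) (x : P) :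
    J.inChart x (chartAt V x x) = J x := by
  have hx := mem_chart_target V x
  have e : (chartAt V x).symm (chartAt V x x) = x := (chartAt V x).left_inv (mem_chart_source V x)
  have e2 : coordCh V x x (chartAt V x x) = chartAt V x x := by rw [coordCh, e]
  rw [EndField.inChart, e, e2, jac_self hx]
  rfl

theorem EndField.IsSmooth.smoothFam {J : EndField 𝓘(ℝ, V) P} (h : J.IsSmooth) :
    SmoothFam J.inChart := by
  have key : ∀ x₁ : P, ContDiffAt ℝ ∞ (J.inChart x₁) (chartAt V x₁ x₁) := fun x₁ => by
    have h1 := (contMDiffAt_hom_bundle _).1 (h x₁)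
    have h2 := h1.2
    have h3 : ContDiffAt ℝ ∞ ((fun x : P => ContinuousLinearMap.inCoordinates V (TangentSpace 𝓘(ℝ, V)) V
        (TangentSpace 𝓘(ℝ, V)) x₁ x x₁ x (J x)) ∘ (chartAt V x₁).symm) (chartAt V x₁ x₁) := by
      rw [← contMDiffAt_iff_contDiffAt]
      have h4 : (chartAt V x₁).symm (chartAt V x₁ x₁) = x₁ :=
        (chartAt V x₁).left_inv (mem_chart_source V x₁)
      refine ContMDiffAt.comp (I' := 𝓘(ℝ, V)) _ (by rw [h4]; exact h2) ?_
      exact (contMDiffOn_chart_symm (I := 𝓘(ℝ, V))).contMDiffAt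
        ((chartAt V x₁).open_target.mem_nhds (mem_chart_target V x₁))
    refine h3.congr_of_eventuallyEq ?_
    filter_upwards [(chartAt V x₁).open_target.mem_nhds (mem_chart_target V x₁)] with y hy
    have h5 := mem_coordDom_self hy
    have h6 : (chartAt V x₁).symm y ∈ (chartAt V x₁).source := (chartAt V x₁).map_target hy
    have := inTangentCoordinates_eq (I := 𝓘(ℝ, V)) (I' := 𝓘(ℝ, V)) (f := fun x : P => x) (g := fun x : P => x) (ϕ := fun x => J x) h6 h6
    refine Eq.trans ?_ this.symm
    have h7 : ∀ a b x : P, ((tangentBundleCore 𝓘(ℝ, V) P).coordChange (achart V a) (achart V b) x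
        : V →L[ℝ] V) = jac V a b (chartAt V a x) := fun a b x => by
      rw [tangentBundleCore_coordChange]
      simp only [mfld_simps, fderivWithin_univ]
      rfl
    rw [h7, h7, (chartAt V x₁).right_inv hy]
    rfl
  intro x₀ y hy
  have hm := mem_coordDom_self hy
  have h1 := key ((chartAt V x₀).symm y)
  set x₁ := (chartAt V x₀).symm y
  have h2 : ContDiffAt ℝ ∞ (fun z => (jac V x₁ x₀ (coordCh V x₀ x₁ z)).comp
      ((J.inChart x₁ (coordCh V x₀ x₁ z)).comp (jac V x₀ x₁ z))) y := by
    have hc := contDiffAt_coordCh hm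
    have a1 : ContDiffAt ℝ ∞ (jac V x₀ x₁) y :=
      (contDiffOn_jac x₀ x₁).contDiffAt ((isOpen_coordDom _ _).mem_nhds hm)
    have a2 : ContDiffAt ℝ ∞ (jac V x₁ x₀) (coordCh V x₀ x₁ y) :=
      (contDiffOn_jac x₁ x₀).contDiffAt ((isOpen_coordDom _ _).mem_nhds (coordCh_mem hm))
    have a3 : ContDiffAt ℝ ∞ (fun z => jac V x₁ x₀ (coordCh V x₀ x₁ z)) y := a2.comp y hc
    have h1' : ContDiffAt ℝ ∞ (J.inChart x₁) (coordCh V x₀ x₁ y) := h1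
    have a4 : ContDiffAt ℝ ∞ (fun z => J.inChart x₁ (coordCh V x₀ x₁ z)) y := h1'.comp y hc
    exact a3.clm_comp (a4.clm_comp a1)
  refine (h2.congr_of_eventuallyEq ?_).contDiffWithinAt
  filter_upwards [(isOpen_coordDom x₀ x₁).mem_nhds hm] with z hz
  ext v
  refine jac_injective hz ?_
  rw [J.isEndFam _ _ _ hz]
  exact (jac_jac_apply' hz _).symm

end Charts

/-! ### Nondegenerate two-forms and bivector densities -/

section Poisson

variable {V : Type*} [NormedAddCommGroup V] [NormedSpace ℝ V] [FiniteDimensional ℝ V]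

theorem finrank_covector : finrank ℝ (V →L[ℝ] ℝ) = finrank ℝ V := by
  rw [← (LinearMap.toContinuousLinearMap (𝕜 := ℝ) (E := V) (F' := ℝ)).finrank_eq]
  exact Subspace.dual_finrank_eq

/-- An injective continuous linear map between spaces of equal finite dimension is an
isomorphism. -/
theorem exists_equiv_of_injective {W : Type*} [NormedAddCommGroup W] [NormedSpace ℝ W]
    [FiniteDimensional ℝ W] (h : finrank ℝ V = finrank ℝ W) {f : V →L[ℝ] W}
    (hf : Function.Injective f) : ∃ e : V ≃L[ℝ] W, (e : V →L[ℝ] W) = f := by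
  have hb : Function.Bijective (f : V →ₗ[ℝ] W) :=
    ⟨hf, (LinearMap.injective_iff_surjective_of_finrank_eq_finrank h).1 hf⟩
  exact ⟨(LinearEquiv.ofBijective (f : V →ₗ[ℝ] W) hb).toContinuousLinearEquiv, by ext; rfl⟩

theorem exists_equiv_flat {ξ : V [⋀^Fin 2]→L[ℝ] ℝ} (hξ : Function.Injective (flat ξ)) :
    ∃ e : V ≃L[ℝ] (V →L[ℝ] ℝ), (e : V →L[ℝ] V →L[ℝ] ℝ) = flat ξ :=
  exists_equiv_of_injective finrank_covector.symm hξ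

variable {m : ℕ} (b : Basis (Fin (2 * (m + 1))) ℝ V)

/-- The density of the volume form `ξ ^ (m + 1)` with respect to a basis. -/
def volCoef (ξ : V [⋀^Fin 2]→L[ℝ] ℝ) : ℝ := |wedgePow ξ (m + 1) b|

/-- The bivector density inverse to a nondegenerate two-form. -/
def poisson (ξ : V [⋀^Fin 2]→L[ℝ] ℝ) : (V →L[ℝ] ℝ) →L[ℝ] V :=
  volCoef b ξ • (flat ξ).inverse

theorem finrank_eq_of_basis {m : ℕ} (b : Basis (Fin (2 * (m + 1))) ℝ V) : finrank ℝ V = 2 * m + 2 := by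
  rw [finrank_eq_card_basis b, Fintype.card_fin]; ring

theorem form_eq_smul_volForm {k : ℕ} (e : Basis (Fin k) ℝ V) (τ : V [⋀^Fin k]→L[ℝ] ℝ) :
    τ = τ e • volForm e := by
  ext w
  exact congrArg (fun t => t w) (τ.toAlternatingMap.eq_smul_basis_det e)

theorem wedgePow_basis_ne_zero {ξ : V [⋀^Fin 2]→L[ℝ] ℝ} (hξ : Function.Injective (flat ξ)) :
    wedgePow ξ (m + 1) b ≠ 0 := by
  intro h0
  obtain ⟨e, he⟩ := exists_equiv_flat hξ
  refine wedgePow_ne_zero ξ (by rw [← he]; exact e.surjective) (m + 1)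
    (by rw [finrank_eq_of_basis b]; omega) ?_
  rw [form_eq_smul_volForm b (wedgePow ξ (m + 1)), h0, zero_smul]

theorem volCoef_pos {ξ : V [⋀^Fin 2]→L[ℝ] ℝ} (hξ : Function.Injective (flat ξ)) :
    0 < volCoef b ξ := abs_pos.2 (wedgePow_basis_ne_zero b hξ)

theorem flat_poisson {ξ : V [⋀^Fin 2]→L[ℝ] ℝ} (hξ : Function.Injective (flat ξ))
    (β : V →L[ℝ] ℝ) : flat ξ (poisson b ξ β) = volCoef b ξ • β := by
  obtain ⟨e, he⟩ := exists_equiv_flat hξ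
  rw [poisson, ← he, ContinuousLinearMap.inverse_equiv, _root_.smul_apply, map_smul]
  congr 1
  exact e.apply_symm_apply β

theorem eq_poisson {ξ : V [⋀^Fin 2]→L[ℝ] ℝ} (hξ : Function.Injective (flat ξ))
    {β : V →L[ℝ] ℝ} {u : V} (hu : flat ξ u = volCoef b ξ • β) : u = poisson b ξ β :=
  hξ (hu.trans (flat_poisson b hξ β).symm)

theorem poisson_skew {ξ : V [⋀^Fin 2]→L[ℝ] ℝ} (hξ : Function.Injective (flat ξ))
    (β γ : V →L[ℝ] ℝ) : β (poisson b ξ γ) = -γ (poisson b ξ β) := by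
  have h1 : ∀ β γ : V →L[ℝ] ℝ, volCoef b ξ * β (poisson b ξ γ)
      = flat ξ (poisson b ξ β) (poisson b ξ γ) := fun β γ => by
    rw [flat_poisson b hξ]; rfl
  have h2 := h1 β γ
  rw [flat_swap, ← h1 γ β] at h2
  have := (volCoef_pos b hξ).ne'
  refine mul_left_cancel₀ this ?_
  rw [h2]; ring

theorem volCoef_comp (ξ : V [⋀^Fin 2]→L[ℝ] ℝ) (A : V →L[ℝ] V) :
    volCoef b (ξ.compContinuousLinearMap A) = |cdet A| * volCoef b ξ := by
  rw [volCoef, volCoef, ← abs_mul, wedgePow_comp, ← form_comp_eq_cdet_mul b]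
  rfl

theorem flat_comp_injective {ξ : V [⋀^Fin 2]→L[ℝ] ℝ} (hξ : Function.Injective (flat ξ))
    {A : V →L[ℝ] V} (hA : Function.Injective A) :
    Function.Injective (flat (ξ.compContinuousLinearMap A)) := by
  obtain ⟨e, he⟩ := exists_equiv_of_injective rfl hA
  refine (injective_iff_map_eq_zero _).2 fun u hu => ?_
  have h1 : flat ξ (A u) = 0 := by
    ext v
    have := congrArg (fun t => t (e.symm v)) hu
    change flat (ξ.compContinuousLinearMap A) u (e.symm v) = 0 at this
    rw [flat_comp, ← he] at this
    change flat ξ (e u) (e (e.symm v)) = 0 at this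
    rw [e.apply_symm_apply] at this
    rw [← he]; exact this
  exact hA ((hξ (h1.trans (map_zero _).symm)).trans (map_zero A).symm)

theorem poisson_comp {ξ : V [⋀^Fin 2]→L[ℝ] ℝ} (hξ : Function.Injective (flat ξ))
    {A : V →L[ℝ] V} (hA : Function.Injective A) (β : V →L[ℝ] ℝ) :
    A (poisson b (ξ.compContinuousLinearMap A) (β.comp A)) = |cdet A| • poisson b ξ β := by
  obtain ⟨e, he⟩ := exists_equiv_of_injective rfl hA
  have h2 := flat_poisson b (flat_comp_injective hξ hA) (β.comp A)
  refine hξ ?_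
  rw [map_smul, flat_poisson b hξ]
  ext v
  have h3 := congrArg (fun t => t (e.symm v)) h2
  change flat (ξ.compContinuousLinearMap A) _ (e.symm v) = _ at h3
  have h4 : A (e.symm v) = v := by rw [← he]; exact e.apply_symm_apply v
  rw [flat_comp, h4, volCoef_comp] at h3
  rw [h3]
  change _ * β (A (e.symm v)) = _ * (_ * β v)
  rw [h4]; ring

theorem contDiffAt_volCoef {ξ : V [⋀^Fin 2]→L[ℝ] ℝ}
    (hξ : Function.Injective (flat ξ)) : ContDiffAt ℝ ∞ (volCoef b) ξ := by
  have h1 : ContDiff ℝ ∞ fun ξ : V [⋀^Fin 2]→L[ℝ] ℝ => wedgePow ξ (m + 1) b :=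
    (ContinuousAlternatingMap.apply ℝ V ℝ (b : Fin (2 * (m + 1)) → V)).contDiff.comp
      (contDiff_wedgePow (m + 1))
  exact (contDiffAt_abs (wedgePow_basis_ne_zero b hξ)).comp ξ h1.contDiffAt

theorem contDiffAt_poisson {ξ : V [⋀^Fin 2]→L[ℝ] ℝ}
    (hξ : Function.Injective (flat ξ)) : ContDiffAt ℝ ∞ (poisson b) ξ := by
  refine (contDiffAt_volCoef b hξ).smul ?_
  obtain ⟨e, he⟩ := exists_equiv_flat hξ
  have h1 : ContDiffAt ℝ ∞ ContinuousLinearMap.inverse (flatL V ξ) := by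
    have := contDiffAt_map_inverse (𝕜 := ℝ) (n := ∞) e
    rwa [he] at this
  exact h1.comp ξ (flatL V).contDiff.contDiffAt

theorem eventually_flat_injective {ξ : V → V [⋀^Fin 2]→L[ℝ] ℝ} {y : V}
    (h : ContinuousAt ξ y) (hξ : Function.Injective (flat (ξ y))) :
    ∀ᶠ z in nhds y, Function.Injective (flat (ξ z)) := by
  obtain ⟨e, he⟩ := exists_equiv_flat hξ
  have h1 : ContinuousAt (fun z => flat (ξ z)) y := (flatL V).continuous.continuousAt.comp h
  have h2 := ContinuousLinearEquiv.nhds e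
  rw [he] at h2
  filter_upwards [h1.eventually_mem h2] with z hz
  obtain ⟨e', he'⟩ := hz
  rw [← he']
  exact e'.injective

/-- The power `ξ ^ m` of a nondegenerate two-form on a space of dimension `2m + 2` is closed if
and only if the associated bivector density is divergence free. -/
theorem extDeriv_wedgePow_eq_zero_iff {ξ : V → V [⋀^Fin 2]→L[ℝ] ℝ} {y : V}
    (h : ContDiffAt ℝ ∞ ξ y) (hξ : Function.Injective (flat (ξ y))) :
    extDeriv (fun z => wedgePow (ξ z) m) y = 0
      ↔ ∀ β : V →L[ℝ] ℝ, divg (fun z => poisson b (ξ z) β) y = 0 := by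
  set c : V → ℝ := fun z => wedgePow (ξ z) (m + 1) b with hc
  have hcc : ContinuousAt c y := by
    have h1 : ContDiff ℝ ∞ fun ξ : V [⋀^Fin 2]→L[ℝ] ℝ => wedgePow ξ (m + 1) b :=
      (ContinuousAlternatingMap.apply ℝ V ℝ (b : Fin (2 * (m + 1)) → V)).contDiff.comp
        (contDiff_wedgePow (m + 1))
    exact h1.continuous.continuousAt.comp h.continuousAt
  -- the sign of the volume form is locally constant
  obtain ⟨s, hs, hsy⟩ : ∃ s : ℝ, s ≠ 0 ∧ ∀ᶠ z in nhds y, c z = s * |c z| := by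
    rcases lt_or_gt_of_ne (wedgePow_basis_ne_zero b hξ) with hn | hp
    · refine ⟨-1, by norm_num, ?_⟩
      filter_upwards [hcc.eventually_lt continuousAt_const hn] with z hz
      rw [abs_of_neg hz]; ring
    · refine ⟨1, by norm_num, ?_⟩
      filter_upwards [continuousAt_const.eventually_lt hcc hp] with z hz
      rw [abs_of_pos hz]; ring
  have hτ : ((s / (m + 1 : ℕ) : ℝ) • volForm b) ≠ 0 :=
    smul_ne_zero (div_ne_zero hs (by positivity)) (volForm_ne_zero b)
  refine extDeriv_eq_zero_iff_divg (k := 2 * m) (finrank_eq_of_basis b)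
    ((s / (m + 1 : ℕ) : ℝ) • volForm b) hτ
    (W := fun β z => poisson b (ξ z) β) ?_ (fun β => ?_) (fun β => ?_)
  · exact ((contDiff_wedgePow m).contDiffAt.comp y h).differentiableAt infty_ne_zero
  · exact (((contDiffAt_poisson b hξ).comp y h).differentiableAt
      infty_ne_zero).clm_apply (differentiableAt_const β)
  · filter_upwards [eventually_flat_injective h.continuousAt hξ, hsy] with z hz hz2
    have h1 := curryLeft_wedgePow_succ (ξ z) m (poisson b (ξ z) β)
    rw [flat_poisson b hz] at h1
    have h2 : extMul (volCoef b (ξ z) • β) (wedgePow (ξ z) m)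
        = volCoef b (ξ z) • extMul β (wedgePow (ξ z) m) := by
      rw [← extMulL_apply, map_smul]; rfl
    rw [h2, form_eq_smul_volForm b (wedgePow (ξ z) (m + 1))] at h1
    change ContinuousAlternatingMap.curryLeft (n := 2 * m + 1) (c z • volForm b) _ = _ at h1
    have h3 : volCoef b (ξ z) = |c z| := rfl
    have h4 : |c z| ≠ 0 := by rw [← h3]; exact (volCoef_pos b hz).ne'
    rw [hz2, h3] at h1
    have hm : ((m + 1 : ℕ) : ℝ) ≠ 0 := by positivity
    ext v
    have h5 := congrArg (fun t => t v) h1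
    change (s * |c z|) * volForm b (Fin.cons (poisson b (ξ z) β) v)
      = ((m + 1 : ℕ) : ℝ) * (|c z| * extMul β (wedgePow (ξ z) m) v) at h5
    change _ = (s / (m + 1 : ℕ) : ℝ) * volForm b (Fin.cons (poisson b (ξ z) β) v)
    field_simp
    have : |c z| * (extMul β (wedgePow (ξ z) m) v * ((m + 1 : ℕ) : ℝ))
      = |c z| * (s * volForm b (Fin.cons (poisson b (ξ z) β) v)) := by
      linear_combination -h5
    have := mul_left_cancel₀ h4 this
    linear_combination this

end Poisson

section PoissonFam

variable {V : Type*} [NormedAddCommGroup V] [NormedSpace ℝ V] [FiniteDimensional ℝ V]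
  {m : ℕ} (b : Basis (Fin (2 * (m + 1))) ℝ V)
  {P : Type*} [TopologicalSpace P] [ChartedSpace V P] [IsManifold 𝓘(ℝ, V) ∞ P]

theorem IsFormFam.flat_injective {ξ : P → V → V [⋀^Fin 2]→L[ℝ] ℝ} (h : IsFormFam ξ)
    (h0 : ∀ x : P, Function.Injective (flat (ξ x (chartAt V x x)))) {x₀ : P} {y : V}
    (hy : y ∈ (chartAt V x₀).target) : Function.Injective (flat (ξ x₀ y)) := by
  have hm := mem_coordDom_self hy
  rw [h _ _ _ hm]
  exact flat_comp_injective (h0 _) (jac_injective hm)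

theorem IsFormFam.isDens_volCoef {ξ : P → V → V [⋀^Fin 2]→L[ℝ] ℝ} (h : IsFormFam ξ) :
    IsDens fun x₀ y => volCoef b (ξ x₀ y) := fun x₀ x₁ y hy => by
  change volCoef b (ξ x₀ y) = |cdet (jac V x₀ x₁ y)| * volCoef b (ξ x₁ (coordCh V x₀ x₁ y))
  rw [h _ _ _ hy, volCoef_comp]

theorem IsFormFam.isCoDens_poisson {ξ : P → V → V [⋀^Fin 2]→L[ℝ] ℝ} (h : IsFormFam ξ)
    (h0 : ∀ x : P, Function.Injective (flat (ξ x (chartAt V x x)))) :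
    IsCoDens fun x₀ y => poisson b (ξ x₀ y) := fun x₀ x₁ y hy β => by
  change jac V x₀ x₁ y (poisson b (ξ x₀ y) (β.comp (jac V x₀ x₁ y)))
    = |cdet (jac V x₀ x₁ y)| • poisson b (ξ x₁ (coordCh V x₀ x₁ y)) β
  rw [h _ _ _ hy]
  exact poisson_comp b (h.flat_injective h0 (coordCh_mem_target hy)) (jac_injective hy) β

theorem SmoothFam.volCoef {ξ : P → V → V [⋀^Fin 2]→L[ℝ] ℝ} (hs : SmoothFam ξ)
    (h : IsFormFam ξ) (h0 : ∀ x : P, Function.Injective (flat (ξ x (chartAt V x x)))) :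
    SmoothFam fun x₀ y => volCoef b (ξ x₀ y) := fun _ _ hy =>
  ((contDiffAt_volCoef b (h.flat_injective h0 hy)).comp _ (hs.contDiffAt hy)).contDiffWithinAt

theorem SmoothFam.poisson {ξ : P → V → V [⋀^Fin 2]→L[ℝ] ℝ} (hs : SmoothFam ξ)
    (h : IsFormFam ξ) (h0 : ∀ x : P, Function.Injective (flat (ξ x (chartAt V x x)))) :
    SmoothFam fun x₀ y => poisson b (ξ x₀ y) := fun _ _ hy =>
  ((contDiffAt_poisson b (h.flat_injective h0 hy)).comp _ (hs.contDiffAt hy)).contDiffWithinAt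

end PoissonFam

/-! ### Roots of bivector densities -/
section Root

variable {V : Type*} [NormedAddCommGroup V] [NormedSpace ℝ V] [FiniteDimensional ℝ V]

/-- The exterior product of two covectors. -/
def wedgeCov (α β : V →L[ℝ] ℝ) : V [⋀^Fin 2]→L[ℝ] ℝ :=
  extMul α (ContinuousAlternatingMap.ofSubsingletonLIE (𝕜 := ℝ) (E := V) (F := ℝ) (0 : Fin 1) β)

theorem flat_wedgeCov (α β : V →L[ℝ] ℝ) (u v : V) :
    flat (wedgeCov α β) u v = α u * β v - α v * β u := by
  rw [flat_apply, wedgeCov, extMul_apply, Fin.sum_univ_two]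
  simp [Fin.removeNth, Fin.succAbove, sub_eq_add_neg]

theorem contDiff_wedgeCov :
    ContDiff ℝ ∞ fun p : (V →L[ℝ] ℝ) × (V →L[ℝ] ℝ) => wedgeCov p.1 p.2 := by
  have h : ContDiff ℝ ∞ fun p : (V →L[ℝ] ℝ) × (V →L[ℝ] ℝ) =>
      ContinuousAlternatingMap.ofSubsingletonLIE (𝕜 := ℝ) (E := V) (F := ℝ) (0 : Fin 1) p.2 :=
    (ContinuousAlternatingMap.ofSubsingletonLIE (𝕜 := ℝ) (E := V) (F := ℝ)
      (0 : Fin 1)).toContinuousLinearEquiv.contDiff.comp contDiff_snd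
  exact ((extMulL V 1).contDiff.comp contDiff_fst).clm_apply h

/-- The antisymmetrization of a bilinear form, as a two-form. -/
def unflat (B : V →L[ℝ] V →L[ℝ] ℝ) : V [⋀^Fin 2]→L[ℝ] ℝ :=
  (1 / 2 : ℝ) • ∑ i, wedgeCov (dualCov (finBasis ℝ V) i) (B (finBasis ℝ V i))

theorem flat_unflat {B : V →L[ℝ] V →L[ℝ] ℝ} (hB : ∀ u v, B u v = -B v u) :
    flat (unflat B) = B := by
  ext u v
  have h2 : ∀ u v, ∑ i, dualCov (finBasis ℝ V) i u * B (finBasis ℝ V i) v = B u v := fun u v => by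
    have h3 := congrArg (fun w => B w v) ((finBasis ℝ V).sum_repr u)
    simp only [map_sum, map_smul, _root_.sum_apply, _root_.smul_apply, smul_eq_mul] at h3
    exact h3
  rw [unflat, flat, map_smul, map_sum, _root_.smul_apply, _root_.smul_apply, _root_.sum_apply,
    _root_.sum_apply]
  change (1 / 2 : ℝ) • ∑ i, flat (wedgeCov (dualCov (finBasis ℝ V) i) (B (finBasis ℝ V i))) u v = _
  rw [Finset.sum_congr rfl fun i _ => flat_wedgeCov _ _ u v,
    Finset.sum_sub_distrib, h2, h2, hB v u, smul_eq_mul]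
  ring

theorem contDiff_unflat : ContDiff ℝ ∞ (unflat (V := V)) := by
  refine ContDiff.const_smul _ (ContDiff.sum fun i _ => ?_)
  exact contDiff_wedgeCov.comp (contDiff_const.prodMk (contDiff_id.clm_apply contDiff_const))

theorem eq_of_flat_eq {ξ η : V [⋀^Fin 2]→L[ℝ] ℝ} (h : ∀ u v, flat ξ u v = flat η u v) : ξ = η := by
  ext w
  have := h (w 0) (w 1)
  rw [flat_apply, flat_apply] at this
  have hw : w = ![w 0, w 1] := by ext i; fin_cases i <;> rfl
  rwa [← hw] at this

theorem wedgePow_smul (c : ℝ) (ξ : V [⋀^Fin 2]→L[ℝ] ℝ) (k : ℕ) :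
    wedgePow (c • ξ) k = c ^ k • wedgePow ξ k := by
  induction k with
  | zero => simp [wedgePow]
  | succ k ih =>
    change wedge (wedgePow (c • ξ) k) (c • ξ) = _ • wedge (wedgePow ξ k) ξ
    rw [ih]
    ext v
    rw [ContinuousAlternatingMap.smul_apply, wedge_apply, wedge_apply]
    simp only [ContinuousAlternatingMap.smul_apply, smul_eq_mul, Finset.mul_sum]
    refine Finset.sum_congr rfl fun σ _ => ?_
    ring

variable {m : ℕ} (b : Basis (Fin (2 * (m + 1))) ℝ V)

theorem volCoef_smul (c : ℝ) (ξ : V [⋀^Fin 2]→L[ℝ] ℝ) :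
    volCoef b (c • ξ) = |c| ^ (m + 1) * volCoef b ξ := by
  rw [volCoef, wedgePow_smul, ContinuousAlternatingMap.smul_apply, smul_eq_mul, abs_mul, abs_pow]
  rfl

/-- The two-form inverse to a bivector. -/
def bivInv (Λ : (V →L[ℝ] ℝ) →L[ℝ] V) : V [⋀^Fin 2]→L[ℝ] ℝ := unflat Λ.inverse

/-- The scale factor which turns the inverse of a bivector density into a two-form. A factor `c`
multiplies `poisson b ξ` by `c ^ m`, which explains the exponent. -/
def rootScale (Λ : (V →L[ℝ] ℝ) →L[ℝ] V) : ℝ := volCoef b (bivInv Λ) ^ (-(1 / (m : ℝ)))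

/-- The two-form `ξ` whose bivector density `poisson b ξ` is the given bivector density, up to
sign: a root of the form of codimension two defined by that density. -/
def rootForm (Λ : (V →L[ℝ] ℝ) →L[ℝ] V) : V [⋀^Fin 2]→L[ℝ] ℝ := (-rootScale b Λ) • bivInv Λ

variable {Λ : (V →L[ℝ] ℝ) →L[ℝ] V}

theorem exists_equiv_biv (hi : Function.Injective Λ) :
    ∃ e : (V →L[ℝ] ℝ) ≃L[ℝ] V, (e : (V →L[ℝ] ℝ) →L[ℝ] V) = Λ :=
  exists_equiv_of_injective finrank_covector hi

theorem flat_bivInv (hi : Function.Injective Λ)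
    (hs : ∀ β γ : V →L[ℝ] ℝ, β (Λ γ) = -γ (Λ β)) (β : V →L[ℝ] ℝ) :
    flat (bivInv Λ) (Λ β) = β := by
  obtain ⟨e, rfl⟩ := exists_equiv_biv hi
  rw [bivInv, ContinuousLinearMap.inverse_equiv, flat_unflat]
  · exact e.symm_apply_apply β
  · intro u v
    have := hs (e.symm u) (e.symm v)
    simpa using this

theorem flat_bivInv_injective (hi : Function.Injective Λ)
    (hs : ∀ β γ : V →L[ℝ] ℝ, β (Λ γ) = -γ (Λ β)) : Function.Injective (flat (bivInv Λ)) := by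
  obtain ⟨e, rfl⟩ := exists_equiv_biv hi
  intro u v huv
  have hu := flat_bivInv hi hs (e.symm u)
  have hv := flat_bivInv hi hs (e.symm v)
  simp only [ContinuousLinearEquiv.coe_coe, e.apply_symm_apply] at hu hv
  rw [hu, hv] at huv
  exact e.symm.injective huv

theorem rootScale_pos (hi : Function.Injective Λ)
    (hs : ∀ β γ : V →L[ℝ] ℝ, β (Λ γ) = -γ (Λ β)) : 0 < rootScale b Λ :=
  Real.rpow_pos_of_pos (volCoef_pos b (flat_bivInv_injective hi hs)) _

theorem rootScale_pow (hm : m ≠ 0) (hi : Function.Injective Λ)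
    (hs : ∀ β γ : V →L[ℝ] ℝ, β (Λ γ) = -γ (Λ β)) :
    rootScale b Λ ^ m * volCoef b (bivInv Λ) = 1 := by
  have h := volCoef_pos b (flat_bivInv_injective hi hs)
  have hm' : (m : ℝ) ≠ 0 := by exact_mod_cast hm
  rw [rootScale, ← Real.rpow_natCast, ← Real.rpow_mul h.le]
  have : -(1 / (m : ℝ)) * m = -1 := by field_simp
  rw [this, Real.rpow_neg_one, inv_mul_cancel₀ h.ne']

theorem flat_rootForm (hi : Function.Injective Λ)
    (hs : ∀ β γ : V →L[ℝ] ℝ, β (Λ γ) = -γ (Λ β)) (β : V →L[ℝ] ℝ) :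
    flat (rootForm b Λ) (Λ β) = -rootScale b Λ • β := by
  rw [rootForm, flat, map_smul]
  change -rootScale b Λ • flat (bivInv Λ) (Λ β) = _
  rw [flat_bivInv hi hs]

theorem flat_rootForm_injective (hi : Function.Injective Λ)
    (hs : ∀ β γ : V →L[ℝ] ℝ, β (Λ γ) = -γ (Λ β)) : Function.Injective (flat (rootForm b Λ)) := by
  have h1 := flat_bivInv_injective hi hs
  intro u v huv
  rw [rootForm, flat, map_smul] at huv
  exact h1 (smul_right_injective _ (neg_ne_zero.2 (rootScale_pos b hi hs).ne') huv)

/-- The bivector density of `rootForm b Λ` is `-Λ`. -/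
theorem poisson_rootForm (hm : m ≠ 0) (hi : Function.Injective Λ)
    (hs : ∀ β γ : V →L[ℝ] ℝ, β (Λ γ) = -γ (Λ β)) (β : V →L[ℝ] ℝ) :
    poisson b (rootForm b Λ) β = -Λ β := by
  symm
  refine eq_poisson b (flat_rootForm_injective b hi hs) ?_
  rw [map_neg, flat_rootForm b hi hs, rootForm, volCoef_smul, abs_neg,
    abs_of_pos (rootScale_pos b hi hs), pow_succ, mul_right_comm, rootScale_pow b hm hi hs, one_mul,
    neg_smul, neg_neg]

/-- If `Λ'` and `Λ` are related by `A` as bivector densities, then their roots are related as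
two-forms: the power of `|det A|` from the inverse cancels the one from the scale factor. -/
theorem rootForm_comp (hm : m ≠ 0) (hi : Function.Injective Λ)
    (hs : ∀ β γ : V →L[ℝ] ℝ, β (Λ γ) = -γ (Λ β)) {Λ' : (V →L[ℝ] ℝ) →L[ℝ] V}
    (hi' : Function.Injective Λ') (hs' : ∀ β γ : V →L[ℝ] ℝ, β (Λ' γ) = -γ (Λ' β))
    {A : V →L[ℝ] V} (hA : cdet A ≠ 0)
    (h : ∀ β : V →L[ℝ] ℝ, A (Λ' (β.comp A)) = |cdet A| • Λ β) :
    rootForm b Λ' = (rootForm b Λ).compContinuousLinearMap A := by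
  have hd : 0 < |cdet A| := abs_pos.2 hA
  -- the inverse of a bivector density is a two-form with values in the dual of the densities
  have h1 : bivInv Λ' = |cdet A|⁻¹ • (bivInv Λ).compContinuousLinearMap A := by
    refine eq_of_flat_eq fun u v => ?_
    obtain ⟨e, rfl⟩ := exists_equiv_biv hi
    obtain ⟨e', rfl⟩ := exists_equiv_biv hi'
    set β := |cdet A|⁻¹ • e.symm (A u) with hβ
    have h2 : A (e' (β.comp A)) = A u := by
      refine (h β).trans ?_
      change |cdet A| • e β = _
      rw [hβ, map_smul, e.apply_symm_apply, smul_smul, mul_inv_cancel₀ hd.ne', one_smul]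
    have hAi : Function.Injective A := by
      have := (LinearMap.equivOfDetNeZero (A : V →ₗ[ℝ] V) hA).injective
      exact this
    have h3 := flat_bivInv hi' hs' (β.comp A)
    have h4 : e' (β.comp A) = u := hAi h2
    change flat (bivInv _) (e' (β.comp A)) = _ at h3
    rw [h4] at h3
    have h5 := flat_bivInv hi hs (e.symm (A u))
    simp only [ContinuousLinearEquiv.coe_coe, e.apply_symm_apply] at h5
    rw [h3, flat, map_smul]
    change _ = |cdet A|⁻¹ * flat ((bivInv _).compContinuousLinearMap A) u v
    rw [flat_comp, h5, hβ]
    rfl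
  -- its volume is multiplied by `|det A|` from the pullback and by `|det A|⁻¹ ^ (m + 1)`
  have h2 : volCoef b (bivInv Λ') = (|cdet A|⁻¹) ^ m * volCoef b (bivInv Λ) := by
    rw [h1, volCoef_smul, volCoef_comp, abs_inv, abs_abs, pow_succ]
    field_simp
  have hm' : (m : ℝ) ≠ 0 := by exact_mod_cast hm
  have h3 : rootScale b Λ' = |cdet A| * rootScale b Λ := by
    have hv := volCoef_pos b (flat_bivInv_injective hi hs)
    rw [rootScale, rootScale, h2, Real.mul_rpow (by positivity) hv.le, ← Real.rpow_natCast,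
      ← Real.rpow_mul (by positivity)]
    have : (m : ℝ) * -(1 / (m : ℝ)) = -1 := by field_simp
    rw [this, Real.rpow_neg_one, inv_inv]
  rw [rootForm, rootForm, h3, h1, smul_smul]
  have : -(|cdet A| * rootScale b Λ) * |cdet A|⁻¹ = -rootScale b Λ := by field_simp
  rw [this]
  ext v; rfl

theorem contDiffAt_rootForm (hi : Function.Injective Λ)
    (hs : ∀ β γ : V →L[ℝ] ℝ, β (Λ γ) = -γ (Λ β)) : ContDiffAt ℝ ∞ (rootForm b) Λ := by
  have h1 : ContDiffAt ℝ ∞ (bivInv (V := V)) Λ := by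
    obtain ⟨e, rfl⟩ := exists_equiv_biv hi
    exact contDiff_unflat.contDiffAt.comp _ (contDiffAt_map_inverse e)
  have hf := flat_bivInv_injective hi hs
  have h2 : ContDiffAt ℝ ∞ (rootScale b) Λ :=
    ((contDiffAt_volCoef b hf).comp Λ h1).rpow_const_of_ne (volCoef_pos b hf).ne'
  exact h2.neg.smul h1

end Root

/-! ### Balanced metrics and divergence free bivector densities -/
section Balanced

variable {V : Type*} [NormedAddCommGroup V] [NormedSpace ℝ V] [FiniteDimensional ℝ V]
  {P : Type*} [TopologicalSpace P] [ChartedSpace V P] [IsManifold 𝓘(ℝ, V) ∞ P]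

theorem eventually_symm_chartAt_center {P : Type*} [TopologicalSpace P] [ChartedSpace V P] (x : P) :
    ∀ᶠ y in nhds (chartAt V x x), y ∈ (chartAt V x).target :=
  (chartAt V x).open_target.mem_nhds (mem_chart_target V x)

/-- The power `ξ ^ m` of a form in a chart. -/
theorem Form.inChart_pow (ξ : Form 𝓘(ℝ, V) P 2) (m : ℕ) (x₀ : P) (y : V) :
    (ξ.pow m).inChart x₀ y = wedgePow (ξ.inChart x₀ y) m :=
  (wedgePow_comp (V := V) (W := V) (ξ ((extChartAt 𝓘(ℝ, V) x₀).symm y)) _ m).symm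

/-- A compatible family of two-forms on the charts comes from a form. -/
theorem IsFormFam.exists_form {η : P → V → V [⋀^Fin 2]→L[ℝ] ℝ} (h : IsFormFam η) :
    ∃ ξ : Form 𝓘(ℝ, V) P 2, (∀ x, ξ x = η x (chartAt V x x)) ∧
      ∀ x₀, ∀ y ∈ (chartAt V x₀).target, ξ.inChart x₀ y = η x₀ y := by
  refine ⟨fun x => η x (chartAt V x x), fun x => rfl, fun x₀ y hy => ?_⟩
  refine (Form.inChart_eq _ hy).trans ?_
  rw [h _ _ _ (mem_coordDom_self hy)]
  rfl

/-- On a manifold of real dimension `2m + 2`, `m ≥ 1`, with a field `J` of complex structures on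
the tangent spaces, a divergence free `J`-invariant definite bivector density gives a balanced
metric, the root of the density. In complex dimension one (`m = 0`) a root need not exist. -/
theorem exists_isBalancedMetric {m : ℕ} (hm : m ≠ 0) (hV : finrank ℝ V = 2 * (m + 1))
    (J : P → V →L[ℝ] V) (hJ : ∀ x (v : V), J x (J x v) = -v)
    {Λ : P → V → (V →L[ℝ] ℝ) →L[ℝ] V} (hs : SmoothFam Λ) (hd : IsCoDens Λ)
    (hskew : ∀ x₀, ∀ y ∈ (chartAt V x₀).target, ∀ β γ : V →L[ℝ] ℝ,
      β (Λ x₀ y γ) = -γ (Λ x₀ y β))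
    (hinv : ∀ (x : P) (β : V →L[ℝ] ℝ),
      J x (Λ x (chartAt V x x) (β.comp (J x))) = Λ x (chartAt V x x) β)
    (hpos : ∀ (x : P) (β : V →L[ℝ] ℝ), β ≠ 0 →
      β (J x (Λ x (chartAt V x x) β)) < 0)
    (hdiv : ∀ (x : P) (β : V →L[ℝ] ℝ), divg (fun z => Λ x z β) (chartAt V x x) = 0) :
    ∃ ξ : Form 𝓘(ℝ, V) P 2, IsBalancedMetric (I := 𝓘(ℝ, V)) (P := P) J (m + 1) ξ := by
  set b : Basis (Fin (2 * (m + 1))) ℝ V := finBasisOfFinrankEq ℝ V hV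
  have hi0 : ∀ x : P, Function.Injective (Λ x (chartAt V x x)) := fun x => by
    refine (injective_iff_map_eq_zero _).2 fun β hβ => ?_
    by_contra h0
    have := hpos x β h0
    rw [hβ, map_zero, map_zero] at this
    exact lt_irrefl _ this
  -- positivity is assumed at the centres of the charts; nondegeneracy is independent of the chart
  have hi : ∀ x₀, ∀ y ∈ (chartAt V x₀).target, Function.Injective (Λ x₀ y) := fun x₀ y hy => by
    have hc := mem_coordDom_self hy
    refine (injective_iff_map_eq_zero _).2 fun β hβ => ?_
    set A := jac V x₀ ((chartAt V x₀).symm y) y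
    set A' := jac V ((chartAt V x₀).symm y) x₀ (coordCh V x₀ ((chartAt V x₀).symm y) y)
    have h1 := hd _ _ _ hc (β.comp A')
    have h2 : (β.comp A').comp A = β := by ext v; exact congrArg β (jac_jac_apply hc v)
    rw [h2, hβ, map_zero] at h1
    have h3 := (smul_eq_zero.1 h1.symm).resolve_left (abs_cdet_jac_pos hc).ne'
    have h4 : β.comp A' = 0 := hi0 _ (h3.trans (map_zero _).symm)
    rw [← h2, h4, ContinuousLinearMap.zero_comp]
  have hff : IsFormFam fun x₀ y => rootForm b (Λ x₀ y) := fun x₀ x₁ y hy =>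
    rootForm_comp b hm (hi _ _ (coordCh_mem_target hy)) (hskew _ _ (coordCh_mem_target hy))
      (hi _ _ (mem_coordDom.1 hy).1) (hskew _ _ (mem_coordDom.1 hy).1) (cdet_jac_ne_zero hy)
      (hd _ _ _ hy)
  have hsm : SmoothFam fun x₀ y => rootForm b (Λ x₀ y) := fun x₀ y hy =>
    ((contDiffAt_rootForm b (hi _ _ hy) (hskew _ _ hy)).comp y
      (hs.contDiffAt hy)).contDiffWithinAt
  obtain ⟨ξ, hξ, hξc⟩ := hff.exists_form
  have hsurj : ∀ x : P, Function.Surjective (Λ x (chartAt V x x)) := fun x => by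
    obtain ⟨e, he⟩ := exists_equiv_biv (hi0 x)
    rw [← he]; exact e.surjective
  have hsk : ∀ (x : P) (β γ : V →L[ℝ] ℝ), β (Λ x (chartAt V x x) γ)
      = -γ (Λ x (chartAt V x x) β) := fun x => hskew x _ (mem_chart_target V x)
  have hval : ∀ (x : P) (β : V →L[ℝ] ℝ) (v : V), (show V [⋀^Fin 2]→L[ℝ] ℝ from ξ x)
      ![Λ x (chartAt V x x) β, v] = -rootScale b (Λ x (chartAt V x x)) * β v := fun x β v => by
    rw [hξ]
    have h1 := flat_rootForm b (hi0 x) (hsk x) β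
    have h2 := congrArg (fun t => t v) h1
    exact (flat_apply _ _ _).symm.trans h2
  refine ⟨ξ, ⟨fun x₀ => ?_, fun x u v => ?_, fun x u hu => ?_, ?_⟩⟩
  · have h1 : (extChartAt 𝓘(ℝ, V) x₀).target = (chartAt V x₀).target := by simp
    rw [h1]
    exact (hsm x₀).congr fun y hy => hξc x₀ y hy
  -- every tangent vector is `Λ β`, and `ξ(Λ β, ·)` is a multiple of `β`
  · obtain ⟨β, rfl⟩ := hsurj x u
    have h1 := hinv x (β.comp (J x))
    have h2 : (β.comp (J x)).comp (J x) = -β := by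
      ext v
      exact (congrArg β (hJ x v)).trans (map_neg β v)
    rw [h2, map_neg, map_neg] at h1
    have h3 : J x (Λ x (chartAt V x x) β)
        = Λ x (chartAt V x x) (-(β.comp (J x))) := by
      rw [map_neg, ← h1, neg_neg]
    refine Eq.trans (congrArg (fun w => (show V [⋀^Fin 2]→L[ℝ] ℝ from ξ x) ![w, J x v]) h3) ?_
    refine (hval x _ _).trans (Eq.trans ?_ (hval x β v).symm)
    change -rootScale b _ * -(β (J x (J x v))) = _
    have h4 : β (J x (J x v)) = -β v := (congrArg β (hJ x v)).trans (map_neg β v)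
    exact congrArg _ ((congrArg Neg.neg h4).trans (neg_neg _))
  · obtain ⟨β, rfl⟩ := hsurj x u
    have hβ : β ≠ 0 := by
      rintro rfl
      exact hu (map_zero _)
    refine lt_of_lt_of_eq ?_ (hval x β _).symm
    rw [neg_mul, ← mul_neg]
    exact mul_pos (rootScale_pos b (hi0 x) (hsk x)) (neg_pos.2 (hpos x β hβ))
  · funext x
    refine (Form.d_eq_zero_iff _ x).2 ?_
    have hx := mem_chart_target V x
    have h1 : (ξ.pow (m + 1 - 1)).inChart x =ᶠ[nhds (chartAt V x x)]
        fun z => wedgePow (rootForm b (Λ x z)) m := by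
      filter_upwards [eventually_symm_chartAt_center x] with z hz
      rw [ξ.inChart_pow, hξc x z hz]; rfl
    rw [Filter.EventuallyEq.extDeriv_eq h1]
    refine (extDeriv_wedgePow_eq_zero_iff b (hsm.contDiffAt hx)
      (flat_rootForm_injective b (hi0 x) (hsk x))).2 fun β => ?_
    have h2 : (fun z => poisson b (rootForm b (Λ x z)) β) =ᶠ[nhds (chartAt V x x)]
        fun z => -Λ x z β := by
      filter_upwards [eventually_symm_chartAt_center x] with z hz
      exact poisson_rootForm b hm (hi _ _ hz) (hskew _ _ hz) β
    rw [Filter.EventuallyEq.divg_eq h2, divg_neg, hdiv, neg_zero]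

end Balanced

/-! ### Riemannian metrics and their densities -/

section Metric

variable (V : Type*) [NormedAddCommGroup V] [NormedSpace ℝ V] [FiniteDimensional ℝ V]
  (P : Type*) [TopologicalSpace P] [ChartedSpace V P] [IsManifold 𝓘(ℝ, V) ∞ P]

/-- The local expressions of a Riemannian metric `g` together with a positive density `ρ` and the
inverse `G` of the metric, multiplied by `ρ`. -/
structure MetricFam where
  g : P → V → V →L[ℝ] V →L[ℝ] ℝ
  ρ : P → V → ℝ
  G : P → V → (V →L[ℝ] ℝ) →L[ℝ] V
  g_smooth : SmoothFam g
  ρ_smooth : SmoothFam ρ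
  G_smooth : SmoothFam G
  g_tensor : ∀ x₀ x₁, ∀ y ∈ coordDom V x₀ x₁, ∀ u v,
    g x₀ y u v = g x₁ (coordCh V x₀ x₁ y) (jac V x₀ x₁ y u) (jac V x₀ x₁ y v)
  ρ_dens : IsDens ρ
  G_dens : IsCoDens G
  g_symm : ∀ x₀, ∀ y ∈ (chartAt V x₀).target, ∀ u v, g x₀ y u v = g x₀ y v u
  g_pos : ∀ x₀, ∀ y ∈ (chartAt V x₀).target, ∀ u, u ≠ 0 → 0 < g x₀ y u u
  ρ_pos : ∀ x₀, ∀ y ∈ (chartAt V x₀).target, 0 < ρ x₀ y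
  g_G : ∀ x₀, ∀ y ∈ (chartAt V x₀).target, ∀ (β : V →L[ℝ] ℝ) v,
    g x₀ y (G x₀ y β) v = ρ x₀ y * β v

variable {V P}

namespace MetricFam

variable (D : MetricFam V P) {x₀ : P} {y : V}

theorem G_symm (hy : y ∈ (chartAt V x₀).target) (β γ : V →L[ℝ] ℝ) :
    β (D.G x₀ y γ) = γ (D.G x₀ y β) := by
  have h1 := D.g_G x₀ y hy β (D.G x₀ y γ)
  have h2 := D.g_G x₀ y hy γ (D.G x₀ y β)
  rw [D.g_symm x₀ y hy, h2] at h1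
  exact (mul_left_cancel₀ (D.ρ_pos x₀ y hy).ne' h1).symm

theorem eq_of_g (hy : y ∈ (chartAt V x₀).target) {u v : V}
    (h : ∀ w, D.g x₀ y u w = D.g x₀ y v w) : u = v := by
  by_contra hne
  have h1 := D.g_pos x₀ y hy (u - v) (sub_ne_zero.2 hne)
  rw [map_sub (D.g x₀ y), _root_.sub_apply, h, sub_self] at h1
  exact lt_irrefl _ h1

theorem G_pos (hy : y ∈ (chartAt V x₀).target) {β : V →L[ℝ] ℝ} (hβ : β ≠ 0) :
    0 < β (D.G x₀ y β) := by
  have h0 : D.G x₀ y β ≠ 0 := by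
    intro h
    apply hβ
    ext v
    have h1 := D.g_G x₀ y hy β v
    rw [h, map_zero] at h1
    exact ((mul_eq_zero.1 h1.symm).resolve_left (D.ρ_pos x₀ y hy).ne')
  have h1 := D.g_pos x₀ y hy _ h0
  rw [D.g_G x₀ y hy] at h1
  exact (mul_pos_iff_of_pos_left (D.ρ_pos x₀ y hy)).1 h1

theorem G_nonneg (hy : y ∈ (chartAt V x₀).target) (β : V →L[ℝ] ℝ) : 0 ≤ β (D.G x₀ y β) := by
  by_cases h : β = 0
  · rw [h]; exact le_rfl
  · exact (D.G_pos hy h).le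

theorem cauchy_schwarz (hy : y ∈ (chartAt V x₀).target) (u v : V) :
    D.g x₀ y u v ^ 2 ≤ D.g x₀ y u u * D.g x₀ y v v := by
  by_cases hv : v = 0
  · simp [hv]
  have h1 := D.g_pos x₀ y hy v hv
  have h2 : 0 ≤ D.g x₀ y (D.g x₀ y v v • u - D.g x₀ y u v • v)
      (D.g x₀ y v v • u - D.g x₀ y u v • v) := by
    by_cases h : D.g x₀ y v v • u - D.g x₀ y u v • v = 0
    · rw [h]; simp
    · exact (D.g_pos x₀ y hy _ h).le
  simp only [map_sub, map_smul, _root_.sub_apply, _root_.smul_apply, smul_eq_mul] at h2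
  rw [D.g_symm x₀ y hy v u] at h2
  have h3 : 0 ≤ D.g x₀ y v v * (D.g x₀ y u u * D.g x₀ y v v - D.g x₀ y u v ^ 2) := by
    linarith
  have := (mul_nonneg_iff_of_pos_left h1).1 h3
  linarith

/-- A vector pairs with covectors in a way bounded by the metric. -/
theorem sq_apply_le (hy : y ∈ (chartAt V x₀).target) (β : V →L[ℝ] ℝ) (u : V) :
    D.ρ x₀ y * β u ^ 2 ≤ β (D.G x₀ y β) * D.g x₀ y u u := by
  have h := D.cauchy_schwarz hy (D.G x₀ y β) u
  rw [D.g_G x₀ y hy, D.g_G x₀ y hy] at h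
  refine le_of_mul_le_mul_left ?_ (D.ρ_pos x₀ y hy)
  linarith

/-- The metric is invariant under a field of endomorphisms. -/
def Compat (J : P → V → V →L[ℝ] V) : Prop :=
  ∀ x₀, ∀ y ∈ (chartAt V x₀).target, ∀ u v,
    D.g x₀ y (J x₀ y u) (J x₀ y v) = D.g x₀ y u v

theorem Compat.G_comp {D : MetricFam V P} {J : P → V → V →L[ℝ] V} (h : D.Compat J)
    (hJ : ∀ x₀, ∀ y ∈ (chartAt V x₀).target, ∀ v, J x₀ y (J x₀ y v) = -v)
    (hy : y ∈ (chartAt V x₀).target) (β : V →L[ℝ] ℝ) :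
    J x₀ y (D.G x₀ y β) = -D.G x₀ y (β.comp (J x₀ y)) := by
  refine D.eq_of_g hy fun w => ?_
  rw [map_neg, _root_.neg_apply, D.g_G x₀ y hy, ContinuousLinearMap.comp_apply, ← D.g_G x₀ y hy,
    ← h x₀ y hy, hJ x₀ y hy, map_neg, _root_.neg_apply]

/-- For a compatible complex structure `J`, the contravariant tensor `J G` is skew. -/
theorem Compat.skew {D : MetricFam V P} {J : P → V → V →L[ℝ] V} (h : D.Compat J)
    (hJ : ∀ x₀, ∀ y ∈ (chartAt V x₀).target, ∀ v, J x₀ y (J x₀ y v) = -v)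
    (hy : y ∈ (chartAt V x₀).target) (β γ : V →L[ℝ] ℝ) :
    β (J x₀ y (D.G x₀ y γ)) = -γ (J x₀ y (D.G x₀ y β)) := by
  have h1 : β (J x₀ y (D.G x₀ y γ)) = (β.comp (J x₀ y)) (D.G x₀ y γ) := rfl
  rw [h1, D.G_symm hy, h.G_comp hJ hy β, map_neg, neg_neg]

end MetricFam

theorem SmoothFam.comp_clm {J : P → V → V →L[ℝ] V} {T : P → V → (V →L[ℝ] ℝ) →L[ℝ] V}
    (hJ : SmoothFam J) (hT : SmoothFam T) : SmoothFam fun x₀ y => (J x₀ y).comp (T x₀ y) :=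
  fun x₀ => (hJ x₀).clm_comp (hT x₀)

/-- A Hermitian metric, given by its fundamental two-form. -/
theorem exists_metricFam_of_form {m : ℕ} (b : Basis (Fin (2 * (m + 1))) ℝ V)
    {η : P → V → V [⋀^Fin 2]→L[ℝ] ℝ} (hη : IsFormFam η) (hηs : SmoothFam η)
    {J : P → V → V →L[ℝ] V} (hJf : IsEndFam J) (hJs : SmoothFam J)
    (hJ : ∀ x₀, ∀ y ∈ (chartAt V x₀).target, ∀ v, J x₀ y (J x₀ y v) = -v)
    (hinv : ∀ x₀, ∀ y ∈ (chartAt V x₀).target, ∀ u v,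
      flat (η x₀ y) (J x₀ y u) (J x₀ y v) = flat (η x₀ y) u v)
    (hpos : ∀ x₀, ∀ y ∈ (chartAt V x₀).target, ∀ u, u ≠ 0 → 0 < flat (η x₀ y) u (J x₀ y u)) :
    ∃ D : MetricFam V P, D.Compat J ∧
      (∀ x₀, ∀ y ∈ (chartAt V x₀).target, ∀ u v, D.g x₀ y u v = flat (η x₀ y) u (J x₀ y v)) ∧
      ∀ x₀ y, D.G x₀ y = (J x₀ y).comp (poisson b (η x₀ y)) := by
  have hi : ∀ x₀, ∀ y ∈ (chartAt V x₀).target, Function.Injective (flat (η x₀ y)) :=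
    fun x₀ y hy => by
    refine (injective_iff_map_eq_zero _).2 fun u hu => ?_
    by_contra h0
    have := hpos x₀ y hy u h0
    rw [hu] at this
    exact lt_irrefl _ this
  have hi0 : ∀ x : P, Function.Injective (flat (η x (chartAt V x x))) := fun x =>
    hi x _ (mem_chart_target V x)
  have hg : ∀ x₀ y u v, ((ContinuousLinearMap.compL ℝ V V ℝ).flip (J x₀ y)).comp (flat (η x₀ y)) u v
      = flat (η x₀ y) u (J x₀ y v) := fun _ _ _ _ => rfl
  refine ⟨{
    g := fun x₀ y => ((ContinuousLinearMap.compL ℝ V V ℝ).flip (J x₀ y)).comp (flat (η x₀ y))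
    ρ := fun x₀ y => volCoef b (η x₀ y)
    G := fun x₀ y => (J x₀ y).comp (poisson b (η x₀ y))
    g_smooth := fun x₀ => ?_
    ρ_smooth := hηs.volCoef b hη hi0
    G_smooth := hJs.comp_clm (hηs.poisson b hη hi0)
    g_tensor := fun x₀ x₁ y hy u v => ?_
    ρ_dens := hη.isDens_volCoef b
    G_dens := hJf.coDens (hη.isCoDens_poisson b hi0)
    g_symm := fun x₀ y hy u v => ?_
    g_pos := fun x₀ y hy u hu => ?_
    ρ_pos := fun x₀ y hy => volCoef_pos b (hi x₀ y hy)
    g_G := fun x₀ y hy β v => ?_ }, fun x₀ y hy u v => ?_, fun x₀ y hy u v => hg _ _ _ _,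
      fun x₀ y => rfl⟩
  · have h1 : ContDiffOn ℝ ∞ (fun y => flat (η x₀ y)) (chartAt V x₀).target :=
      (flatL V).contDiff.comp_contDiffOn (hηs x₀)
    exact ((ContinuousLinearMap.compL ℝ V V ℝ).flip.contDiff.comp_contDiffOn (hJs x₀)).clm_comp h1
  · rw [hg, hg, hη _ _ _ hy, flat_comp, hJf _ _ _ hy]
  · rw [hg, hg, flat_swap, ← hinv x₀ y hy, hJ x₀ y hy, map_neg, _root_.neg_apply, neg_neg]
  · rw [hg]; exact hpos x₀ y hy u hu
  · rw [hg, ContinuousLinearMap.comp_apply, hinv x₀ y hy, flat_poisson b (hi x₀ y hy)]; rfl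
  · rw [hg, hg, hinv x₀ y hy]

/-- The metric on a manifold of dimension zero. -/
theorem exists_metricFam_of_finrank_eq_zero (h : finrank ℝ V = 0) : Nonempty (MetricFam V P) := by
  have hs : Subsingleton V := finrank_zero_iff.1 h
  have hd : ∀ A : V →L[ℝ] V, cdet A = 1 := fun A =>
    LinearMap.det_eq_one_of_finrank_eq_zero h (A : V →ₗ[ℝ] V)
  exact ⟨{
    g := 0
    ρ := 1
    G := 0
    g_smooth := fun _ => contDiffOn_const
    ρ_smooth := fun _ => contDiffOn_const
    G_smooth := fun _ => contDiffOn_const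
    g_tensor := fun _ _ _ _ _ _ => rfl
    ρ_dens := fun _ _ _ _ => by rw [hd]; simp
    G_dens := fun _ _ _ _ _ => Subsingleton.elim _ _
    g_symm := fun _ _ _ _ _ => rfl
    g_pos := fun _ _ _ u hu => absurd (Subsingleton.elim u 0) hu
    ρ_pos := fun _ _ _ => one_pos
    g_G := fun _ _ _ β v => by rw [Subsingleton.elim v 0, map_zero, map_zero, mul_zero] }⟩

/-- On a compact manifold a function with continuous local expressions is bounded. -/
theorem exists_bound_of_compact [CompactSpace P] {u : P → V → ℝ} (hu : IsFun u)
    (hc : ∀ x₀, ContinuousOn (u x₀) (chartAt V x₀).target) :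
    ∃ K : ℝ, 0 < K ∧ ∀ x₀, ∀ y ∈ (chartAt V x₀).target, |u x₀ y| ≤ K := by
  have hcont : Continuous fun x : P => u x (chartAt V x x) := by
    refine continuous_iff_continuousAt.2 fun x => ?_
    have h1 : (fun x' : P => u x' (chartAt V x' x')) =ᶠ[nhds x]
        fun x' => u x (chartAt V x x') := by
      filter_upwards [(chartAt V x).open_source.mem_nhds (mem_chart_source V x)] with x' hx'
      have e := (chartAt V x).left_inv hx'
      have h2 := hu x x' (chartAt V x x') (mem_coordDom.2
        ⟨(chartAt V x).map_source hx', by rw [e]; exact mem_chart_source V x'⟩)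
      rw [h2, coordCh, e]
    refine ContinuousAt.congr ?_ h1.symm
    have h3 := (hc x).continuousAt ((chartAt V x).open_target.mem_nhds (mem_chart_target V x))
    exact ContinuousAt.comp (f := chartAt V x) h3
      ((chartAt V x).continuousAt (mem_chart_source V x))
  obtain ⟨K, hK⟩ := (isCompact_range hcont).isBounded.exists_norm_le
  refine ⟨max K 1, by positivity, fun x₀ y hy => ?_⟩
  rw [hu _ _ _ (mem_coordDom_self hy)]
  exact (hK _ ⟨_, rfl⟩).trans (le_max_left _ _)

/-- On a compact manifold densities are bounded by multiples of a positive density. -/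
theorem IsDens.exists_le [CompactSpace P] {s ρ : P → V → ℝ} (hs : IsDens s)
    (hsc : ∀ x₀, ContinuousOn (s x₀) (chartAt V x₀).target) (hρ : IsDens ρ)
    (hρc : ∀ x₀, ContinuousOn (ρ x₀) (chartAt V x₀).target)
    (hpos : ∀ x₀, ∀ y ∈ (chartAt V x₀).target, 0 < ρ x₀ y) :
    ∃ K : ℝ, 0 < K ∧ ∀ x₀, ∀ y ∈ (chartAt V x₀).target, |s x₀ y| ≤ K * ρ x₀ y := by
  obtain ⟨K, hK, h⟩ := exists_bound_of_compact (u := fun x₀ y => s x₀ y / ρ x₀ y)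
    (fun x₀ x₁ y hy => by
      change s x₀ y / ρ x₀ y = s x₁ (coordCh V x₀ x₁ y) / ρ x₁ (coordCh V x₀ x₁ y)
      rw [hs _ _ _ hy, hρ _ _ _ hy, mul_div_mul_left _ _ (abs_cdet_jac_pos hy).ne'])
    (fun x₀ => (hsc x₀).div (hρc x₀) fun y hy => (hpos x₀ y hy).ne')
  refine ⟨K, hK, fun x₀ y hy => ?_⟩
  have := h x₀ y hy
  rw [abs_div, abs_of_pos (hpos x₀ y hy), div_le_iff₀ (hpos x₀ y hy)] at this
  exact this

/-- On a compact manifold, the values of a covector on a vector density are bounded by the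
metric. -/
theorem MetricFam.exists_sq_le [CompactSpace P] (D : MetricFam V P) {W : P → V → V}
    (hW : IsVecDens W) (hWs : SmoothFam W) :
    ∃ K : ℝ, 0 < K ∧ ∀ x₀, ∀ y ∈ (chartAt V x₀).target, ∀ β : V →L[ℝ] ℝ,
      β (W x₀ y) ^ 2 ≤ K * D.ρ x₀ y * β (D.G x₀ y β) := by
  obtain ⟨K, hK, h⟩ := exists_bound_of_compact
    (u := fun x₀ y => D.g x₀ y (W x₀ y) (W x₀ y) / D.ρ x₀ y ^ 2)
    (fun x₀ x₁ y hy => by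
      change D.g x₀ y (W x₀ y) (W x₀ y) / D.ρ x₀ y ^ 2 = D.g x₁ (coordCh V x₀ x₁ y)
        (W x₁ (coordCh V x₀ x₁ y)) (W x₁ (coordCh V x₀ x₁ y)) / D.ρ x₁ (coordCh V x₀ x₁ y) ^ 2
      rw [D.g_tensor _ _ _ hy, hW _ _ _ hy, D.ρ_dens _ _ _ hy]
      have := (abs_cdet_jac_pos hy).ne'
      simp only [map_smul, _root_.smul_apply, smul_eq_mul]
      rw [mul_pow, ← mul_assoc, ← sq, mul_div_mul_left _ _ (pow_ne_zero 2 this)])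
    (fun x₀ => by
      refine ContinuousOn.div ?_ ((D.ρ_smooth x₀).continuousOn.pow 2)
        fun y hy => pow_ne_zero 2 (D.ρ_pos x₀ y hy).ne'
      exact (((D.g_smooth x₀).clm_apply (hWs x₀)).clm_apply (hWs x₀)).continuousOn)
  refine ⟨K, hK, fun x₀ y hy β => ?_⟩
  have h1 := (le_abs_self _).trans (h x₀ y hy)
  have hρ := D.ρ_pos x₀ y hy
  rw [div_le_iff₀ (by positivity)] at h1
  have h2 := D.sq_apply_le hy β (W x₀ y)
  have h3 := mul_le_mul_of_nonneg_left h1 (D.G_nonneg hy β)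
  refine le_of_mul_le_mul_left ?_ hρ
  nlinarith

end Metric

/-! ### Hypercomplex structures in charts -/

section Nijenhuis

variable {V : Type*} [NormedAddCommGroup V] [NormedSpace ℝ V] [FiniteDimensional ℝ V]
  {P : Type*} [TopologicalSpace P] [ChartedSpace V P] [IsManifold 𝓘(ℝ, V) ∞ P]

theorem mfderiv_extChartAt_self (x : P) :
    mfderiv 𝓘(ℝ, V) 𝓘(ℝ, V) (extChartAt 𝓘(ℝ, V) x) x = ContinuousLinearMap.id ℝ V := by
  have h := mdifferentiableAt_extChartAt (I := 𝓘(ℝ, V)) (mem_chart_source V x)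
  refine (if_pos h).trans ?_
  simp only [mfld_simps, fderivWithin_univ]
  exact jac_self (mem_chart_target V x)

/-- The Lie bracket of two vector fields is computed by their expressions in a chart. -/
theorem mlieBracket_eq_of_chart {X W : ∀ q : P, TangentSpace 𝓘(ℝ, V) q} {X' W' : V → V} {x : P}
    (hX : ∀ y ∈ (chartAt V x).target, X ((chartAt V x).symm y)
      = jac V x ((chartAt V x).symm y) y (X' y))
    (hW : ∀ y ∈ (chartAt V x).target, W ((chartAt V x).symm y)
      = jac V x ((chartAt V x).symm y) y (W' y)) :
    VectorField.mlieBracket 𝓘(ℝ, V) X W x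
      = fderiv ℝ W' (chartAt V x x) (X' (chartAt V x x))
        - fderiv ℝ X' (chartAt V x x) (W' (chartAt V x x)) := by
  have key : ∀ (X : ∀ q : P, TangentSpace 𝓘(ℝ, V) q) (X' : V → V),
      (∀ y ∈ (chartAt V x).target, X ((chartAt V x).symm y)
        = jac V x ((chartAt V x).symm y) y (X' y)) → ∀ y ∈ (chartAt V x).target,
      VectorField.mpullbackWithin 𝓘(ℝ, V) 𝓘(ℝ, V) (extChartAt 𝓘(ℝ, V) x).symm X
        (range 𝓘(ℝ, V)) y = X' y := fun X X' h y hy => by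
    have hm := mem_coordDom_self hy
    obtain ⟨e, he⟩ := exists_equiv_of_injective rfl (jac_injective hm)
    have h1 : (mfderivWithin 𝓘(ℝ, V) 𝓘(ℝ, V) (extChartAt 𝓘(ℝ, V) x).symm (range 𝓘(ℝ, V)) y).inverse
        = (jac V x ((chartAt V x).symm y) y).inverse :=
      congrArg ContinuousLinearMap.inverse (mfderivWithin_extChartAt_symm_eq hy)
    refine (congrArg (fun A : V →L[ℝ] V => A (X ((chartAt V x).symm y))) h1).trans ?_
    refine (congrArg ((jac V x ((chartAt V x).symm y) y).inverse) (h y hy)).trans ?_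
    rw [← he, ContinuousLinearMap.inverse_equiv]
    exact e.symm_apply_apply _
  have hX1 := key X X' hX
  have hW1 := key W W' hW
  have hn := (chartAt V x).open_target.mem_nhds (mem_chart_target V x)
  have hX2 : VectorField.mpullbackWithin 𝓘(ℝ, V) 𝓘(ℝ, V) (extChartAt 𝓘(ℝ, V) x).symm X
        (range 𝓘(ℝ, V)) =ᶠ[nhds (chartAt V x x)] X' := Filter.eventually_of_mem hn hX1
  have hW2 : VectorField.mpullbackWithin 𝓘(ℝ, V) 𝓘(ℝ, V) (extChartAt 𝓘(ℝ, V) x).symm W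
        (range 𝓘(ℝ, V)) =ᶠ[nhds (chartAt V x x)] W' := Filter.eventually_of_mem hn hW1
  have h3 : (mfderiv 𝓘(ℝ, V) 𝓘(ℝ, V) (extChartAt 𝓘(ℝ, V) x) x).inverse
      = ContinuousLinearMap.id ℝ V := by
    refine (congrArg ContinuousLinearMap.inverse (mfderiv_extChartAt_self x)).trans ?_
    exact ContinuousLinearMap.inverse_id
  have hs : ((extChartAt 𝓘(ℝ, V) x).symm ⁻¹' univ ∩ range 𝓘(ℝ, V)) = univ := by simp
  rw [VectorField.mlieBracket, VectorField.mlieBracketWithin_apply]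
  refine (congrArg (fun A : V →L[ℝ] V => A _) h3).trans ?_
  have aux : ∀ (f g : V → V) (s : Set V), f =ᶠ[nhds (chartAt V x x)] X' →
      g =ᶠ[nhds (chartAt V x x)] W' → s = univ →
      VectorField.lieBracketWithin ℝ f g s (chartAt V x x)
        = VectorField.lieBracket ℝ X' W' (chartAt V x x) := fun f g s hf hg hs => by
    rw [hs, VectorField.lieBracketWithin_univ, hf.lieBracket_vectorField_eq hg]
  exact aux _ _ _ hX2 hW2 hs

/-- The vector field with constant coefficients in a chart. -/
def constField (x : P) (u : V) (q : P) : TangentSpace 𝓘(ℝ, V) q := jac V x q (chartAt V x q) u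

theorem constField_symm {x : P} (u : V) {y : V} (hy : y ∈ (chartAt V x).target) :
    constField x u ((chartAt V x).symm y) = jac V x ((chartAt V x).symm y) y u := by
  rw [constField, (chartAt V x).right_inv hy]

theorem contMDiffAt_constField (x : P) (u : V) :
    ContMDiffAt 𝓘(ℝ, V) 𝓘(ℝ, V).tangent ∞
      (fun q => (⟨q, constField x u q⟩ : TangentBundle 𝓘(ℝ, V) P)) x := by
  refine (Bundle.contMDiffAt_section x).2 ?_
  refine (contMDiffAt_const (c := u)).congr_of_eventuallyEq ?_
  filter_upwards [(chartAt V x).open_source.mem_nhds (mem_chart_source V x)] with q hq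
  have h7 : ((tangentBundleCore 𝓘(ℝ, V) P).coordChange (achart V q) (achart V x) q
        : V →L[ℝ] V) = jac V q x (chartAt V q q) := by
    rw [tangentBundleCore_coordChange]
    simp only [mfld_simps, fderivWithin_univ]
    rfl
  change ((tangentBundleCore 𝓘(ℝ, V) P).coordChange (achart V q) (achart V x) q) _ = u
  rw [h7]
  have hm : chartAt V x q ∈ coordDom V x q := mem_coordDom.2
    ⟨(chartAt V x).map_source hq, by rw [(chartAt V x).left_inv hq]; exact mem_chart_source V q⟩
  have h8 := jac_jac_apply hm u
  rw [coordCh, (chartAt V x).left_inv hq] at h8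
  exact h8

theorem EndField.inChart_sq {J : EndField 𝓘(ℝ, V) P} (hJ : ∀ (x : P) (v : TangentSpace 𝓘(ℝ, V) x),
    J x (J x v) = -v) {x₀ : P} {y : V} (hy : y ∈ (chartAt V x₀).target) (v : V) :
    J.inChart x₀ y (J.inChart x₀ y v) = -v := by
  refine jac_injective (mem_coordDom_self hy) ?_
  rw [J.jac_inChart hy, J.jac_inChart hy, map_neg]
  exact hJ _ _

theorem EndField.inChart_mul {J K L : EndField 𝓘(ℝ, V) P}
    (hJ : ∀ (x : P) (v : TangentSpace 𝓘(ℝ, V) x),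
    J x (K x v) = L x v) {x₀ : P} {y : V} (hy : y ∈ (chartAt V x₀).target) (v : V) :
    J.inChart x₀ y (K.inChart x₀ y v) = L.inChart x₀ y v := by
  refine jac_injective (mem_coordDom_self hy) ?_
  rw [J.jac_inChart hy, K.jac_inChart hy, L.jac_inChart hy]
  exact hJ _ _

/-- The vanishing of the Nijenhuis tensor at the centre of a chart. -/
theorem EndField.IsComplexStructure.nijenhuis_chart {J : EndField 𝓘(ℝ, V) P}
    (h : J.IsComplexStructure) (x : P) (u v : V) :
    fderiv ℝ (J.inChart x) (chartAt V x x) (J.inChart x (chartAt V x x) u) v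
      - fderiv ℝ (J.inChart x) (chartAt V x x) (J.inChart x (chartAt V x x) v) u
      + J.inChart x (chartAt V x x) (fderiv ℝ (J.inChart x) (chartAt V x x) v u)
      - J.inChart x (chartAt V x x) (fderiv ℝ (J.inChart x) (chartAt V x x) u v) = 0 := by
  have h0 := h.integrable x (constField x u) (constField x v) (contMDiffAt_constField x u)
    (contMDiffAt_constField x v)
  have hc : ∀ u : V, ∀ y ∈ (chartAt V x).target, constField x u ((chartAt V x).symm y)
      = jac V x ((chartAt V x).symm y) y ((fun _ => u) y) := fun u y hy => constField_symm u hy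
  have hJc : ∀ u : V, ∀ y ∈ (chartAt V x).target, (fun q => J q (constField x u q))
      ((chartAt V x).symm y) = jac V x ((chartAt V x).symm y) y
        ((fun y => J.inChart x y u) y) := fun u y hy => by
    refine Eq.trans ?_ (J.jac_inChart hy u).symm
    exact congrArg (J ((chartAt V x).symm y)) (constField_symm u hy)
  have hd : DifferentiableAt ℝ (J.inChart x) (chartAt V x x) :=
    h.smooth.smoothFam.differentiableAt (mem_chart_target V x)
  have hdu : ∀ u : V, fderiv ℝ (fun y => J.inChart x y u) (chartAt V x x)
      = (fderiv ℝ (J.inChart x) (chartAt V x x)).flip u := fun u => by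
    have := (hd.hasFDerivAt.clm_apply (hasFDerivAt_const u _)).fderiv
    rw [this]; ext w; simp
  have b1 := mlieBracket_eq_of_chart (X := fun q => J q (constField x u q))
    (W := fun q => J q (constField x v q)) (hJc u) (hJc v)
  have b2 := mlieBracket_eq_of_chart (X := fun q => J q (constField x u q)) (hJc u) (hc v)
  have b3 := mlieBracket_eq_of_chart (W := fun q => J q (constField x v q)) (hc u) (hJc v)
  have b4 := mlieBracket_eq_of_chart (hc u) (hc v)
  have e := J.inChart_center x
  have aux : ∀ (N : V →L[ℝ] V) (a b c d a' b' c' d' : V), a = a' → b = b' → c = c' → d = d' →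
      a - N b - N c - d = 0 → a' - N b' - N c' - d' = 0 := by
    rintro N a b c d _ _ _ _ rfl rfl rfl rfl h
    exact h
  have h1 := aux (J x) _ _ _ _ _ _ _ _ b1 b2 b3 b4 h0
  rw [← e] at h1
  simp only [hdu, fderiv_const_apply] at h1
  simp only [ContinuousLinearMap.flip_apply, _root_.zero_apply, zero_sub, sub_zero, map_neg,
    sub_neg_eq_add] at h1
  exact h1

end Nijenhuis

/-! ### The divergence field of a hyperhermitian metric -/
section Trace

variable {V : Type*} [NormedAddCommGroup V] [NormedSpace ℝ V] [FiniteDimensional ℝ V]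

/-- The contraction of a vector-valued bilinear map with a contravariant tensor. -/
def contr (G : (V →L[ℝ] ℝ) →L[ℝ] V) (B : V →L[ℝ] V →L[ℝ] V) : V :=
  ∑ k, B (finBasis ℝ V k) (G (dualCov (finBasis ℝ V) k))

/-- Endomorphisms move from one factor of a contraction to the other one by transposition. -/
theorem sum_apply_comp (G : (V →L[ℝ] ℝ) →L[ℝ] V) (B : V →L[ℝ] V →L[ℝ] V) (A : V →L[ℝ] V) :
    ∑ k, B (A (finBasis ℝ V k)) (G (dualCov (finBasis ℝ V) k))
      = ∑ k, B (finBasis ℝ V k) (G ((dualCov (finBasis ℝ V) k).comp A)) := by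
  set e := finBasis ℝ V
  have h1 : ∀ k, A (e k) = ∑ j, dualCov e j (A (e k)) • e j := fun k => (e.sum_repr _).symm
  have h2 : ∀ j, (dualCov e j).comp A = ∑ k, dualCov e j (A (e k)) • dualCov e k := fun j =>
    (sum_dualCov_smul e ((dualCov e j).comp A)).symm
  calc ∑ k, B (A (e k)) (G (dualCov e k))
      = ∑ k, ∑ j, dualCov e j (A (e k)) • B (e j) (G (dualCov e k)) := by
        refine Finset.sum_congr rfl fun k _ => ?_
        conv_lhs => rw [h1 k]
        simp only [map_sum, map_smul, _root_.sum_apply, _root_.smul_apply]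
    _ = ∑ j, ∑ k, dualCov e j (A (e k)) • B (e j) (G (dualCov e k)) := Finset.sum_comm
    _ = _ := by
        refine Finset.sum_congr rfl fun j _ => ?_
        rw [h2 j]
        simp only [map_sum, map_smul]

/-- The contraction with a symmetric tensor does not depend on the order of the arguments. -/
theorem sum_apply_swap {G : (V →L[ℝ] ℝ) →L[ℝ] V} (hG : ∀ β γ : V →L[ℝ] ℝ, β (G γ) = γ (G β))
    (B : V →L[ℝ] V →L[ℝ] V) :
    ∑ k, B (G (dualCov (finBasis ℝ V) k)) (finBasis ℝ V k) = contr G B := by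
  set e := finBasis ℝ V
  have h1 : ∀ k, G (dualCov e k) = ∑ j, dualCov e j (G (dualCov e k)) • e j := fun k =>
    (e.sum_repr _).symm
  calc ∑ k, B (G (dualCov e k)) (e k)
      = ∑ k, ∑ j, dualCov e j (G (dualCov e k)) • B (e j) (e k) := by
        refine Finset.sum_congr rfl fun k _ => ?_
        conv_lhs => rw [h1 k]
        simp only [map_sum, map_smul, _root_.sum_apply, _root_.smul_apply]
    _ = ∑ j, ∑ k, dualCov e j (G (dualCov e k)) • B (e j) (e k) := Finset.sum_comm
    _ = _ := by
        refine Finset.sum_congr rfl fun j _ => ?_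
        conv_rhs => rw [h1 j]
        simp only [map_sum, map_smul]
        refine Finset.sum_congr rfl fun k _ => ?_
        rw [hG]

variable {G : (V →L[ℝ] ℝ) →L[ℝ] V} {I J : V →L[ℝ] V} {T T' : V →L[ℝ] V →L[ℝ] V}

/-- If `T` is the derivative of an integrable `I` and `J` is a second complex structure which
anticommutes with `I`, then the contraction of `T(·, J ·)` with a compatible metric vanishes. -/
theorem contr_comp_eq_zero (hG : ∀ β γ : V →L[ℝ] ℝ, β (G γ) = γ (G β))
    (hI : ∀ v, I (I v) = -v) (hIJ : ∀ v, J (I v) = -I (J v))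
    (hGI : ∀ β : V →L[ℝ] ℝ, G (β.comp I) = -I (G β))
    (hGJ : ∀ β : V →L[ℝ] ℝ, G (β.comp J) = -J (G β))
    (hT : ∀ u v, T u (I v) = -I (T u v))
    (hN : ∀ u v, T (I u) v - T (I v) u + I (T v u) - I (T u v) = 0) :
    ∑ k, T (finBasis ℝ V k) (J (G (dualCov (finBasis ℝ V) k))) = 0 := by
  set e := finBasis ℝ V
  -- contracted with the metric after inserting `J`, each of the four terms of the Nijenhuis tensor
  -- becomes `-I p`
  set p := ∑ k, T (e k) (J (G (dualCov e k))) with hp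
  have comp_right : ∀ (B : V →L[ℝ] V →L[ℝ] V) (A : V →L[ℝ] V), ∃ B' : V →L[ℝ] V →L[ℝ] V,
      ∀ u v, B' u v = B u (A v) := fun B A =>
    ⟨((ContinuousLinearMap.compL ℝ V V V).flip A).comp B, fun _ _ => rfl⟩
  have moveI : ∀ B : V →L[ℝ] V →L[ℝ] V, ∑ k, B (I (e k)) (G (dualCov e k))
      = -∑ k, B (e k) (I (G (dualCov e k))) := fun B => by
    rw [sum_apply_comp, ← Finset.sum_neg_distrib]
    exact Finset.sum_congr rfl fun k _ => by rw [hGI, map_neg]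
  have moveJ : ∀ B : V →L[ℝ] V →L[ℝ] V, ∑ k, B (J (e k)) (G (dualCov e k))
      = -∑ k, B (e k) (J (G (dualCov e k))) := fun B => by
    rw [sum_apply_comp, ← Finset.sum_neg_distrib]
    exact Finset.sum_congr rfl fun k _ => by rw [hGJ, map_neg]
  have h1 : ∑ k, T (I (e k)) (J (G (dualCov e k))) = -I p := by
    obtain ⟨B, hB⟩ := comp_right T J
    have := moveI B
    simp only [hB, hIJ, map_neg, hT, neg_neg, Finset.sum_neg_distrib] at this
    rw [this, hp, map_sum]
  have h2 : ∑ k, T (I (J (G (dualCov e k)))) (e k) = I p := by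
    have := sum_apply_swap hG (T.comp (I.comp J))
    simp only [contr, ContinuousLinearMap.comp_apply] at this
    rw [this]
    have h3 := moveJ (T.comp I)
    simp only [ContinuousLinearMap.comp_apply] at h3
    rw [h3, h1, neg_neg]
  have h3 : ∑ k, T (J (G (dualCov e k))) (e k) = -p := by
    have := sum_apply_swap hG (T.comp J)
    simp only [contr, ContinuousLinearMap.comp_apply] at this
    rw [this, moveJ]
  have h4 : ∑ k, (T (I (e k)) (J (G (dualCov e k))) - T (I (J (G (dualCov e k)))) (e k)
      + I (T (J (G (dualCov e k))) (e k)) - I (T (e k) (J (G (dualCov e k))))) = 0 :=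
    Finset.sum_eq_zero fun k _ => hN _ _
  simp only [Finset.sum_add_distrib, Finset.sum_sub_distrib, ← map_sum] at h4
  rw [h1, h2, h3, ← hp] at h4
  have h5 : (4 : ℝ) • I p = 0 := by
    rw [map_neg] at h4
    have : (4 : ℝ) • I p = -(-I p - I p + -I p - I p) := by module
    rw [this, h4, neg_zero]
  have h6 : I p = 0 := (smul_eq_zero.1 h5).resolve_left (by norm_num)
  have h7 := hI p
  rw [h6, map_zero] at h7
  exact neg_eq_zero.1 h7.symm

/-- The vector `I (tr T)`, where `T` is the derivative of `I`, is the same for two anticommuting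
integrable complex structures compatible with the metric. -/
theorem apply_contr_eq (hG : ∀ β γ : V →L[ℝ] ℝ, β (G γ) = γ (G β))
    (hI : ∀ v, I (I v) = -v) (hJ : ∀ v, J (J v) = -v) (hIJ : ∀ v, J (I v) = -I (J v))
    (hGI : ∀ β : V →L[ℝ] ℝ, G (β.comp I) = -I (G β))
    (hGJ : ∀ β : V →L[ℝ] ℝ, G (β.comp J) = -J (G β))
    (hT : ∀ u v, T u (I v) = -I (T u v)) (hT' : ∀ u v, T' u (J v) = -J (T' u v))
    (hTT : ∀ u v, T u (J v) + I (T' u v) + T' u (I v) + J (T u v) = 0)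
    (hN : ∀ u v, T (I u) v - T (I v) u + I (T v u) - I (T u v) = 0)
    (hN' : ∀ u v, T' (J u) v - T' (J v) u + J (T' v u) - J (T' u v) = 0) :
    I (contr G T) = J (contr G T') := by
  have h1 := contr_comp_eq_zero hG hI hIJ hGI hGJ hT hN
  have h2 := contr_comp_eq_zero hG hJ (I := J) (J := I) (fun v => by rw [hIJ, neg_neg]) hGJ hGI
    hT' hN'
  set e := finBasis ℝ V
  have h3 : ∑ k, (T (e k) (J (G (dualCov e k))) + I (T' (e k) (G (dualCov e k)))
      + T' (e k) (I (G (dualCov e k))) + J (T (e k) (G (dualCov e k)))) = 0 :=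
    Finset.sum_eq_zero fun k _ => hTT _ _
  simp only [Finset.sum_add_distrib, ← map_sum] at h3
  rw [h1, h2, zero_add, add_zero] at h3
  change I (contr G T') + J (contr G T) = 0 at h3
  -- apply `J` and use that `I` and `J` anticommute
  have h4 : J (J (contr G T)) = -J (I (contr G T')) := by
    rw [← map_neg]; congr 1; exact eq_neg_of_add_eq_zero_right h3
  rw [hJ, hIJ, neg_neg] at h4
  have h5 : I (I (J (contr G T'))) = -I (contr G T) := by rw [← h4, map_neg]
  rw [hI] at h5
  exact (neg_injective h5).symm

/-- The divergence of `z ↦ J G (β ∘ J)`, with the inner `J` frozen: it differs from the divergence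
of `G β` by the derivative of the inner `J`. -/
theorem divg_comp_frozen {J : V → V →L[ℝ] V} {G : V → (V →L[ℝ] ℝ) →L[ℝ] V} {y : V}
    (hJd : DifferentiableAt ℝ J y) (hGd : DifferentiableAt ℝ G y)
    (hJ : ∀ᶠ z in nhds y, ∀ v, J z (J z v) = -v)
    (hJG : ∀ᶠ z in nhds y, ∀ β : V →L[ℝ] ℝ, J z (G z β) = -G z (β.comp (J z)))
    (hsk : ∀ β γ : V →L[ℝ] ℝ, β (J y (G y γ)) = -γ (J y (G y β))) (β : V →L[ℝ] ℝ) :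
    divg (fun z => J z (G z (β.comp (J y)))) y
      = divg (fun z => G z β) y - β (J y (contr (G y) (fderiv ℝ J y))) := by
  set e := finBasis ℝ V
  set R : V → V := fun z => J z (G z (β.comp (J z - J y))) with hR
  have h1 : (fun z => J z (G z (β.comp (J y)))) =ᶠ[nhds y] fun z => G z β - R z := by
    filter_upwards [hJ, hJG] with z hz hzG
    have h2 : (β.comp (J z)).comp (J z) = -β := by
      ext v; rw [ContinuousLinearMap.comp_apply, ContinuousLinearMap.comp_apply, hz]; simp
    have h3 : J z (G z (β.comp (J z))) = G z β := by rw [hzG, h2, map_neg, neg_neg]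
    rw [hR]
    simp only [ContinuousLinearMap.comp_sub, map_sub, h3]
    abel
  have hb : HasFDerivAt (fun z => β.comp (J z - J y))
      ((ContinuousLinearMap.compL ℝ V V ℝ β).comp (fderiv ℝ J y)) y :=
    (ContinuousLinearMap.compL ℝ V V ℝ β).hasFDerivAt.comp y (hJd.hasFDerivAt.sub_const _)
  have hRd : HasFDerivAt R _ y := hJd.hasFDerivAt.clm_apply (hGd.hasFDerivAt.clm_apply hb)
  rw [Filter.EventuallyEq.divg_eq h1, divg_sub (hGd.clm_apply (differentiableAt_const β))
    hRd.differentiableAt]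
  congr 1
  rw [divg, hRd.fderiv, trace_eq_sum_dualCov e, contr, map_sum, map_sum]
  refine Finset.sum_congr rfl fun k _ => ?_
  have hT : J y (fderiv ℝ J y (e k) (G y (dualCov e k)))
      = -fderiv ℝ J y (e k) (J y (G y (dualCov e k))) := by
    have hsq : (fun z => (J z).comp (J z)) =ᶠ[nhds y] fun _ => -ContinuousLinearMap.id ℝ V := by
      filter_upwards [hJ] with z hz
      ext v; exact hz v
    have h2 := (hJd.hasFDerivAt.clm_comp hJd.hasFDerivAt).fderiv
    rw [hsq.fderiv_eq, fderiv_const_apply] at h2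
    have h3 := congrArg (fun A => A (e k) (G y (dualCov e k))) h2
    simp at h3
    rw [eq_neg_iff_add_eq_zero, ← h3]
  rw [hT, map_neg]
  simp [hsk (dualCov e k)]

end Trace

section Hypercomplex

variable {V : Type*} [NormedAddCommGroup V] [NormedSpace ℝ V] [FiniteDimensional ℝ V]
  {P : Type*} [TopologicalSpace P] [ChartedSpace V P] [IsManifold 𝓘(ℝ, V) ∞ P]

/-- The vector density `Z` dual to `β ↦ div (J G β)`. -/
def MetricFam.kahlerVec (D : MetricFam V P) (J : P → V → V →L[ℝ] V) (x₀ : P) (y : V) : V :=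
  divVec (fun z => (J x₀ z).comp (D.G x₀ z)) y

section

variable {D : MetricFam V P} {J : EndField 𝓘(ℝ, V) P}

theorem kahlerVec_smooth (hJ : J.IsComplexStructure) :
    SmoothFam (D.kahlerVec J.inChart) := (hJ.smooth.smoothFam.comp_clm D.G_smooth).divVec

theorem apply_kahlerVec (hJ : J.IsComplexStructure) {x₀ : P} {y : V}
    (hy : y ∈ (chartAt V x₀).target) (β : V →L[ℝ] ℝ) :
    β (D.kahlerVec J.inChart x₀ y) = divg (fun z => J.inChart x₀ z (D.G x₀ z β)) y :=
  apply_divVec ((hJ.smooth.smoothFam.comp_clm D.G_smooth).differentiableAt hy) β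

theorem kahlerVec_skew (hJ : J.IsComplexStructure) (hc : D.Compat J.inChart) {x₀ : P} {y : V}
    (hy : y ∈ (chartAt V x₀).target) (β γ : V →L[ℝ] ℝ) :
    β (((J.inChart x₀ y).comp (D.G x₀ y)) γ) = -γ (((J.inChart x₀ y).comp (D.G x₀ y)) β) :=
  hc.skew (fun _ _ hy => EndField.inChart_sq hJ.sq hy) hy β γ

theorem kahlerVec_isVecDens (hJ : J.IsComplexStructure) (hc : D.Compat J.inChart) :
    IsVecDens (D.kahlerVec J.inChart) :=
  (J.isEndFam.coDens D.G_dens).divVec (hJ.smooth.smoothFam.comp_clm D.G_smooth)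
    fun _ _ hy => kahlerVec_skew hJ hc hy

theorem divg_kahlerVec (hJ : J.IsComplexStructure) (hc : D.Compat J.inChart) {x₀ : P} {y : V}
    (hy : y ∈ (chartAt V x₀).target) : divg (D.kahlerVec J.inChart x₀) y = 0 := by
  have hn := (chartAt V x₀).open_target.mem_nhds hy
  refine divg_divg_eq_zero (P := fun z => (J.inChart x₀ z).comp (D.G x₀ z))
    (((hJ.smooth.smoothFam.comp_clm D.G_smooth).contDiffAt hy).of_le two_le_infty)
    (Filter.eventually_of_mem hn fun z hz => kahlerVec_skew hJ hc hz)
    ((kahlerVec_smooth hJ).differentiableAt hy)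
    (Filter.eventually_of_mem hn fun z hz => apply_kahlerVec hJ hz)

theorem apply_inChart_kahlerVec (hJ : J.IsComplexStructure) (hc : D.Compat J.inChart) {x₀ : P}
    {y : V} (hy : y ∈ (chartAt V x₀).target) (β : V →L[ℝ] ℝ) :
    β (J.inChart x₀ y (D.kahlerVec J.inChart x₀ y)) = divg (fun z => D.G x₀ z β) y
      - β (J.inChart x₀ y (contr (D.G x₀ y) (fderiv ℝ (J.inChart x₀) y))) := by
  have hn := (chartAt V x₀).open_target.mem_nhds hy
  have hsq : ∀ x₀, ∀ y ∈ (chartAt V x₀).target, ∀ v, J.inChart x₀ y (J.inChart x₀ y v) = -v :=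
    fun _ _ hy => EndField.inChart_sq hJ.sq hy
  rw [← divg_comp_frozen (hJ.smooth.smoothFam.differentiableAt hy) (D.G_smooth.differentiableAt hy)
    (Filter.eventually_of_mem hn fun z hz => hsq x₀ z hz)
    (Filter.eventually_of_mem hn fun z hz => hc.G_comp hsq hz) (kahlerVec_skew hJ hc hy)]
  exact apply_kahlerVec hJ hy (β.comp (J.inChart x₀ y))

/-- The derivative of `J² = -1`. -/
theorem fderiv_inChart_comp (hJ : J.IsComplexStructure) {x₀ : P} {y : V}
    (hy : y ∈ (chartAt V x₀).target) (u v : V) :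
    fderiv ℝ (J.inChart x₀) y u (J.inChart x₀ y v)
      = -J.inChart x₀ y (fderiv ℝ (J.inChart x₀) y u v) := by
  have hJd := hJ.smooth.smoothFam.differentiableAt hy
  have hsq : (fun z => (J.inChart x₀ z).comp (J.inChart x₀ z)) =ᶠ[nhds y]
      fun _ => -ContinuousLinearMap.id ℝ V := by
    filter_upwards [(chartAt V x₀).open_target.mem_nhds hy] with z hz
    ext v; exact EndField.inChart_sq hJ.sq hz v
  have h2 := (hJd.hasFDerivAt.clm_comp hJd.hasFDerivAt).fderiv
  rw [hsq.fderiv_eq, fderiv_const_apply] at h2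
  have h3 := congrArg (fun A => A u v) h2
  simp at h3
  rw [eq_neg_iff_add_eq_zero, add_comm, ← h3]

end

/-- For two anticommuting complex structures which are compatible with the metric, the vector
densities `J Z_J` agree. -/
theorem inChart_kahlerVec_eq {D : MetricFam V P} {J K : EndField 𝓘(ℝ, V) P}
    (hJ : J.IsComplexStructure) (hK : K.IsComplexStructure)
    (hJK : ∀ (x : P) (v : TangentSpace 𝓘(ℝ, V) x), K x (J x v) = -J x (K x v))
    (hcJ : D.Compat J.inChart) (hcK : D.Compat K.inChart) {x₀ : P} {y : V}
    (hy : y ∈ (chartAt V x₀).target) :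
    J.inChart x₀ y (D.kahlerVec J.inChart x₀ y) = K.inChart x₀ y (D.kahlerVec K.inChart x₀ y) := by
  have hsqJ : ∀ x₀, ∀ y ∈ (chartAt V x₀).target, ∀ v, J.inChart x₀ y (J.inChart x₀ y v) = -v :=
    fun _ _ hy => EndField.inChart_sq hJ.sq hy
  have hsqK : ∀ x₀, ∀ y ∈ (chartAt V x₀).target, ∀ v, K.inChart x₀ y (K.inChart x₀ y v) = -v :=
    fun _ _ hy => EndField.inChart_sq hK.sq hy
  have hanti : ∀ x₀, ∀ y ∈ (chartAt V x₀).target, ∀ v, K.inChart x₀ y (J.inChart x₀ y v)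
      = -J.inChart x₀ y (K.inChart x₀ y v) := fun x₀ y hy v => by
    refine jac_injective (mem_coordDom_self hy) ?_
    rw [map_neg, K.jac_inChart hy, J.jac_inChart hy, J.jac_inChart hy, K.jac_inChart hy]
    exact hJK _ _
  -- both sides are vector densities, so that it suffices to compare them at the centres of charts,
  -- where the Nijenhuis tensor is known
  refine sub_eq_zero.1 (((J.isEndFam.vecDens (kahlerVec_isVecDens hJ hcJ)).sub
    (K.isEndFam.vecDens (kahlerVec_isVecDens hK hcK))).eq_zero (fun x => ?_) hy)
  have hx := mem_chart_target V x
  refine sub_eq_zero.2 (eq_of_forall_covector fun β => ?_)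
  rw [apply_inChart_kahlerVec hJ hcJ hx, apply_inChart_kahlerVec hK hcK hx]
  congr 2
  refine apply_contr_eq (D.G_symm hx) (hsqJ x _ hx) (hsqK x _ hx) (hanti x _ hx)
    (fun β => by rw [hcJ.G_comp hsqJ hx, neg_neg]) (fun β => by rw [hcK.G_comp hsqK hx, neg_neg])
    (fderiv_inChart_comp hJ hx) (fderiv_inChart_comp hK hx) (fun u v => ?_)
    (hJ.nijenhuis_chart x) (hK.nijenhuis_chart x)
  have hJd := hJ.smooth.smoothFam.differentiableAt hx
  have hKd := hK.smooth.smoothFam.differentiableAt hx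
  -- the derivative of the relation `J K + K J = 0`
  have h0 : (fun z => (J.inChart x z).comp (K.inChart x z) + (K.inChart x z).comp (J.inChart x z))
      =ᶠ[nhds (chartAt V x x)] fun _ => 0 := by
    filter_upwards [(chartAt V x).open_target.mem_nhds hx] with z hz
    ext v
    simp [hanti x z hz]
  have h2 := ((hJd.hasFDerivAt.clm_comp hKd.hasFDerivAt).add
    (hKd.hasFDerivAt.clm_comp hJd.hasFDerivAt)).fderiv
  have h3 := congrArg (fun A => A u v) (h2.symm.trans h0.fderiv_eq)
  simp at h3
  rw [← h3]
  abel

/-- The three complex structures of a hypercomplex structure. -/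
def HypercomplexStructure.str (S : HypercomplexStructure 𝓘(ℝ, V) P) :
    Fin 3 → EndField 𝓘(ℝ, V) P := ![S.i, S.j, S.k]

namespace HypercomplexStructure

variable (S : HypercomplexStructure 𝓘(ℝ, V) P)

theorem isComplexStructure_str (l : Fin 3) : (S.str l).IsComplexStructure := by
  fin_cases l
  exacts [S.isComplex_i, S.isComplex_j, S.isComplex_k]

theorem j_i (x : P) (v : TangentSpace 𝓘(ℝ, V) x) : S.j x (S.i x v) = -S.k x v := by
  rw [← S.k_i, S.isComplex_i.sq, map_neg]

theorem i_k (x : P) (v : TangentSpace 𝓘(ℝ, V) x) : S.i x (S.k x v) = -S.j x v := by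
  rw [← S.j_k, S.isComplex_k.sq, map_neg]

theorem str_sq (l : Fin 3) {x₀ : P} {y : V} (hy : y ∈ (chartAt V x₀).target) (v : V) :
    (S.str l).inChart x₀ y ((S.str l).inChart x₀ y v) = -v :=
  EndField.inChart_sq (S.isComplexStructure_str l).sq hy v

/-- The vector density `Y` of a compatible metric, with `div (J G β) = -β (J Y)` for all three
complex structures `J`. -/
theorem exists_lee_field (D : MetricFam V P) (hD : ∀ l, D.Compat (S.str l).inChart) :
    ∃ Y : P → V → V, SmoothFam Y ∧ IsVecDens Y ∧
      (∀ l x₀, ∀ y ∈ (chartAt V x₀).target, ∀ β : V →L[ℝ] ℝ,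
        divg (fun z => (S.str l).inChart x₀ z (D.G x₀ z β)) y
          = -β ((S.str l).inChart x₀ y (Y x₀ y))) ∧
      ∀ l x₀, ∀ y ∈ (chartAt V x₀).target,
        divg (fun z => (S.str l).inChart x₀ z (Y x₀ z)) y = 0 := by
  set Z : Fin 3 → P → V → V := fun l => D.kahlerVec (S.str l).inChart with hZ
  set Y : P → V → V := fun x₀ y => (S.str 0).inChart x₀ y (Z 0 x₀ y) with hYdef
  have hY : ∀ l x₀, ∀ y ∈ (chartAt V x₀).target, Y x₀ y = (S.str l).inChart x₀ y (Z l x₀ y) := by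
    intro l x₀ y hy
    fin_cases l
    · rfl
    · exact inChart_kahlerVec_eq (S.isComplexStructure_str 0) (S.isComplexStructure_str 1)
        (fun x v => (S.j_i x v).trans (congrArg Neg.neg (S.i_j x v)).symm) (hD 0) (hD 1) hy
    · exact inChart_kahlerVec_eq (S.isComplexStructure_str 0) (S.isComplexStructure_str 2)
        (fun x v => (S.k_i x v).trans
          ((congrArg Neg.neg (S.i_k x v)).trans (neg_neg _)).symm) (hD 0) (hD 2) hy
  have hJY : ∀ l x₀, ∀ y ∈ (chartAt V x₀).target,
      (S.str l).inChart x₀ y (Y x₀ y) = -Z l x₀ y := fun l x₀ y hy => by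
    rw [hY l x₀ y hy, S.str_sq l hy]
  refine ⟨Y, fun x₀ => ?_, ?_, fun l x₀ y hy β => ?_, fun l x₀ y hy => ?_⟩
  · exact ((S.isComplexStructure_str 0).smooth.smoothFam x₀).clm_apply
      (kahlerVec_smooth (S.isComplexStructure_str 0) x₀)
  · exact (S.str 0).isEndFam.vecDens (kahlerVec_isVecDens (S.isComplexStructure_str 0) (hD 0))
  · rw [hJY l x₀ y hy, map_neg, neg_neg]
    exact (apply_kahlerVec (S.isComplexStructure_str l) hy β).symm
  · have h : (fun z => (S.str l).inChart x₀ z (Y x₀ z)) =ᶠ[nhds y] fun z => -Z l x₀ z := by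
      filter_upwards [(chartAt V x₀).open_target.mem_nhds hy] with z hz using hJY l x₀ z hz
    rw [Filter.EventuallyEq.divg_eq h, divg_neg]
    have := divg_kahlerVec (S.isComplexStructure_str l) (hD l) hy
    exact neg_eq_zero.2 this

end HypercomplexStructure

/-! ### Existence of hyperhermitian metrics -/
/-- The differentials of the components of an embedding of a compact manifold into a Euclidean
space: finitely many exact one-forms which span the cotangent spaces. -/
theorem exists_spanning_covectors (V : Type*) [NormedAddCommGroup V] [NormedSpace ℝ V]
    [FiniteDimensional ℝ V] (P : Type*) [TopologicalSpace P] [ChartedSpace V P]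
    [IsManifold 𝓘(ℝ, V) ∞ P] [T2Space P] [CompactSpace P] :
    ∃ (n : ℕ) (ℓ : Fin n → P → V → V →L[ℝ] ℝ), (∀ i, SmoothFam (ℓ i)) ∧
      (∀ i x₀ x₁, ∀ y ∈ coordDom V x₀ x₁, ∀ v,
        ℓ i x₀ y v = ℓ i x₁ (coordCh V x₀ x₁ y) (jac V x₀ x₁ y v)) ∧
      ∀ x₀, ∀ y ∈ (chartAt V x₀).target, ∀ v, (∀ i, ℓ i x₀ y v = 0) → v = 0 := by
  obtain ⟨n, e, hes, -, hei⟩ := exists_embedding_euclidean_of_compact (I := 𝓘(ℝ, V)) (M := P)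
  set L : P → V → V →L[ℝ] EuclideanSpace ℝ (Fin n) := fun x₀ y =>
    fderiv ℝ (fun z => e ((chartAt V x₀).symm z)) y with hL
  have hec : ∀ x₀, ContDiffOn ℝ ∞ (fun z => e ((chartAt V x₀).symm z)) (chartAt V x₀).target :=
    fun x₀ => by
    rw [← contMDiffOn_iff_contDiffOn]
    exact hes.comp_contMDiffOn (contMDiffOn_chart_symm (I := 𝓘(ℝ, V)))
  have hLs : SmoothFam L := fun x₀ =>
    (hec x₀).fderiv_of_isOpen (chartAt V x₀).open_target infty_add_one.le
  have hLt : ∀ x₀ x₁, ∀ y ∈ coordDom V x₀ x₁,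
      L x₀ y = (L x₁ (coordCh V x₀ x₁ y)).comp (jac V x₀ x₁ y) := fun x₀ x₁ y hy => by
    have h1 : DifferentiableAt ℝ (fun z => e ((chartAt V x₁).symm z)) (coordCh V x₀ x₁ y) :=
      ((hec x₁).contDiffAt ((chartAt V x₁).open_target.mem_nhds
        (coordCh_mem_target hy))).differentiableAt infty_ne_zero
    rw [← (h1.hasFDerivAt.comp y (differentiableAt_coordCh hy).hasFDerivAt).fderiv]
    refine Filter.EventuallyEq.fderiv_eq ?_
    filter_upwards [(isOpen_coordDom x₀ x₁).mem_nhds hy] with z hz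
    exact congrArg e (chartAt_symm_coordCh hz).symm
  have hL0 : ∀ x, Function.Injective (L x (chartAt V x x)) := fun x => by
    have h1 : mfderiv 𝓘(ℝ, V) 𝓘(ℝ, EuclideanSpace ℝ (Fin n)) e x = L x (chartAt V x x) := by
      refine (if_pos (hes.mdifferentiable infty_ne_zero x)).trans ?_
      simp only [mfld_simps, fderivWithin_univ]
      rfl
    exact h1 ▸ hei x
  refine ⟨n, fun i x₀ y => (EuclideanSpace.proj i).comp (L x₀ y), fun i x₀ => ?_,
    fun i x₀ x₁ y hy v => ?_, fun x₀ y hy v hv => ?_⟩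
  · exact contDiffOn_const.clm_comp (hLs x₀)
  · exact congrArg (fun A : V →L[ℝ] EuclideanSpace ℝ (Fin n) => A v i) (hLt _ _ _ hy)
  · have hm := mem_coordDom_self hy
    have h1 : L x₀ y v = 0 := by ext i; exact hv i
    rw [hLt _ _ _ hm] at h1
    exact jac_injective hm ((hL0 _ (h1.trans (map_zero _).symm)).trans (map_zero _).symm)

section HyperForm

variable {I J K : V →L[ℝ] V}

/-- The fundamental form, with respect to `I`, of the average of the square of a covector over the
quaternion group generated by `I`, `J` and `K`. -/
def hyperForm (I J K : V →L[ℝ] V) (l : V →L[ℝ] ℝ) : V [⋀^Fin 2]→L[ℝ] ℝ :=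
  wedgeCov (l.comp I) l + wedgeCov (l.comp J) (l.comp K)

theorem flat_hyperForm (l : V →L[ℝ] ℝ) (u v : V) : flat (hyperForm I J K l) u v
    = l (I u) * l v - l (I v) * l u + (l (J u) * l (K v) - l (J v) * l (K u)) := by
  rw [hyperForm, flat, map_add, _root_.add_apply, _root_.add_apply]
  exact congrArg₂ _ (flat_wedgeCov _ _ u v) (flat_wedgeCov _ _ u v)

theorem flat_hyperForm_right (hI : ∀ v, I (I v) = -v) (hKI : ∀ v, K (I v) = J v)
    (hJI : ∀ v, J (I v) = -K v) (l : V →L[ℝ] ℝ) (u v : V) : flat (hyperForm I J K l) u (I v)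
    = l (I u) * l (I v) + l u * l v + l (J u) * l (J v) + l (K u) * l (K v) := by
  rw [flat_hyperForm, hI, hKI, hJI, map_neg, map_neg]; ring

end HyperForm

namespace HypercomplexStructure

variable (S : HypercomplexStructure 𝓘(ℝ, V) P)

/-- A compact hypercomplex manifold carries a metric compatible with the three complex
structures: the average of any metric, here the one induced by an embedding into a Euclidean
space. -/
theorem exists_compat_metric [T2Space P] [CompactSpace P] {r : ℕ} (hr : finrank ℝ V = 2 * r) :
    ∃ D : MetricFam V P, ∀ l, D.Compat (S.str l).inChart := by
  rcases r with _ | m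
  -- in dimension zero there is nothing to average, and no basis indexed by `2 (m + 1)` elements
  · obtain ⟨D⟩ := exists_metricFam_of_finrank_eq_zero (P := P) hr
    have : Subsingleton V := finrank_zero_iff.1 hr
    refine ⟨D, fun l x₀ y hy u v => ?_⟩
    rw [Subsingleton.elim ((S.str l).inChart x₀ y u) u, Subsingleton.elim ((S.str l).inChart x₀ y v) v]
  obtain ⟨n, ℓ, hℓs, hℓt, hℓi⟩ := exists_spanning_covectors V P
  have hmul : ∀ a b c, (∀ x (v : V), (S.str a x : V →L[ℝ] V) ((S.str b x : V →L[ℝ] V) v)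
      = (S.str c x : V →L[ℝ] V) v) → ∀ x₀, ∀ y ∈ (chartAt V x₀).target, ∀ v,
      (S.str a).inChart x₀ y ((S.str b).inChart x₀ y v) = (S.str c).inChart x₀ y v :=
    fun a b c h x₀ y hy v => EndField.inChart_mul h hy v
  have m01 := hmul 0 1 2 S.i_j
  have m12 := hmul 1 2 0 S.j_k
  have m20 := hmul 2 0 1 S.k_i
  have sq : ∀ l x₀, ∀ y ∈ (chartAt V x₀).target, ∀ v,
      (S.str l).inChart x₀ y ((S.str l).inChart x₀ y v) = -v :=
    fun l x₀ y hy v => S.str_sq l hy v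
  have hJs : ∀ l, SmoothFam (S.str l).inChart := fun l =>
    (S.isComplexStructure_str l).smooth.smoothFam
  have hJt : ∀ l, IsEndFam (S.str l).inChart := fun l => (S.str l).isEndFam
  generalize hJ : (fun l => (S.str l).inChart : Fin 3 → P → V → V →L[ℝ] V) = J
  have hJ' : ∀ l, (S.str l).inChart = J l := fun l => congrFun hJ l
  simp only [hJ'] at *
  have m10 : ∀ x₀, ∀ y ∈ (chartAt V x₀).target, ∀ v, J 1 x₀ y (J 0 x₀ y v) = -J 2 x₀ y v :=
    fun x₀ y hy v => by rw [← m20 x₀ y hy, sq 0 x₀ y hy, map_neg]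
  have m21 : ∀ x₀, ∀ y ∈ (chartAt V x₀).target, ∀ v, J 2 x₀ y (J 1 x₀ y v) = -J 0 x₀ y v :=
    fun x₀ y hy v => by rw [← m01 x₀ y hy, sq 1 x₀ y hy, map_neg]
  have m02 : ∀ x₀, ∀ y ∈ (chartAt V x₀).target, ∀ v, J 0 x₀ y (J 2 x₀ y v) = -J 1 x₀ y v :=
    fun x₀ y hy v => by rw [← m12 x₀ y hy, sq 2 x₀ y hy, map_neg]
  -- the fundamental form of the averaged metric, with respect to the first complex structure
  set η : P → V → V [⋀^Fin 2]→L[ℝ] ℝ := fun x₀ y => ∑ i,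
    hyperForm (J 0 x₀ y) (J 1 x₀ y) (J 2 x₀ y) (ℓ i x₀ y) with hη
  have hsum : ∀ x₀ y u v, flat (η x₀ y) u v
      = ∑ i, flat (hyperForm (J 0 x₀ y) (J 1 x₀ y) (J 2 x₀ y) (ℓ i x₀ y)) u v := fun x₀ y u v => by
    rw [flat, map_sum, _root_.sum_apply, _root_.sum_apply]; rfl
  have hval : ∀ x₀, ∀ y ∈ (chartAt V x₀).target, ∀ u v, flat (η x₀ y) u (J 0 x₀ y v) = ∑ i,
      (ℓ i x₀ y (J 0 x₀ y u) * ℓ i x₀ y (J 0 x₀ y v) + ℓ i x₀ y u * ℓ i x₀ y v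
      + ℓ i x₀ y (J 1 x₀ y u) * ℓ i x₀ y (J 1 x₀ y v)
      + ℓ i x₀ y (J 2 x₀ y u) * ℓ i x₀ y (J 2 x₀ y v)) := fun x₀ y hy u v => by
    rw [hsum]
    exact Finset.sum_congr rfl fun i _ =>
      flat_hyperForm_right (sq 0 x₀ y hy) (m20 x₀ y hy) (m10 x₀ y hy) _ u v
  have hηt : IsFormFam η := fun x₀ x₁ y hy => by
    refine eq_of_flat_eq fun u v => ?_
    rw [flat_comp, hsum, hsum]
    refine Finset.sum_congr rfl fun i _ => ?_
    rw [flat_hyperForm, flat_hyperForm]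
    simp only [hℓt i _ _ y hy, hJt _ _ _ y hy]
  have hηs : SmoothFam η := fun x₀ => by
    refine ContDiffOn.sum fun i _ => ContDiffOn.add ?_ ?_
    · exact contDiff_wedgeCov.comp_contDiffOn
        (((hℓs i x₀).clm_comp (hJs 0 x₀)).prodMk (hℓs i x₀))
    · exact contDiff_wedgeCov.comp_contDiffOn
        (((hℓs i x₀).clm_comp (hJs 1 x₀)).prodMk ((hℓs i x₀).clm_comp (hJs 2 x₀)))
  have hpos : ∀ x₀, ∀ y ∈ (chartAt V x₀).target, ∀ u, u ≠ 0 →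
      0 < flat (η x₀ y) u (J 0 x₀ y u) := fun x₀ y hy u hu => by
    rw [hval x₀ y hy]
    obtain ⟨i, hi⟩ : ∃ i, ℓ i x₀ y u ≠ 0 := by
      by_contra! h
      exact hu (hℓi x₀ y hy u h)
    refine Finset.sum_pos' (fun j _ => ?_) ⟨i, Finset.mem_univ _, ?_⟩
    · simp only [← pow_two]; positivity
    · simp only [← pow_two]; positivity
  obtain ⟨D, -, hDg, -⟩ := exists_metricFam_of_form (finBasisOfFinrankEq ℝ V hr) hηt hηs
    (hJt 0) (hJs 0) (sq 0)
    (fun x₀ y hy u v => by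
      rw [hval x₀ y hy, flat_swap, ← neg_eq_iff_eq_neg]
      have h := hval x₀ y hy v (-J 0 x₀ y u)
      rw [map_neg, sq 0 x₀ y hy, neg_neg] at h
      rw [h, ← Finset.sum_neg_distrib]
      refine Finset.sum_congr rfl fun i _ => ?_
      simp only [sq 0 x₀ y hy, m10 x₀ y hy, m20 x₀ y hy, map_neg]
      ring) hpos
  refine ⟨D, fun l x₀ y hy u v => ?_⟩
  rw [hDg x₀ y hy, hDg x₀ y hy, hval x₀ y hy, hval x₀ y hy]
  refine Finset.sum_congr rfl fun i _ => ?_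
  have hl : l = 0 ∨ l = 1 ∨ l = 2 := by fin_cases l <;> simp
  rcases hl with rfl | rfl | rfl
  · simp only [sq _ x₀ y hy, m10 x₀ y hy, m20 x₀ y hy, map_neg]
    ring
  · simp only [sq _ x₀ y hy, m01 x₀ y hy, m21 x₀ y hy, map_neg]
    ring
  · simp only [sq _ x₀ y hy, m12 x₀ y hy, m02 x₀ y hy, map_neg]
    ring

end HypercomplexStructure

end Hypercomplex

/-! ### Holomorphic functions of several variables are smooth -/

section Holomorphic

open Metric

variable {F : Type*} [NormedAddCommGroup F] [NormedSpace ℂ F] [FiniteDimensional ℂ F]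

/-- Cauchy's formula for a directional derivative of a holomorphic function. -/
theorem exists_cauchy_formula {g : F → ℂ} {U : Set F} (hU : IsOpen U) (hg : DifferentiableOn ℂ g U)
    {z₀ : F} (hz₀ : z₀ ∈ U) (v : F) : ∃ (ε : ℝ) (c : ℝ → F) (k : ℝ → ℂ), 0 < ε ∧ Continuous c ∧
      Continuous k ∧ closedBall z₀ (2 * ε) ⊆ U ∧
      (∀ z ∈ ball z₀ ε, ∀ θ, z + c θ ∈ closedBall z₀ (2 * ε)) ∧
      ∀ z ∈ ball z₀ ε, fderiv ℂ g z v = ∫ θ in (0 : ℝ)..2 * Real.pi, k θ * g (z + c θ) := by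
  obtain ⟨δ, hδ, hball⟩ := Metric.isOpen_iff.1 hU z₀ hz₀
  -- for `z` at distance at most `ε` from `z₀`, the circle `z + ζ v`, `|ζ| = r`, stays in the ball of
  -- radius `2 ε`
  set ε := δ / 4 with hε
  have hε0 : 0 < ε := by positivity
  set r := ε / (‖v‖ + 1) with hr
  have hr0 : 0 < r := by positivity
  have hrv : r * ‖v‖ ≤ ε := by
    rw [hr, div_mul_eq_mul_div, div_le_iff₀ (by positivity)]
    nlinarith [norm_nonneg v]
  have hsub : closedBall z₀ (2 * ε) ⊆ U := fun w hw =>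
    hball (mem_ball.2 (lt_of_le_of_lt (mem_closedBall.1 hw) (by rw [hε]; linarith)))
  have hmem : ∀ z ∈ ball z₀ ε, ∀ ζ ∈ closedBall (0 : ℂ) r, z + ζ • v ∈ closedBall z₀ (2 * ε) := by
    intro z hz ζ hζ
    rw [mem_ball, dist_eq_norm] at hz
    rw [mem_closedBall, dist_zero_right] at hζ
    rw [mem_closedBall, dist_eq_norm]
    have h1 : z + ζ • v - z₀ = (z - z₀) + ζ • v := by abel
    have h2 : ‖ζ • v‖ ≤ r * ‖v‖ := by
      rw [norm_smul]; exact mul_le_mul_of_nonneg_right hζ (norm_nonneg v)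
    calc ‖z + ζ • v - z₀‖ ≤ ‖z - z₀‖ + ‖ζ • v‖ := by rw [h1]; exact norm_add_le _ _
      _ ≤ 2 * ε := by linarith
  have hcirc : ∀ θ, circleMap 0 r θ ∈ closedBall (0 : ℂ) r := fun θ =>
    circleMap_mem_closedBall 0 hr0.le θ
  have hne : ∀ θ, circleMap 0 r θ ≠ 0 := fun θ => circleMap_ne_center hr0.ne'
  have hcm : Continuous fun θ => circleMap (0 : ℂ) r θ := continuous_circleMap 0 r
  refine ⟨ε, fun θ => circleMap 0 r θ • v,
    fun θ => (2 * Real.pi * Complex.I : ℂ)⁻¹ *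
      (circleMap 0 r θ * Complex.I * (circleMap 0 r θ ^ 2)⁻¹), hε0, hcm.smul continuous_const,
    continuous_const.mul ((hcm.mul continuous_const).mul
      ((hcm.pow 2).inv₀ fun θ => pow_ne_zero 2 (hne θ))), hsub,
    fun z hz θ => hmem z hz _ (hcirc θ), fun z hz => ?_⟩
  have hz' : z ∈ U := by
    have := hmem z hz 0 (by simp [hr0.le])
    rw [zero_smul, add_zero] at this
    exact hsub this
  set φ : ℂ → F := fun ζ => z + ζ • v with hφ
  have hφc : Continuous φ := by fun_prop
  have hφd : Differentiable ℂ φ := by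
    rw [hφ]; fun_prop
  have h1 := Complex.two_pi_I_inv_smul_circleIntegral_sub_sq_inv_smul_of_differentiable
    (f := fun ζ => g (φ ζ)) (hU.preimage hφc) (c := 0) (w₀ := 0) (R := r)
    (fun ζ hζ => hsub (hmem z hz ζ hζ))
    (hg.comp hφd.differentiableOn fun ζ hζ => hζ) (mem_ball_self hr0)
  have h2 : deriv (fun ζ => g (φ ζ)) 0 = fderiv ℂ g z v := by
    have hφ0 : φ 0 = z := by rw [hφ]; simp
    have hd : HasDerivAt φ v 0 := by
      have := ((hasDerivAt_id (0 : ℂ)).smul_const v).const_add z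
      rw [one_smul] at this
      exact this
    have hgd : HasFDerivAt g (fderiv ℂ g z) (φ 0) := by
      rw [hφ0]; exact (hg.differentiableAt (hU.mem_nhds hz')).hasFDerivAt
    exact (hgd.comp_hasDerivAt 0 hd).deriv
  rw [← h2, ← h1, circleIntegral, smul_eq_mul, ← intervalIntegral.integral_const_mul]
  refine intervalIntegral.integral_congr fun θ _ => ?_
  simp only [deriv_circleMap, sub_zero, smul_eq_mul, hφ]
  ring

/-- The directional derivatives of a holomorphic function are continuous: the integral in Cauchy's
formula depends continuously on the point. -/
theorem continuousOn_fderiv_of_differentiableOn {g : F → ℂ} {U : Set F} (hU : IsOpen U)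
    (hg : DifferentiableOn ℂ g U) (v : F) : ContinuousOn (fun z => fderiv ℂ g z v) U := by
  have : ProperSpace F := FiniteDimensional.proper ℂ F
  intro z₀ hz₀
  obtain ⟨ε, c, k, hε, hc, hk, hsub, hmem, hform⟩ := exists_cauchy_formula hU hg hz₀ v
  have hgc : ContinuousOn g (closedBall z₀ (2 * ε)) := hg.continuousOn.mono hsub
  obtain ⟨C, hC⟩ := (isCompact_closedBall z₀ (2 * ε)).exists_bound_of_continuousOn hgc
  have hcont : ∀ z ∈ ball z₀ ε, Continuous fun θ => k θ * g (z + c θ) := fun z hz =>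
    hk.mul (hgc.comp_continuous (continuous_const.add hc) fun θ => hmem z hz θ)
  have h1 : ContinuousAt (fun z => ∫ θ in (0 : ℝ)..2 * Real.pi, k θ * g (z + c θ)) z₀ := by
    refine intervalIntegral.continuousAt_of_dominated_interval (bound := fun θ => ‖k θ‖ * C)
      ?_ ?_ ?_ ?_
    · filter_upwards [ball_mem_nhds z₀ hε] with z hz
      exact (hcont z hz).aestronglyMeasurable
    · filter_upwards [ball_mem_nhds z₀ hε] with z hz
      refine Filter.Eventually.of_forall fun θ _ => ?_
      rw [norm_mul]
      exact mul_le_mul_of_nonneg_left (hC _ (hmem z hz θ)) (norm_nonneg _)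
    · exact (hk.norm.mul continuous_const).intervalIntegrable _ _
    · refine Filter.Eventually.of_forall fun θ _ => ?_
      have h2 : ContinuousAt g (z₀ + c θ) :=
        (hg.continuousOn).continuousAt (hU.mem_nhds (hsub (hmem z₀ (mem_ball_self hε) θ)))
      exact continuousAt_const.mul (ContinuousAt.comp (f := fun z => z + c θ) h2 (by fun_prop))
  refine (h1.congr ?_).continuousWithinAt
  filter_upwards [ball_mem_nhds z₀ hε] with z hz using (hform z hz).symm

/-- The directional derivatives of a holomorphic function are holomorphic, by differentiation
under the integral in Cauchy's formula. -/
theorem differentiableOn_fderiv_apply {g : F → ℂ} {U : Set F} (hU : IsOpen U)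
    (hg : DifferentiableOn ℂ g U) (v : F) : DifferentiableOn ℂ (fun z => fderiv ℂ g z v) U := by
  have : ProperSpace F := FiniteDimensional.proper ℂ F
  have hdc : ContinuousOn (fderiv ℂ g) U :=
    continuousOn_clm_apply.2 fun w => continuousOn_fderiv_of_differentiableOn hU hg w
  intro z₀ hz₀
  obtain ⟨ε, c, k, hε, hc, hk, hsub, hmem, hform⟩ := exists_cauchy_formula hU hg hz₀ v
  have hgc : ContinuousOn g (closedBall z₀ (2 * ε)) := hg.continuousOn.mono hsub
  have hdc' : ContinuousOn (fderiv ℂ g) (closedBall z₀ (2 * ε)) := hdc.mono hsub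
  obtain ⟨C, hC⟩ := (isCompact_closedBall z₀ (2 * ε)).exists_bound_of_continuousOn hdc'
  have hcont : ∀ z ∈ ball z₀ ε, Continuous fun θ => k θ * g (z + c θ) := fun z hz =>
    hk.mul (hgc.comp_continuous (continuous_const.add hc) fun θ => hmem z hz θ)
  have hz0 := mem_ball_self (x := z₀) hε
  have h1 := intervalIntegral.hasFDerivAt_integral_of_dominated_of_fderiv_le (𝕜 := ℂ)
    (μ := MeasureTheory.volume) (a := 0) (b := 2 * Real.pi)
    (F := fun z θ => k θ * g (z + c θ)) (F' := fun z θ => k θ • fderiv ℂ g (z + c θ))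
    (x₀ := z₀) (bound := fun θ => ‖k θ‖ * C) (ball_mem_nhds z₀ hε)
    (by
      filter_upwards [ball_mem_nhds z₀ hε] with z hz
      exact (hcont z hz).aestronglyMeasurable)
    ((hcont z₀ hz0).intervalIntegrable _ _)
    ((hk.smul (hdc'.comp_continuous (continuous_const.add hc)
      fun θ => hmem z₀ hz0 θ)).aestronglyMeasurable)
    (Filter.Eventually.of_forall fun θ _ z hz => by
      rw [norm_smul]
      exact mul_le_mul_of_nonneg_left (hC _ (hmem z hz θ)) (norm_nonneg _))
    ((hk.norm.mul continuous_const).intervalIntegrable _ _)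
    (Filter.Eventually.of_forall fun θ _ z hz => by
      have h2 : HasFDerivAt g (fderiv ℂ g (z + c θ)) (z + c θ) :=
        (hg.differentiableAt (hU.mem_nhds (hsub (hmem z hz θ)))).hasFDerivAt
      have h3 := h2.comp z ((hasFDerivAt_id z).add_const (c θ))
      rw [ContinuousLinearMap.comp_id] at h3
      exact h3.const_mul (k θ))
  refine (h1.differentiableAt.congr_of_eventuallyEq ?_).differentiableWithinAt
  filter_upwards [ball_mem_nhds z₀ hε] with z hz using hform z hz

/-- A function which is complex differentiable on an open set is smooth there. -/
theorem contDiffOn_of_differentiableOn_complex {g : F → ℂ} {U : Set F} (hU : IsOpen U)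
    (hg : DifferentiableOn ℂ g U) : ContDiffOn ℂ ∞ g U := by
  refine contDiffOn_infty.2 fun n => ?_
  induction n generalizing g with
  | zero => exact contDiffOn_zero.2 hg.continuousOn
  | succ n ih =>
    have h : ContDiffOn ℂ ((n : WithTop ℕ∞) + 1) g U :=
      (contDiffOn_succ_iff_fderiv_of_isOpen hU).2 ⟨hg, fun h => absurd h (WithTop.coe_ne_top), ?_⟩
    · exact_mod_cast h
    exact contDiffOn_clm_apply.2 fun v => ih (differentiableOn_fderiv_apply hU hg v)

end Holomorphic

section RealManifold

variable {F : Type*} [NormedAddCommGroup F] [NormedSpace ℂ F]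
  {Q : Type*} [TopologicalSpace Q] [ChartedSpace F Q]

/-- The real manifold underlying a complex manifold. -/
theorem isManifold_real [h : IsManifold 𝓘(ℂ, F) ω Q] : IsManifold 𝓘(ℝ, F) ∞ Q := by
  refine isManifold_of_contDiffOn 𝓘(ℝ, F) ∞ Q fun e e' he he' => ?_
  have h1 := (contDiffGroupoid ω 𝓘(ℂ, F)).compatible he he'
  rw [contDiffGroupoid, mem_groupoid_of_pregroupoid] at h1
  have h2 : ContDiffOn ℂ ω (𝓘(ℂ, F) ∘ e.symm ≫ₕ e' ∘ 𝓘(ℂ, F).symm)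
    (𝓘(ℂ, F).symm ⁻¹' (e.symm ≫ₕ e').source ∩ range 𝓘(ℂ, F)) := h1.1
  exact (h2.restrict_scalars ℝ).of_le le_top

/-- Coordinate changes of a complex manifold are complex linear to first order. -/
theorem jac_smul_I [h : IsManifold 𝓘(ℂ, F) ω Q] {x₀ x₁ : Q} {y : F} (hy : y ∈ coordDom F x₀ x₁)
    (v : F) : jac F x₀ x₁ y (Complex.I • v) = Complex.I • jac F x₀ x₁ y v := by
  have h1 : ContDiffOn ℂ ω (coordCh F x₀ x₁) (coordDom F x₀ x₁) := by
    have h := contDiffOn_ext_coord_change (I := 𝓘(ℂ, F)) (n := ω) x₁ x₀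
    refine ContDiffOn.congr_mono h (fun y _ => ?_) (fun y hy => ?_)
    · simp [coordCh]
    · rw [mem_coordDom] at hy
      simpa using hy
  have h2 : DifferentiableAt ℂ (coordCh F x₀ x₁) y :=
    (h1.contDiffAt ((isOpen_coordDom x₀ x₁).mem_nhds hy)).differentiableAt (by simp)
  have h3 : jac F x₀ x₁ y = (fderiv ℂ (coordCh F x₀ x₁) y).restrictScalars ℝ :=
    (h2.hasFDerivAt.restrictScalars ℝ).fderiv
  rw [h3]
  exact map_smul (fderiv ℂ (coordCh F x₀ x₁) y) Complex.I v

end RealManifold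

/-! ### Laplacians and bump functions -/

section Laplacian

variable {V : Type*} [NormedAddCommGroup V] [NormedSpace ℝ V] [FiniteDimensional ℝ V]

/-- The second order operator `u ↦ div (G du)`. -/
def lapl (G : V → (V →L[ℝ] ℝ) →L[ℝ] V) (u : V → ℝ) (y : V) : ℝ :=
  divg (fun z => G z (fderiv ℝ u z)) y

variable {G : V → (V →L[ℝ] ℝ) →L[ℝ] V} {u v : V → ℝ} {y : V}

theorem lapl_congr (h : u =ᶠ[nhds y] v) : lapl G u y = lapl G v y := by
  refine Filter.EventuallyEq.divg_eq ?_
  filter_upwards [Filter.EventuallyEq.fderiv (𝕜 := ℝ) h] with z hz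
  rw [hz]

theorem differentiableAt_fderiv (hu : ContDiffAt ℝ ∞ u y) :
    DifferentiableAt ℝ (fderiv ℝ u) y :=
  ((hu.of_le two_le_infty).fderiv_right (m := 1) (by norm_num)).differentiableAt (by norm_num)

theorem eventually_differentiableAt (hu : ContDiffAt ℝ ∞ u y) :
    ∀ᶠ z in nhds y, DifferentiableAt ℝ u z := by
  filter_upwards [(hu.of_le two_le_infty).eventually (by simp)] with z hz
    using hz.differentiableAt (by norm_num)

theorem lapl_add_const_mul (hG : DifferentiableAt ℝ G y) (hu : ContDiffAt ℝ ∞ u y)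
    (hv : ContDiffAt ℝ ∞ v y) (c : ℝ) :
    lapl G (fun z => u z + c * v z) y = lapl G u y + c * lapl G v y := by
  have h1 : (fun z => G z (fderiv ℝ (fun z => u z + c * v z) z)) =ᶠ[nhds y]
      fun z => G z (fderiv ℝ u z) + c • G z (fderiv ℝ v z) := by
    filter_upwards [eventually_differentiableAt hu, eventually_differentiableAt hv] with z hz hz'
    rw [fderiv_fun_add hz (hz'.const_mul c), fderiv_const_mul hz', map_add, map_smul]
  have hud := hG.clm_apply (differentiableAt_fderiv hu)
  have hvd := hG.clm_apply (differentiableAt_fderiv hv)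
  rw [lapl, Filter.EventuallyEq.divg_eq h1, divg_add hud (W' := fun z => c • G z (fderiv ℝ v z))
    (hvd.const_smul c), divg_const_smul (W := fun z => G z (fderiv ℝ v z)) hvd]
  rfl

theorem lapl_const (c : ℝ) : lapl G (fun _ => c) y = 0 := by
  have : (fun z => G z (fderiv ℝ (fun _ : V => c) z)) = fun _ => 0 := by
    ext1 z; rw [fderiv_const_apply, map_zero]
  rw [lapl, this, divg, fderiv_const_apply]
  exact map_zero _

/-- The chain rule. -/
theorem lapl_comp (hG : DifferentiableAt ℝ G y) {s : V → ℝ} (hs : ContDiffAt ℝ ∞ s y)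
    {χ χ₁ : ℝ → ℝ} {c : ℝ} (h₁ : ∀ t, HasDerivAt χ (χ₁ t) t) (h₂ : HasDerivAt χ₁ c (s y)) :
    lapl G (fun z => χ (s z)) y
      = c * fderiv ℝ s y (G y (fderiv ℝ s y)) + χ₁ (s y) * lapl G s y := by
  have h1 : (fun z => G z (fderiv ℝ (fun z => χ (s z)) z)) =ᶠ[nhds y]
      fun z => χ₁ (s z) • G z (fderiv ℝ s z) := by
    filter_upwards [eventually_differentiableAt hs] with z hz
    have h2 : HasFDerivAt (fun z => χ (s z)) (χ₁ (s z) • fderiv ℝ s z) z :=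
      (h₁ (s z)).comp_hasFDerivAt z hz.hasFDerivAt
    rw [h2.fderiv, map_smul]
  have h3 : HasFDerivAt (fun z => χ₁ (s z)) (c • fderiv ℝ s y) y := h₂.comp_hasFDerivAt y (hs.differentiableAt infty_ne_zero).hasFDerivAt
  rw [lapl, Filter.EventuallyEq.divg_eq h1, divg_smul (u := fun z => χ₁ (s z))
    h3.differentiableAt (hG.clm_apply (differentiableAt_fderiv hs))]
  rw [h3.fderiv]
  rfl

theorem hasDerivAt_expNegInvGlue (t : ℝ) :
    HasDerivAt expNegInvGlue ((t⁻¹) ^ 2 * expNegInvGlue t) t := by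
  have := expNegInvGlue.hasDerivAt_polynomial_eval_inv_mul 1 t
  simpa using this

theorem hasDerivAt_expNegInvGlue' (t : ℝ) :
    HasDerivAt (fun t => (t⁻¹) ^ 2 * expNegInvGlue t)
      ((t⁻¹) ^ 2 * ((t⁻¹) ^ 2 - 2 * t⁻¹) * expNegInvGlue t) t := by
  have := expNegInvGlue.hasDerivAt_polynomial_eval_inv_mul (Polynomial.X ^ 2) t
  simpa [one_add_one_eq_two] using this

theorem contDiffOn_lapl {T : Set V} (hT : IsOpen T) (hG : ContDiffOn ℝ ∞ G T)
    (hu : ContDiffOn ℝ ∞ u T) : ContDiffOn ℝ ∞ (lapl G u) T :=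
  contDiffOn_divg hT (hG.clm_apply (hu.fderiv_of_isOpen hT infty_add_one.le))

theorem fderiv_sub_norm_sq_ne_zero {E' : Type*} [NormedAddCommGroup E'] [InnerProductSpace ℝ E']
    (L : V ≃L[ℝ] E') {w : V} (hy : y ≠ w) (c : ℝ) :
    fderiv ℝ (fun y => c - ‖L y - L w‖ ^ 2) y ≠ 0 := fun h0 => by
  have h1 : HasFDerivAt (fun y => L y - L w) (L : V →L[ℝ] E') y := L.hasFDerivAt.sub_const (L w)
  have h2 := (h1.norm_sq.const_sub c).fderiv
  have h3 : fderiv ℝ (fun y => c - ‖L y - L w‖ ^ 2) y (y - w) = -(2 * ‖L y - L w‖ ^ 2) := by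
    rw [h2]
    simp [← map_sub, real_inner_self_eq_norm_sq]
  rw [h0] at h3
  have h4 : ‖L y - L w‖ ^ 2 = 0 := by
    have : (0 : ℝ) = -(2 * ‖L y - L w‖ ^ 2) := h3
    linarith
  have h5 : L y - L w = 0 := norm_eq_zero.1 (pow_eq_zero_iff two_ne_zero |>.1 h4)
  exact hy (L.injective (sub_eq_zero.1 h5))

/-- A bump function on a ball whose Laplacian is positive outside of a given smaller concentric
ball: the function `exp (-μ / (R² - |y - w|²))` with `μ` large. -/
theorem exists_bump {T : Set V} (hT : IsOpen T) (hG : ContDiffOn ℝ ∞ G T)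
    (hpos : ∀ y ∈ T, ∀ β : V →L[ℝ] ℝ, β ≠ 0 → 0 < β (G y β)) {w : V} {ρ R : ℝ} (hρ : 0 < ρ)
    (hR : 0 < R) (hsub : Euclidean.closedBall w R ⊆ T) :
    ∃ u : V → ℝ, ContDiff ℝ ∞ u ∧ (∀ y, 0 ≤ u y) ∧ (∀ y, y ∉ Euclidean.ball w R → u y = 0) ∧
      (∀ y ∈ Euclidean.ball w R, y ∉ Euclidean.ball w ρ → 0 < lapl G u y) ∧
      ∀ y ∈ T, y ∉ Euclidean.ball w R → lapl G u y = 0 := by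
  obtain ⟨L, hL⟩ : ∃ L : V ≃L[ℝ] EuclideanSpace ℝ (Fin (finrank ℝ V)), L = toEuclidean :=
    ⟨_, rfl⟩
  set s : V → ℝ := fun y => R ^ 2 - ‖L y - L w‖ ^ 2 with hs
  have hsc : ContDiff ℝ ∞ s :=
    contDiff_const.sub ((L.contDiff.sub contDiff_const).norm_sq ℝ)
  have hdist : ∀ y, Euclidean.dist y w = ‖L y - L w‖ := fun y => by
    rw [hL]; exact dist_eq_norm _ _
  have hds : ∀ y, y ≠ w → fderiv ℝ s y ≠ 0 := fun y hy => fderiv_sub_norm_sq_ne_zero L hy _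
  set K : Set V := Euclidean.closedBall w R \ Euclidean.ball w ρ
  have hK : IsCompact K := Euclidean.isCompact_closedBall.diff Euclidean.isOpen_ball
  have hKT : K ⊆ T := fun y hy => hsub hy.1
  set mm : V → ℝ := fun y => fderiv ℝ s y (G y (fderiv ℝ s y)) with hmm
  have hmpos : ∀ y ∈ K, 0 < mm y := fun y hy => by
    refine hpos y (hKT hy) _ (hds y ?_)
    rintro rfl
    exact hy.2 (Euclidean.mem_ball_self hρ)
  have hdsc : ContDiff ℝ ∞ (fderiv ℝ s) := hsc.fderiv_right infty_add_one.le
  have hmc : ContinuousOn mm T := (hdsc.contDiffOn.clm_apply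
    (hG.clm_apply hdsc.contDiffOn)).continuousOn
  have hlc : ContinuousOn (lapl G s) T := (contDiffOn_lapl hT hG hsc.contDiffOn).continuousOn
  -- on the annulus `K` the first order term `ds (G ds)` controls the Laplacian of `s`
  obtain ⟨C, hC⟩ := hK.exists_bound_of_continuousOn (f := fun y => lapl G s y / mm y)
    ((hlc.mono hKT).div (hmc.mono hKT) fun y hy => (hmpos y hy).ne')
  -- the Laplacian of `exp (-μ / s)` is a positive multiple of `(μ - 2 s) ds (G ds) + s² Δs`, and
  -- `s ≤ R²`
  set μ : ℝ := 2 * R ^ 2 + |C| * R ^ 4 + 1 with hμ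
  have hμ0 : 0 < μ := by positivity
  set χ : ℝ → ℝ := fun t => expNegInvGlue (t / μ) with hχ
  set χ₁ : ℝ → ℝ := fun t => ((t / μ)⁻¹ ^ 2 * expNegInvGlue (t / μ)) * μ⁻¹ with hχ₁
  have hdiv : ∀ t : ℝ, HasDerivAt (fun t => t / μ) μ⁻¹ t := fun t => by
    have := (hasDerivAt_id t).div_const μ
    simpa using this
  have hd1 : ∀ t, HasDerivAt χ (χ₁ t) t := fun t =>
    HasDerivAt.comp (h₂ := expNegInvGlue) t (hasDerivAt_expNegInvGlue (t / μ)) (hdiv t)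
  have hd2 : ∀ t, HasDerivAt χ₁ (((t / μ)⁻¹ ^ 2 * ((t / μ)⁻¹ ^ 2 - 2 * (t / μ)⁻¹)
      * expNegInvGlue (t / μ)) * μ⁻¹ * μ⁻¹) t := fun t =>
    (HasDerivAt.comp (h₂ := fun t => (t⁻¹) ^ 2 * expNegInvGlue t) t
      (hasDerivAt_expNegInvGlue' (t / μ)) (hdiv t)).mul_const μ⁻¹
  have hlapl : ∀ y ∈ T, lapl G (fun z => χ (s z)) y
      = (((s y / μ)⁻¹ ^ 2 * ((s y / μ)⁻¹ ^ 2 - 2 * (s y / μ)⁻¹)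
      * expNegInvGlue (s y / μ)) * μ⁻¹ * μ⁻¹) * mm y + χ₁ (s y) * lapl G s y := fun y hy =>
    lapl_comp ((hG.contDiffAt (hT.mem_nhds hy)).differentiableAt infty_ne_zero)
      hsc.contDiffAt hd1 (hd2 (s y))
  have hout : ∀ y, y ∉ Euclidean.ball w R → s y ≤ 0 := fun y hy => by
    have h1 : R ≤ ‖L y - L w‖ := by rw [← hdist]; exact not_lt.1 hy
    have : R ^ 2 ≤ ‖L y - L w‖ ^ 2 := by gcongr
    rw [hs]; linarith
  have hout' : ∀ y, y ∉ Euclidean.ball w R → expNegInvGlue (s y / μ) = 0 := fun y hy =>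
    expNegInvGlue.zero_of_nonpos (div_nonpos_of_nonpos_of_nonneg (hout y hy) hμ0.le)
  refine ⟨fun z => χ (s z), ?_, fun y => expNegInvGlue.nonneg _, hout', fun y hy hy' => ?_,
    fun y hy hy' => ?_⟩
  · exact expNegInvGlue.contDiff.comp (hsc.div_const μ)
  · have hyK : y ∈ K := ⟨Euclidean.ball_subset_closedBall hy, hy'⟩
    rw [hlapl y (hKT hyK)]
    have hs0 : 0 < s y := by
      have h1 : ‖L y - L w‖ < R := by rw [← hdist]; exact hy
      have : ‖L y - L w‖ ^ 2 < R ^ 2 := by gcongr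
      rw [hs]; linarith
    have hsR : s y ≤ R ^ 2 := by
      rw [hs]; have := sq_nonneg ‖L y - L w‖; linarith
    have hE := expNegInvGlue.pos_of_pos (div_pos hs0 hμ0)
    have h2 : (((s y / μ)⁻¹ ^ 2 * ((s y / μ)⁻¹ ^ 2 - 2 * (s y / μ)⁻¹)
        * expNegInvGlue (s y / μ)) * μ⁻¹ * μ⁻¹) * mm y + χ₁ (s y) * lapl G s y
        = (s y / μ)⁻¹ ^ 2 * expNegInvGlue (s y / μ) * μ⁻¹ / s y ^ 2
          * ((μ - 2 * s y) * mm y + s y ^ 2 * lapl G s y) := by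
      rw [hχ₁]; field_simp
    rw [h2]
    refine mul_pos (by positivity) ?_
    have h3 := hC y hyK
    rw [Real.norm_eq_abs, abs_div, abs_of_pos (hmpos y hyK), div_le_iff₀ (hmpos y hyK)] at h3
    have h4 : -(|C| * mm y) ≤ lapl G s y := by
      have h5 := neg_abs_le (lapl G s y)
      have h6 := mul_le_mul_of_nonneg_right (le_abs_self C) (hmpos y hyK).le
      linarith
    have h7 : s y ^ 2 ≤ R ^ 4 := by
      have : s y ^ 2 ≤ (R ^ 2) ^ 2 := by gcongr
      calc s y ^ 2 ≤ (R ^ 2) ^ 2 := this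
        _ = R ^ 4 := by ring
    have h8 : s y ^ 2 * -(|C| * mm y) ≤ s y ^ 2 * lapl G s y :=
      mul_le_mul_of_nonneg_left h4 (sq_nonneg _)
    have h9 : 0 < (μ - 2 * s y - s y ^ 2 * |C|) * mm y := by
      refine mul_pos ?_ (hmpos y hyK)
      have := mul_le_mul_of_nonneg_right h7 (abs_nonneg C)
      rw [hμ]; linarith
    linarith
  · rw [hlapl y hy, hout' y hy', hχ₁]
    simp only [hout' y hy']
    ring

end Laplacian

/-! ### Strict subsolutions on compact manifolds -/
section Positive

variable {V : Type*} [NormedAddCommGroup V] [NormedSpace ℝ V]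
  {P : Type*} [TopologicalSpace P] [ChartedSpace V P]

variable (V) in
/-- The local expressions of a function. -/
def loc (g : P → ℝ) (x₀ : P) (y : V) : ℝ := g ((chartAt V x₀).symm y)

theorem isFun_loc (g : P → ℝ) : IsFun (loc V g) := fun x₀ x₁ y hy => by
  rw [loc, loc, chartAt_symm_coordCh hy]

variable [FiniteDimensional ℝ V]

/-- The operator `g ↦ div (T dg) + 2 e g`, which sends functions to densities. -/
def schr (T : P → V → (V →L[ℝ] ℝ) →L[ℝ] V) (e : P → V → ℝ) (g : P → ℝ) (x₀ : P) (y : V) : ℝ :=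
  lapl (T x₀) (loc V g x₀) y + 2 * e x₀ y * loc V g x₀ y

variable {T : P → V → (V →L[ℝ] ℝ) →L[ℝ] V} {e : P → V → ℝ} {g g' : P → ℝ}

variable [IsManifold 𝓘(ℝ, V) ∞ P]

theorem SmoothFam.lapl {u : P → V → ℝ} (hT : SmoothFam T) (hu : SmoothFam u) :
    SmoothFam fun x₀ y => lapl (T x₀) (u x₀) y := fun x₀ =>
  contDiffOn_lapl (chartAt V x₀).open_target (hT x₀) (hu x₀)

theorem smoothFam_schr (hT : SmoothFam T) (he : SmoothFam e) (hg : SmoothFam (loc V g)) :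
    SmoothFam (schr T e g) := fun x₀ =>
  (hT.lapl hg x₀).add ((contDiffOn_const.mul (he x₀)).mul (hg x₀))

theorem isDens_schr (hT : IsCoDens T) (hTs : SmoothFam T) (he : IsDens e)
    (hg : SmoothFam (loc V g)) : IsDens (schr T e g) := fun x₀ x₁ y hy => by
  have h1 : lapl (T x₀) (loc V g x₀) y = _ :=
    (hT.grad (isFun_loc g) hg).divg (hTs.grad hg) x₀ x₁ y hy
  rw [schr, h1, he x₀ x₁ y hy, isFun_loc g x₀ x₁ y hy, schr, lapl]
  ring

theorem schr_add_const_mul (hT : SmoothFam T) (hg : SmoothFam (loc V g))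
    (hg' : SmoothFam (loc V g')) (c : ℝ) {x₀ : P} {y : V} (hy : y ∈ (chartAt V x₀).target) :
    schr T e (fun p => g p + c * g' p) x₀ y = schr T e g x₀ y + c * schr T e g' x₀ y := by
  have h := lapl_add_const_mul (hT.differentiableAt hy) (hg.contDiffAt hy) (hg'.contDiffAt hy) c
  have h2 : lapl (T x₀) (loc V (fun p => g p + c * g' p) x₀) y = _ := h
  rw [schr, h2, schr, schr, loc, loc, loc]
  ring

theorem IsDens.pos_iff {s : P → V → ℝ} (hs : IsDens s) {x₀ x₁ : P} {y : V}
    (hy : y ∈ coordDom V x₀ x₁) : 0 < s x₀ y ↔ 0 < s x₁ (coordCh V x₀ x₁ y) := by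
  rw [hs x₀ x₁ y hy]
  exact mul_pos_iff_of_pos_left (abs_cdet_jac_pos hy)

theorem IsDens.nonneg_iff {s : P → V → ℝ} (hs : IsDens s) {x₀ x₁ : P} {y : V}
    (hy : y ∈ coordDom V x₀ x₁) : 0 ≤ s x₀ y ↔ 0 ≤ s x₁ (coordCh V x₀ x₁ y) := by
  rw [hs x₀ x₁ y hy]
  exact mul_nonneg_iff_of_pos_left (abs_cdet_jac_pos hy)

theorem IsDens.pos_center_iff {s : P → V → ℝ} (hs : IsDens s) {x₀ x : P}
    (hx : x ∈ (chartAt V x₀).source) :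
    0 < s x (chartAt V x x) ↔ 0 < s x₀ (chartAt V x₀ x) := by
  have h : chartAt V x x ∈ coordDom V x x₀ := by
    refine mem_coordDom.2 ⟨mem_chart_target V x, ?_⟩
    rwa [(chartAt V x).left_inv (mem_chart_source V x)]
  rw [hs.pos_iff h, coordCh, (chartAt V x).left_inv (mem_chart_source V x)]

theorem IsDens.isOpen_pos {s : P → V → ℝ} (hs : IsDens s) (hss : SmoothFam s) :
    IsOpen {x | 0 < s x (chartAt V x x)} := by
  refine isOpen_iff_mem_nhds.2 fun x hx => ?_
  have h1 : IsOpen ((chartAt V x).source ∩ chartAt V x ⁻¹' ((chartAt V x).target ∩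
      s x ⁻¹' Ioi 0)) :=
    (chartAt V x).isOpen_inter_preimage
      ((hss x).continuousOn.isOpen_inter_preimage (chartAt V x).open_target isOpen_Ioi)
  refine Filter.mem_of_superset (h1.mem_nhds ⟨mem_chart_source V x, mem_chart_target V x, hx⟩) ?_
  exact fun z hz => (hs.pos_center_iff hz.1).2 hz.2.2

open Classical in
/-- Extension by zero of a function on a chart. -/
def extZero (x₀ : P) (u : V → ℝ) (p : P) : ℝ :=
  if p ∈ (chartAt V x₀).source then u (chartAt V x₀ p) else 0

theorem loc_extZero {x₀ : P} {u : V → ℝ} {y : V} (hy : y ∈ (chartAt V x₀).target) :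
    loc V (extZero x₀ u) x₀ y = u y := by
  rw [loc, extZero, if_pos ((chartAt V x₀).map_target hy), (chartAt V x₀).right_inv hy]

variable [T2Space P]

theorem eventually_loc_extZero_eq_zero {x₀ : P} {u : V → ℝ} {K : Set V} (hK : IsCompact K)
    (hKT : K ⊆ (chartAt V x₀).target) (hu : ∀ y, y ∉ K → u y = 0) {x₁ : P} {y : V}
    (hy : y ∈ (chartAt V x₁).target) (hy' : (chartAt V x₁).symm y ∉ (chartAt V x₀).source) :
    loc V (extZero x₀ u) x₁ =ᶠ[nhds y] fun _ => 0 := by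
  have hc : IsClosed ((chartAt V x₀).symm '' K) :=
    (hK.image_of_continuousOn ((chartAt V x₀).continuousOn_symm.mono hKT)).isClosed
  have h1 : (chartAt V x₁).symm y ∈ ((chartAt V x₀).symm '' K)ᶜ := by
    rintro ⟨z, hz, hzy⟩
    exact hy' (hzy ▸ (chartAt V x₀).map_target (hKT hz))
  have h2 : ContinuousAt (chartAt V x₁).symm y := (chartAt V x₁).continuousAt_symm hy
  filter_upwards [h2.preimage_mem_nhds (hc.isOpen_compl.mem_nhds h1)] with z hz
  rw [loc, extZero]
  split_ifs with hs
  · refine hu _ fun hzK => hz ⟨_, hzK, (chartAt V x₀).left_inv hs⟩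
  · rfl

theorem smoothFam_extZero {x₀ : P} {u : V → ℝ} (huc : ContDiff ℝ ∞ u) {K : Set V}
    (hK : IsCompact K) (hKT : K ⊆ (chartAt V x₀).target) (hu : ∀ y, y ∉ K → u y = 0) :
    SmoothFam (loc V (extZero x₀ u)) := fun x₁ y hy => by
  refine ContDiffAt.contDiffWithinAt ?_
  by_cases hy' : (chartAt V x₁).symm y ∈ (chartAt V x₀).source
  · have hm : y ∈ coordDom V x₁ x₀ := mem_coordDom.2 ⟨hy, hy'⟩
    refine (huc.contDiffAt.comp y (contDiffAt_coordCh hm)).congr_of_eventuallyEq ?_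
    filter_upwards [(isOpen_coordDom x₁ x₀).mem_nhds hm] with z hz
    rw [loc, extZero, if_pos (mem_coordDom.1 hz).2]; rfl
  · exact contDiffAt_const.congr_of_eventuallyEq
      (eventually_loc_extZero_eq_zero hK hKT hu hy hy')

/-- The set of points at which some subsolution is strict is closed: a bump function centred at a
nearby point of the set has positive Laplacian away from a small ball, and on that ball its
Laplacian is compensated by a multiple of a subsolution that is strict there. -/
theorem isClosed_strict (hT : IsCoDens T) (hTs : SmoothFam T)
    (hpos : ∀ x₀, ∀ y ∈ (chartAt V x₀).target, ∀ β : V →L[ℝ] ℝ, β ≠ 0 → 0 < β (T x₀ y β))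
    (he : IsDens e) (hes : SmoothFam e) (he0 : ∀ x₀, ∀ y ∈ (chartAt V x₀).target, 0 ≤ e x₀ y) :
    IsClosed {p : P | ∃ g : P → ℝ, SmoothFam (loc V g) ∧
      (∀ x₀, ∀ y ∈ (chartAt V x₀).target, 0 ≤ schr T e g x₀ y) ∧
      0 < schr T e g p (chartAt V p p)} := by
  refine isClosed_of_closure_subset fun p₀ hp₀ => ?_
  set φ := chartAt V p₀
  obtain ⟨R₀, hR₀, hsub₀⟩ := Euclidean.nhds_basis_closedBall.mem_iff.1
    (φ.open_target.mem_nhds (mem_chart_target V p₀))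
  set R := R₀ / 3 with hR
  have hRpos : 0 < R := by positivity
  have hop : IsOpen (φ.source ∩ φ ⁻¹' Euclidean.ball (φ p₀) R) :=
    φ.isOpen_inter_preimage Euclidean.isOpen_ball
  have hmem : p₀ ∈ φ.source ∩ φ ⁻¹' Euclidean.ball (φ p₀) R :=
    mem_inter (mem_chart_source V p₀) (mem_preimage.2 (Euclidean.mem_ball_self hRpos))
  -- a point `p₁` of the set at distance less than `R` from `p₀`, so that the ball of radius `2 R`
  -- around `p₁` contains `p₀` and stays inside the chart
  obtain ⟨p₁, hp₁, hp₁W⟩ := mem_closure_iff.1 hp₀ _ hop hmem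
  have hp₁s : p₁ ∈ φ.source := hp₁.1
  have hp₁b : φ p₁ ∈ Euclidean.ball (φ p₀) R := hp₁.2
  rw [mem_setOf_eq] at hp₁W
  obtain ⟨g₁, hg₁, hg₁0, hg₁p⟩ := hp₁W
  set w := φ p₁ with hw
  have hd : ∀ a b c : V, Euclidean.dist a c ≤ Euclidean.dist a b + Euclidean.dist b c :=
    fun a b c => dist_triangle _ _ _
  have hsub : Euclidean.closedBall w (2 * R) ⊆ φ.target := fun y hy => hsub₀ <| by
    have h1 : Euclidean.dist y w ≤ 2 * R := hy
    have h2 : Euclidean.dist w (φ p₀) < R := hp₁b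
    have h3 := hd y w (φ p₀)
    change Euclidean.dist y (φ p₀) ≤ R₀
    linarith
  have hds := isDens_schr hT hTs he hg₁
  have hss := smoothFam_schr hTs hes hg₁
  have hwpos : 0 < schr T e g₁ p₀ w := (hds.pos_center_iff hp₁s).1 hg₁p
  have hwt : w ∈ φ.target := φ.map_source hp₁s
  have hev : {y | 0 < schr T e g₁ p₀ y} ∈ nhds w :=
    (hss.contDiffAt hwt).continuousAt.preimage_mem_nhds (isOpen_Ioi.mem_nhds hwpos)
  obtain ⟨ρ, hρ, hρs⟩ := Euclidean.nhds_basis_closedBall.mem_iff.1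
    (Filter.inter_mem (φ.open_target.mem_nhds hwt) hev)
  obtain ⟨u, huc, hu0, huz, hu1, hu2⟩ := exists_bump φ.open_target (hTs p₀) (hpos p₀) hρ
    (by positivity : 0 < 2 * R) hsub
  have hKc : IsCompact (Euclidean.closedBall w (2 * R)) := Euclidean.isCompact_closedBall
  have hus : ∀ y, y ∉ Euclidean.closedBall w (2 * R) → u y = 0 := fun y hy =>
    huz y fun h => hy (Euclidean.ball_subset_closedBall h)
  have hû := smoothFam_extZero huc hKc hsub hus
  set û : P → ℝ := extZero p₀ u
  have hloc : ∀ y ∈ φ.target, schr T e û p₀ y = lapl (T p₀) u y + 2 * e p₀ y * u y := by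
    intro y hy
    have h1 : loc V û p₀ =ᶠ[nhds y] u := by
      filter_upwards [φ.open_target.mem_nhds hy] with z hz using loc_extZero hz
    rw [schr, lapl_congr h1, h1.eq_of_nhds]
  obtain ⟨C, hC⟩ := (Euclidean.isCompact_closedBall (x := w) (r := ρ)).exists_bound_of_continuousOn
    (f := fun y => schr T e û p₀ y / schr T e g₁ p₀ y)
    (((smoothFam_schr hTs hes hû p₀).continuousOn.mono fun y hy => (hρs hy).1).div
      ((hss p₀).continuousOn.mono fun y hy => (hρs hy).1) fun y hy => (hρs hy).2.ne')
  -- with this constant, `c g₁` outweighs the possibly negative contribution of the bump function on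
  -- the small ball
  set c : ℝ := |C| + 1 with hc
  have hc0 : 0 < c := by positivity
  set g : P → ℝ := fun p => û p + c * g₁ p with hg
  have hgs : SmoothFam (loc V g) := fun x₀ => (hû x₀).add (contDiffOn_const.mul (hg₁ x₀))
  have hgd := isDens_schr hT hTs he hgs
  have hadd : ∀ x₀, ∀ y ∈ (chartAt V x₀).target,
      schr T e g x₀ y = schr T e û x₀ y + c * schr T e g₁ x₀ y := fun x₀ y hy =>
    schr_add_const_mul hTs hû hg₁ c hy
  have hball : ∀ y ∈ Euclidean.ball w (2 * R), 0 < schr T e g p₀ y := fun y hy => by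
    have hyt := hsub (Euclidean.ball_subset_closedBall hy)
    rw [hadd p₀ y hyt]
    have h1 := mul_nonneg hc0.le (hg₁0 p₀ y hyt)
    by_cases hyρ : y ∈ Euclidean.ball w ρ
    · have hy2 := Euclidean.ball_subset_closedBall hyρ
      have h2 : 0 < schr T e g₁ p₀ y := (hρs hy2).2
      have h3 := hC y hy2
      rw [Real.norm_eq_abs, abs_div, abs_of_pos h2, div_le_iff₀ h2] at h3
      have h4 := neg_abs_le (schr T e û p₀ y)
      have h5 := mul_le_mul_of_nonneg_right (le_abs_self C) h2.le
      rw [hc]; linarith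
    · rw [hloc y hyt]
      have h2 := hu1 y hy hyρ
      have h3 := mul_nonneg (mul_nonneg zero_le_two (he0 p₀ y hyt)) (hu0 y)
      linarith
  have hnn : ∀ y ∈ φ.target, 0 ≤ schr T e g p₀ y := fun y hy => by
    by_cases hyb : y ∈ Euclidean.ball w (2 * R)
    · exact (hball y hyb).le
    · rw [hadd p₀ y hy, hloc y hy, hu2 y hy hyb, huz y hyb]
      have := mul_nonneg hc0.le (hg₁0 p₀ y hy)
      linarith
  refine ⟨g, hgs, fun x₀ y hy => ?_, hball _ ?_⟩
  · by_cases hy' : (chartAt V x₀).symm y ∈ φ.source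
    · have hm : y ∈ coordDom V x₀ p₀ := mem_coordDom.2 ⟨hy, hy'⟩
      exact (hgd.nonneg_iff hm).2 (hnn _ (coordCh_mem_target hm))
    · have h1 := eventually_loc_extZero_eq_zero hKc hsub hus hy hy'
      have h2 : schr T e û x₀ y = 0 := by
        rw [schr, lapl_congr h1, lapl_const, h1.eq_of_nhds]; ring
      rw [hadd x₀ y hy, h2, zero_add]
      exact mul_nonneg hc0.le (hg₁0 x₀ y hy)
  · change Euclidean.dist (φ p₀) w < 2 * R
    have h2 : Euclidean.dist w (φ p₀) < R := hp₁b
    have h3 : Euclidean.dist (φ p₀) w = Euclidean.dist w (φ p₀) := dist_comm _ _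
    linarith

/-- If a nonnegative potential `e` is not identically zero on any component, then the operator
`g ↦ div (T dg) + 2 e g` has a strict subsolution. The points at which some subsolution is strict
form a clopen set, and finitely many subsolutions can be added up. -/
theorem exists_schr_pos [CompactSpace P] (hT : IsCoDens T) (hTs : SmoothFam T)
    (hpos : ∀ x₀, ∀ y ∈ (chartAt V x₀).target, ∀ β : V →L[ℝ] ℝ, β ≠ 0 → 0 < β (T x₀ y β))
    (he : IsDens e) (hes : SmoothFam e) (he0 : ∀ x₀, ∀ y ∈ (chartAt V x₀).target, 0 ≤ e x₀ y)
    (hclopen : ∀ W : Set P, IsClopen W → (∀ x, 0 < e x (chartAt V x x) → x ∈ W) → W = univ) :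
    ∃ f : P → ℝ, SmoothFam (loc V f) ∧
      ∀ x₀, ∀ y ∈ (chartAt V x₀).target, 0 < schr T e f x₀ y := by
  set W : Set P := {p : P | ∃ g : P → ℝ, SmoothFam (loc V g) ∧
      (∀ x₀, ∀ y ∈ (chartAt V x₀).target, 0 ≤ schr T e g x₀ y) ∧
      0 < schr T e g p (chartAt V p p)} with hW
  have hconst : ∀ c : ℝ, SmoothFam (loc V fun _ : P => c) := fun c x₀ => contDiffOn_const
  have hschr : ∀ (c : ℝ) x₀ y, schr T e (fun _ => c) x₀ y = 2 * e x₀ y * c := fun c x₀ y => by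
    have h1 : lapl (T x₀) (loc V (fun _ : P => c) x₀) y = 0 := lapl_const c
    rw [schr, h1, zero_add]; rfl
  have hopen : ∀ p ∈ W, ∃ g : P → ℝ, SmoothFam (loc V g) ∧
      (∀ x₀, ∀ y ∈ (chartAt V x₀).target, 0 ≤ schr T e g x₀ y) ∧
      {x | 0 < schr T e g x (chartAt V x x)} ∈ nhds p := by
    rintro p ⟨g, hg, hg0, hgp⟩
    exact ⟨g, hg, hg0, ((isDens_schr hT hTs he hg).isOpen_pos
      (smoothFam_schr hTs hes hg)).mem_nhds hgp⟩
  have huniv : W = univ := by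
    refine hclopen W ⟨isClosed_strict hT hTs hpos he hes he0, ?_⟩ fun x hx => ?_
    · refine isOpen_iff_mem_nhds.2 fun p hp => ?_
      obtain ⟨g, hg, hg0, hgn⟩ := hopen p hp
      exact Filter.mem_of_superset hgn fun z hz => ⟨g, hg, hg0, hz⟩
    -- constants are subsolutions, strict where `e` is positive
    · refine ⟨fun _ => 1, hconst 1, fun x₀ y hy => ?_, ?_⟩
      · rw [hschr]; have := he0 x₀ y hy; linarith
      · rw [hschr]; linarith
  obtain ⟨f, hf, hf0, hfp⟩ := isCompact_univ.induction_on (X := P)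
    (p := fun s => ∃ g : P → ℝ, SmoothFam (loc V g) ∧
      (∀ x₀, ∀ y ∈ (chartAt V x₀).target, 0 ≤ schr T e g x₀ y) ∧
      ∀ x ∈ s, 0 < schr T e g x (chartAt V x x))
    ⟨fun _ => 0, hconst 0, fun x₀ y _ => by rw [hschr, mul_zero], fun x hx => hx.elim⟩
    (fun s t hst ⟨g, h1, h2, h3⟩ => ⟨g, h1, h2, fun x hx => h3 x (hst hx)⟩)
    (fun s t ⟨g, h1, h2, h3⟩ ⟨g', h1', h2', h3'⟩ => by
      have hadd : ∀ x₀, ∀ y ∈ (chartAt V x₀).target,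
          schr T e (fun p => g p + 1 * g' p) x₀ y = schr T e g x₀ y + 1 * schr T e g' x₀ y :=
        fun x₀ y hy => schr_add_const_mul hTs h1 h1' 1 hy
      refine ⟨fun p => g p + 1 * g' p, fun x₀ => (h1 x₀).add (contDiffOn_const.mul (h1' x₀)),
        fun x₀ y hy => ?_, fun x hx => ?_⟩
      · rw [hadd x₀ y hy, one_mul]; exact add_nonneg (h2 _ _ hy) (h2' _ _ hy)
      · have hx0 := mem_chart_target V x
        rw [hadd x _ hx0, one_mul]
        rcases hx with hx | hx
        · exact add_pos_of_pos_of_nonneg (h3 x hx) (h2' _ _ hx0)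
        · exact add_pos_of_nonneg_of_pos (h2 _ _ hx0) (h3' x hx))
    (fun x _ => by
      obtain ⟨g, hg, hg0, hgn⟩ := hopen x (huniv ▸ mem_univ x)
      exact ⟨_, mem_nhdsWithin_of_mem_nhds hgn, g, hg, hg0, fun z hz => hz⟩)
  refine ⟨f, hf, fun x₀ y hy => ?_⟩
  have := ((isDens_schr hT hTs he hf).pos_center_iff ((chartAt V x₀).map_target hy)).1
    (hfp _ (mem_univ _))
  rwa [(chartAt V x₀).right_inv hy] at this

end Positive

/-! ### The map to the sphere defined by a map to the projective line -/

section Sphere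

/-- The numerators of `sphereVec`, as real polynomials. -/
def sphNum (Z : Fin 2 → ℂ) : Fin 3 → ℝ :=
  ![((Z 1).re ^ 2 + (Z 1).im ^ 2) - ((Z 0).re ^ 2 + (Z 0).im ^ 2),
    2 * ((Z 0).re * (Z 1).re + (Z 0).im * (Z 1).im),
    2 * ((Z 0).im * (Z 1).re - (Z 0).re * (Z 1).im)]

/-- The common denominator of `sphereVec`, as a real polynomial. -/
def sphDen (Z : Fin 2 → ℂ) : ℝ :=
  (Z 0).re ^ 2 + (Z 0).im ^ 2 + ((Z 1).re ^ 2 + (Z 1).im ^ 2)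

theorem sphereVec_eq (Z : Fin 2 → ℂ) (l : Fin 3) : sphereVec Z l = sphNum Z l / sphDen Z := by
  have h : ∀ z : ℂ, ‖z‖ ^ 2 = z.re ^ 2 + z.im ^ 2 := fun z => by
    rw [← Complex.normSq_eq_norm_sq, Complex.normSq_apply]; ring
  fin_cases l <;> simp [sphereVec, sphNum, sphDen, h] <;> ring

theorem sphDen_pos {Z : Fin 2 → ℂ} (hZ : Z ≠ 0) : 0 < sphDen Z := by
  by_contra h
  apply hZ
  have h0 : sphDen Z = 0 := le_antisymm (not_lt.1 h) (by unfold sphDen; positivity)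
  unfold sphDen at h0
  have h1 := sq_nonneg (Z 0).re
  have h2 := sq_nonneg (Z 0).im
  have h3 := sq_nonneg (Z 1).re
  have h4 := sq_nonneg (Z 1).im
  have e1 : (Z 0).re = 0 := pow_eq_zero_iff two_ne_zero |>.1 (by linarith)
  have e2 : (Z 0).im = 0 := pow_eq_zero_iff two_ne_zero |>.1 (by linarith)
  have e3 : (Z 1).re = 0 := pow_eq_zero_iff two_ne_zero |>.1 (by linarith)
  have e4 : (Z 1).im = 0 := pow_eq_zero_iff two_ne_zero |>.1 (by linarith)
  ext k
  fin_cases k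
  · exact Complex.ext e1 e2
  · exact Complex.ext e3 e4

theorem sphereVec_mul_sphDen {Z : Fin 2 → ℂ} (hZ : Z ≠ 0) (l : Fin 3) :
    sphereVec Z l * sphDen Z = sphNum Z l := by
  rw [sphereVec_eq, div_mul_cancel₀ _ (sphDen_pos hZ).ne']

theorem sum_sphereVec_sq {Z : Fin 2 → ℂ} (hZ : Z ≠ 0) : ∑ l, sphereVec Z l ^ 2 = 1 := by
  have h := (sphDen_pos hZ).ne'
  have h2 : ∑ l, sphNum Z l ^ 2 = sphDen Z ^ 2 := by
    rw [Fin.sum_univ_three]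
    simp only [sphNum, sphDen, Matrix.cons_val]
    ring
  simp only [sphereVec_eq, div_pow]
  rw [← Finset.sum_div, h2, div_self (pow_ne_zero 2 h)]

theorem contDiff_re_im (k : Fin 2) : ContDiff ℝ ∞ (fun Z : Fin 2 → ℂ => (Z k).re) ∧
    ContDiff ℝ ∞ (fun Z : Fin 2 → ℂ => (Z k).im) :=
  ⟨Complex.reCLM.contDiff.comp (contDiff_apply ℝ ℂ k),
    Complex.imCLM.contDiff.comp (contDiff_apply ℝ ℂ k)⟩

theorem contDiff_sphDen : ContDiff ℝ ∞ sphDen :=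
  ((((contDiff_re_im 0).1.pow 2).add ((contDiff_re_im 0).2.pow 2)).add
    (((contDiff_re_im 1).1.pow 2).add ((contDiff_re_im 1).2.pow 2)))

theorem contDiff_sphNum (l : Fin 3) : ContDiff ℝ ∞ fun Z => sphNum Z l := by
  obtain ⟨hp, hq⟩ := contDiff_re_im 0
  obtain ⟨hr, hs⟩ := contDiff_re_im 1
  fin_cases l
  · exact ((hr.pow 2).add (hs.pow 2)).sub ((hp.pow 2).add (hq.pow 2))
  · exact contDiff_const.mul ((hp.mul hr).add (hq.mul hs))
  · exact contDiff_const.mul ((hq.mul hr).sub (hp.mul hs))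

theorem contDiffAt_sphereVec {Z : Fin 2 → ℂ} (hZ : Z ≠ 0) (l : Fin 3) :
    ContDiffAt ℝ ∞ (fun Z => sphereVec Z l) Z := by
  simp only [sphereVec_eq]
  exact (contDiff_sphNum l).contDiffAt.div contDiff_sphDen.contDiffAt (sphDen_pos hZ).ne'

variable {V : Type*} [NormedAddCommGroup V] [NormedSpace ℝ V]

/-- The Cauchy-Riemann equations for the composition of a holomorphic map with `sphereVec`: the
complex structure of the sphere is `v ↦ a × v` at the point `a`. -/
theorem fderiv_sphereVec_comp {Z : V → Fin 2 → ℂ} {Z' : V →L[ℝ] Fin 2 → ℂ} {y : V}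
    (hZ : HasFDerivAt Z Z' y) (hy : Z y ≠ 0) {J : V →L[ℝ] V}
    (hJ : ∀ v k, Z' (J v) k = Complex.I * Z' v k) (l : Fin 3) (v : V) :
    fderiv ℝ (fun z => sphereVec (Z z) l) y (J v)
      = sphereVec (Z y) (l + 1) * fderiv ℝ (fun z => sphereVec (Z z) (l + 2)) y v
        - sphereVec (Z y) (l + 2) * fderiv ℝ (fun z => sphereVec (Z z) (l + 1)) y v := by
  have hre : ∀ k, HasFDerivAt (fun z => (Z z k).re)
      ((Complex.reCLM.comp (ContinuousLinearMap.proj (R := ℝ) (φ := fun _ : Fin 2 => ℂ) k)).comp Z')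
      y := fun k =>
    (Complex.reCLM.comp (ContinuousLinearMap.proj (R := ℝ) (φ := fun _ : Fin 2 => ℂ)
      k)).hasFDerivAt.comp y hZ
  have him : ∀ k, HasFDerivAt (fun z => (Z z k).im)
      ((Complex.imCLM.comp (ContinuousLinearMap.proj (R := ℝ) (φ := fun _ : Fin 2 => ℂ) k)).comp Z')
      y := fun k =>
    (Complex.imCLM.comp (ContinuousLinearMap.proj (R := ℝ) (φ := fun _ : Fin 2 => ℂ)
      k)).hasFDerivAt.comp y hZ
  have hA : ∀ l, HasFDerivAt (fun z => sphereVec (Z z) l)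
      (fderiv ℝ (fun z => sphereVec (Z z) l) y) y := fun l => by
    have := (contDiffAt_sphereVec hy l).differentiableAt infty_ne_zero
    exact (DifferentiableAt.comp (g := fun Z => sphereVec Z l) y this
      hZ.differentiableAt).hasFDerivAt
  have hD := ((hre 0).mul (hre 0)).add ((him 0).mul (him 0)) |>.add
    (((hre 1).mul (hre 1)).add ((him 1).mul (him 1)))
  have hN0 := (((hre 1).mul (hre 1)).add ((him 1).mul (him 1))).sub
    (((hre 0).mul (hre 0)).add ((him 0).mul (him 0)))
  have hN1 := (((hre 0).mul (hre 1)).add ((him 0).mul (him 1))).const_mul 2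
  have hN2 := (((him 0).mul (hre 1)).sub ((hre 0).mul (him 1))).const_mul 2
  have hev : ∀ᶠ z in nhds y, Z z ≠ 0 := hZ.continuousAt.eventually_ne hy
  -- the derivative of `sphereVec` times the squared norm, by the quotient rule
  set p := (Z y 0).re
  set q := (Z y 0).im
  set r := (Z y 1).re
  set s := (Z y 1).im
  have key : ∀ w, (fderiv ℝ (fun z => sphereVec (Z z) 0) y w * sphDen (Z y)
      + sphereVec (Z y) 0 * (2 * (p * (Z' w 0).re + q * (Z' w 0).im + r * (Z' w 1).re
        + s * (Z' w 1).im))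
      = 2 * (r * (Z' w 1).re + s * (Z' w 1).im - p * (Z' w 0).re - q * (Z' w 0).im)) ∧
      (fderiv ℝ (fun z => sphereVec (Z z) 1) y w * sphDen (Z y)
      + sphereVec (Z y) 1 * (2 * (p * (Z' w 0).re + q * (Z' w 0).im + r * (Z' w 1).re
        + s * (Z' w 1).im))
      = 2 * (p * (Z' w 1).re + q * (Z' w 1).im + r * (Z' w 0).re + s * (Z' w 0).im)) ∧
      (fderiv ℝ (fun z => sphereVec (Z z) 2) y w * sphDen (Z y)
      + sphereVec (Z y) 2 * (2 * (p * (Z' w 0).re + q * (Z' w 0).im + r * (Z' w 1).re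
        + s * (Z' w 1).im))
      = 2 * (q * (Z' w 1).re + r * (Z' w 0).im - p * (Z' w 1).im - s * (Z' w 0).re)) := by
    intro w
    have hD' : HasFDerivAt (fun z => sphDen (Z z)) _ y :=
      hD.congr_of_eventuallyEq (Filter.Eventually.of_forall fun z => by
        simp only [sphDen, Pi.add_apply, Pi.mul_apply]; ring)
    refine ⟨?_, ?_, ?_⟩
    · have h1 : HasFDerivAt (fun z => sphereVec (Z z) 0 * sphDen (Z z)) _ y := (hA 0).mul hD'
      have h2 := hN0.congr_of_eventuallyEq (f₁ := fun z => sphereVec (Z z) 0 * sphDen (Z z)) (by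
        filter_upwards [hev] with z hz
        rw [sphereVec_mul_sphDen hz]
        simp only [sphNum, Matrix.cons_val, Pi.add_apply, Pi.mul_apply, Pi.sub_apply]; ring)
      have h3 := congrArg (fun t => t w) (h1.unique h2)
      simp at h3
      linarith
    · have h1 : HasFDerivAt (fun z => sphereVec (Z z) 1 * sphDen (Z z)) _ y := (hA 1).mul hD'
      have h2 := hN1.congr_of_eventuallyEq (f₁ := fun z => sphereVec (Z z) 1 * sphDen (Z z)) (by
        filter_upwards [hev] with z hz
        rw [sphereVec_mul_sphDen hz]
        simp only [sphNum, Matrix.cons_val, Pi.add_apply, Pi.mul_apply, Pi.sub_apply])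
      have h3 := congrArg (fun t => t w) (h1.unique h2)
      simp at h3
      linarith
    · have h1 : HasFDerivAt (fun z => sphereVec (Z z) 2 * sphDen (Z z)) _ y := (hA 2).mul hD'
      have h2 := hN2.congr_of_eventuallyEq (f₁ := fun z => sphereVec (Z z) 2 * sphDen (Z z)) (by
        filter_upwards [hev] with z hz
        rw [sphereVec_mul_sphDen hz]
        simp only [sphNum, Matrix.cons_val, Pi.add_apply, Pi.mul_apply, Pi.sub_apply])
      have h3 := congrArg (fun t => t w) (h1.unique h2)
      simp at h3
      linarith
  obtain ⟨k0, k1, k2⟩ := key v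
  obtain ⟨j0, j1, j2⟩ := key (J v)
  simp only [hJ, Complex.I_mul_re, Complex.I_mul_im] at j0 j1 j2
  have m0 := sphereVec_mul_sphDen hy 0
  have m1 := sphereVec_mul_sphDen hy 1
  have m2 := sphereVec_mul_sphDen hy 2
  have hN : sphDen (Z y) = p ^ 2 + q ^ 2 + (r ^ 2 + s ^ 2) := rfl
  have e0 : sphNum (Z y) 0 = (r ^ 2 + s ^ 2) - (p ^ 2 + q ^ 2) := rfl
  have e1 : sphNum (Z y) 1 = 2 * (p * r + q * s) := rfl
  have e2 : sphNum (Z y) 2 = 2 * (q * r - p * s) := rfl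
  have hpos := sphDen_pos hy
  rw [e0] at m0
  rw [e1] at m1
  rw [e2] at m2
  have hN2 : sphDen (Z y) ^ 2 ≠ 0 := pow_ne_zero 2 hpos.ne'
  have hl : l = 0 ∨ l = 1 ∨ l = 2 := by fin_cases l <;> simp
  have c01 : (0 : Fin 3) + 1 = 1 := rfl
  have c02 : (0 : Fin 3) + 2 = 2 := rfl
  have c11 : (1 : Fin 3) + 1 = 2 := rfl
  have c12 : (1 : Fin 3) + 2 = 0 := rfl
  have c21 : (2 : Fin 3) + 1 = 0 := rfl
  have c22 : (2 : Fin 3) + 2 = 1 := rfl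
  refine mul_left_cancel₀ hN2 ?_
  set x0 := (Z' v 0).re
  set x1 := (Z' v 0).im
  set x2 := (Z' v 1).re
  set x3 := (Z' v 1).im
  rcases hl with rfl | rfl | rfl
  · rw [c01, c02]
    linear_combination (exp := 1) sphDen (Z y) * j0
      - m0 * (2 * (p * -x1 + q * x0 + r * -x3 + s * x2))
      - (sphDen (Z y) * sphereVec (Z y) 1 * k2 + m1 * (2 * (q * x2 + r * x1 - p * x3 - s * x0)))
      + (sphDen (Z y) * sphereVec (Z y) 2 * k1 + m2 * (2 * (p * x2 + q * x3 + r * x0 + s * x1)))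
      + (2 * (r * -x3 + s * x2 - p * -x1 - q * x0)) * hN
  · rw [c11, c12]
    linear_combination (exp := 1) sphDen (Z y) * j1
      - m1 * (2 * (p * -x1 + q * x0 + r * -x3 + s * x2))
      - (sphDen (Z y) * sphereVec (Z y) 2 * k0 + m2 * (2 * (r * x2 + s * x3 - p * x0 - q * x1)))
      + (sphDen (Z y) * sphereVec (Z y) 0 * k2 + m0 * (2 * (q * x2 + r * x1 - p * x3 - s * x0)))
      + (2 * (p * -x3 + q * x2 + r * -x1 + s * x0)) * hN
  · rw [c21, c22]
    linear_combination (exp := 1) sphDen (Z y) * j2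
      - m2 * (2 * (p * -x1 + q * x0 + r * -x3 + s * x2))
      - (sphDen (Z y) * sphereVec (Z y) 0 * k1 + m0 * (2 * (p * x2 + q * x3 + r * x0 + s * x1)))
      + (sphDen (Z y) * sphereVec (Z y) 1 * k0 + m1 * (2 * (r * x2 + s * x3 - p * x0 - q * x1)))
      + (2 * (q * -x3 + r * x0 - p * x2 - s * -x1)) * hN

end Sphere

/-! ### The complex manifold with a map to the projective line -/

section ProjLine

theorem toSphere_mk (Z : Fin 2 → ℂ) (hZ : Z ≠ 0) :
    toSphere (Projectivization.mk ℂ Z hZ) = sphereVec Z := rfl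

theorem sum_toSphere_sq (p : P1) : ∑ l, toSphere p l ^ 2 = 1 := by
  induction p using Projectivization.ind with
  | h Z hZ => rw [toSphere_mk]; exact sum_sphereVec_sq hZ

/-- The identification of the projective line with the sphere is injective. -/
theorem toSphere_injective : Function.Injective toSphere := by
  intro p p' h
  induction p using Projectivization.ind with
  | h Z hZ =>
  induction p' using Projectivization.ind with
  | h W hW =>
  rw [toSphere_mk, toSphere_mk] at h
  -- twice `|Z₀ W₁ - Z₁ W₀|²` is the product of the norms times one minus the inner product
  have h1 : 2 * Complex.normSq (Z 0 * W 1 - Z 1 * W 0)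
      = sphDen Z * sphDen W - ∑ l, sphNum Z l * sphNum W l := by
    rw [Fin.sum_univ_three]
    simp only [sphNum, sphDen, Matrix.cons_val, Complex.normSq_apply, Complex.sub_re,
      Complex.sub_im, Complex.mul_re, Complex.mul_im]
    ring
  have h2 : ∑ l, sphNum Z l * sphNum W l = sphDen Z * sphDen W := by
    have h3 : ∀ l, sphNum Z l * sphNum W l = sphereVec W l ^ 2 * (sphDen Z * sphDen W) := fun l => by
      rw [← sphereVec_mul_sphDen hZ, ← sphereVec_mul_sphDen hW, h]; ring
    simp only [h3]
    rw [← Finset.sum_mul, sum_sphereVec_sq hW, one_mul]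
  have h4 : Z 0 * W 1 - Z 1 * W 0 = 0 := Complex.normSq_eq_zero.1 (by linarith)
  have h5 : Z 0 * W 1 = Z 1 * W 0 := sub_eq_zero.1 h4
  refine (Projectivization.mk_eq_mk_iff' ℂ _ _ hZ hW).2 ?_
  by_cases h0 : W 0 = 0
  · have hW1 : W 1 ≠ 0 := fun hW1 => hW (by ext k; fin_cases k <;> assumption)
    refine ⟨Z 1 / W 1, ?_⟩
    have h6 : Z 0 = 0 := by simpa [h0, hW1] using h5
    ext k
    fin_cases k
    · simp [h0, h6]
    · simp [hW1]
  · refine ⟨Z 0 / W 0, ?_⟩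
    ext k
    fin_cases k
    · simp [h0]
    · change Z 0 / W 0 * W 1 = Z 1
      rw [div_mul_eq_mul_div, h5, mul_div_cancel_right₀ _ h0]

end ProjLine

section Base

variable {F : Type*} [NormedAddCommGroup F] [NormedSpace ℂ F]
  {Q : Type*} [TopologicalSpace Q] [ChartedSpace F Q] [IsManifold 𝓘(ℂ, F) ω Q]
  [IsManifold 𝓘(ℝ, F) ∞ Q]

theorem mulI_inChart {x₀ : Q} {y : F} (hy : y ∈ (chartAt F x₀).target) (v : F) :
    (mulI F Q).inChart x₀ y v = Complex.I • v := by
  have hm := mem_coordDom_self hy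
  refine jac_injective hm ?_
  refine ((mulI F Q).jac_inChart hy v).trans ?_
  exact (jac_smul_I hm v).symm

/-- Near every point, the map to the sphere is `sphereVec` of a holomorphic map. -/
theorem IsHolomorphicToP1.exists_lift [FiniteDimensional ℂ F] {h : Q → P1}
    (hh : IsHolomorphicToP1 F h) {x₀ : Q} {y : F} (hy : y ∈ (chartAt F x₀).target) :
    ∃ Z : F → Fin 2 → ℂ, ContDiffAt ℝ ∞ Z y ∧ Z y ≠ 0 ∧
      (∃ Z' : F →L[ℝ] Fin 2 → ℂ, HasFDerivAt Z Z' y ∧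
        ∀ v k, Z' (Complex.I • v) k = Complex.I * Z' v k) ∧
      ∀ᶠ z in nhds y, ∀ l, loc F (fun q => toSphere (h q) l) x₀ z = sphereVec (Z z) l := by
  obtain ⟨U, hU, hyU, f, hf, hfh⟩ := hh ((chartAt F x₀).symm y)
  set Ω : Set F := (chartAt F x₀).target ∩ (chartAt F x₀).symm ⁻¹' U with hΩ
  have hΩo : IsOpen Ω := (chartAt F x₀).isOpen_inter_preimage_symm hU
  have hyΩ : y ∈ Ω := ⟨hy, hyU⟩
  set Z : F → Fin 2 → ℂ := fun z => f ((chartAt F x₀).symm z) with hZ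
  have h1 : MDifferentiableOn 𝓘(ℂ, F) 𝓘(ℂ, F) (extChartAt 𝓘(ℂ, F) x₀).symm
      (extChartAt 𝓘(ℂ, F) x₀).target :=
    (contMDiffOn_extChartAt_symm (n := 1) x₀).mdifferentiableOn one_ne_zero
  have h2 : MDifferentiableOn 𝓘(ℂ, F) 𝓘(ℂ, Fin 2 → ℂ) Z Ω := by
    refine hf.comp (h1.mono fun z hz => ?_) fun z hz => hz.2
    simpa using hz.1
  have h3 : DifferentiableOn ℂ Z Ω := mdifferentiableOn_iff_differentiableOn.1 h2
  have h4 : ContDiffOn ℂ ∞ Z Ω := contDiffOn_pi.2 fun k =>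
    contDiffOn_of_differentiableOn_complex hΩo (differentiableOn_pi.1 h3 k)
  have h5 : DifferentiableAt ℂ Z y := h3.differentiableAt (hΩo.mem_nhds hyΩ)
  obtain ⟨h0, -⟩ := hfh _ hyU
  refine ⟨Z, (h4.restrict_scalars ℝ).contDiffAt (hΩo.mem_nhds hyΩ), h0,
    ⟨_, h5.hasFDerivAt.restrictScalars ℝ, fun v k => ?_⟩, ?_⟩
  · exact congrFun (map_smul (fderiv ℂ Z y) Complex.I v) k
  · filter_upwards [hΩo.mem_nhds hyΩ] with z hz l
    obtain ⟨hne, hz'⟩ := hfh _ hz.2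
    rw [loc, hz', toSphere_mk]

variable [FiniteDimensional ℂ F] {h : Q → P1}

theorem IsHolomorphicToP1.smoothFam (hh : IsHolomorphicToP1 F h) (l : Fin 3) :
    SmoothFam (loc F fun q => toSphere (h q) l) := fun x₀ y hy => by
  obtain ⟨Z, hZ, hZ0, -, hev⟩ := hh.exists_lift hy
  refine ContDiffAt.contDiffWithinAt ?_
  refine ((contDiffAt_sphereVec hZ0 l).comp y hZ).congr_of_eventuallyEq ?_
  filter_upwards [hev] with z hz using hz l

theorem IsHolomorphicToP1.fderiv_smul_I (hh : IsHolomorphicToP1 F h) {x₀ : Q} {y : F}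
    (hy : y ∈ (chartAt F x₀).target) (l : Fin 3) (v : F) :
    fderiv ℝ (loc F (fun q => toSphere (h q) l) x₀) y (Complex.I • v)
      = loc F (fun q => toSphere (h q) (l + 1)) x₀ y
          * fderiv ℝ (loc F (fun q => toSphere (h q) (l + 2)) x₀) y v
        - loc F (fun q => toSphere (h q) (l + 2)) x₀ y
          * fderiv ℝ (loc F (fun q => toSphere (h q) (l + 1)) x₀) y v := by
  obtain ⟨Z, hZ, hZ0, ⟨Z', hZ', hI⟩, hev⟩ := hh.exists_lift hy
  have h1 : ∀ l, loc F (fun q => toSphere (h q) l) x₀ =ᶠ[nhds y] fun z => sphereVec (Z z) l :=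
    fun l => by filter_upwards [hev] with z hz using hz l
  rw [(h1 l).fderiv_eq, (h1 _).fderiv_eq, (h1 (l + 1)).fderiv_eq, (h1 _).eq_of_nhds,
    (h1 _).eq_of_nhds]
  exact fderiv_sphereVec_comp hZ' hZ0 (J := Complex.I • ContinuousLinearMap.id ℝ F) hI l v

end Base

/-! ### The Laplacian of a holomorphic map to the sphere -/
section Laplacian

variable {V : Type*} [NormedAddCommGroup V] [NormedSpace ℝ V] [FiniteDimensional ℝ V]

/-- A skew contravariant tensor with vanishing divergence, applied to a differential, has
vanishing divergence. -/
theorem divg_skew_fderiv {A : V → (V →L[ℝ] ℝ) →L[ℝ] V} {u : V → ℝ} {y : V}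
    (hA : DifferentiableAt ℝ A y) (hskew : ∀ β γ : V →L[ℝ] ℝ, β (A y γ) = -γ (A y β))
    (hdiv : ∀ β : V →L[ℝ] ℝ, divg (fun z => A z β) y = 0) (hu : ContDiffAt ℝ ∞ u y) :
    divg (fun z => A z (fderiv ℝ u z)) y = 0 := by
  have hd := differentiableAt_fderiv hu
  have h1 : HasFDerivAt (fun z => A z (fderiv ℝ u z))
      ((A y).comp (fderiv ℝ (fderiv ℝ u) y) + (fderiv ℝ A y).flip (fderiv ℝ u y)) y :=
    hA.hasFDerivAt.clm_apply hd.hasFDerivAt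
  have h2 : fderiv ℝ (fun z => A z (fderiv ℝ u y)) y = (fderiv ℝ A y).flip (fderiv ℝ u y) := by
    have h3 : HasFDerivAt (fun z => A z (fderiv ℝ u y)) _ y :=
      hA.hasFDerivAt.clm_apply (hasFDerivAt_const (fderiv ℝ u y) y)
    rw [h3.fderiv]
    ext v; simp
  have h4 := hdiv (fderiv ℝ u y)
  rw [divg, h2] at h4
  have h5 : IsSymmSndFDerivAt ℝ u y :=
    (hu.of_le two_le_infty).isSymmSndFDerivAt (by simp)
  have h6 := trace_comp_skew (A y) hskew (fderiv ℝ (fderiv ℝ u) y) fun v w => h5 v w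
  rw [divg, h1.fderiv, ContinuousLinearMap.coe_add, map_add, h4, add_zero]
  exact h6

/-- The components of a holomorphic map to the sphere are eigenfunctions of the Laplacian of a
balanced metric, up to the energy density. -/
theorem lapl_sphere_map {T : Set V} (hT : IsOpen T) {G : V → (V →L[ℝ] ℝ) →L[ℝ] V}
    {J : V → V →L[ℝ] V} (hG : ContDiffOn ℝ ∞ G T) (hJ : ContDiffOn ℝ ∞ J T)
    (hskew : ∀ y ∈ T, ∀ β γ : V →L[ℝ] ℝ, β (J y (G y γ)) = -γ (J y (G y β)))
    (hsymm : ∀ y ∈ T, ∀ β γ : V →L[ℝ] ℝ, β (G y γ) = γ (G y β))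
    (hdiv : ∀ y ∈ T, ∀ β : V →L[ℝ] ℝ, divg (fun z => J z (G z β)) y = 0)
    {a : Fin 3 → V → ℝ} (ha : ∀ l, ContDiffOn ℝ ∞ (a l) T)
    (hsq : ∀ y ∈ T, ∑ l, a l y ^ 2 = 1)
    (hcr : ∀ y ∈ T, ∀ l, J y (G y (fderiv ℝ (a l) y))
      = a (l + 2) y • G y (fderiv ℝ (a (l + 1)) y) - a (l + 1) y • G y (fderiv ℝ (a (l + 2)) y))
    {y : V} (hy : y ∈ T) :
    (∑ j, a j y • fderiv ℝ (a j) y = 0) ∧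
    ∀ l, lapl G (a l) y = -(∑ j, fderiv ℝ (a j) y (G y (fderiv ℝ (a j) y))) * a l y := by
  have hTy := hT.mem_nhds hy
  have hGd : DifferentiableAt ℝ G y := (hG.contDiffAt hTy).differentiableAt infty_ne_zero
  have hJd : DifferentiableAt ℝ J y := (hJ.contDiffAt hTy).differentiableAt infty_ne_zero
  have had : ∀ l, ∀ z ∈ T, DifferentiableAt ℝ (a l) z := fun l z hz =>
    ((ha l).contDiffAt (hT.mem_nhds hz)).differentiableAt infty_ne_zero
  have hgd : ∀ l, DifferentiableAt ℝ (fun z => G z (fderiv ℝ (a l) z)) y := fun l =>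
    hGd.clm_apply (differentiableAt_fderiv ((ha l).contDiffAt hTy))
  have hsum : ∀ z ∈ T, ∑ j, a j z • fderiv ℝ (a j) z = 0 := fun z hz => by
    have h1 : HasFDerivAt (fun z => ∑ l, a l z * a l z)
        (∑ l, (a l z • fderiv ℝ (a l) z + a l z • fderiv ℝ (a l) z)) z :=
      HasFDerivAt.fun_sum fun l _ => (had l z hz).hasFDerivAt.mul (had l z hz).hasFDerivAt
    have h2 : (fun z => ∑ l, a l z * a l z) =ᶠ[nhds z] fun _ => 1 := by
      filter_upwards [hT.mem_nhds hz] with w hw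
      rw [← hsq w hw]
      exact Finset.sum_congr rfl fun l _ => (sq _).symm
    have h3 := h1.unique ((hasFDerivAt_const (1 : ℝ) z).congr_of_eventuallyEq h2)
    rw [Finset.sum_add_distrib, ← two_smul ℝ] at h3
    exact (smul_eq_zero.1 h3).resolve_left two_ne_zero
  refine ⟨hsum y hy, ?_⟩
  -- the divergence of the relation `∑ aₗ ∇aₗ = 0`
  have hrad : ∑ j, a j y * lapl G (a j) y
      = -∑ j, fderiv ℝ (a j) y (G y (fderiv ℝ (a j) y)) := by
    have h1 : (fun z => ∑ j, a j z • G z (fderiv ℝ (a j) z)) =ᶠ[nhds y] fun _ => 0 := by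
      filter_upwards [hTy] with z hz
      have := congrArg (G z) (hsum z hz)
      rw [map_zero, map_sum] at this
      simpa only [map_smul] using this
    have h2 := Filter.EventuallyEq.divg_eq h1
    rw [divg_sum Finset.univ (W := fun j z => a j z • G z (fderiv ℝ (a j) z))
      fun j _ => (had j y hy).smul (hgd j)] at h2
    have h3 : divg (fun _ : V => (0 : V)) y = 0 := by rw [divg, fderiv_const_apply]; simp
    rw [h3] at h2
    have h4 : ∀ j, divg (fun z => a j z • G z (fderiv ℝ (a j) z)) y
        = fderiv ℝ (a j) y (G y (fderiv ℝ (a j) y)) + a j y * lapl G (a j) y := fun j =>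
      divg_smul (had j y hy) (hgd j)
    simp only [h4, Finset.sum_add_distrib] at h2
    linarith
  -- the divergence of the Cauchy-Riemann equations; the two relations determine all `Δaₗ`
  have hrot : ∀ l, a (l + 2) y * lapl G (a (l + 1)) y = a (l + 1) y * lapl G (a (l + 2)) y := by
    intro l
    have h1 : divg (fun z => J z (G z (fderiv ℝ (a l) z))) y = 0 :=
      divg_skew_fderiv (A := fun z => (J z).comp (G z)) (hJd.clm_comp hGd) (hskew y hy) (hdiv y hy)
        ((ha l).contDiffAt hTy)
    have h2 : (fun z => J z (G z (fderiv ℝ (a l) z))) =ᶠ[nhds y] fun z =>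
        a (l + 2) z • G z (fderiv ℝ (a (l + 1)) z)
          - a (l + 1) z • G z (fderiv ℝ (a (l + 2)) z) := by
      filter_upwards [hTy] with z hz using hcr z hz l
    rw [Filter.EventuallyEq.divg_eq h2,
      divg_sub (W := fun z => a (l + 2) z • G z (fderiv ℝ (a (l + 1)) z))
        (W' := fun z => a (l + 1) z • G z (fderiv ℝ (a (l + 2)) z))
        ((had _ y hy).smul (hgd _)) ((had _ y hy).smul (hgd _)),
      divg_smul (u := a (l + 2)) (W := fun z => G z (fderiv ℝ (a (l + 1)) z)) (had _ y hy) (hgd _),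
      divg_smul (u := a (l + 1)) (W := fun z => G z (fderiv ℝ (a (l + 2)) z)) (had _ y hy) (hgd _)]
      at h1
    rw [hsymm y hy (fderiv ℝ (a (l + 2)) y)] at h1
    change _ + a (l + 2) y * lapl G (a (l + 1)) y - (_ + a (l + 1) y * lapl G (a (l + 2)) y) = 0
      at h1
    linarith
  intro l
  have h0 := hrot 0
  have h1 := hrot 1
  have h2 := hrot 2
  have hs := hsq y hy
  rw [Fin.sum_univ_three] at hrad hs
  rw [← hrad]
  have c01 : (0 : Fin 3) + 1 = 1 := rfl
  have c02 : (0 : Fin 3) + 2 = 2 := rfl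
  have c11 : (1 : Fin 3) + 1 = 2 := rfl
  have c12 : (1 : Fin 3) + 2 = 0 := rfl
  have c21 : (2 : Fin 3) + 1 = 0 := rfl
  have c22 : (2 : Fin 3) + 2 = 1 := rfl
  rw [c01, c02] at h0
  rw [c11, c12] at h1
  rw [c21, c22] at h2
  have hl : l = 0 ∨ l = 1 ∨ l = 2 := by fin_cases l <;> simp
  rcases hl with rfl | rfl | rfl
  · linear_combination -lapl G (a 0) y * hs + a 1 y * h2 - a 2 y * h1
  · linear_combination -lapl G (a 1) y * hs + a 2 y * h0 - a 0 y * h2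
  · linear_combination -lapl G (a 2) y * hs + a 0 y * h1 - a 1 y * h0

end Laplacian

/-! ### The base of the twistor fibration -/
section BaseFam

variable {V : Type*} [NormedAddCommGroup V] [NormedSpace ℝ V] [FiniteDimensional ℝ V]
  {P : Type*} [TopologicalSpace P] [ChartedSpace V P] [IsManifold 𝓘(ℝ, V) ∞ P]

/-- The energy density of a map to Euclidean space. -/
def energy (T : P → V → (V →L[ℝ] ℝ) →L[ℝ] V) (a : Fin 3 → P → ℝ) (x₀ : P) (y : V) : ℝ :=
  (1 / 2 : ℝ) * ∑ l, fderiv ℝ (loc V (a l) x₀) y (T x₀ y (fderiv ℝ (loc V (a l) x₀) y))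

theorem isDens_energy {T : P → V → (V →L[ℝ] ℝ) →L[ℝ] V} (hT : IsCoDens T) {a : Fin 3 → P → ℝ}
    (ha : ∀ l, SmoothFam (loc V (a l))) : IsDens (energy T a) := fun x₀ x₁ y hy => by
  have h : ∀ l, fderiv ℝ (loc V (a l) x₀) y (T x₀ y (fderiv ℝ (loc V (a l) x₀) y))
      = |cdet (jac V x₀ x₁ y)| * fderiv ℝ (loc V (a l) x₁) (coordCh V x₀ x₁ y)
        (T x₁ (coordCh V x₀ x₁ y) (fderiv ℝ (loc V (a l) x₁) (coordCh V x₀ x₁ y))) := fun l => by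
    rw [(isFun_loc (a l)).fderiv_eq (ha l) hy, ContinuousLinearMap.comp_apply, hT x₀ x₁ y hy,
      map_smul, smul_eq_mul]
  rw [energy, energy]
  simp only [h]
  rw [← Finset.mul_sum]
  ring

theorem smoothFam_energy {T : P → V → (V →L[ℝ] ℝ) →L[ℝ] V} (hT : SmoothFam T) {a : Fin 3 → P → ℝ}
    (ha : ∀ l, SmoothFam (loc V (a l))) : SmoothFam (energy T a) := fun x₀ =>
  contDiffOn_const.mul (ContDiffOn.sum fun l _ =>
    ((ha l).fderiv x₀).clm_apply (hT.grad (ha l) x₀))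

/-- If the energy of a map vanishes on the complement of a clopen set, then the map is constant on
the components that are not contained in that set. -/
theorem eq_on_connectedComponent {T : P → V → (V →L[ℝ] ℝ) →L[ℝ] V} (hT : IsCoDens T)
    (hpos : ∀ x₀, ∀ y ∈ (chartAt V x₀).target, ∀ β : V →L[ℝ] ℝ, β ≠ 0 → 0 < β (T x₀ y β))
    {a : Fin 3 → P → ℝ} (ha : ∀ l, SmoothFam (loc V (a l))) {W : Set P} (hW : IsClopen W)
    (he : ∀ x, 0 < energy T a x (chartAt V x x) → x ∈ W) {q : P} (hq : q ∉ W) {q' : P}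
    (hq' : q' ∈ connectedComponent q) (l : Fin 3) : a l q' = a l q := by
  have hac : ∀ l, Continuous (a l) := fun l => by
    refine continuous_iff_continuousAt.2 fun x => ?_
    have h1 := ((ha l).contDiffAt (mem_chart_target V x)).continuousAt
    have h2 : ContinuousAt (fun z => loc V (a l) x (chartAt V x z)) x :=
      ContinuousAt.comp (f := chartAt V x) h1
        ((chartAt V x).continuousAt (mem_chart_source V x))
    refine h2.congr ?_
    filter_upwards [(chartAt V x).open_source.mem_nhds (mem_chart_source V x)] with z hz
    rw [loc, (chartAt V x).left_inv hz]
  have hd0 : ∀ x₀, ∀ y ∈ (chartAt V x₀).target, (chartAt V x₀).symm y ∉ W →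
      ∀ l, fderiv ℝ (loc V (a l) x₀) y = 0 := fun x₀ y hy hyW l => by
    by_contra hne
    refine hyW (he _ (((isDens_energy hT ha).pos_center_iff ((chartAt V x₀).map_target hy)).2 ?_))
    rw [(chartAt V x₀).right_inv hy, energy]
    refine mul_pos (by norm_num) (Finset.sum_pos' (fun j _ => ?_)
      ⟨l, Finset.mem_univ l, hpos x₀ y hy _ hne⟩)
    by_cases h0 : fderiv ℝ (loc V (a j) x₀) y = 0
    · rw [h0]; exact le_rfl
    · exact (hpos x₀ y hy _ h0).le
  -- the points outside of `W` where `a` takes the same value as at `q` form a clopen set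
  set C : Set P := Wᶜ ∩ ⋂ l, {z | a l z = a l q}
  have hCc : IsClosed C := hW.isOpen.isClosed_compl.inter
    (isClosed_iInter fun l => isClosed_eq (hac l) continuous_const)
  have hCo : IsOpen C := by
    refine isOpen_iff_mem_nhds.2 fun x hx => ?_
    set φ := chartAt V x
    have h1 : IsOpen (φ.target ∩ φ.symm ⁻¹' Wᶜ) :=
      φ.isOpen_inter_preimage_symm hW.isClosed.isOpen_compl
    obtain ⟨ε, hε, hball⟩ := Metric.isOpen_iff.1 h1 (φ x) ⟨mem_chart_target V x, by
      rw [mem_preimage, φ.left_inv (mem_chart_source V x)]; exact hx.1⟩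
    have h2 : IsOpen (φ.source ∩ φ ⁻¹' Metric.ball (φ x) ε) :=
      φ.isOpen_inter_preimage Metric.isOpen_ball
    have h2x : x ∈ φ.source ∩ φ ⁻¹' Metric.ball (φ x) ε :=
      mem_inter (mem_chart_source V x) (mem_preimage.2 (Metric.mem_ball_self hε))
    refine Filter.mem_of_superset (h2.mem_nhds h2x) fun z hz => ?_
    have hzW : z ∉ W := by
      have h3 : φ.symm (φ z) ∉ W := (hball hz.2).2
      rwa [φ.left_inv hz.1] at h3
    refine ⟨hzW, mem_iInter.2 fun l => ?_⟩
    have hconst : loc V (a l) x (φ z) = loc V (a l) x (φ x) := by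
      refine Metric.isOpen_ball.is_const_of_fderiv_eq_zero (𝕜 := ℝ) (s := Metric.ball (φ x) ε)
        (convex_ball (φ x) ε).isPreconnected (fun w hw => ?_) (fun w hw => ?_) hz.2
        (Metric.mem_ball_self hε)
      · exact ((ha l).differentiableAt (hball hw).1).differentiableWithinAt
      · exact hd0 x w (hball hw).1 (hball hw).2 l
    rw [loc, loc, φ.left_inv hz.1, φ.left_inv (mem_chart_source V x)] at hconst
    exact hconst.trans (mem_iInter.1 hx.2 l)
  have hsub := IsClopen.connectedComponent_subset ⟨hCc, hCo⟩ (x := q)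
    ⟨hq, mem_iInter.2 fun l => rfl⟩
  exact mem_iInter.1 (hsub hq').2 l

variable (V P) in
/-- The data on the base of the twistor fibration which enter the construction: a balanced
Hermitian metric, a holomorphic map `a` to the unit sphere, and a strict subsolution `f` of
`Δ f + 2 e f` where `e` is the energy density of `a`. -/
structure BaseFam where
  D : MetricFam V P
  J : P → V → V →L[ℝ] V
  a : Fin 3 → P → ℝ
  f : P → ℝ
  J_end : IsEndFam J
  J_smooth : SmoothFam J
  J_sq : ∀ x₀, ∀ y ∈ (chartAt V x₀).target, ∀ v, J x₀ y (J x₀ y v) = -v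
  compat : D.Compat J
  div_J : ∀ x₀, ∀ y ∈ (chartAt V x₀).target, ∀ β : V →L[ℝ] ℝ,
    divg (fun z => J x₀ z (D.G x₀ z β)) y = 0
  a_smooth : ∀ l, SmoothFam (loc V (a l))
  a_sq : ∀ q, ∑ l, a l q ^ 2 = 1
  a_J : ∀ x₀, ∀ y ∈ (chartAt V x₀).target, ∀ l v, fderiv ℝ (loc V (a l) x₀) y (J x₀ y v)
    = loc V (a (l + 1)) x₀ y * fderiv ℝ (loc V (a (l + 2)) x₀) y v
      - loc V (a (l + 2)) x₀ y * fderiv ℝ (loc V (a (l + 1)) x₀) y v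
  f_smooth : SmoothFam (loc V f)
  schr_pos : ∀ x₀, ∀ y ∈ (chartAt V x₀).target, 0 < schr D.G (energy D.G a) f x₀ y

end BaseFam

section Base

variable {F : Type*} [NormedAddCommGroup F] [NormedSpace ℂ F] [FiniteDimensional ℂ F]
  {Q : Type*} [TopologicalSpace Q] [ChartedSpace F Q] [IsManifold 𝓘(ℂ, F) ω Q]
  [IsManifold 𝓘(ℝ, F) ∞ Q]

/-- The Hermitian metric family of a balanced metric on a complex manifold. -/
theorem IsBalancedMetric.exists_metricFam {m : ℕ} (hm : finrank ℂ F = m + 1)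
    {ξQ : Form 𝓘(ℝ, F) Q 2} (hξ : IsBalancedMetric (mulI F Q) (m + 1) ξQ) :
    ∃ D : MetricFam F Q, D.Compat (mulI F Q).inChart ∧
      ∀ x₀, ∀ y ∈ (chartAt F x₀).target, ∀ β : F →L[ℝ] ℝ,
        divg (fun z => (mulI F Q).inChart x₀ z (D.G x₀ z β)) y = 0 := by
  have hdim : finrank ℝ F = 2 * (m + 1) := by rw [finrank_real_of_complex, hm]
  set b : Basis (Fin (2 * (m + 1))) ℝ F := finBasisOfFinrankEq ℝ F hdim
  have hη : IsFormFam (V := F) (P := Q) ξQ.inChart := ξQ.isFormFam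
  have hηs := hξ.smooth.smoothFam
  have hJs : SmoothFam (mulI F Q).inChart := fun x₀ =>
    contDiffOn_const (c := (Complex.I • ContinuousLinearMap.id ℝ F : F →L[ℝ] F)).congr
      fun y hy => by ext v; exact mulI_inChart hy v
  have hJ : ∀ x₀, ∀ y ∈ (chartAt F x₀).target, ∀ v,
      (mulI F Q).inChart x₀ y ((mulI F Q).inChart x₀ y v) = -v := fun x₀ y hy v => by
    rw [mulI_inChart hy, mulI_inChart hy, smul_smul, Complex.I_mul_I, neg_one_smul]
  have hform : ∀ (x₀ : Q) (y : F), y ∈ (chartAt F x₀).target → ∀ u v, flat (ξQ.inChart x₀ y) u v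
      = flat (show F [⋀^Fin 2]→L[ℝ] ℝ from ξQ ((chartAt F x₀).symm y))
        (jac F x₀ ((chartAt F x₀).symm y) y u) (jac F x₀ ((chartAt F x₀).symm y) y v) :=
    fun x₀ y hy u v => by rw [ξQ.inChart_eq hy]; exact flat_comp _ _ _ _
  have hinv : ∀ x₀, ∀ y ∈ (chartAt F x₀).target, ∀ u v,
      flat (ξQ.inChart x₀ y) ((mulI F Q).inChart x₀ y u) ((mulI F Q).inChart x₀ y v)
        = flat (ξQ.inChart x₀ y) u v := fun x₀ y hy u v => by
    have hm := mem_coordDom_self hy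
    rw [mulI_inChart hy, mulI_inChart hy, hform x₀ y hy, hform x₀ y hy, jac_smul_I hm,
      jac_smul_I hm, flat_apply, flat_apply]
    exact hξ.type_one_one _ _ _
  have hpos : ∀ x₀, ∀ y ∈ (chartAt F x₀).target, ∀ u, u ≠ 0 →
      0 < flat (ξQ.inChart x₀ y) u ((mulI F Q).inChart x₀ y u) := fun x₀ y hy u hu => by
    have hm := mem_coordDom_self hy
    rw [mulI_inChart hy, hform x₀ y hy, jac_smul_I hm, flat_apply]
    refine hξ.pos _ _ fun h0 => hu (jac_injective hm ?_)
    rw [map_zero]; exact h0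
  obtain ⟨D, hD, -, hG⟩ := exists_metricFam_of_form b hη hηs (mulI F Q).isEndFam hJs hJ hinv hpos
  have hi : ∀ x₀, ∀ y ∈ (chartAt F x₀).target, Function.Injective (flat (ξQ.inChart x₀ y)) :=
    fun x₀ y hy => by
    refine (injective_iff_map_eq_zero _).2 fun u hu => ?_
    by_contra h0
    have := hpos x₀ y hy u h0
    rw [hu] at this
    exact lt_irrefl _ this
  have hi0 : ∀ x : Q, Function.Injective (flat (ξQ.inChart x (chartAt F x x))) := fun x =>
    hi x _ (mem_chart_target F x)
  have hPs : SmoothFam (V := F) (P := Q) fun x₀ y => poisson b (ξQ.inChart x₀ y) :=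
    hηs.poisson b hη hi0
  have hPd := hη.isCoDens_poisson b hi0
  -- the closedness of the power of `ξQ`, at the centre of each chart
  have hcentre : ∀ (x : Q) (β : F →L[ℝ] ℝ),
      divg (fun z => poisson b (ξQ.inChart x z) β) (chartAt F x x) = 0 := fun x => by
    refine (extDeriv_wedgePow_eq_zero_iff b (hηs.contDiffAt (mem_chart_target F x)) (hi0 x)).1 ?_
    have h1 := congrFun hξ.closed x
    have h2 := ((ξQ.pow m).d_eq_zero_iff x).1 h1
    rw [← h2]
    refine Filter.EventuallyEq.extDeriv_eq ?_
    filter_upwards [(chartAt F x).open_target.mem_nhds (mem_chart_target F x)] with z hz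
    exact (Form.inChart_pow ξQ m x z).symm
  have hvec : ∀ x₀, ∀ y ∈ (chartAt F x₀).target,
      divVec (fun z => poisson b (ξQ.inChart x₀ z)) y = 0 := fun x₀ y hy => by
    refine (hPd.divVec hPs fun x₀ y hy => poisson_skew b (hi x₀ y hy)).eq_zero (fun x => ?_) hy
    refine eq_of_forall_covector fun β => ?_
    rw [apply_divVec (hPs.differentiableAt (mem_chart_target F x)), map_zero]
    exact hcentre x β
  refine ⟨D, hD, fun x₀ y hy β => ?_⟩
  have h1 : (fun z => (mulI F Q).inChart x₀ z (D.G x₀ z β)) =ᶠ[nhds y]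
      fun z => -poisson b (ξQ.inChart x₀ z) β := by
    filter_upwards [(chartAt F x₀).open_target.mem_nhds hy] with z hz
    rw [hG, ContinuousLinearMap.comp_apply, hJ x₀ z hz]
  rw [Filter.EventuallyEq.divg_eq h1, divg_neg (W := fun z => poisson b (ξQ.inChart x₀ z) β),
    ← apply_divVec (T := fun z => poisson b (ξQ.inChart x₀ z)) (hPs.differentiableAt hy),
    hvec x₀ y hy, map_zero, neg_zero]

/-- A compact complex manifold with a balanced metric and a holomorphic map to the projective line,
not constant on any connected component, carries the data of a `BaseFam`. -/
theorem exists_baseFam [T2Space Q] [CompactSpace Q] {m : ℕ} (hm : finrank ℂ F = m + 1)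
    {ξQ : Form 𝓘(ℝ, F) Q 2} (hξ : IsBalancedMetric (mulI F Q) (m + 1) ξQ)
    {h : Q → P1} (hh : IsHolomorphicToP1 F h)
    (hconst : ∀ q : Q, ∃ q' ∈ connectedComponent q, h q' ≠ h q) :
    ∃ B : BaseFam F Q, B.J = (mulI F Q).inChart ∧ B.a = fun l q => toSphere (h q) l := by
  obtain ⟨D, hD, hdiv⟩ := hξ.exists_metricFam hm
  set a : Fin 3 → Q → ℝ := fun l q => toSphere (h q) l with ha
  have has : ∀ l, SmoothFam (loc F (a l)) := hh.smoothFam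
  obtain ⟨f, hf, hfp⟩ := exists_schr_pos D.G_dens D.G_smooth
    (fun x₀ y hy β hβ => D.G_pos hy hβ) (isDens_energy D.G_dens has)
    (smoothFam_energy D.G_smooth has)
    (fun x₀ y hy => mul_nonneg (by norm_num) (Finset.sum_nonneg fun l _ => D.G_nonneg hy _))
    (fun W hW he => by
      refine eq_univ_of_forall fun q => ?_
      by_contra hq
      obtain ⟨q', hq', hne⟩ := hconst q
      refine hne (toSphere_injective (funext fun l => ?_))
      exact eq_on_connectedComponent D.G_dens (fun x₀ y hy β hβ => D.G_pos hy hβ) has hW he hq hq' l)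
  exact ⟨{
    D := D
    J := (mulI F Q).inChart
    a := a
    f := f
    J_end := (mulI F Q).isEndFam
    J_smooth := fun x₀ =>
      contDiffOn_const (c := (Complex.I • ContinuousLinearMap.id ℝ F : F →L[ℝ] F)).congr
        fun y hy => by ext v; exact mulI_inChart hy v
    J_sq := fun x₀ y hy v => by
      rw [mulI_inChart hy, mulI_inChart hy, smul_smul, Complex.I_mul_I, neg_one_smul]
    compat := hD
    div_J := hdiv
    a_smooth := has
    a_sq := fun q => sum_toSphere_sq (h q)
    a_J := fun x₀ y hy l v => by
      rw [mulI_inChart hy]; exact hh.fderiv_smul_I hy l v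
    f_smooth := hf
    schr_pos := hfp }, rfl, rfl⟩

end Base

/-! ### The bivector density on the product -/

section Quaternion

variable {E : Type*} [NormedAddCommGroup E] [NormedSpace ℝ E]
  {F : Type*} [NormedAddCommGroup F] [NormedSpace ℝ F]

/-- The combination `∑ aₗ Kₗ` of three endomorphisms. -/
def quat (a : Fin 3 → ℝ) (K : Fin 3 → E →L[ℝ] E) : E →L[ℝ] E := ∑ l, a l • K l

theorem quat_apply (a : Fin 3 → ℝ) (K : Fin 3 → E →L[ℝ] E) (v : E) :
    quat a K v = a 0 • K 0 v + a 1 • K 1 v + a 2 • K 2 v := by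
  rw [quat, Fin.sum_univ_three]; rfl

/-- The multiplication table of the imaginary quaternions. -/
structure IsQuat (K : Fin 3 → E →L[ℝ] E) : Prop where
  sq : ∀ l v, K l (K l v) = -v
  mul : ∀ l v, K l (K (l + 1) v) = K (l + 2) v

variable {K : Fin 3 → E →L[ℝ] E} {a : Fin 3 → ℝ}

theorem IsQuat.table (h : IsQuat K) (v : E) :
    K 0 (K 1 v) = K 2 v ∧ K 1 (K 2 v) = K 0 v ∧ K 2 (K 0 v) = K 1 v ∧
      K 1 (K 0 v) = -K 2 v ∧ K 2 (K 1 v) = -K 0 v ∧ K 0 (K 2 v) = -K 1 v := by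
  have h1 : ∀ v, K 0 (K 1 v) = K 2 v := h.mul 0
  have h2 : ∀ v, K 1 (K 2 v) = K 0 v := h.mul 1
  have h3 : ∀ v, K 2 (K 0 v) = K 1 v := h.mul 2
  refine ⟨h1 v, h2 v, h3 v, ?_, ?_, ?_⟩
  · rw [← h2, h.sq]
  · rw [← h3, h.sq]
  · rw [← h1, h.sq]

theorem IsQuat.quat_sq (h : IsQuat K) (ha : ∑ l, a l ^ 2 = 1) (v : E) :
    quat a K (quat a K v) = -v := by
  obtain ⟨h1, h2, h3, h4, h5, h6⟩ := h.table v
  rw [Fin.sum_univ_three] at ha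
  simp only [quat_apply, map_add, map_smul, h.sq, h1, h2, h3, h4, h5, h6]
  linear_combination (norm := module) -(ha • v)

/-- The equivariance of the mixed part of the bivector density: if `J` acts on `N`, `U₀`, `U₁`,
`U₂` as `∑ aₗ Kₗ` acts on `Y`, `-K₀ Y`, `-K₁ Y`, `-K₂ Y`, then the tensor
`N ⊗ Y - ∑ Uₗ ⊗ Kₗ Y` is invariant. -/
theorem IsQuat.quat_mixed (h : IsQuat K) (ha : ∑ l, a l ^ 2 = 1) {J : F →L[ℝ] F} {N : F}
    {U : Fin 3 → F} (hN : J N = -∑ l, a l • U l)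
    (hU : ∀ l, J (U l) = a l • N + a (l + 2) • U (l + 1) - a (l + 1) • U (l + 2))
    (Y : E) (γ : F →L[ℝ] ℝ) :
    quat a K (γ (J N) • Y - ∑ l, γ (J (U l)) • K l Y) = γ N • Y - ∑ l, γ (U l) • K l Y := by
  obtain ⟨h1, h2, h3, h4, h5, h6⟩ := h.table Y
  have u0 : J (U 0) = a 0 • N + a 2 • U 1 - a 1 • U 2 := hU 0
  have u1 : J (U 1) = a 1 • N + a 0 • U 2 - a 2 • U 0 := hU 1
  have u2 : J (U 2) = a 2 • N + a 1 • U 0 - a 0 • U 1 := hU 2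
  rw [Fin.sum_univ_three] at ha hN
  rw [Fin.sum_univ_three, Fin.sum_univ_three, u0, u1, u2, hN]
  simp only [quat_apply, map_add, map_sub, map_neg, map_smul, h.sq, h1, h2, h3, h4, h5, h6,
    smul_eq_mul]
  linear_combination (norm := module)
    ha • (γ N • Y - (γ (U 0) • K 0 Y + γ (U 1) • K 1 Y + γ (U 2) • K 2 Y))

end Quaternion

section FibreFam

variable (V : Type*) [NormedAddCommGroup V] [NormedSpace ℝ V] [FiniteDimensional ℝ V]
  (P : Type*) [TopologicalSpace P] [ChartedSpace V P] [IsManifold 𝓘(ℝ, V) ∞ P]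

/-- The data on the fibre of the twistor fibration which enter the construction: a hyperhermitian
metric for the hypercomplex structure `K`, and the vector density `Y` which measures its failure to
be balanced. -/
structure FibreFam where
  D : MetricFam V P
  K : Fin 3 → P → V → V →L[ℝ] V
  Y : P → V → V
  K_end : ∀ l, IsEndFam (K l)
  K_smooth : ∀ l, SmoothFam (K l)
  isQuat : ∀ x₀, ∀ y ∈ (chartAt V x₀).target, IsQuat fun l => K l x₀ y
  compat : ∀ l, D.Compat (K l)
  Y_smooth : SmoothFam Y
  Y_dens : IsVecDens Y
  div_K : ∀ l x₀, ∀ y ∈ (chartAt V x₀).target, ∀ β : V →L[ℝ] ℝ,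
    divg (fun z => K l x₀ z (D.G x₀ z β)) y = -β (K l x₀ y (Y x₀ y))
  div_K_Y : ∀ l x₀, ∀ y ∈ (chartAt V x₀).target, divg (fun z => K l x₀ z (Y x₀ z)) y = 0

variable {V P}

/-- A compact hypercomplex manifold carries the data of a `FibreFam`. -/
theorem HypercomplexStructure.exists_fibreFam [T2Space P] [CompactSpace P]
    (S : HypercomplexStructure 𝓘(ℝ, V) P) {r : ℕ} (hr : finrank ℝ V = 2 * r) :
    ∃ R : FibreFam V P, R.K = fun l => (S.str l).inChart := by
  obtain ⟨D, hD⟩ := S.exists_compat_metric hr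
  obtain ⟨Y, hYs, hYd, hY1, hY2⟩ := S.exists_lee_field D hD
  exact ⟨{
    D := D
    K := fun l => (S.str l).inChart
    Y := Y
    K_end := fun l => (S.str l).isEndFam
    K_smooth := fun l => (S.isComplexStructure_str l).smooth.smoothFam
    isQuat := fun x₀ y hy => by
      refine ⟨fun l v => S.str_sq l hy v, fun l v => ?_⟩
      have hl : l = 0 ∨ l = 1 ∨ l = 2 := by fin_cases l <;> simp
      rcases hl with rfl | rfl | rfl
      · exact EndField.inChart_mul (J := S.str 0) (K := S.str 1) (L := S.str 2) S.i_j hy v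
      · exact EndField.inChart_mul (J := S.str 1) (K := S.str 2) (L := S.str 0) S.j_k hy v
      · exact EndField.inChart_mul (J := S.str 2) (K := S.str 0) (L := S.str 1) S.k_i hy v
    compat := hD
    Y_smooth := hYs
    Y_dens := hYd
    div_K := hY1
    div_K_Y := hY2 }, rfl⟩

end FibreFam

namespace BaseFam

variable {V : Type*} [NormedAddCommGroup V] [NormedSpace ℝ V] [FiniteDimensional ℝ V]
  {P : Type*} [TopologicalSpace P] [ChartedSpace V P] [IsManifold 𝓘(ℝ, V) ∞ P]
  (B : BaseFam V P) {x₀ : P} {y : V}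

/-- The map to the sphere in a chart. -/
def av (x₀ : P) (y : V) : Fin 3 → ℝ := fun l => loc V (B.a l) x₀ y

/-- The image under `J` of the gradient of `f`. -/
def rotGrad (x₀ : P) (y : V) : V := B.J x₀ y (B.D.G x₀ y (fderiv ℝ (loc V B.f x₀) y))

/-- The vector densities `aₗ ∇f - f ∇aₗ`. -/
def wronsk (l : Fin 3) (x₀ : P) (y : V) : V :=
  B.av x₀ y l • B.D.G x₀ y (fderiv ℝ (loc V B.f x₀) y)
    - loc V B.f x₀ y • B.D.G x₀ y (fderiv ℝ (loc V (B.a l) x₀) y)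

theorem rotGrad_dens : IsVecDens B.rotGrad :=
  B.J_end.vecDens (B.D.G_dens.grad (isFun_loc B.f) B.f_smooth)

theorem rotGrad_smooth : SmoothFam B.rotGrad := fun x₀ =>
  (B.J_smooth x₀).clm_apply (B.D.G_smooth.grad B.f_smooth x₀)

theorem wronsk_dens (l : Fin 3) : IsVecDens (B.wronsk l) := fun x₀ x₁ y hy => by
  have h1 := B.D.G_dens.grad (isFun_loc B.f) B.f_smooth x₀ x₁ y hy
  have h2 := B.D.G_dens.grad (isFun_loc (B.a l)) (B.a_smooth l) x₀ x₁ y hy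
  rw [wronsk, map_sub, map_smul, map_smul, h1, h2, av, isFun_loc (B.a l) x₀ x₁ y hy,
    isFun_loc B.f x₀ x₁ y hy, wronsk, av, smul_sub, smul_comm, smul_comm (loc V B.f x₁ _)]

theorem wronsk_smooth (l : Fin 3) : SmoothFam (B.wronsk l) := fun x₀ =>
  ((B.a_smooth l x₀).smul (B.D.G_smooth.grad B.f_smooth x₀)).sub
    ((B.f_smooth x₀).smul (B.D.G_smooth.grad (B.a_smooth l) x₀))

theorem sum_av_sq (x₀ : P) (y : V) : ∑ l, B.av x₀ y l ^ 2 = 1 := B.a_sq _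

theorem J_skew (hy : y ∈ (chartAt V x₀).target) (β γ : V →L[ℝ] ℝ) :
    β (B.J x₀ y (B.D.G x₀ y γ)) = -γ (B.J x₀ y (B.D.G x₀ y β)) :=
  B.compat.skew B.J_sq hy β γ

/-- The Cauchy-Riemann equations for the gradients of the components of the map to the sphere. -/
theorem J_grad (hy : y ∈ (chartAt V x₀).target) (l : Fin 3) :
    B.J x₀ y (B.D.G x₀ y (fderiv ℝ (loc V (B.a l) x₀) y))
      = B.av x₀ y (l + 2) • B.D.G x₀ y (fderiv ℝ (loc V (B.a (l + 1)) x₀) y)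
        - B.av x₀ y (l + 1) • B.D.G x₀ y (fderiv ℝ (loc V (B.a (l + 2)) x₀) y) := by
  have h : (fderiv ℝ (loc V (B.a l) x₀) y).comp (B.J x₀ y)
      = B.av x₀ y (l + 1) • fderiv ℝ (loc V (B.a (l + 2)) x₀) y
        - B.av x₀ y (l + 2) • fderiv ℝ (loc V (B.a (l + 1)) x₀) y := by
    ext v; exact B.a_J x₀ y hy l v
  rw [B.compat.G_comp B.J_sq hy, h, map_sub, map_smul, map_smul, neg_sub]

/-- The consequences of `|a| = 1` and of holomorphy: `∑ aₗ daₗ = 0` and `Δaₗ = -2 e aₗ`. -/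
theorem sphere_map (hy : y ∈ (chartAt V x₀).target) :
    (∑ j, B.av x₀ y j • fderiv ℝ (loc V (B.a j) x₀) y = 0) ∧
    ∀ l, lapl (B.D.G x₀) (loc V (B.a l) x₀) y
      = -(∑ j, fderiv ℝ (loc V (B.a j) x₀) y
        (B.D.G x₀ y (fderiv ℝ (loc V (B.a j) x₀) y))) * B.av x₀ y l :=
  lapl_sphere_map (chartAt V x₀).open_target (B.D.G_smooth x₀) (B.J_smooth x₀)
    (fun _ hy => B.J_skew hy) (fun _ hy => B.D.G_symm hy) (fun y hy => B.div_J x₀ y hy)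
    (a := fun l => loc V (B.a l) x₀) (fun l => B.a_smooth l x₀) (fun y _ => B.sum_av_sq x₀ y)
    (fun _ hy l => B.J_grad hy l) hy

/-- Since `∑ aₗ² = 1` and `∑ aₗ ∇aₗ = 0`, the vector `J J∇f = -∇f` is a combination of the fields
`aₗ ∇f - f ∇aₗ`. -/
theorem J_rotGrad (hy : y ∈ (chartAt V x₀).target) :
    B.J x₀ y (B.rotGrad x₀ y) = -∑ l, B.av x₀ y l • B.wronsk l x₀ y := by
  have h1 := congrArg (B.D.G x₀ y) (B.sphere_map hy).1
  have h2 := B.sum_av_sq x₀ y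
  rw [map_zero, Fin.sum_univ_three] at h1
  simp only [map_add, map_smul] at h1
  rw [Fin.sum_univ_three] at h2
  rw [rotGrad, B.J_sq x₀ y hy, Fin.sum_univ_three]
  simp only [wronsk]
  linear_combination (norm := module)
    h2 • B.D.G x₀ y (fderiv ℝ (loc V B.f x₀) y) - loc V B.f x₀ y • h1

theorem J_wronsk (hy : y ∈ (chartAt V x₀).target) (l : Fin 3) :
    B.J x₀ y (B.wronsk l x₀ y) = B.av x₀ y l • B.rotGrad x₀ y
      + B.av x₀ y (l + 2) • B.wronsk (l + 1) x₀ y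
      - B.av x₀ y (l + 1) • B.wronsk (l + 2) x₀ y := by
  rw [wronsk, map_sub, map_smul, map_smul, B.J_grad hy, wronsk, wronsk, rotGrad]
  module

theorem div_rotGrad (hy : y ∈ (chartAt V x₀).target) : divg (B.rotGrad x₀) y = 0 :=
  divg_skew_fderiv (A := fun z => (B.J x₀ z).comp (B.D.G x₀ z))
    ((B.J_smooth.differentiableAt hy).clm_comp (B.D.G_smooth.differentiableAt hy))
    (B.J_skew hy) (B.div_J x₀ y hy) (B.f_smooth.contDiffAt hy)

/-- The strictly positive density `Δf + 2 e f`. -/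
def pot (x₀ : P) (y : V) : ℝ := schr B.D.G (energy B.D.G B.a) B.f x₀ y

theorem pot_pos (hy : y ∈ (chartAt V x₀).target) : 0 < B.pot x₀ y := B.schr_pos x₀ y hy

theorem pot_smooth : SmoothFam B.pot :=
  smoothFam_schr B.D.G_smooth (smoothFam_energy B.D.G_smooth B.a_smooth) B.f_smooth

theorem pot_dens : IsDens B.pot :=
  isDens_schr B.D.G_dens B.D.G_smooth (isDens_energy B.D.G_dens B.a_smooth) B.f_smooth

/-- The divergence of `aₗ ∇f - f ∇aₗ` is `aₗ Δf - f Δaₗ = aₗ (Δf + 2 e f)`. -/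
theorem div_wronsk (hy : y ∈ (chartAt V x₀).target) (l : Fin 3) :
    divg (B.wronsk l x₀) y = B.av x₀ y l * B.pot x₀ y := by
  have hgf := (B.D.G_smooth.grad B.f_smooth).differentiableAt hy
  have hga := (B.D.G_smooth.grad (B.a_smooth l)).differentiableAt hy
  have hf := B.f_smooth.differentiableAt hy
  have ha := (B.a_smooth l).differentiableAt hy
  have h1 : divg (B.wronsk l x₀) y
      = (fderiv ℝ (loc V (B.a l) x₀) y (B.D.G x₀ y (fderiv ℝ (loc V B.f x₀) y))
          + loc V (B.a l) x₀ y * lapl (B.D.G x₀) (loc V B.f x₀) y)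
        - (fderiv ℝ (loc V B.f x₀) y (B.D.G x₀ y (fderiv ℝ (loc V (B.a l) x₀) y))
          + loc V B.f x₀ y * lapl (B.D.G x₀) (loc V (B.a l) x₀) y) := by
    refine (divg_sub (ha.smul hgf) (hf.smul hga)).trans ?_
    exact congrArg₂ (· - ·) (divg_smul ha hgf) (divg_smul hf hga)
  rw [h1, (B.sphere_map hy).2 l, B.D.G_symm hy, pot, schr, energy, av]
  ring

end BaseFam

section ProdChart

variable {E : Type*} [NormedAddCommGroup E] [NormedSpace ℝ E] [FiniteDimensional ℝ E]
  {M : Type*} [TopologicalSpace M] [ChartedSpace E M] [IsManifold 𝓘(ℝ, E) ∞ M]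
  {F : Type*} [NormedAddCommGroup F] [NormedSpace ℝ F] [FiniteDimensional ℝ F]
  {Q : Type*} [TopologicalSpace Q] [ChartedSpace F Q] [IsManifold 𝓘(ℝ, F) ∞ Q]
  [ChartedSpace (E × F) (M × Q)]

variable (E M F Q) in
/-- The charts of a product manifold are the products of charts. -/
def IsProdAtlas : Prop :=
  ∀ x : M × Q, chartAt (E × F) x = (chartAt E x.1).prod (chartAt F x.2)

theorem IsProdAtlas.mem_target (hch : IsProdAtlas E M F Q) {x : M × Q} {y : E × F} :
    y ∈ (chartAt (E × F) x).target ↔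
      y.1 ∈ (chartAt E x.1).target ∧ y.2 ∈ (chartAt F x.2).target := by
  rw [hch x]; exact Iff.rfl

theorem IsProdAtlas.coordCh (hch : IsProdAtlas E M F Q) (x₀ x₁ : M × Q) :
    coordCh (E × F) x₀ x₁ = Prod.map (coordCh E x₀.1 x₁.1) (coordCh F x₀.2 x₁.2) := by
  ext1 y
  rw [TwistorBalanced.coordCh, hch x₀, hch x₁]; rfl

theorem IsProdAtlas.mem_coordDom (hch : IsProdAtlas E M F Q) {x₀ x₁ : M × Q} {y : E × F} :
    y ∈ coordDom (E × F) x₀ x₁ ↔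
      y.1 ∈ coordDom E x₀.1 x₁.1 ∧ y.2 ∈ coordDom F x₀.2 x₁.2 := by
  rw [TwistorBalanced.mem_coordDom, TwistorBalanced.mem_coordDom, TwistorBalanced.mem_coordDom,
    hch x₀, hch x₁]
  exact ⟨fun h => ⟨⟨h.1.1, h.2.1⟩, ⟨h.1.2, h.2.2⟩⟩, fun h => ⟨⟨h.1.1, h.2.1⟩, ⟨h.1.2, h.2.2⟩⟩⟩

theorem IsProdAtlas.jac (hch : IsProdAtlas E M F Q) {x₀ x₁ : M × Q} {y : E × F}
    (hy : y ∈ coordDom (E × F) x₀ x₁) :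
    jac (E × F) x₀ x₁ y = (jac E x₀.1 x₁.1 y.1).prodMap (jac F x₀.2 x₁.2 y.2) := by
  obtain ⟨h1, h2⟩ := hch.mem_coordDom.1 hy
  rw [TwistorBalanced.jac, hch.coordCh]
  exact ((differentiableAt_coordCh h1).hasFDerivAt.prodMap y
    (differentiableAt_coordCh h2).hasFDerivAt).fderiv

theorem cdet_prodMap (A : E →L[ℝ] E) (A' : F →L[ℝ] F) :
    cdet (A.prodMap A') = cdet A * cdet A' :=
  LinearMap.det_prodMap (A : E →ₗ[ℝ] E) (A' : F →ₗ[ℝ] F)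

end ProdChart

section Tensor

variable {E : Type*} [NormedAddCommGroup E] [NormedSpace ℝ E] [FiniteDimensional ℝ E]
  {F : Type*} [NormedAddCommGroup F] [NormedSpace ℝ F] [FiniteDimensional ℝ F]

/-- The map `γ ↦ γ(u) v`. -/
def rankOne (u : F) (v : E) : (F →L[ℝ] ℝ) →L[ℝ] E :=
  (ContinuousLinearMap.apply ℝ ℝ u).smulRight v

theorem rankOne_apply (u : F) (v : E) (γ : F →L[ℝ] ℝ) : rankOne u v γ = γ u • v := rfl

theorem contDiffOn_rankOne {X : Type*} [NormedAddCommGroup X] [NormedSpace ℝ X] {s : Set X}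
    {u : X → F} {v : X → E} (hu : ContDiffOn ℝ ∞ u s) (hv : ContDiffOn ℝ ∞ v s) :
    ContDiffOn ℝ ∞ (fun x => rankOne (u x) (v x)) s := by
  have h1 : ContDiffOn ℝ ∞ (fun x => ContinuousLinearMap.apply ℝ ℝ (u x)) s :=
    (ContinuousLinearMap.apply ℝ ℝ (E := F)).contDiff.comp_contDiffOn hu
  exact ((ContinuousLinearMap.smulRightL ℝ (F →L[ℝ] ℝ) E).contDiff.comp_contDiffOn h1).clm_apply hv

variable (E F) in
/-- Restriction of covectors to the first factor. -/
def covFst : (E × F →L[ℝ] ℝ) →L[ℝ] E →L[ℝ] ℝ :=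
  (ContinuousLinearMap.compL ℝ E (E × F) ℝ).flip (ContinuousLinearMap.inl ℝ E F)

variable (E F) in
/-- Restriction of covectors to the second factor. -/
def covSnd : (E × F →L[ℝ] ℝ) →L[ℝ] F →L[ℝ] ℝ :=
  (ContinuousLinearMap.compL ℝ F (E × F) ℝ).flip (ContinuousLinearMap.inr ℝ E F)

theorem apply_eq_cov (α : E × F →L[ℝ] ℝ) (v : E × F) :
    α v = covFst E F α v.1 + covSnd E F α v.2 := by
  change α v = α (v.1, 0) + α (0, v.2)
  rw [← map_add]; simp

theorem prodMap_mk (A : E →L[ℝ] E) (A' : F →L[ℝ] F) (u : E) (v : F) :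
    A.prodMap A' (u, v) = (A u, A' v) := rfl

theorem covFst_comp (α : E × F →L[ℝ] ℝ) (A : E →L[ℝ] E) (A' : F →L[ℝ] F) :
    covFst E F (α.comp (A.prodMap A')) = (covFst E F α).comp A := by
  ext v; change α (A v, A' 0) = α (A v, 0); rw [map_zero]

theorem covSnd_comp (α : E × F →L[ℝ] ℝ) (A : E →L[ℝ] E) (A' : F →L[ℝ] F) :
    covSnd E F (α.comp (A.prodMap A')) = (covSnd E F α).comp A' := by
  ext v; change α (A 0, A' v) = α (0, A' v); rw [map_zero]

/-- The contravariant tensor `(β, γ) ↦ (T β + S γ, T' γ - S' β)` on a product. With the minus sign it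
is skew-symmetric if `T` and `T'` are so and `S'` is the transpose of `S`. -/
def blockTensor (T : (E →L[ℝ] ℝ) →L[ℝ] E) (S : (F →L[ℝ] ℝ) →L[ℝ] E) (S' : (E →L[ℝ] ℝ) →L[ℝ] F)
    (T' : (F →L[ℝ] ℝ) →L[ℝ] F) : (E × F →L[ℝ] ℝ) →L[ℝ] E × F :=
  (ContinuousLinearMap.inl ℝ E F).comp (T.comp (covFst E F) + S.comp (covSnd E F))
    + (ContinuousLinearMap.inr ℝ E F).comp (T'.comp (covSnd E F) - S'.comp (covFst E F))

theorem blockTensor_apply (T : (E →L[ℝ] ℝ) →L[ℝ] E) (S : (F →L[ℝ] ℝ) →L[ℝ] E)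
    (S' : (E →L[ℝ] ℝ) →L[ℝ] F) (T' : (F →L[ℝ] ℝ) →L[ℝ] F) (α : E × F →L[ℝ] ℝ) :
    blockTensor T S S' T' α = (T (covFst E F α) + S (covSnd E F α),
      T' (covSnd E F α) - S' (covFst E F α)) := by
  simp [blockTensor]

theorem contDiffOn_blockTensor {X : Type*} [NormedAddCommGroup X] [NormedSpace ℝ X] {s : Set X}
    {T : X → (E →L[ℝ] ℝ) →L[ℝ] E} {S : X → (F →L[ℝ] ℝ) →L[ℝ] E} {S' : X → (E →L[ℝ] ℝ) →L[ℝ] F}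
    {T' : X → (F →L[ℝ] ℝ) →L[ℝ] F} (hT : ContDiffOn ℝ ∞ T s) (hS : ContDiffOn ℝ ∞ S s)
    (hS' : ContDiffOn ℝ ∞ S' s) (hT' : ContDiffOn ℝ ∞ T' s) :
    ContDiffOn ℝ ∞ (fun x => blockTensor (T x) (S x) (S' x) (T' x)) s :=
  (contDiffOn_const.clm_comp ((hT.clm_comp contDiffOn_const).add (hS.clm_comp contDiffOn_const))).add
    (contDiffOn_const.clm_comp
      ((hT'.clm_comp contDiffOn_const).sub (hS'.clm_comp contDiffOn_const)))

variable {M : Type*} [TopologicalSpace M] [ChartedSpace E M] [IsManifold 𝓘(ℝ, E) ∞ M]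
  {Q : Type*} [TopologicalSpace Q] [ChartedSpace F Q] [IsManifold 𝓘(ℝ, F) ∞ Q]
  (R : FibreFam E M) (B : BaseFam F Q) (C : ℝ)

/-- The weight `C ρ + f div Y` of the base part. Its second term makes up for the divergence of
`J∇f ⊗ Y` along the fibre; the first one, which does not depend on the base, is there for
positivity. -/
def weight (x : M × Q) (y : E × F) : ℝ :=
  C * R.D.ρ x.1 y.1 + loc F B.f x.2 y.2 * divg (R.Y x.1) y.1

/-- The complex structure of the fibre. -/
def fibreJ (x : M × Q) (y : E × F) : E →L[ℝ] E := quat (B.av x.2 y.2) fun l => R.K l x.1 y.1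

/-- The bivector density on the product. Its diagonal blocks are the bivector densities of the
metrics on the fibre and on the base, with weights, and its mixed part is
`J∇f ⊗ Y - ∑ (aₗ ∇f - f ∇aₗ) ⊗ Kₗ Y`. -/
def lam (x : M × Q) (y : E × F) : (E × F →L[ℝ] ℝ) →L[ℝ] E × F :=
  blockTensor (B.pot x.2 y.2 • (fibreJ R B x y).comp (R.D.G x.1 y.1))
    (rankOne (B.rotGrad x.2 y.2) (R.Y x.1 y.1)
      - ∑ l, rankOne (B.wronsk l x.2 y.2) (R.K l x.1 y.1 (R.Y x.1 y.1)))
    (rankOne (R.Y x.1 y.1) (B.rotGrad x.2 y.2)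
      - ∑ l, rankOne (R.K l x.1 y.1 (R.Y x.1 y.1)) (B.wronsk l x.2 y.2))
    (weight R B C x y • (B.J x.2 y.2).comp (B.D.G x.2 y.2))

theorem lam_apply (x : M × Q) (y : E × F) (α : E × F →L[ℝ] ℝ) :
    lam R B C x y α =
      (B.pot x.2 y.2 • fibreJ R B x y (R.D.G x.1 y.1 (covFst E F α))
        + (covSnd E F α (B.rotGrad x.2 y.2) • R.Y x.1 y.1
          - ∑ l, covSnd E F α (B.wronsk l x.2 y.2) • R.K l x.1 y.1 (R.Y x.1 y.1)),
       weight R B C x y • B.J x.2 y.2 (B.D.G x.2 y.2 (covSnd E F α))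
        - (covFst E F α (R.Y x.1 y.1) • B.rotGrad x.2 y.2
          - ∑ l, covFst E F α (R.K l x.1 y.1 (R.Y x.1 y.1)) • B.wronsk l x.2 y.2)) := by
  rw [lam, blockTensor_apply]
  simp only [_root_.sub_apply, _root_.sum_apply, rankOne_apply, _root_.smul_apply,
    ContinuousLinearMap.comp_apply]

variable {R B C} [ChartedSpace (E × F) (M × Q)]

theorem smoothFam_fst (hch : IsProdAtlas E M F Q) {W : Type*} [NormedAddCommGroup W]
    [NormedSpace ℝ W] {s : M → E → W} (hs : SmoothFam s) :
    SmoothFam (V := E × F) (P := M × Q) fun x y => s x.1 y.1 := fun x =>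
  (hs x.1).comp contDiff_fst.contDiffOn fun _ hy => (hch.mem_target.1 hy).1

theorem smoothFam_snd (hch : IsProdAtlas E M F Q) {W : Type*} [NormedAddCommGroup W]
    [NormedSpace ℝ W] {s : Q → F → W} (hs : SmoothFam s) :
    SmoothFam (V := E × F) (P := M × Q) fun x y => s x.2 y.2 := fun x =>
  (hs x.2).comp contDiff_snd.contDiffOn fun _ hy => (hch.mem_target.1 hy).2

theorem smoothFam_lam (hch : IsProdAtlas E M F Q) : SmoothFam (lam R B C) := fun x => by
  have hY := smoothFam_fst hch R.Y_smooth x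
  have hK := fun l => smoothFam_fst hch (R.K_smooth l) x
  have hN := smoothFam_snd hch B.rotGrad_smooth x
  have hU := fun l => smoothFam_snd hch (B.wronsk_smooth l) x
  refine contDiffOn_blockTensor ?_ ?_ ?_ ?_
  · refine (smoothFam_snd hch B.pot_smooth x).smul (ContDiffOn.clm_comp ?_
      (smoothFam_fst hch R.D.G_smooth x))
    exact ContDiffOn.sum (s := Finset.univ) fun l _ =>
      (smoothFam_snd hch (B.a_smooth l) x).smul (hK l)
  · exact (contDiffOn_rankOne hN hY).sub
      (ContDiffOn.sum fun l _ => contDiffOn_rankOne (hU l) ((hK l).clm_apply hY))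
  · exact (contDiffOn_rankOne hY hN).sub
      (ContDiffOn.sum fun l _ => contDiffOn_rankOne ((hK l).clm_apply hY) (hU l))
  · have hw : ContDiffOn ℝ ∞ (weight R B C x) (chartAt (E × F) x).target :=
      (contDiffOn_const.mul (smoothFam_fst hch R.D.ρ_smooth x)).add
        ((smoothFam_snd hch B.f_smooth x).mul (smoothFam_fst hch R.Y_smooth.divg x))
    exact hw.smul ((smoothFam_snd hch B.J_smooth x).clm_comp (smoothFam_snd hch B.D.G_smooth x))

variable [IsManifold 𝓘(ℝ, E × F) ∞ (M × Q)]

/-- Each block is the product of a density on the fibre and a density on the base, and the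
Jacobian determinant of a product of coordinate changes is the product of the determinants. -/
theorem isCoDens_lam (hch : IsProdAtlas E M F Q) : IsCoDens (lam R B C) := fun x₀ x₁ y hy α => by
  obtain ⟨h1, h2⟩ := hch.mem_coordDom.1 hy
  rw [hch.jac hy, cdet_prodMap, abs_mul, hch.coordCh]
  obtain ⟨A, hA⟩ : ∃ A, A = jac E x₀.1 x₁.1 y.1 := ⟨_, rfl⟩
  obtain ⟨A', hA'⟩ : ∃ A', A' = jac F x₀.2 x₁.2 y.2 := ⟨_, rfl⟩
  have hG := R.D.G_dens _ _ _ h1 (covFst E F α)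
  have hG' := (B.J_end.coDens B.D.G_dens) _ _ _ h2 (covSnd E F α)
  simp only [ContinuousLinearMap.comp_apply] at hG'
  have hK := fun l v => R.K_end l _ _ _ h1 v
  have hY := R.Y_dens _ _ _ h1
  have hN := B.rotGrad_dens _ _ _ h2
  have hU := fun l => B.wronsk_dens l _ _ _ h2
  have ha : B.av x₀.2 y.2 = B.av x₁.2 (coordCh F x₀.2 x₁.2 y.2) :=
    funext fun l => isFun_loc (B.a l) _ _ _ h2
  have hf := isFun_loc B.f _ _ _ h2
  have hρ := R.D.ρ_dens _ _ _ h1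
  have hdiv : divg (R.Y x₀.1) y.1 = _ * divg (R.Y x₁.1) (coordCh E x₀.1 x₁.1 y.1) := (R.Y_dens.divg R.Y_smooth) _ _ _ h1
  have hp := B.pot_dens _ _ _ h2
  rw [← hA] at hG hY hdiv hρ
  rw [← hA'] at hG' hN hp
  simp only [← hA, ← hA'] at hK hU ⊢
  rw [lam_apply, lam_apply, covFst_comp, covSnd_comp]
  rw [prodMap_mk, Prod.smul_mk, Prod.mk.injEq]
  constructor
  · simp only [map_add, map_sub, map_smul, map_sum, fibreJ, quat, _root_.sum_apply,
      _root_.smul_apply, hK, hG, hY, hp, ContinuousLinearMap.comp_apply, hN, hU, ha, smul_eq_mul,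
      Prod.map_fst, Prod.map_snd]
    simp only [Fin.sum_univ_three]
    module
  · simp only [map_add, map_sub, map_smul, map_sum, weight, hG', hK, hY,
      ContinuousLinearMap.comp_apply, hN, hU, hf, hρ, hdiv, smul_eq_mul, Prod.map_fst,
      Prod.map_snd]
    simp only [Fin.sum_univ_three]
    module

end Tensor

/-! ### Invariance and divergence of the bivector density -/
section Product

variable {E : Type*} [NormedAddCommGroup E] [NormedSpace ℝ E] [FiniteDimensional ℝ E]
  {F : Type*} [NormedAddCommGroup F] [NormedSpace ℝ F] [FiniteDimensional ℝ F]
  {M : Type*} [TopologicalSpace M] [ChartedSpace E M] [IsManifold 𝓘(ℝ, E) ∞ M]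
  {Q : Type*} [TopologicalSpace Q] [ChartedSpace F Q] [IsManifold 𝓘(ℝ, F) ∞ Q]
  {R : FibreFam E M} {B : BaseFam F Q} {C : ℝ} {x : M × Q} {y : E × F}

theorem fibreJ_sq (h1 : y.1 ∈ (chartAt E x.1).target) (v : E) :
    fibreJ R B x y (fibreJ R B x y v) = -v :=
  (R.isQuat x.1 y.1 h1).quat_sq (B.sum_av_sq x.2 y.2) v

theorem K_G (h1 : y.1 ∈ (chartAt E x.1).target) (l : Fin 3) (β : E →L[ℝ] ℝ) :
    R.K l x.1 y.1 (R.D.G x.1 y.1 β) = -R.D.G x.1 y.1 (β.comp (R.K l x.1 y.1)) :=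
  (R.compat l).G_comp (fun x₀ y hy v => (R.isQuat x₀ y hy).sq l v) h1 β

theorem fibreJ_G (h1 : y.1 ∈ (chartAt E x.1).target) (β : E →L[ℝ] ℝ) :
    fibreJ R B x y (R.D.G x.1 y.1 β) = -R.D.G x.1 y.1 (β.comp (fibreJ R B x y)) := by
  have h : β.comp (fibreJ R B x y)
      = ∑ l, B.av x.2 y.2 l • β.comp (R.K l x.1 y.1) := by
    ext v
    simp only [fibreJ, quat, ContinuousLinearMap.comp_apply, _root_.sum_apply, _root_.smul_apply,
      map_sum, map_smul]
  rw [h, map_sum, fibreJ, quat, _root_.sum_apply, ← Finset.sum_neg_distrib]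
  refine Finset.sum_congr rfl fun l _ => ?_
  rw [_root_.smul_apply, K_G h1, map_smul, smul_neg]

theorem fibreJ_skew (h1 : y.1 ∈ (chartAt E x.1).target) (β γ : E →L[ℝ] ℝ) :
    β (fibreJ R B x y (R.D.G x.1 y.1 γ)) = -γ (fibreJ R B x y (R.D.G x.1 y.1 β)) := by
  have h2 : β (fibreJ R B x y (R.D.G x.1 y.1 γ))
      = (β.comp (fibreJ R B x y)) (R.D.G x.1 y.1 γ) := rfl
  rw [h2, R.D.G_symm h1, fibreJ_G h1 β, map_neg, neg_neg]

theorem lam_skew (h1 : y.1 ∈ (chartAt E x.1).target) (h2 : y.2 ∈ (chartAt F x.2).target)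
    (α α' : E × F →L[ℝ] ℝ) : α (lam R B C x y α') = -α' (lam R B C x y α) := by
  rw [apply_eq_cov, apply_eq_cov α', lam_apply, lam_apply]
  simp only [map_add, map_sub, map_smul, map_sum, smul_eq_mul]
  rw [fibreJ_skew h1 (covFst E F α), B.J_skew h2 (covSnd E F α)]
  simp only [Fin.sum_univ_three]
  ring

/-- The mixed part of the bivector density is invariant. -/
theorem mixed_inv (h1 : y.1 ∈ (chartAt E x.1).target) (h2 : y.2 ∈ (chartAt F x.2).target)
    (γ : F →L[ℝ] ℝ) :
    fibreJ R B x y (γ (B.J x.2 y.2 (B.rotGrad x.2 y.2)) • R.Y x.1 y.1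
        - ∑ l, γ (B.J x.2 y.2 (B.wronsk l x.2 y.2)) • R.K l x.1 y.1 (R.Y x.1 y.1))
      = γ (B.rotGrad x.2 y.2) • R.Y x.1 y.1
        - ∑ l, γ (B.wronsk l x.2 y.2) • R.K l x.1 y.1 (R.Y x.1 y.1) :=
  (R.isQuat x.1 y.1 h1).quat_mixed (B.sum_av_sq x.2 y.2) (B.J_rotGrad h2) (B.J_wronsk h2) _ γ

theorem mixed_inv' (h1 : y.1 ∈ (chartAt E x.1).target) (h2 : y.2 ∈ (chartAt F x.2).target)
    (β : E →L[ℝ] ℝ) :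
    B.J x.2 y.2 (β (fibreJ R B x y (R.Y x.1 y.1)) • B.rotGrad x.2 y.2
        - ∑ l, β (fibreJ R B x y (R.K l x.1 y.1 (R.Y x.1 y.1))) • B.wronsk l x.2 y.2)
      = β (R.Y x.1 y.1) • B.rotGrad x.2 y.2
        - ∑ l, β (R.K l x.1 y.1 (R.Y x.1 y.1)) • B.wronsk l x.2 y.2 := by
  refine eq_of_forall_covector fun γ => ?_
  have h := congrArg β (mixed_inv (R := R) (B := B) h1 h2 γ)
  simp only [map_sub, map_smul, map_sum, smul_eq_mul, Fin.sum_univ_three, map_add] at h ⊢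
  linarith

/-- The bivector density is invariant under the complex structure of the product. -/
theorem lam_inv (h1 : y.1 ∈ (chartAt E x.1).target) (h2 : y.2 ∈ (chartAt F x.2).target)
    (α : E × F →L[ℝ] ℝ) :
    ((fibreJ R B x y).prodMap (B.J x.2 y.2))
      (lam R B C x y (α.comp ((fibreJ R B x y).prodMap (B.J x.2 y.2)))) = lam R B C x y α := by
  have g1 := fibreJ_G (R := R) (B := B) h1 (covFst E F α)
  have g2 := B.compat.G_comp B.J_sq h2 (covSnd E F α)
  rw [← neg_eq_iff_eq_neg] at g1 g2
  rw [lam_apply, lam_apply, covFst_comp, covSnd_comp, ← g1, ← g2]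
  simp only [ContinuousLinearMap.comp_apply]
  rw [prodMap_mk, Prod.mk.injEq, map_add, mixed_inv h1 h2, map_smul, map_neg, map_neg, fibreJ_sq h1,
    neg_neg, map_sub, mixed_inv' h1 h2, map_smul, map_neg, map_neg, B.J_sq _ _ h2, neg_neg]
  exact ⟨rfl, rfl⟩

/-- The divergence of the first component of the bivector density along the fibre. -/
theorem divg_lam_fst (h1 : y.1 ∈ (chartAt E x.1).target) (α : E × F →L[ℝ] ℝ) :
    divg (fun p => (lam R B C x (p, y.2) α).1) y.1
      = covSnd E F α (B.rotGrad x.2 y.2) * divg (R.Y x.1) y.1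
        - B.pot x.2 y.2 * covFst E F α (fibreJ R B x y (R.Y x.1 y.1)) := by
  have hKG : ∀ l, DifferentiableAt ℝ (fun p => R.K l x.1 p (R.D.G x.1 p (covFst E F α))) y.1 :=
    fun l => ((R.K_smooth l).differentiableAt h1).clm_apply
      ((R.D.G_smooth.differentiableAt h1).clm_apply (differentiableAt_const _))
  have hKY : ∀ l, DifferentiableAt ℝ (fun p => R.K l x.1 p (R.Y x.1 p)) y.1 := fun l =>
    ((R.K_smooth l).differentiableAt h1).clm_apply (R.Y_smooth.differentiableAt h1)
  have hY := R.Y_smooth.differentiableAt h1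
  have e : (fun p => (lam R B C x (p, y.2) α).1) = fun p =>
      (B.pot x.2 y.2 • ∑ l, B.av x.2 y.2 l • R.K l x.1 p (R.D.G x.1 p (covFst E F α)))
        + (covSnd E F α (B.rotGrad x.2 y.2) • R.Y x.1 p
          - ∑ l, covSnd E F α (B.wronsk l x.2 y.2) • R.K l x.1 p (R.Y x.1 p)) := by
    ext1 p
    rw [lam_apply]
    simp only [fibreJ, quat, _root_.sum_apply, _root_.smul_apply]
  have hA : DifferentiableAt ℝ (fun p => ∑ l, B.av x.2 y.2 l •
      R.K l x.1 p (R.D.G x.1 p (covFst E F α))) y.1 :=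
    DifferentiableAt.fun_sum fun l _ => (hKG l).const_smul _
  have hA2 : DifferentiableAt ℝ (fun p => ∑ l, covSnd E F α (B.wronsk l x.2 y.2) •
      R.K l x.1 p (R.Y x.1 p)) y.1 := DifferentiableAt.fun_sum fun l _ => (hKY l).const_smul _
  have d1 := divg_sum Finset.univ (W := fun l p => B.av x.2 y.2 l •
      R.K l x.1 p (R.D.G x.1 p (covFst E F α))) fun l _ => (hKG l).const_smul _
  have d2 := divg_sum Finset.univ (W := fun l p => covSnd E F α (B.wronsk l x.2 y.2) •
      R.K l x.1 p (R.Y x.1 p)) fun l _ => (hKY l).const_smul _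
  have d3 : ∀ l, divg (fun p => B.av x.2 y.2 l • R.K l x.1 p (R.D.G x.1 p (covFst E F α))) y.1
      = B.av x.2 y.2 l * -covFst E F α (R.K l x.1 y.1 (R.Y x.1 y.1)) := fun l => by
    rw [divg_const_smul (W := fun p => R.K l x.1 p (R.D.G x.1 p (covFst E F α))) (hKG l),
      R.div_K l x.1 y.1 h1]
  have d4 : ∀ l, divg (fun p => covSnd E F α (B.wronsk l x.2 y.2) • R.K l x.1 p (R.Y x.1 p)) y.1
      = 0 := fun l => by
    rw [divg_const_smul (W := fun p => R.K l x.1 p (R.Y x.1 p)) (hKY l), R.div_K_Y l x.1 y.1 h1,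
      mul_zero]
  rw [e, divg_add (W := fun p => B.pot x.2 y.2 • ∑ l, B.av x.2 y.2 l •
      R.K l x.1 p (R.D.G x.1 p (covFst E F α)))
      (W' := fun p => covSnd E F α (B.rotGrad x.2 y.2) • R.Y x.1 p
        - ∑ l, covSnd E F α (B.wronsk l x.2 y.2) • R.K l x.1 p (R.Y x.1 p))
      (hA.const_smul _) ((hY.const_smul _).sub hA2),
    divg_const_smul (W := fun p => ∑ l, B.av x.2 y.2 l •
      R.K l x.1 p (R.D.G x.1 p (covFst E F α))) hA, d1,
    divg_sub (W := fun p => covSnd E F α (B.rotGrad x.2 y.2) • R.Y x.1 p)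
      (W' := fun p => ∑ l, covSnd E F α (B.wronsk l x.2 y.2) • R.K l x.1 p (R.Y x.1 p))
      (hY.const_smul _) hA2, d2, divg_const_smul (W := R.Y x.1) hY]
  simp only [d3, d4, fibreJ, quat, _root_.sum_apply, _root_.smul_apply, map_sum, map_smul,
    smul_eq_mul, Fin.sum_univ_three, _root_.add_apply, map_add]
  ring

/-- The divergence of the second component of the bivector density along the base. -/
theorem divg_lam_snd (h2 : y.2 ∈ (chartAt F x.2).target) (α : E × F →L[ℝ] ℝ) :
    divg (fun q => (lam R B C x (y.1, q) α).2) y.2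
      = B.pot x.2 y.2 * covFst E F α (fibreJ R B x y (R.Y x.1 y.1))
        - covSnd E F α (B.rotGrad x.2 y.2) * divg (R.Y x.1) y.1 := by
  have hJG : DifferentiableAt ℝ (fun q => B.J x.2 q (B.D.G x.2 q (covSnd E F α))) y.2 :=
    (B.J_smooth.differentiableAt h2).clm_apply
      ((B.D.G_smooth.differentiableAt h2).clm_apply (differentiableAt_const _))
  have hN := B.rotGrad_smooth.differentiableAt h2
  have hU := fun l => (B.wronsk_smooth l).differentiableAt h2
  have hf := B.f_smooth.differentiableAt h2
  have hw : HasFDerivAt (fun q => weight R B C x (y.1, q))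
      (divg (R.Y x.1) y.1 • fderiv ℝ (loc F B.f x.2) y.2) y.2 :=
    (hf.hasFDerivAt.mul_const (divg (R.Y x.1) y.1)).const_add (C * R.D.ρ x.1 y.1)
  have e : (fun q => (lam R B C x (y.1, q) α).2) = fun q =>
      weight R B C x (y.1, q) • B.J x.2 q (B.D.G x.2 q (covSnd E F α))
        - (covFst E F α (R.Y x.1 y.1) • B.rotGrad x.2 q
          - ∑ l, covFst E F α (R.K l x.1 y.1 (R.Y x.1 y.1)) • B.wronsk l x.2 q) := by
    ext1 q
    rw [lam_apply]
  have hA : DifferentiableAt ℝ (fun q => ∑ l, covFst E F α (R.K l x.1 y.1 (R.Y x.1 y.1)) •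
      B.wronsk l x.2 q) y.2 := DifferentiableAt.fun_sum fun l _ => (hU l).const_smul _
  have d1 := divg_sum Finset.univ (W := fun l q => covFst E F α (R.K l x.1 y.1 (R.Y x.1 y.1)) •
      B.wronsk l x.2 q) fun l _ => (hU l).const_smul _
  have d2 : ∀ l, divg (fun q => covFst E F α (R.K l x.1 y.1 (R.Y x.1 y.1)) • B.wronsk l x.2 q) y.2
      = covFst E F α (R.K l x.1 y.1 (R.Y x.1 y.1)) * (B.av x.2 y.2 l * B.pot x.2 y.2) := fun l => by
    rw [divg_const_smul (W := B.wronsk l x.2) (hU l), B.div_wronsk h2]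
  have d3 := B.J_skew h2 (fderiv ℝ (loc F B.f x.2) y.2) (covSnd E F α)
  rw [e, divg_sub (W := fun q => weight R B C x (y.1, q) • B.J x.2 q (B.D.G x.2 q (covSnd E F α)))
      (W' := fun q => covFst E F α (R.Y x.1 y.1) • B.rotGrad x.2 q
        - ∑ l, covFst E F α (R.K l x.1 y.1 (R.Y x.1 y.1)) • B.wronsk l x.2 q)
      (hw.differentiableAt.smul hJG) ((hN.const_smul _).sub hA),
    divg_smul (u := fun q => weight R B C x (y.1, q)) 
      (W := fun q => B.J x.2 q (B.D.G x.2 q (covSnd E F α))) hw.differentiableAt hJG, hw.fderiv,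
    B.div_J x.2 y.2 h2,
    divg_sub (W := fun q => covFst E F α (R.Y x.1 y.1) • B.rotGrad x.2 q)
      (W' := fun q => ∑ l, covFst E F α (R.K l x.1 y.1 (R.Y x.1 y.1)) • B.wronsk l x.2 q)
      (hN.const_smul _) hA, d1,
    divg_const_smul (W := B.rotGrad x.2) hN, B.div_rotGrad h2, _root_.smul_apply, d3]
  simp only [d2, fibreJ, quat, _root_.sum_apply, _root_.smul_apply, map_sum, map_smul,
    smul_eq_mul, Fin.sum_univ_three, _root_.add_apply, map_add, BaseFam.rotGrad]
  ring

variable [ChartedSpace (E × F) (M × Q)]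

/-- The bivector density is divergence free. -/
theorem divg_lam (hch : IsProdAtlas E M F Q) (hy : y ∈ (chartAt (E × F) x).target)
    (α : E × F →L[ℝ] ℝ) : divg (fun z => lam R B C x z α) y = 0 := by
  obtain ⟨h1, h2⟩ := hch.mem_target.1 hy
  have hd : DifferentiableAt ℝ (fun z => lam R B C x z α) y :=
    ((((smoothFam_lam hch x).contDiffAt ((chartAt (E × F) x).open_target.mem_nhds
      hy)).differentiableAt infty_ne_zero)).clm_apply (differentiableAt_const _)
  rw [divg_prod hd, divg_lam_fst h1, divg_lam_snd h2]
  ring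

end Product

/-- A weighted inequality between arithmetic and geometric means. The weight `1 / 8` allows four
such terms, for `Y` and the three fields `Kₗ Y`, to be absorbed by half of `s`. -/
theorem abs_two_mul_le {x s t : ℝ} (hs : 0 ≤ s) (ht : 0 ≤ t) (h : x ^ 2 ≤ s * t) :
    |2 * x| ≤ s / 8 + 8 * t := by
  refine abs_le_of_sq_le_sq ?_ (by positivity)
  nlinarith [sq_nonneg (s / 8 - 8 * t)]

/-! ### Definiteness of the bivector density -/
section Product

variable {E : Type*} [NormedAddCommGroup E] [NormedSpace ℝ E] [FiniteDimensional ℝ E]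
  {F : Type*} [NormedAddCommGroup F] [NormedSpace ℝ F] [FiniteDimensional ℝ F]
  {M : Type*} [TopologicalSpace M] [ChartedSpace E M] [IsManifold 𝓘(ℝ, E) ∞ M]
  {Q : Type*} [TopologicalSpace Q] [ChartedSpace F Q] [IsManifold 𝓘(ℝ, F) ∞ Q]
  {R : FibreFam E M} {B : BaseFam F Q} {C : ℝ} {x : M × Q} {y : E × F}

/-- The quadratic form defined by the bivector density and the complex structure. -/
theorem lam_pairing (h1 : y.1 ∈ (chartAt E x.1).target) (h2 : y.2 ∈ (chartAt F x.2).target)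
    (α : E × F →L[ℝ] ℝ) :
    α (((fibreJ R B x y).prodMap (B.J x.2 y.2)) (lam R B C x y α))
      = -(B.pot x.2 y.2 * covFst E F α (R.D.G x.1 y.1 (covFst E F α))
        + weight R B C x y * covSnd E F α (B.D.G x.2 y.2 (covSnd E F α))
        + 2 * (covFst E F α (R.Y x.1 y.1) * covSnd E F α (B.J x.2 y.2 (B.rotGrad x.2 y.2))
          - ∑ l, covFst E F α (R.K l x.1 y.1 (R.Y x.1 y.1))
            * covSnd E F α (B.J x.2 y.2 (B.wronsk l x.2 y.2)))) := by
  have hm := congrArg (fibreJ R B x y) (mixed_inv (R := R) (B := B) h1 h2 (covSnd E F α))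
  rw [fibreJ_sq h1] at hm
  rw [lam_apply, prodMap_mk, apply_eq_cov]
  simp only
  rw [map_add (fibreJ R B x y), ← hm, map_smul, fibreJ_sq h1, map_sub (B.J x.2 y.2),
    map_smul (B.J x.2 y.2), B.J_sq x.2 y.2 h2]
  simp only [map_add, map_sub, map_smul, map_sum, map_neg, smul_eq_mul, Fin.sum_univ_three]
  ring

variable (R B) in
/-- A large multiple of the bivector density of the base makes the bivector density of the product
definite: the mixed part is controlled by the Cauchy–Schwarz inequality. -/
theorem exists_lam_definite [CompactSpace M] [CompactSpace Q] :
    ∃ C : ℝ, ∀ (x : M × Q) (y : E × F), y.1 ∈ (chartAt E x.1).target →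
      y.2 ∈ (chartAt F x.2).target → ∀ α : E × F →L[ℝ] ℝ, α ≠ 0 →
      α (((fibreJ R B x y).prodMap (B.J x.2 y.2)) (lam R B C x y α)) < 0 := by
  obtain ⟨k0, hk0, H0⟩ := R.D.exists_sq_le R.Y_dens R.Y_smooth
  have hKY := fun l => R.D.exists_sq_le ((R.K_end l).vecDens R.Y_dens)
    (fun x₀ => (R.K_smooth l x₀).clm_apply (R.Y_smooth x₀))
  choose k hk H using hKY
  obtain ⟨e0, he0, L0⟩ := B.D.exists_sq_le (B.J_end.vecDens B.rotGrad_dens)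
    (fun x₀ => (B.J_smooth x₀).clm_apply (B.rotGrad_smooth x₀))
  have hJU := fun l => B.D.exists_sq_le (B.J_end.vecDens (B.wronsk_dens l))
    (fun x₀ => (B.J_smooth x₀).clm_apply (B.wronsk_smooth l x₀))
  choose e he L using hJU
  obtain ⟨c, hc, Hc⟩ := B.D.ρ_dens.exists_le (fun x₀ => (B.D.ρ_smooth x₀).continuousOn)
    B.pot_dens (fun x₀ => (B.pot_smooth x₀).continuousOn) (fun _ _ hy => B.pot_pos hy)
  obtain ⟨m, hm, Hm⟩ := exists_bound_of_compact (isFun_loc B.f)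
    (fun x₀ => (B.f_smooth x₀).continuousOn)
  obtain ⟨d, hd, Hd⟩ := (R.Y_dens.divg R.Y_smooth).exists_le
    (fun x₀ => (R.Y_smooth.divg x₀).continuousOn) R.D.ρ_dens
    (fun x₀ => (R.D.ρ_smooth x₀).continuousOn) R.D.ρ_pos
  obtain ⟨A, hA⟩ : ∃ A, A = k0 * e0 * c + ∑ l, k l * e l * c := ⟨_, rfl⟩
  have hnn : ∀ l, 0 ≤ k l * e l * c := fun l => by have := hk l; have := he l; positivity
  have hnn0 : 0 ≤ k0 * e0 * c := by positivity
  have hA0 : k0 * e0 * c ≤ A := by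
    rw [hA]; exact le_add_of_nonneg_right (Finset.sum_nonneg fun l _ => hnn l)
  have hAl : ∀ l, k l * e l * c ≤ A := fun l => by
    rw [hA]
    exact (Finset.single_le_sum (f := fun l => k l * e l * c) (fun l _ => hnn l)
      (Finset.mem_univ l)).trans (le_add_of_nonneg_left hnn0)
  -- four mixed terms with constant `8 A`, and `m d` for the term `f div Y` of the weight
  refine ⟨32 * A + m * d + 1, fun x y h1 h2 α hα => ?_⟩
  rw [lam_pairing h1 h2, neg_lt_zero]
  set β := covFst E F α with hβ
  set γ := covSnd E F α with hγ
  have hρ := R.D.ρ_pos x.1 y.1 h1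
  have hρ' := B.D.ρ_pos x.2 y.2 h2
  have hp := B.pot_pos h2
  have hg := R.D.G_nonneg h1 β
  have hg' := B.D.G_nonneg h2 γ
  have hcp : B.D.ρ x.2 y.2 ≤ c * B.pot x.2 y.2 := (le_abs_self _).trans (Hc x.2 y.2 h2)
  -- each mixed term is dominated by the diagonal ones
  have key : ∀ u v κ ε : ℝ, 0 < κ → 0 < ε → κ * ε * c ≤ A →
      u ^ 2 ≤ κ * R.D.ρ x.1 y.1 * β (R.D.G x.1 y.1 β) →
      v ^ 2 ≤ ε * B.D.ρ x.2 y.2 * γ (B.D.G x.2 y.2 γ) →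
      |2 * (u * v)| ≤ B.pot x.2 y.2 * β (R.D.G x.1 y.1 β) / 8
        + 8 * (A * R.D.ρ x.1 y.1 * γ (B.D.G x.2 y.2 γ)) := by
    intro u v κ ε hκ hε hle hu hv
    refine abs_two_mul_le (by positivity)
      (mul_nonneg (mul_nonneg (hnn0.trans hA0) hρ.le) hg') ?_
    calc (u * v) ^ 2 = u ^ 2 * v ^ 2 := mul_pow _ _ _
      _ ≤ (κ * R.D.ρ x.1 y.1 * β (R.D.G x.1 y.1 β))
          * (ε * (c * B.pot x.2 y.2) * γ (B.D.G x.2 y.2 γ)) := by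
        refine mul_le_mul hu (hv.trans ?_) (sq_nonneg _) (by positivity)
        gcongr
      _ = (κ * ε * c) * (R.D.ρ x.1 y.1 * β (R.D.G x.1 y.1 β) * B.pot x.2 y.2
          * γ (B.D.G x.2 y.2 γ)) := by ring
      _ ≤ A * (R.D.ρ x.1 y.1 * β (R.D.G x.1 y.1 β) * B.pot x.2 y.2
          * γ (B.D.G x.2 y.2 γ)) := by gcongr
      _ = _ := by ring
  have t0 := key _ _ _ _ hk0 he0 hA0 (H0 x.1 y.1 h1 β) (L0 x.2 y.2 h2 γ)
  have tl := fun l => key _ _ _ _ (hk l) (he l) (hAl l) (H l x.1 y.1 h1 β) (L l x.2 y.2 h2 γ)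
  have tw : -(m * d * R.D.ρ x.1 y.1) ≤ loc F B.f x.2 y.2 * divg (R.Y x.1) y.1 := by
    refine neg_le_of_abs_le ?_
    rw [abs_mul, mul_assoc]
    exact mul_le_mul (Hm x.2 y.2 h2) (Hd x.1 y.1 h1) (abs_nonneg _) hm.le
  have hw : (32 * A + 1) * R.D.ρ x.1 y.1 ≤ weight R B (32 * A + m * d + 1) x y := by
    rw [weight]; linarith
  have hw' := mul_le_mul_of_nonneg_right hw hg'
  have hpos : 0 < B.pot x.2 y.2 * β (R.D.G x.1 y.1 β) / 2
      + R.D.ρ x.1 y.1 * γ (B.D.G x.2 y.2 γ) := by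
    by_cases hβ0 : β = 0
    · have hγ0 : γ ≠ 0 := by
        intro hγ0
        refine hα (ContinuousLinearMap.ext fun v => ?_)
        rw [apply_eq_cov, ← hβ, ← hγ, hβ0, hγ0]
        simp
      have := mul_pos hρ (B.D.G_pos h2 hγ0)
      have := mul_nonneg hp.le hg
      linarith
    · have := mul_pos hp (R.D.G_pos h1 hβ0)
      have := mul_nonneg hρ.le hg'
      linarith
  rw [Fin.sum_univ_three]
  have a0 := (abs_le.1 t0).1
  have a1 := (abs_le.1 (tl 0)).2
  have a2 := (abs_le.1 (tl 1)).2
  have a3 := (abs_le.1 (tl 2)).2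
  linarith

end Product

/-! ### Balanced metrics on the product -/
section Product

variable {E : Type*} [NormedAddCommGroup E] [NormedSpace ℝ E] [FiniteDimensional ℝ E]
  {F : Type*} [NormedAddCommGroup F] [NormedSpace ℝ F] [FiniteDimensional ℝ F]
  {M : Type*} [TopologicalSpace M] [ChartedSpace E M] [IsManifold 𝓘(ℝ, E) ∞ M]
  {Q : Type*} [TopologicalSpace Q] [ChartedSpace F Q] [IsManifold 𝓘(ℝ, F) ∞ Q]
  [ChartedSpace (E × F) (M × Q)] [IsManifold 𝓘(ℝ, E × F) ∞ (M × Q)]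

/-- In complex dimension at least two, the root of the bivector density `lam` is a balanced metric
on the product. -/
theorem exists_isBalancedMetric_prod [CompactSpace M] [CompactSpace Q] (R : FibreFam E M)
    (B : BaseFam F Q) (hch : IsProdAtlas E M F Q) {m : ℕ} (hm : m ≠ 0)
    (hdim : finrank ℝ (E × F) = 2 * (m + 1)) (J : M × Q → E × F →L[ℝ] E × F)
    (hJ : ∀ x, J x = (fibreJ R B x (chartAt (E × F) x x)).prodMap
      (B.J x.2 (chartAt (E × F) x x).2)) :
    ∃ ξ : Form 𝓘(ℝ, E × F) (M × Q) 2,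
      IsBalancedMetric (I := 𝓘(ℝ, E × F)) (P := M × Q) J (m + 1) ξ := by
  obtain ⟨C, hC⟩ := exists_lam_definite R B
  have hx := fun x : M × Q => hch.mem_target.1 (mem_chart_target (E × F) x)
  refine exists_isBalancedMetric hm hdim J (fun x v => ?_) (smoothFam_lam (R := R) (B := B) (C := C) hch)
    (isCoDens_lam hch) (fun x₀ y hy α α' => ?_) (fun x α => ?_) (fun x α hα => ?_) (fun x α => ?_)
  · rw [hJ x]
    exact Prod.ext (fibreJ_sq (hx x).1 v.1) (B.J_sq _ _ (hx x).2 v.2)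
  · exact lam_skew (hch.mem_target.1 hy).1 (hch.mem_target.1 hy).2 α α'
  · rw [hJ x]
    exact lam_inv (hx x).1 (hx x).2 α
  · rw [hJ x]
    exact hC x _ (hx x).1 (hx x).2 α hα
  · exact divg_lam hch (mem_chart_target (E × F) x) α

/-- On a product with a zero-dimensional manifold, positive forms can be pulled back from the other
factor. In complex dimension one there is no differential condition. -/
theorem exists_isBalancedMetric_of_subsingleton [Subsingleton E] (hch : IsProdAtlas E M F Q)
    {JQ : EndField 𝓘(ℝ, F) Q} {ξQ : Form 𝓘(ℝ, F) Q 2} (hξ : IsBalancedMetric JQ 1 ξQ)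
    (J : M × Q → E × F →L[ℝ] E × F)
    (hJ : ∀ x v, (J x v).2 = (show F →L[ℝ] F from JQ x.2) v.2) :
    ∃ ξ : Form 𝓘(ℝ, E × F) (M × Q) 2,
      IsBalancedMetric (I := 𝓘(ℝ, E × F)) (P := M × Q) J 1 ξ := by
  obtain ⟨ξ, hdef⟩ : ∃ ξ : M × Q → (E × F) [⋀^Fin 2]→L[ℝ] ℝ, ξ = fun x : M × Q =>
    (show F [⋀^Fin 2]→L[ℝ] ℝ from ξQ x.2).compContinuousLinearMap (ContinuousLinearMap.snd ℝ E F) :=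
    ⟨_, rfl⟩
  have hval : ∀ x u v, ξ x ![u, v] = (show F [⋀^Fin 2]→L[ℝ] ℝ from ξQ x.2) ![u.2, v.2] := by
    intro x u v
    rw [hdef]
    exact congrArg (show F [⋀^Fin 2]→L[ℝ] ℝ from ξQ x.2) (by ext i; fin_cases i <;> rfl)
  refine ⟨ξ, ⟨fun x₀ => ?_, fun x u v => ?_, fun x u hu => ?_, ?_⟩⟩
  · have h1 : (extChartAt 𝓘(ℝ, E × F) x₀).target = (chartAt (E × F) x₀).target := by simp
    rw [h1]
    have h2 : ContDiffOn ℝ ∞ (fun y : E × F =>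
        ContinuousAlternatingMap.compContinuousLinearMapCLM (ι := Fin 2) (F := ℝ) (𝕜 := ℝ)
          (ContinuousLinearMap.snd ℝ E F) (ξQ.inChart x₀.2 y.2)) (chartAt (E × F) x₀).target :=
      (ContinuousLinearMap.contDiff _).comp_contDiffOn
        (smoothFam_snd hch (W := F [⋀^Fin 2]→L[ℝ] ℝ) hξ.smooth.smoothFam x₀)
    refine h2.congr fun y hy => ?_
    have hy2 := (hch.mem_target.1 hy).2
    have e : (chartAt (E × F) x₀).symm y
        = ((chartAt E x₀.1).symm y.1, (chartAt F x₀.2).symm y.2) := by rw [hch x₀]; rfl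
    rw [Form.inChart_eq ξ hy, Form.inChart_eq ξQ hy2, hch.jac (mem_coordDom_self hy), e, hdef]
    rfl
  · refine (hval x _ _).trans ((Eq.trans ?_ (hξ.type_one_one x.2 u.2 v.2)).trans (hval x u v).symm)
    exact congrArg₂ (fun a b : F => (show F [⋀^Fin 2]→L[ℝ] ℝ from ξQ x.2) ![a, b]) (hJ x u) (hJ x v)
  · have hu2 : u.2 ≠ 0 := fun h => hu (Prod.ext (Subsingleton.elim _ _) h)
    refine lt_of_lt_of_eq (hξ.pos x.2 u.2 hu2) ?_
    refine Eq.trans ?_ (hval x _ _).symm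
    exact congrArg (fun a : F => (show F [⋀^Fin 2]→L[ℝ] ℝ from ξQ x.2) ![u.2, a]) (hJ x u).symm
  · funext x
    refine (Form.d_eq_zero_iff _ x).2 ?_
    have h1 : (Form.pow (I := 𝓘(ℝ, E × F)) (P := M × Q) ξ (1 - 1)).inChart x
        = fun _ => ContinuousAlternatingMap.constOfIsEmpty ℝ (E × F) (Fin 0) (1 : ℝ) := by
      funext y; ext v; rfl
    rw [h1]
    rw [extDeriv, fderiv_const_apply]
    exact map_zero (ContinuousAlternatingMap.alternatizeUncurryFinCLM ℝ (E × F) ℝ)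

end Product

/-- The notion of a balanced metric is insensitive to rewriting the model with corners. -/
theorem exists_isBalancedMetric_congr {V H : Type*} [NormedAddCommGroup V] [NormedSpace ℝ V]
    [TopologicalSpace H] {I I' : ModelWithCorners ℝ V H} (e : I = I') {P : Type*}
    [TopologicalSpace P] [ChartedSpace H P] (J : P → V →L[ℝ] V) (p : ℕ)
    (h : ∃ ξ : Form I P 2, IsBalancedMetric (I := I) (P := P) J p ξ) :
    ∃ ξ : Form I' P 2, IsBalancedMetric (I := I') (P := P) J p ξ := by
  subst e; exact h

/-- A connected component of a zero-dimensional manifold is a point. -/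
theorem connectedComponent_subsingleton_of_subsingleton {F Q : Type*} [TopologicalSpace F]
    [Subsingleton F] [TopologicalSpace Q] [ChartedSpace F Q] {q q' : Q}
    (h : q' ∈ connectedComponent q) : q' = q := by
  haveI : DiscreteTopology Q := by
    refine discreteTopology_iff_isOpen_singleton.2 fun q => ?_
    convert (chartAt F q).open_source
    ext p
    refine ⟨fun hp => hp ▸ mem_chart_source F q, fun hp => ?_⟩
    exact (chartAt F q).injOn hp (mem_chart_source F q) (Subsingleton.elim _ _)
  simpa using h

end TwistorBalanced

end

theorem mainTheorem3
    {E : Type*} [NormedAddCommGroup E] [NormedSpace ℝ E] [FiniteDimensional ℝ E]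
    {M : Type*} [TopologicalSpace M] [T2Space M] [CompactSpace M] [ChartedSpace E M]
    [IsManifold 𝓘(ℝ, E) ∞ M]
    (S : TwistorBalanced.HypercomplexStructure 𝓘(ℝ, E) M)
    {F : Type*} [NormedAddCommGroup F] [NormedSpace ℂ F] [FiniteDimensional ℂ F]
    {Q : Type*} [TopologicalSpace Q] [T2Space Q] [CompactSpace Q] [ChartedSpace F Q]
    [IsManifold 𝓘(ℂ, F) ω Q]
    (r n : ℕ) (hr : Module.finrank ℝ E = 2 * r) (hn : Module.finrank ℂ F = n)
    (ξQ : TwistorBalanced.Form 𝓘(ℝ, F) Q 2)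
    (hξQ : TwistorBalanced.IsBalancedMetric (TwistorBalanced.mulI F Q) n ξQ)
    (h : Q → TwistorBalanced.P1) (hh : TwistorBalanced.IsHolomorphicToP1 F h)
    (hconst : ∀ q : Q, ∃ q' ∈ connectedComponent q, h q' ≠ h q) :
    ∃ ξ : TwistorBalanced.Form (𝓘(ℝ, E).prod 𝓘(ℝ, F)) (M × Q) 2,
      TwistorBalanced.IsBalancedMetric (TwistorBalanced.twistorStructure S h) (n + r) ξ := by
  rcases isEmpty_or_nonempty Q with hQ | ⟨⟨q⟩⟩
  -- if `Q` is empty then so is the product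
  · exact ⟨fun x => isEmptyElim x.2, fun x => isEmptyElim x.2, fun x => isEmptyElim x.2,
      fun x => isEmptyElim x.2, funext fun x => isEmptyElim x.2⟩
  -- the components of a zero-dimensional `Q` are points, on which `h` is constant
  obtain ⟨m, rfl⟩ : ∃ m, n = m + 1 := by
    refine Nat.exists_eq_succ_of_ne_zero fun h0 => ?_
    haveI : Subsingleton F := Module.finrank_zero_iff.1 (hn.trans h0)
    obtain ⟨q', h1, h2⟩ := hconst q
    exact h2 (congrArg h (TwistorBalanced.connectedComponent_subsingleton_of_subsingleton (F := F) h1))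
  haveI : IsManifold 𝓘(ℝ, F) ∞ Q := TwistorBalanced.isManifold_real
  letI : ChartedSpace (E × F) (M × Q) := prodChartedSpace E M F Q
  haveI : IsManifold 𝓘(ℝ, E × F) ∞ (M × Q) := by
    rw [modelWithCornersSelf_prod]
    exact IsManifold.prod (I := 𝓘(ℝ, E)) (I' := 𝓘(ℝ, F)) M Q
  have hch : TwistorBalanced.IsProdAtlas E M F Q := fun x => rfl
  refine TwistorBalanced.exists_isBalancedMetric_congr (V := E × F) (H := E × F)
    (modelWithCornersSelf_prod (𝕜 := ℝ) (E := E) (F := F)) (P := M × Q)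
    (TwistorBalanced.twistorStructure S h) (m + 1 + r) ?_
  by_cases hmr : m + r = 0
  -- in complex dimension one the differential condition is void
  · obtain ⟨rfl, rfl⟩ : m = 0 ∧ r = 0 := by omega
    haveI : Subsingleton E := Module.finrank_zero_iff.1 hr
    exact TwistorBalanced.exists_isBalancedMetric_of_subsingleton hch hξQ _ fun x v => rfl
  · obtain ⟨R, hR⟩ := S.exists_fibreFam hr
    obtain ⟨B, hBJ, hBa⟩ := TwistorBalanced.exists_baseFam hn hξQ hh hconst
    have e : m + 1 + r = (m + r) + 1 := by omega
    rw [e]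
    refine TwistorBalanced.exists_isBalancedMetric_prod R B hch hmr ?_ _ fun x => ?_
    · rw [Module.finrank_prod, hr, finrank_real_of_complex, hn]
      omega
    · have e1 : (chartAt (E × F) x x).1 = chartAt E x.1 x.1 := rfl
      have e2 : (chartAt (E × F) x x).2 = chartAt F x.2 x.2 := rfl
      have e3 : B.av x.2 (chartAt F x.2 x.2) = fun l => TwistorBalanced.toSphere (h x.2) l := by
        funext l
        rw [TwistorBalanced.BaseFam.av, TwistorBalanced.loc, (chartAt F x.2).left_inv (mem_chart_source F x.2), hBa]
      have e4 : (fun l => R.K l x.1 (chartAt E x.1 x.1))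
          = fun l => (show E →L[ℝ] E from S.str l x.1) := by
        funext l
        rw [hR]
        exact (S.str l).inChart_center x.1
      rw [TwistorBalanced.fibreJ, e1, e2, e3, e4, TwistorBalanced.quat, Fin.sum_univ_three, hBJ]
      have e5 := (TwistorBalanced.mulI F Q).inChart_center x.2
      rw [e5]
      rfl
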